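/- **Setting.** Let $\mathcal S'$ be a separable metric space with metric $\rho'$, let $\mathcal S=\mathbb N\times\mathbb N\times\mathcal S'$ (elements $\mathbf x=(d^-,d^+,\mathbf a)$), with metric $\rho(\mathbf x,\tilde{\mathbf x})=|d^--\tilde d^-|+|d^+-\tilde d^+|+\rho'(\mathbf a,\tilde{\mathbf a})$, and let $p\in[1,\infty)$. For each $n\ge1$ let $G_n$ be a random directed graph on $V_n=\{1,\dots,n\}$ (self-loops and parallel edges allowed) with random vertex attributes $\mathbf a_i\in\mathcal S'$; let $D_i^-,D_i^+$ be the in- and out-degrees, $\mathbf X_i=(D_i^-,D_i^+,\mathbf a_i)$, $\mathscr F_n=\sigma(\mathbf a_i:i\in V_n)$, $\mathscr G_n=\sigma(\mathscr F_n,G_n)$, $\mathbb P_n=P(\cdot|\mathscr F_n)$, $\mathbf P_n=P(\cdot|\mathscr G_n)$, with expectations $\mathbb E_n$, $\mathbf E_n$. Let $I$ be uniform on $V_n$, independent of $\mathscr G_n$. On $G_n$ consider the chain $$R_i^{(k+1)}=\Phi\bigl(\mathbf X_i,\zeta_i^{(k)},\{g(R_j^{(k)},\mathbf X_j),\xi_{j,i}^{(k)}:j\to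 i\}\bigr),\qquad i\in V_n,\ k\ge0,$$ where sums and collections over $j\to i$ run over edges, $\Phi$ is a measurable function of a mark, a vertex noise and an unordered finite collection of (value, edge noise) pairs, the $R_i^{(0)}$ are i.i.d. with law $\mu_0$, the vertex noises are i.i.d., the edge noises are i.i.d., and all these are independent of each other and of the graph. Put $\Psi(\mathbf x,\cdot)=g(\Phi(\mathbf x,\cdot),\mathbf x)$ and $r_0=(E|R_1^{(0)}|^p)^{1/p}$; assume $r_0<\infty$. Write $(\zeta,\{\xi_j\})$ for a generic noise vector. The Wasserstein distances of order $p$ on $\mathbb R$ (with $|\cdot|$) and on $\mathbb R^n$ (with $\|\cdot\|_p$) are denoted $d_p$ and $W_p$; matrix norms are the operator norms induced by $\|\cdot\|_p$. **Assumptions on the maps.** There are continuous $\sigma_-,\sigma_+,\beta:\mathcal S\to\mathbb R$ such that: (1) $\bigl(E|\Phi(\mathbf x,\zeta,\{v_j,\xi_j:j\le m\})-\Phi(\mathbf x,\zeta,\{\tilde v_j,\xi_j:j\le m\})|^p\bigr)^{1/p}\le\sigma_-(\mathbf x)\sum_{j\le m}|v_j-\tilde v_j|$ and (3) $\bigl(E|\Phi(\mathbf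 x,\zeta,\{v_j,\xi_j:j\le m\})|^p\bigr)^{1/p}\le\sum_{j\le m}\sigma_-(\mathbf x)|v_j|+\beta(\mathbf x)$, for all real $v_j,\tilde v_j$ and almost surely for every pair $(m,\mathbf x)=(D_i^-,\mathbf X_i)$ of the graphs and for the pairs $(\mathcal N_\emptyset,\boldsymbol X_\emptyset)$, $(\mathcal N_1,\boldsymbol X_1)$ of the limiting tree below; (2) $|g(r,\mathbf x)-g(\tilde r,\mathbf x)|\le\sigma_+(\mathbf x)|r-\tilde r|$ for all $\mathbf x\in\mathcal S$, $r,\tilde r\in\mathbb R$; (4) the matrices $C_{i,j}=\sigma_-(\mathbf X_i)\sigma_+(\mathbf X_j)1(j\to i)$ and $C^{(0)}_{i,j}=\sigma_-(\mathbf X_i)|g(0,\mathbf X_j)|1(j\to i)$ (edges counted with multiplicity) satisfy $\|C\|_p\le K<1$ and $\|C^{(0)}\|_p\le K_0<\infty$ a.s., with constants $K,K_0$ not depending on $n$; (5) there are $H,Q,\alpha,\gamma>0$ such that, whenever $\rho(\mathbf x,\tilde{\mathbf x})<1$, for all $v_j,r\in\mathbb R$, $\bigl(E|\Phi(\mathbf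 x,\zeta,\{v_j,\xi_j:j\le d^-\})-\Phi(\tilde{\mathbf x},\zeta,\{v_j,\xi_j:j\le d^-\})|^p\bigr)^{1/p}\le H\bigl(1\vee(\sum_{j\le d^-}\sigma_-(\mathbf x)|v_j|+\beta(\mathbf x))\bigr)\rho(\mathbf x,\tilde{\mathbf x})^\alpha$ and $|g(r,\mathbf x)-g(r,\tilde{\mathbf x})|\le Q(1\vee\sigma_+(\mathbf x)|r|)\rho(\mathbf x,\tilde{\mathbf x})^\gamma$. **Assumptions on the graphs.** Let $\mathcal T$ be a delayed marked Galton–Watson tree: independent pairs (offspring number, mark) $(\mathcal N_{\mathbf i},\boldsymbol X_{\mathbf i})\in\mathbb N\times\mathcal S$, one law for the root $\emptyset$, a common law (that of $(\mathcal N_1,\boldsymbol X_1)$) for all other nodes. The graphs admit a strong coupling with it: for each $k\ge1$ there are, for every $n$, a copy of the tree, independent of $\mathscr F_n$, and a random map $\theta$ from nodes to $V_n$ with the following properties, as $n\to\infty$. The $\mathbb P_n$-probability that $\theta$ is not an isomorphism of the first $k$ generations (edges directed to the root, root mapped to $I$) onto the depth-$k$ inbound neighborhood of $I$ tends to $0$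 in probability; $\mathbb E_n[\rho(\mathbf X_I,\boldsymbol X_\emptyset)]\to0$ in probability; and for every $\epsilon\in(0,1)$, the $\mathbb P_n$-probability that $\rho(\mathbf X_{\theta(\mathbf i)},\boldsymbol X_{\mathbf i})\le\epsilon$ for all nodes $\mathbf i$ of the first $k$ generations tends to $1$ in probability. Moreover the $p$-th absolute moments of $\mathcal N_\emptyset\sigma_-(\boldsymbol X_\emptyset)$, $\beta(\boldsymbol X_\emptyset)$, $\mathcal N_1\sigma_-(\boldsymbol X_1)\sigma_+(\boldsymbol X_1)$, $\sigma_+(\boldsymbol X_1)\beta(\boldsymbol X_1)$, $\sigma_+(\boldsymbol X_1)$, $g(0,\boldsymbol X_1)$ are finite, and the $d_p$-distances between the conditional laws given $\mathscr F_n$ of $\sigma_-(\mathbf X_I)D_I^-$, $\beta(\mathbf X_I)$ and the laws of $\sigma_-(\boldsymbol X_\emptyset)d^-(\boldsymbol X_\emptyset)$, $\beta(\boldsymbol X_\emptyset)$ tend to $0$ in probability, where $d^-(\boldsymbol X_\emptyset)$ is the first component of $\boldsymbol X_\emptyset$. **Conclusion.** Let $\lambda_{k,n}=\mathbf P_n(\mathbf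 R^{(k)}\in\cdot)$, the law of the chain on the fixed graph. There are probability measures $\lambda_n$ on $\mathbb R^n$, depending measurably on the weighted graph, such that for every $n$ and almost every realization of the graph: $\lambda_n$ is stationary for the chain; $W_p(\lambda_{k,n},\lambda_n)\to0$ as $k\to\infty$; and for every $k\ge0$ there is a coupling of $\mathbf R^{(k)}$ (of law $\lambda_{k,n}$) with a vector $\mathbf R$ of law $\lambda_n$ for which $$\bigl(\mathbf E_n\|\mathbf R^{(k)}-\mathbf R\|_p^p\bigr)^{1/p}\le\|C\|_p^k\Bigl(2r_0n^{1/p}+\frac{\|C^{(0)}\mathbf e+\boldsymbol\beta\|_p}{1-\|C\|_p}\Bigr),$$ where $\mathbf e=(1,\dots,1)$ and $\boldsymbol\beta=(\beta(\mathbf X_i))_i$. Moreover, suppose $E[(\mathcal N_1\sigma_-(\boldsymbol X_1)\sigma_+(\boldsymbol X_1))^p]<1$. On the tree with i.i.d. noises at nodes and edges, let $\nu_k$ be the law of $\mathcal R_\emptyset^{(k)}$, the result at the root of $k$ steps of the recursion started from i.i.d. values of law $\mu_0$ at generation $k$. Then there is a probability measure $\nu$ with $d_p(\nu_k,\nu)\to0$;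 it is the law of $\Phi(\boldsymbol X_\emptyset,\zeta,\{\mathcal V_j,\xi_j:1\le j\le\mathcal N_\emptyset\})$, with $\mathcal V_j$ i.i.d. copies, independent of the rest, of the attracting endogenous solution of $\mathcal V\stackrel{\mathcal D}{=}\Psi(\boldsymbol X_1,\zeta,\{\mathcal V_j,\xi_j:1\le j\le\mathcal N_1\})$. (That is, the law of $\mathcal V$ is the $d_p$-limit, started from $g(0,\boldsymbol X_{\mathbf i})$ at generation $k$, of $k$ steps of the $\Psi$-recursion on the non-delayed tree, all of whose pairs are distributed as $(\mathcal N_1,\boldsymbol X_1)$; the root variables converge in $L^p$ to a variable measurable with respect to the marked tree.) If, given $\mathscr G_n$, $\mathbf R=(R_1,\dots,R_n)$ has law $\lambda_n$ and is independent of $I$, and $\mu_n=\mathbb P_n(R_I\in\cdot)$, then $d_p(\mu_n,\nu)\to0$ in probability as $n\to\infty$. -/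

import Mathlib

open MeasureTheory ProbabilityTheory Filter Topology
open scoped ENNReal

noncomputable section

namespace GraphRecursion

universe u

/-! ### Wasserstein distance and convergence in probability -/

/-- The Wasserstein distance of order `p`: the infimum of `(E[d(X, Y)^p])^(1/p)` over all couplings
of `μ` and `ν`. -/
def wasserstein (p : ℝ≥0∞) {E : Type*} [PseudoEMetricSpace E] [MeasurableSpace E]
    (μ ν : Measure E) : ℝ≥0∞ :=
  ⨅ π : {π : Measure (E × E) // π.map Prod.fst = μ ∧ π.map Prod.snd = ν},
    (∫⁻ z, edist z.1 z.2 ^ p.toReal ∂(π : Measure (E × E))) ^ (1 / p.toReal)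

/-- Convergence in probability to `0` of nonnegative random variables, the `n`-th of which may live
on its own probability space. -/
def TendstoZeroInProb {Ω : ℕ → Type*} [∀ n, MeasurableSpace (Ω n)] (P : ∀ n, Measure (Ω n))
    (Y : ∀ n, Ω n → ℝ≥0∞) : Prop :=
  ∀ ε : ℝ≥0∞, 0 < ε → Tendsto (fun n => P n {ω | ε ≤ Y n ω}) atTop (𝓝 0)

/-! ### Marks and vertex-weighted directed (multi)graphs -/

/-- The space of marks `(d⁻, d⁺, a)`: in-degree, out-degree, attribute. -/
abbrev Mark (S : Type*) : Type _ := ℕ × ℕ × S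

/-- The metric `|d⁻ - d̃⁻| + |d⁺ - d̃⁺| + dist a ã` on marks. -/
def rho {S : Type*} [PseudoMetricSpace S] (x y : Mark S) : ℝ :=
  |(x.1 : ℝ) - y.1| + |(x.2.1 : ℝ) - y.2.1| + dist x.2.2 y.2.2

/-- A directed graph with vertex attributes: `G.1 j i` is the number of edges from `j` to `i`
(self-loops and parallel edges are allowed; a digraph without parallel edges has `G.1 j i ≤ 1`) and
`G.2 i` is the attribute of the vertex `i`. -/
abbrev WDigraph (V S : Type*) : Type _ := (V → V → ℕ) × (V → S)

section Graph

variable {V S : Type*} [Fintype V]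

def inDeg (G : WDigraph V S) (i : V) : ℕ := ∑ j, G.1 j i

def outDeg (G : WDigraph V S) (i : V) : ℕ := ∑ j, G.1 i j

/-- The mark `X_i = (D_i⁻, D_i⁺, a_i)` of the vertex `i`. -/
def mark (G : WDigraph V S) (i : V) : Mark S := (inDeg G i, outDeg G i, G.2 i)

/-- The inbound edges of `i`: pairs of a vertex `j` and one of the parallel edges from `j` to
`i`. -/
abbrev InEdge (G : WDigraph V S) (i : V) : Type _ := Σ j : V, Fin (G.1 j i)

end Graph

/-! ### The recursion -/

/-- The unordered collection `{v_j, ξ_j : j}`. -/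
def bag {Ξ ι : Type*} [Fintype ι] (v : ι → ℝ) (e : ι → Ξ) : Multiset (ℝ × Ξ) :=
  Finset.univ.val.map fun j => (v j, e j)

/-- The data of the recursion: the maps `Φ` and `g`, the laws of the i.i.d. noises on the vertices
and on the edges, and the law `μ₀` of the i.i.d. initial values. -/
structure Recursion (S Z Ξ : Type*) [MeasurableSpace S] [MeasurableSpace Z] [MeasurableSpace Ξ] where
  Φ : Mark S → Z → Multiset (ℝ × Ξ) → ℝ
  g : ℝ → Mark S → ℝ
  vertexNoise : Measure Z
  edgeNoise : Measure Ξ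
  initial : Measure ℝ
  [prob_vertexNoise : IsProbabilityMeasure vertexNoise]
  [prob_edgeNoise : IsProbabilityMeasure edgeNoise]
  [prob_initial : IsProbabilityMeasure initial]
  measurable_Φ : ∀ m : ℕ, Measurable fun q : Mark S × Z × (Fin m → ℝ) × (Fin m → Ξ) =>
    Φ q.1 q.2.1 (bag q.2.2.1 q.2.2.2)

attribute [instance] Recursion.prob_vertexNoise Recursion.prob_edgeNoise Recursion.prob_initial

section Recursion

variable {S Z Ξ : Type*} [MeasurableSpace S] [MeasurableSpace Z] [MeasurableSpace Ξ]

/-- The map `Ψ(x, z, ·) = g(Φ(x, z, ·), x)`. -/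
def Recursion.Ψ (M : Recursion S Z Ξ) (x : Mark S) (z : Z) (b : Multiset (ℝ × Ξ)) : ℝ :=
  M.g (M.Φ x z b) x

/-- The law of the noise `(ζ, ξ_1, …, ξ_m)` that a vertex with `m` inbound edges sees. -/
def Recursion.localNoise (M : Recursion S Z Ξ) (m : ℕ) : Measure (Z × (Fin m → Ξ)) :=
  M.vertexNoise.prod (Measure.pi fun _ => M.edgeNoise)

/-- `Φ(x, ζ, {v_j, ξ_j : j ≤ m})` is Lipschitz in `v`, in the `L^p` sense, with constant `s`. -/
def Recursion.LipschitzAt (M : Recursion S Z Ξ) (p : ℝ≥0∞) (s : ℝ) (m : ℕ) (x : Mark S) : Prop :=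
  ∀ v w : Fin m → ℝ,
    MemLp (fun e : Z × (Fin m → Ξ) => M.Φ x e.1 (bag v e.2) - M.Φ x e.1 (bag w e.2)) p
      (M.localNoise m) ∧
    (eLpNorm (fun e : Z × (Fin m → Ξ) => M.Φ x e.1 (bag v e.2) - M.Φ x e.1 (bag w e.2)) p
      (M.localNoise m)).toReal ≤ s * ∑ j, |v j - w j|

/-- `Φ(x, ζ, {v_j, ξ_j : j ≤ m})` has `L^p` norm at most `s ∑ |v_j| + b`. -/
def Recursion.GrowthAt (M : Recursion S Z Ξ) (p : ℝ≥0∞) (s b : ℝ) (m : ℕ) (x : Mark S) : Prop :=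
  ∀ v : Fin m → ℝ,
    MemLp (fun e : Z × (Fin m → Ξ) => M.Φ x e.1 (bag v e.2)) p (M.localNoise m) ∧
    (eLpNorm (fun e : Z × (Fin m → Ξ) => M.Φ x e.1 (bag v e.2)) p (M.localNoise m)).toReal
      ≤ (∑ j, s * |v j|) + b

/-! ### The Markov chain on a fixed graph -/

variable {V : Type*} [Fintype V]

/-- All noises on the vertex set `V`: `ζ (k, i)` acts on the vertex `i` at time `k`, and
`ξ (k, j, i, l)` acts on the `l`-th edge from `j` to `i` at time `k`. -/
abbrev Noise (V Z Ξ : Type*) : Type _ := (ℕ × V → Z) × (ℕ × V × V × ℕ → Ξ)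

/-- The law of the noises: all of them independent, each family identically distributed. -/
def Recursion.noiseLaw (M : Recursion S Z Ξ) (V : Type*) : Measure (Noise V Z Ξ) :=
  (Measure.infinitePi fun _ : ℕ × V => M.vertexNoise).prod
    (Measure.infinitePi fun _ : ℕ × V × V × ℕ => M.edgeNoise)

/-- The process `R^(k)` on the graph `G`, started from `r`, as a function of the noises:
`R_i^(k+1) = Φ(X_i, ζ_i^(k), {g(R_j^(k), X_j), ξ_{j,i}^(k) : j → i})`. -/
def Recursion.chain (M : Recursion S Z Ξ) (G : WDigraph V S) (r : V → ℝ) (e : Noise V Z Ξ) :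
    ℕ → V → ℝ
  | 0 => r
  | k + 1 => fun i => M.Φ (mark G i) (e.1 (k, i))
      (bag (fun a : InEdge G i => M.g (M.chain G r e k a.1) (mark G a.1))
        (fun a : InEdge G i => e.2 (k, a.1, i, (a.2 : ℕ))))

/-- The law of `R^(k)` on the fixed graph `G` when `R^(0)` has law `m` and is independent of the
noises. -/
def Recursion.chainLaw (M : Recursion S Z Ξ) (p : ℝ≥0∞) (G : WDigraph V S)
    (m : Measure (PiLp p fun _ : V => ℝ)) (k : ℕ) : Measure (PiLp p fun _ : V => ℝ) :=
  (m.prod (M.noiseLaw V)).map fun q => WithLp.toLp p (M.chain G (WithLp.ofLp q.1) q.2 k)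

/-- The law of an initial vector `R^(0)` with i.i.d. components of law `μ₀`. -/
def Recursion.initialLaw (M : Recursion S Z Ξ) (p : ℝ≥0∞) (V : Type*) [Fintype V] :
    Measure (PiLp p fun _ : V => ℝ) :=
  (Measure.pi fun _ : V => M.initial).map (WithLp.toLp p)

/-- The matrix `C_{i,j} = σ₋(X_i) σ₊(X_j) 1(j → i)`, edges being counted with multiplicity. -/
def matC (σm σp : Mark S → ℝ) (G : WDigraph V S) : Matrix V V ℝ :=
  Matrix.of fun i j => σm (mark G i) * σp (mark G j) * (G.1 j i : ℝ)

/-- The matrix `C⁰_{i,j} = σ₋(X_i) |g(0, X_j)| 1(j → i)`, edges being counted with multiplicity. -/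
def Recursion.matC0 (M : Recursion S Z Ξ) (σm : Mark S → ℝ) (G : WDigraph V S) : Matrix V V ℝ :=
  Matrix.of fun i j => σm (mark G i) * |M.g 0 (mark G j)| * (G.1 j i : ℝ)

/-- The operator norm of a matrix induced by the vector norm `‖·‖_p`. -/
def opNorm (p : ℝ≥0∞) [Fact (1 ≤ p)] [DecidableEq V] (A : Matrix V V ℝ) : ℝ :=
  ‖LinearMap.toContinuousLinearMap (Matrix.toLpLin p p A)‖

/-- The bound `‖C‖_p^k (2 r₀ n^{1/p} + ‖C⁰ e + β‖_p / (1 - ‖C‖_p))`, with `n` the number of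
vertices and `r₀ = (E|R^(0)|^p)^{1/p}`. -/
def Recursion.rate (M : Recursion S Z Ξ) (p : ℝ≥0∞) [Fact (1 ≤ p)] [DecidableEq V]
    (σm σp β : Mark S → ℝ) (G : WDigraph V S) (k : ℕ) : ℝ :=
  opNorm p (matC σm σp G) ^ k *
    (2 * (eLpNorm id p M.initial).toReal * (Fintype.card V : ℝ) ^ (1 / p.toReal) +
      ‖(WithLp.toLp p (fun i => (M.matC0 σm G).mulVec 1 i + β (mark G i)) : PiLp p fun _ : V => ℝ)‖
        / (1 - opNorm p (matC σm σp G)))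

end Recursion

/-! ### Delayed marked Galton-Watson trees and the recursion on them

The node `(i_1, …, i_k)` is the list `[i_k, …, i_1]`, with children numbered from `0`: the root is
`[]` and the `j`-th child of `q` is `j :: q`. -/

section Tree

variable {S Z Ξ : Type*} [MeasurableSpace S] [MeasurableSpace Z] [MeasurableSpace Ξ]

/-- The family `(𝒩_q, X_q)` of offspring numbers and marks, over all potential nodes. -/
abbrev Tree (S : Type*) : Type _ := List ℕ → ℕ × Mark S

/-- `q` is a node of the tree. -/
def InTree (t : Tree S) : List ℕ → Prop
  | [] => True
  | j :: q => InTree t q ∧ j < (t q).1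

/-- The law of a delayed marked Galton-Watson process: independent vectors `(𝒩_q, X_q)`, with law
`root` at the root and law `child` at every other node. -/
def gwLaw (root child : Measure (ℕ × Mark S)) : Measure (Tree S) :=
  Measure.infinitePi fun q : List ℕ => if q = [] then root else child

/-- A tree with noises: `ζ q` at the node `q`, and `ξ (j :: q)` on the edge from `j :: q` to its
parent `q`. -/
abbrev NoisyTree (S Z Ξ : Type*) : Type _ := Tree S × (List ℕ → Z) × (List ℕ → Ξ)

def Recursion.noisyTreeLaw (M : Recursion S Z Ξ) (root child : Measure (ℕ × Mark S)) :
    Measure (NoisyTree S Z Ξ) :=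
  (gwLaw root child).prod ((Measure.infinitePi fun _ : List ℕ => M.vertexNoise).prod
    (Measure.infinitePi fun _ : List ℕ => M.edgeNoise))

/-- `Φ(X_q, ζ_q, {v_{(q,j)}, ξ_{(q,j)} : j ≤ 𝒩_q})`. -/
def Recursion.treeΦ (M : Recursion S Z Ξ) (τ : NoisyTree S Z Ξ) (v : List ℕ → ℝ) (q : List ℕ) : ℝ :=
  M.Φ (τ.1 q).2 (τ.2.1 q)
    (bag (fun j : Fin (τ.1 q).1 => v ((j : ℕ) :: q)) (fun j => τ.2.2 ((j : ℕ) :: q)))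

/-- The variables `𝒱_q^(r)`: `𝒱_q^(0) = g(r0_q, X_q)` and
`𝒱_q^(r+1) = Ψ(X_q, ζ_q, {𝒱_{(q,j)}^(r), ξ_{(q,j)} : j ≤ 𝒩_q})`. -/
def Recursion.treeV (M : Recursion S Z Ξ) (τ : NoisyTree S Z Ξ) (r0 : List ℕ → ℝ) :
    ℕ → List ℕ → ℝ
  | 0 => fun q => M.g (r0 q) (τ.1 q).2
  | r + 1 => fun q => M.g (M.treeΦ τ (M.treeV τ r0 r) q) (τ.1 q).2

/-- The variable `ℛ_∅^(k)` at the root. -/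
def Recursion.treeR (M : Recursion S Z Ξ) (τ : NoisyTree S Z Ξ) (r0 : List ℕ → ℝ) : ℕ → ℝ
  | 0 => r0 []
  | k + 1 => M.treeΦ τ (M.treeV τ r0 k) []

/-- The law `ν_k` of `ℛ_∅^(k)`, with i.i.d. initial values of law `μ₀`. -/
def Recursion.treeRLaw (M : Recursion S Z Ξ) (root child : Measure (ℕ × Mark S)) (k : ℕ) :
    Measure ℝ :=
  ((M.noisyTreeLaw root child).prod (Measure.infinitePi fun _ : List ℕ => M.initial)).map
    fun z => M.treeR z.1 z.2 k

/-- The law of `F(X, ζ, {V_j, ξ_j : j ≤ N})` where `(N, X)` has law `m`, the `V_j` are i.i.d. of law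
`η`, and `(N, X)`, `ζ`, `(ξ_j)`, `(V_j)` are independent. -/
def Recursion.branchingLaw (M : Recursion S Z Ξ) (F : Mark S → Z → Multiset (ℝ × Ξ) → ℝ)
    (m : Measure (ℕ × Mark S)) (η : Measure ℝ) : Measure ℝ :=
  (m.prod (M.vertexNoise.prod ((Measure.infinitePi fun _ : ℕ => M.edgeNoise).prod
    (Measure.infinitePi fun _ : ℕ => η)))).map
    fun z => F z.1.2 z.2.1 (bag (fun j : Fin z.1.1 => z.2.2.2 j) (fun j => z.2.2.1 j))

/-- The σ-algebra generated by the marked tree: what `𝒩_q`, `X_q`, `ζ_q` and `(ξ_{(q,j)})_j` reveal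
at the nodes `q` of the tree. -/
@[reducible] def treeSigma (S Z Ξ : Type*) [MeasurableSpace S] [MeasurableSpace Z] [MeasurableSpace Ξ] :
    MeasurableSpace (NoisyTree S Z Ξ) :=
  MeasurableSpace.generateFrom
    {A | ∃ (q : List ℕ) (B : Set ((ℕ × Mark S) × Z × (ℕ → Ξ))), MeasurableSet B ∧
      A = {τ | InTree τ.1 q ∧ (τ.1 q, τ.2.1 q, fun j => τ.2.2 (j :: q)) ∈ B}}

/-- `η` is the attracting endogenous solution of `𝒱 =ᵈ Ψ(X, ζ, {𝒱_j, ξ_j : j ≤ 𝒩})`, for `(𝒩, X)`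
of law `child`: it is the limit of the laws of `𝒱_∅^(k)` started from `𝒱^(0) = g(0, X)` on the
(non-delayed) tree, it solves the equation, and it is the law of a variable that is measurable with
respect to the marked tree, namely of the `L^p` limit of the `𝒱_∅^(k)`. -/
structure Recursion.IsAttractingEndogenous (M : Recursion S Z Ξ) (p : ℝ≥0∞)
    (child : Measure (ℕ × Mark S)) (η : Measure ℝ) : Prop where
  isProbabilityMeasure : IsProbabilityMeasure η
  attracting : Tendsto (fun k => wasserstein p
    ((M.noisyTreeLaw child child).map fun τ => M.treeV τ 0 k []) η) atTop (𝓝 0)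
  solution : M.branchingLaw M.Ψ child η = η
  endogenous : ∃ v : NoisyTree S Z Ξ → ℝ, Measurable[treeSigma S Z Ξ] v ∧
    (M.noisyTreeLaw child child).map v = η ∧
    Tendsto (fun k => eLpNorm (fun τ => M.treeV τ 0 k [] - v τ) p (M.noisyTreeLaw child child))
      atTop (𝓝 0)

end Tree

/-! ### Sequences of random graphs -/

/-- The vertex set of the `n`-th graph: `n + 1` vertices, so that no vertex set is empty. -/
abbrev Vert (n : ℕ) : Type := Fin (n + 1)

/-- A sequence of vertex-weighted directed random graphs, with a uniformly chosen vertex `I n` that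
is independent of the weighted graph. -/
structure GraphSeq (S : Type*) [MeasurableSpace S] where
  Ω : ℕ → Type u
  [mΩ : ∀ n, MeasurableSpace (Ω n)]
  P : ∀ n, Measure (Ω n)
  [prob : ∀ n, IsProbabilityMeasure (P n)]
  graph : ∀ n, Ω n → WDigraph (Vert n) S
  I : ∀ n, Ω n → Vert n
  measurable_graph : ∀ n, Measurable (graph n)
  measurable_I : ∀ n, Measurable (I n)
  uniform_I : ∀ n i, P n (I n ⁻¹' {i}) = ((n : ℝ≥0∞) + 1)⁻¹
  indep_I : ∀ n, IndepFun (I n) (graph n) (P n)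

attribute [instance] GraphSeq.mΩ GraphSeq.prob

section GraphSeq

variable {S : Type*} [MeasurableSpace S]

/-- The vertex attributes of the `n`-th graph. -/
def GraphSeq.attr (G : GraphSeq.{u} S) (n : ℕ) (ω : G.Ω n) : Vert n → S := (G.graph n ω).2

/-- The σ-algebra `ℱ_n` generated by the vertex attributes. -/
@[reducible] def GraphSeq.𝓕 (G : GraphSeq.{u} S) (n : ℕ) : MeasurableSpace (G.Ω n) :=
  MeasurableSpace.comap (G.attr n) inferInstance

/-- The mark `X_I` of the uniformly chosen vertex. -/
def GraphSeq.markI (G : GraphSeq.{u} S) (n : ℕ) (ω : G.Ω n) : Mark S :=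
  mark (G.graph n ω) (G.I n ω)

/-- The conditional law, given `ℱ_n`, of `f(X_I)`, as a random measure on `ℝ`. -/
def GraphSeq.markILaw (G : GraphSeq.{u} S) (f : Mark S → ℝ) (n : ℕ) (ω : G.Ω n) : Measure ℝ :=
  condDistrib (fun ω' => f (G.markI n ω')) (G.attr n) (G.P n) (G.attr n ω)

/-- The vertices from which a directed path of length `r` leads to `i`. -/
def sphere {V : Type*} (G : WDigraph V S) (i : V) : ℕ → Set V
  | 0 => {i}
  | r + 1 => {j | ∃ l ∈ sphere G i r, 0 < G.1 j l}

/-- The vertex set of the depth-`k` inbound neighborhood of `i`. -/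
def inBall {V : Type*} (G : WDigraph V S) (i : V) (k : ℕ) : Set V :=
  {j | ∃ r ≤ k, j ∈ sphere G i r}

/-- The nodes of the first `k` generations. -/
def treeBall (t : Tree S) (k : ℕ) : Set (List ℕ) := {q | InTree t q ∧ q.length ≤ k}

open scoped Classical in
/-- `θ` is an isomorphism from the first `k` generations of the tree, with edges directed towards
the root, onto the depth-`k` inbound neighborhood of `i`, and it maps the root to `i`. -/
def IsTreeIso {V : Type*} (G : WDigraph V S) (i : V) (t : Tree S) (k : ℕ) (θ : List ℕ → V) : Prop :=
  θ [] = i ∧ Set.BijOn θ (treeBall t k) (inBall G i k) ∧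
    ∀ q ∈ treeBall t k, ∀ q' ∈ treeBall t k,
      G.1 (θ q) (θ q') = if ∃ j, q = j :: q' then 1 else 0

/-- The graph sequence admits a strong coupling with the delayed marked Galton-Watson process whose
offspring number and mark have law `root` at the root and law `child` elsewhere: for each `k ≥ 1`
there are random trees `T n` with that law, independent of `ℱ_n`, and random maps `θ n` from nodes
to vertices, such that the conditional probability given `ℱ_n` that `θ n` fails to be an isomorphism
of the first `k` generations onto the depth-`k` inbound neighborhood of `I` tends to `0`, the
conditional mean distance of the root marks tends to `0`, and the conditional probability that all
corresponding marks of the first `k` generations are `ε`-close tends to `1`. -/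
def GraphSeq.AdmitsStrongCoupling [PseudoMetricSpace S] (G : GraphSeq.{u} S)
    (root child : Measure (ℕ × Mark S)) : Prop :=
  ∀ k : ℕ, 1 ≤ k → ∃ (T : ∀ n, G.Ω n → Tree S) (θ : ∀ n, G.Ω n → List ℕ → Vert n),
    (∀ n, Measurable (T n)) ∧ (∀ n, Measurable (θ n)) ∧
    (∀ n, (G.P n).map (T n) = gwLaw root child) ∧
    (∀ n, IndepFun (T n) (G.attr n) (G.P n)) ∧
    TendstoZeroInProb G.P (fun n => condLExp (G.𝓕 n) (G.P n) (Set.indicator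
      {ω | ¬ IsTreeIso (G.graph n ω) (G.I n ω) (T n ω) k (θ n ω)} 1)) ∧
    TendstoZeroInProb G.P (fun n => condLExp (G.𝓕 n) (G.P n)
      (fun ω => ENNReal.ofReal (rho (G.markI n ω) (T n ω []).2))) ∧
    ∀ ε : ℝ, 0 < ε → ε < 1 → TendstoZeroInProb G.P (fun n ω =>
      1 - condLExp (G.𝓕 n) (G.P n) (Set.indicator {ω' | ∀ q ∈ treeBall (T n ω') k,
        rho (mark (G.graph n ω') (θ n ω' q)) (T n ω' q).2 ≤ ε} 1) ω)

/-- The conditional law given `ℱ_n` of `R_I`, where, given the weighted graph, `R` has law `lam` of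
that graph and is independent of the uniformly chosen vertex `I`. -/
def GraphSeq.rootMarginal (G : GraphSeq.{u} S) (p : ℝ≥0∞) {n : ℕ}
    (lam : Kernel (WDigraph (Vert n) S) (PiLp p fun _ : Vert n => ℝ)) [IsMarkovKernel lam]
    (ω : G.Ω n) : Measure ℝ :=
  condDistrib (fun z : G.Ω n × PiLp p (fun _ : Vert n => ℝ) => z.2 (G.I n z.1))
    (fun z => G.attr n z.1) (G.P n ⊗ₘ lam.comap (G.graph n) (G.measurable_graph n)) (G.attr n ω)

end GraphSeq

/-! ### The assumptions -/

section Assumptions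

variable {S Z Ξ : Type*} [PseudoMetricSpace S] [MeasurableSpace S] [MeasurableSpace Z]
  [MeasurableSpace Ξ]

/-- The assumptions on the maps `Φ` and `g`, with the bounds on the matrices `C` and `C⁰`. The
Lipschitz and growth conditions on `Φ` are required at the marks that occur, almost surely, in the
graphs and in the limiting tree. -/
structure Recursion.Regular (M : Recursion S Z Ξ) (p : ℝ≥0∞) [Fact (1 ≤ p)]
    (σm σp β : Mark S → ℝ) (K K₀ : ℝ) (G : GraphSeq.{u} S)
    (root child : Measure (ℕ × Mark S)) : Prop where
  continuous_σm : Continuous σm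
  continuous_σp : Continuous σp
  continuous_β : Continuous β
  lipschitz_graph : ∀ n, ∀ᵐ ω ∂G.P n, ∀ i,
    M.LipschitzAt p (σm (mark (G.graph n ω) i)) (inDeg (G.graph n ω) i) (mark (G.graph n ω) i)
  lipschitz_root : ∀ᵐ y ∂root, M.LipschitzAt p (σm y.2) y.1 y.2
  lipschitz_child : ∀ᵐ y ∂child, M.LipschitzAt p (σm y.2) y.1 y.2
  lipschitz_g : ∀ x r r', |M.g r x - M.g r' x| ≤ σp x * |r - r'|
  growth_graph : ∀ n, ∀ᵐ ω ∂G.P n, ∀ i,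
    M.GrowthAt p (σm (mark (G.graph n ω) i)) (β (mark (G.graph n ω) i)) (inDeg (G.graph n ω) i)
      (mark (G.graph n ω) i)
  growth_root : ∀ᵐ y ∂root, M.GrowthAt p (σm y.2) (β y.2) y.1 y.2
  growth_child : ∀ᵐ y ∂child, M.GrowthAt p (σm y.2) (β y.2) y.1 y.2
  norm_C : ∀ n, ∀ᵐ ω ∂G.P n, opNorm p (matC σm σp (G.graph n ω)) ≤ K
  norm_C0 : ∀ n, ∀ᵐ ω ∂G.P n, opNorm p (M.matC0 σm (G.graph n ω)) ≤ K₀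
  continuity : ∃ H Q α γ : ℝ, 0 < H ∧ 0 < Q ∧ 0 < α ∧ 0 < γ ∧
    ∀ x x' : Mark S, rho x x' < 1 →
      (∀ v : Fin x.1 → ℝ,
        MemLp (fun e : Z × (Fin x.1 → Ξ) => M.Φ x e.1 (bag v e.2) - M.Φ x' e.1 (bag v e.2)) p
          (M.localNoise x.1) ∧
        (eLpNorm (fun e : Z × (Fin x.1 → Ξ) => M.Φ x e.1 (bag v e.2) - M.Φ x' e.1 (bag v e.2)) p
          (M.localNoise x.1)).toReal ≤
          H * max 1 ((∑ j, σm x * |v j|) + β x) * rho x x' ^ α) ∧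
      ∀ r : ℝ, |M.g r x - M.g r x'| ≤ Q * max 1 (σp x * |r|) * rho x x' ^ γ

/-- The assumptions on the sequence of graphs: strong coupling with the Galton-Watson process,
moments of its marks, and convergence in `d_p` of `σ₋(X_I) D_I⁻` and of `β(X_I)`. -/
structure GraphSeq.Regular (G : GraphSeq.{u} S) (M : Recursion S Z Ξ) (p : ℝ≥0∞)
    (σm σp β : Mark S → ℝ) (root child : Measure (ℕ × Mark S)) : Prop where
  strongCoupling : G.AdmitsStrongCoupling root child
  root_σm : MemLp (fun y : ℕ × Mark S => (y.1 : ℝ) * σm y.2) p root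
  root_β : MemLp (fun y : ℕ × Mark S => β y.2) p root
  child_σ : MemLp (fun y : ℕ × Mark S => (y.1 : ℝ) * σm y.2 * σp y.2) p child
  child_σβ : MemLp (fun y : ℕ × Mark S => σp y.2 * β y.2) p child
  child_σp : MemLp (fun y : ℕ × Mark S => σp y.2) p child
  child_g : MemLp (fun y : ℕ × Mark S => M.g 0 y.2) p child
  tendsto_σm : TendstoZeroInProb G.P fun n ω => wasserstein p
    (G.markILaw (fun x => σm x * (x.1 : ℝ)) n ω) (root.map fun y => σm y.2 * (y.2.1 : ℝ))
  tendsto_β : TendstoZeroInProb G.P fun n ω => wasserstein p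
    (G.markILaw β n ω) (root.map fun y => β y.2)

end Assumptions

end GraphRecursion

end

noncomputable section

set_option linter.unusedSectionVars false

namespace GraphRecursion

/-! ### `L^q` norms of nonnegative functions -/

section LqNorm

variable {α β : Type*} [MeasurableSpace α] [MeasurableSpace β]

/-- The `L^q` norm of a nonnegative function. -/
def lqn (q : ℝ) (μ : Measure α) (f : α → ℝ≥0∞) : ℝ≥0∞ := (∫⁻ x, f x ^ q ∂μ) ^ (1 / q)

variable {q : ℝ} {μ : Measure α} {f g : α → ℝ≥0∞}

lemma lqn_rpow (hq : 1 ≤ q) : lqn q μ f ^ q = ∫⁻ x, f x ^ q ∂μ := by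
  rw [lqn, ← ENNReal.rpow_mul, one_div_mul_cancel (by positivity), ENNReal.rpow_one]

lemma lqn_le_iff (hq : 1 ≤ q) {c : ℝ≥0∞} : lqn q μ f ≤ c ↔ ∫⁻ x, f x ^ q ∂μ ≤ c ^ q := by
  rw [← lqn_rpow hq, ENNReal.rpow_le_rpow_iff (by positivity)]

lemma lqn_mono_ae (hq : 1 ≤ q) (h : ∀ᵐ x ∂μ, f x ≤ g x) : lqn q μ f ≤ lqn q μ g :=
  ENNReal.rpow_le_rpow (lintegral_mono_ae (h.mono fun _ hx => ENNReal.rpow_le_rpow hx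
    (by positivity))) (by positivity)

lemma lqn_mono (hq : 1 ≤ q) (h : ∀ x, f x ≤ g x) : lqn q μ f ≤ lqn q μ g :=
  lqn_mono_ae hq (Eventually.of_forall h)

lemma lqn_add_le (hq : 1 ≤ q) (hf : Measurable f) (hg : Measurable g) :
    lqn q μ (fun x => f x + g x) ≤ lqn q μ f + lqn q μ g :=
  ENNReal.lintegral_Lp_add_le hf.aemeasurable hg.aemeasurable hq

lemma lqn_zero (hq : 1 ≤ q) : lqn q μ (fun _ => 0) = 0 := by
  rw [← nonpos_iff_eq_zero, lqn_le_iff hq]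
  simp [ENNReal.zero_rpow_of_pos (show 0 < q by positivity)]

lemma lqn_sum_le (hq : 1 ≤ q) {ι : Type*} (s : Finset ι) {f : ι → α → ℝ≥0∞}
    (hf : ∀ i, Measurable (f i)) :
    lqn q μ (fun x => ∑ i ∈ s, f i x) ≤ ∑ i ∈ s, lqn q μ (f i) := by
  classical
  induction s using Finset.induction_on with
  | empty => simp [lqn_zero hq]
  | insert a s ha ih =>
    simp only [Finset.sum_insert ha]
    exact (lqn_add_le hq (hf a) (Finset.measurable_sum s fun i _ => hf i)).trans
      (add_le_add le_rfl ih)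

lemma lqn_const_mul (hq : 1 ≤ q) (c : ℝ≥0∞) (hf : Measurable f) :
    lqn q μ (fun x => c * f x) = c * lqn q μ f := by
  have h0 : (0 : ℝ) ≤ q := by positivity
  simp only [lqn, ENNReal.mul_rpow_of_nonneg _ _ h0]
  rw [lintegral_const_mul _ (hf.pow_const q), ENNReal.mul_rpow_of_nonneg _ _ (by positivity),
    ← ENNReal.rpow_mul, mul_one_div_cancel (by positivity), ENNReal.rpow_one]

lemma lqn_mul_const (hq : 1 ≤ q) (c : ℝ≥0∞) (hf : Measurable f) :
    lqn q μ (fun x => f x * c) = lqn q μ f * c := by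
  simp only [mul_comm _ c, lqn_const_mul hq c hf]

lemma lqn_const (hq : 1 ≤ q) [IsProbabilityMeasure μ] (c : ℝ≥0∞) :
    lqn q μ (fun _ => c) = c := by
  simp only [lqn, lintegral_const, measure_univ, mul_one]
  rw [← ENNReal.rpow_mul, mul_one_div_cancel (by positivity), ENNReal.rpow_one]

lemma lqn_map {φ : β → α} {ν : Measure β} (hφ : Measurable φ) (hf : Measurable f) :
    lqn q (ν.map φ) f = lqn q ν (fun y => f (φ y)) := by
  rw [lqn, lintegral_map (hf.pow_const q) hφ, lqn]

lemma lqn_prod (hq : 1 ≤ q) {ν : Measure β} [SFinite ν] {f : α × β → ℝ≥0∞} (hf : Measurable f) :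
    lqn q (μ.prod ν) f = lqn q μ (fun x => lqn q ν (fun y => f (x, y))) := by
  rw [lqn, lintegral_prod _ (hf.pow_const q).aemeasurable, lqn]
  simp only [lqn_rpow hq]

lemma lqn_prod_symm (hq : 1 ≤ q) [SFinite μ] {ν : Measure β} [SFinite ν] {f : α × β → ℝ≥0∞}
    (hf : Measurable f) :
    lqn q (μ.prod ν) f = lqn q ν (fun y => lqn q μ (fun x => f (x, y))) := by
  rw [lqn, lintegral_prod_symm _ (hf.pow_const q).aemeasurable, lqn]
  simp only [lqn_rpow hq]

lemma measurable_lqn {ν : Measure β} [SFinite ν] {f : α × β → ℝ≥0∞} (hf : Measurable f) :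
    Measurable fun x => lqn q ν (fun y => f (x, y)) :=
  (Measurable.lintegral_prod_right' (hf.pow_const q)).pow_const _

lemma lintegral_le_lqn (hq : 1 ≤ q) [IsProbabilityMeasure μ] (hf : Measurable f) :
    ∫⁻ x, f x ∂μ ≤ lqn q μ f := by
  have := eLpNorm'_le_eLpNorm'_of_exponent_le (p := 1) (q := q) (μ := μ) zero_lt_one hq
    (f := f) hf.aestronglyMeasurable
  simpa [eLpNorm', lqn] using this

lemma lqn_eq_eLpNorm {p : ℝ≥0∞} [hp1 : Fact (1 ≤ p)] (hp : p ≠ ∞) {E : Type*}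
    [NormedAddCommGroup E] (f : α → E) : eLpNorm f p μ = lqn p.toReal μ (fun x => ‖f x‖ₑ) :=
  eLpNorm_eq_lintegral_rpow_enorm_toReal (zero_lt_one.trans_le hp1.out).ne' hp

lemma lqn_le_of_tendsto (hq : 1 ≤ q) {f : ℕ → α → ℝ≥0∞} (hf : ∀ n, Measurable (f n))
    {g : α → ℝ≥0∞} (h : ∀ᵐ x ∂μ, Tendsto (fun n => f n x) atTop (𝓝 (g x))) {c : ℝ≥0∞}
    (hc : ∀ᶠ n in atTop, lqn q μ (f n) ≤ c) : lqn q μ g ≤ c := by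
  rw [lqn_le_iff hq]
  have h1 : ∀ᵐ x ∂μ, g x ^ q = liminf (fun n => f n x ^ q) atTop := by
    filter_upwards [h] with x hx
    exact ((ENNReal.continuous_rpow_const.tendsto _).comp hx).liminf_eq.symm
  rw [lintegral_congr_ae h1]
  refine (lintegral_liminf_le fun n => (hf n).pow_const q).trans ?_
  refine liminf_le_of_frequently_le' ?_
  exact (hc.mono fun n hn => (lqn_le_iff hq).1 hn).frequently

/-- A sequence whose increments decay geometrically in `L^q` converges almost surely and in `L^q`
to its pointwise limit. -/
lemma geometric_limit (hq : 1 ≤ q) [IsProbabilityMeasure μ] {E : Type*} [NormedAddCommGroup E]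
    [CompleteSpace E] [SecondCountableTopology E] [MeasurableSpace E] [BorelSpace E]
    {f : ℕ → α → E} (hf : ∀ k, Measurable (f k)) {κ b : ℝ≥0∞} (hκ : κ < 1) (hb : b ≠ ∞)
    (h : ∀ k, lqn q μ (fun x => ‖f (k + 1) x - f k x‖ₑ) ≤ κ ^ k * b) :
    (∀ᵐ x ∂μ, Tendsto (fun k => f k x) atTop (𝓝 (limUnder atTop fun k => f k x))) ∧
      ∀ k, lqn q μ (fun x => ‖(limUnder atTop fun k => f k x) - f k x‖ₑ) ≤
        κ ^ k * (b * (1 - κ)⁻¹) := by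
  have hm : ∀ j k, Measurable fun x => ‖f j x - f k x‖ₑ :=
    fun j k => ((hf j).sub (hf k)).enorm
  have h1 : ∀ᵐ x ∂μ, Tendsto (fun k => f k x) atTop (𝓝 (limUnder atTop fun k => f k x)) := by
    have : ∫⁻ x, ∑' k, ‖f (k + 1) x - f k x‖ₑ ∂μ ≠ ∞ := by
      rw [lintegral_tsum fun k => (hm _ _).aemeasurable]
      refine ne_top_of_le_ne_top ?_ (ENNReal.tsum_le_tsum fun k =>
        (lintegral_le_lqn hq (hm _ _)).trans (h k))
      rw [ENNReal.tsum_mul_right, ENNReal.tsum_geometric]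
      exact ENNReal.mul_ne_top (ENNReal.inv_ne_top.2 (tsub_pos_of_lt hκ).ne') hb
    filter_upwards [ae_lt_top (Measurable.tsum fun k => hm _ _) this] with x hx
    have hc : CauchySeq fun k => f k x := by
      refine cauchySeq_of_edist_le_of_tsum_ne_top (fun k => ‖f (k + 1) x - f k x‖ₑ) (fun k => ?_)
        hx.ne
      rw [edist_comm, edist_eq_enorm_sub]
    exact tendsto_nhds_limUnder (cauchySeq_tendsto_of_complete hc)
  refine ⟨h1, fun k => ?_⟩
  have h2 : ∀ m, lqn q μ (fun x => ‖f (k + m) x - f k x‖ₑ) ≤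
      κ ^ k * (b * ∑ i ∈ Finset.range m, κ ^ i) := by
    intro m
    induction m with
    | zero => simp [lqn_zero hq]
    | succ m ih =>
      calc lqn q μ (fun x => ‖f (k + (m + 1)) x - f k x‖ₑ)
          ≤ lqn q μ (fun x => ‖f (k + m) x - f k x‖ₑ + ‖f (k + m + 1) x - f (k + m) x‖ₑ) := by
            refine lqn_mono hq fun x => ?_
            have : f (k + (m + 1)) x - f k x
              = (f (k + m) x - f k x) + (f (k + m + 1) x - f (k + m) x) := by
              rw [← add_assoc k m 1]; abel
            rw [this]
            exact enorm_add_le _ _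
        _ ≤ κ ^ k * (b * ∑ i ∈ Finset.range m, κ ^ i) + κ ^ (k + m) * b :=
            (lqn_add_le hq (hm _ _) (hm _ _)).trans (add_le_add ih (h _))
        _ = _ := by rw [Finset.sum_range_succ, pow_add]; ring
  refine lqn_le_of_tendsto hq (f := fun m x => ‖f (k + m) x - f k x‖ₑ) (fun m => hm _ _) ?_
    (Eventually.of_forall fun m => (h2 m).trans ?_)
  · filter_upwards [h1] with x hx
    have : Tendsto (fun m => f (k + m) x) atTop (𝓝 (limUnder atTop fun k => f k x)) := by
      simpa only [add_comm k] using (tendsto_add_atTop_iff_nat k).2 hx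
    exact (continuous_enorm.tendsto _).comp (this.sub_const _)
  · gcongr
    rw [← ENNReal.tsum_geometric]
    exact ENNReal.sum_le_tsum _

lemma measurable_enorm_sub {E : Type*} [NormedAddCommGroup E] [MeasurableSpace E] [BorelSpace E]
    [SecondCountableTopology E] {f g : α → E} (hf : Measurable f) (hg : Measurable g) :
    Measurable fun x => ‖f x - g x‖ₑ :=
  (hf.sub hg).enorm

lemma tendsto_pow_mul_zero {κ b : ℝ≥0∞} (hκ : κ < 1) (hb : b ≠ ∞) :
    Tendsto (fun k : ℕ => κ ^ k * b) atTop (𝓝 0) := by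
  have := ENNReal.Tendsto.mul_const (ENNReal.tendsto_pow_atTop_nhds_zero_of_lt_one hκ)
    (Or.inr hb)
  simpa using this

lemma tendsto_lqn_tail (hq : 1 ≤ q) (hf : Measurable f) (h : lqn q μ f ≠ ∞) :
    Tendsto (fun n : ℕ => lqn q μ (fun x => f x - n)) atTop (𝓝 0) := by
  have h0 : (0 : ℝ) < q := by positivity
  have hint : ∫⁻ x, f x ^ q ∂μ ≠ ∞ := by
    rw [← lqn_rpow hq]; exact ENNReal.rpow_ne_top_of_nonneg h0.le h
  have key : Tendsto (fun n : ℕ => ∫⁻ x, (f x - n) ^ q ∂μ) atTop (𝓝 (∫⁻ _, 0 ∂μ)) := by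
    refine tendsto_lintegral_of_dominated_convergence (fun x => f x ^ q)
      (fun n => (hf.sub_const _).pow_const q) (fun n => Eventually.of_forall fun x =>
        ENNReal.rpow_le_rpow tsub_le_self h0.le) hint ?_
    filter_upwards [ae_lt_top (hf.pow_const q) hint] with x hx
    have hx' : f x ≠ ∞ := fun h => by simp [h, h0] at hx
    obtain ⟨n, hn⟩ := ENNReal.exists_nat_gt hx'
    refine tendsto_const_nhds.congr' ?_
    filter_upwards [eventually_ge_atTop n] with m hm
    rw [tsub_eq_zero_of_le (hn.le.trans (by exact_mod_cast hm)), ENNReal.zero_rpow_of_pos h0]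
  have := (ENNReal.continuous_rpow_const (y := 1 / q)).tendsto _ |>.comp key
  simpa [lqn, Function.comp_def, ENNReal.zero_rpow_of_pos, h0] using this

end LqNorm

/-! ### Wasserstein distance -/

section Wasserstein

variable {p : ℝ≥0∞} {E : Type*} [PseudoEMetricSpace E] [MeasurableSpace E]

lemma wasserstein_le {μ ν : Measure E} (π : Measure (E × E)) (h1 : π.map Prod.fst = μ)
    (h2 : π.map Prod.snd = ν) :
    wasserstein p μ ν ≤ lqn p.toReal π (fun z => edist z.1 z.2) :=
  iInf_le _ (⟨π, h1, h2⟩ : {π : Measure (E × E) // π.map Prod.fst = μ ∧ π.map Prod.snd = ν})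

lemma exists_coupling_lt {μ ν : Measure E} {c : ℝ≥0∞} (h : wasserstein p μ ν < c) :
    ∃ π : Measure (E × E), π.map Prod.fst = μ ∧ π.map Prod.snd = ν ∧
      lqn p.toReal π (fun z => edist z.1 z.2) < c := by
  obtain ⟨π, hπ⟩ := iInf_lt_iff.1 h
  exact ⟨π, π.2.1, π.2.2, hπ⟩

lemma wasserstein_map_le {Ω : Type*} [MeasurableSpace Ω] {P : Measure Ω} {X Y : Ω → E}
    [SecondCountableTopology E] [OpensMeasurableSpace E]
    (hX : Measurable X) (hY : Measurable Y) :
    wasserstein p (P.map X) (P.map Y) ≤ lqn p.toReal P (fun ω => edist (X ω) (Y ω)) := by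
  have := wasserstein_le (p := p) (P.map fun ω => (X ω, Y ω))
    (Measure.map_map measurable_fst (hX.prodMk hY))
    (Measure.map_map measurable_snd (hX.prodMk hY))
  rwa [lqn_map (hX.prodMk hY) measurable_edist] at this

lemma wasserstein_comm [SecondCountableTopology E] [OpensMeasurableSpace E] (μ ν : Measure E) :
    wasserstein p μ ν = wasserstein p ν μ := by
  have key : ∀ μ ν : Measure E, wasserstein p μ ν ≤ wasserstein p ν μ := by
    intro μ ν
    refine le_iInf fun π => ?_
    have := wasserstein_map_le (p := p) (P := (π : Measure (E × E))) measurable_snd measurable_fst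
    rw [π.2.1, π.2.2] at this
    simpa only [edist_comm, lqn] using this
  exact le_antisymm (key _ _) (key _ _)

lemma wasserstein_triangle {E : Type*} [PseudoEMetricSpace E] [MeasurableSpace E]
    [SecondCountableTopology E] [OpensMeasurableSpace E] [StandardBorelSpace E] [Nonempty E]
    (hp : 1 ≤ p.toReal) (μ₁ μ₂ μ₃ : Measure E) [IsFiniteMeasure μ₂] :
    wasserstein p μ₁ μ₃ ≤ wasserstein p μ₁ μ₂ + wasserstein p μ₂ μ₃ := by
  rw [wasserstein_comm μ₁ μ₂]
  refine le_of_forall_gt fun c hc => ?_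
  obtain ⟨a, b, hab, ha, hb⟩ : ∃ a b, a + b < c ∧ wasserstein p μ₂ μ₁ < a ∧
      wasserstein p μ₂ μ₃ < b := by
    obtain ⟨b, hb, hb'⟩ := exists_between (lt_tsub_iff_left.2 hc)
    obtain ⟨a, ha, ha'⟩ := exists_between (lt_tsub_iff_right.2 (lt_tsub_iff_left.1 hb'))
    exact ⟨a, b, lt_tsub_iff_right.1 ha', ha, hb⟩
  obtain ⟨π, h1, h2, h3⟩ := exists_coupling_lt ha
  obtain ⟨ρ, k1, k2, k3⟩ := exists_coupling_lt hb
  have : IsFiniteMeasure π := ⟨by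
    have := congrArg (fun m => m Set.univ) h1
    simp only [Measure.map_apply measurable_fst MeasurableSet.univ, Set.preimage_univ] at this
    rw [this]; exact measure_lt_top _ _⟩
  have : IsFiniteMeasure ρ := ⟨by
    have := congrArg (fun m => m Set.univ) k1
    simp only [Measure.map_apply measurable_fst MeasurableSet.univ, Set.preimage_univ] at this
    rw [this]; exact measure_lt_top _ _⟩
  have h1' : π.fst = μ₂ := h1
  have k1' : ρ.fst = μ₂ := k1
  let σ : Measure (E × (E × E)) := μ₂ ⊗ₘ (π.condKernel ×ₖ ρ.condKernel)
  have hσ1 : σ.map (fun z => (z.1, z.2.1)) = π := by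
    conv_rhs => rw [← π.disintegrate π.condKernel, h1']
    change (μ₂ ⊗ₘ (π.condKernel ×ₖ ρ.condKernel)).map (Prod.map id Prod.fst) = _
    rw [← Measure.compProd_map measurable_fst, ← Kernel.fst_eq, Kernel.fst_prod]
  have hσ2 : σ.map (fun z => (z.1, z.2.2)) = ρ := by
    conv_rhs => rw [← ρ.disintegrate ρ.condKernel, k1']
    change (μ₂ ⊗ₘ (π.condKernel ×ₖ ρ.condKernel)).map (Prod.map id Prod.snd) = _
    rw [← Measure.compProd_map measurable_snd, ← Kernel.snd_eq, Kernel.snd_prod]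
  have e1 : σ.map (fun z => z.2.1) = μ₁ := by
    rw [← h2, ← hσ1, Measure.map_map (by fun_prop) (by fun_prop)]; rfl
  have e2 : σ.map (fun z => z.2.2) = μ₃ := by
    rw [← k2, ← hσ2, Measure.map_map (by fun_prop) (by fun_prop)]; rfl
  rw [← e1, ← e2]
  have m1 : Measurable fun z : E × (E × E) => edist z.1 z.2.1 :=
    measurable_edist.comp (f := fun z : E × (E × E) => (z.1, z.2.1)) (by fun_prop)
  have m2 : Measurable fun z : E × (E × E) => edist z.1 z.2.2 :=
    measurable_edist.comp (f := fun z : E × (E × E) => (z.1, z.2.2)) (by fun_prop)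
  calc _ ≤ lqn p.toReal σ (fun z => edist z.2.1 z.2.2) :=
        wasserstein_map_le (by fun_prop) (by fun_prop)
    _ ≤ lqn p.toReal σ (fun z => edist z.1 z.2.1 + edist z.1 z.2.2) :=
        lqn_mono hp fun z => (edist_triangle_left _ _ z.1)
    _ ≤ lqn p.toReal σ (fun z => edist z.1 z.2.1) + lqn p.toReal σ (fun z => edist z.1 z.2.2) :=
        lqn_add_le hp m1 m2
    _ < c := by
        refine lt_of_le_of_lt (add_le_add ?_ ?_) hab
        · rw [← hσ1, lqn_map (by fun_prop) measurable_edist] at h3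
          exact h3.le
        · rw [← hσ2, lqn_map (by fun_prop) measurable_edist] at k3
          exact k3.le

end Wasserstein

/-! ### Infinite products of probability measures -/

section InfinitePi

open Measure

variable {ι α X Y : Type*} [MeasurableSpace X] [MeasurableSpace Y]

/-- The finite measurable boxes of a product space. -/
def boxes (ι X : Type*) [MeasurableSpace X] : Set (Set (ι → X)) :=
  {A | ∃ (s : Finset ι) (t : ι → Set X), (∀ i, MeasurableSet (t i)) ∧ A = Set.pi s t}

lemma generateFrom_boxes :
    MeasurableSpace.generateFrom (boxes ι X) = MeasurableSpace.pi := by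
  refine le_antisymm (MeasurableSpace.generateFrom_le ?_) ?_
  · rintro _ ⟨s, t, ht, rfl⟩
    exact MeasurableSet.pi s.countable_toSet fun i _ => ht i
  · refine iSup_le fun i => ?_
    rintro _ ⟨u, hu, rfl⟩
    refine MeasurableSpace.measurableSet_generateFrom ⟨{i}, fun _ => u, fun _ => hu, ?_⟩
    ext w; simp

lemma isPiSystem_boxes : IsPiSystem (boxes ι X) := by
  classical
  rintro _ ⟨s, t, ht, rfl⟩ _ ⟨s', t', ht', rfl⟩ -
  refine ⟨s ∪ s', fun i => (if i ∈ s then t i else Set.univ) ∩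
    (if i ∈ s' then t' i else Set.univ), fun i => ?_, ?_⟩
  · refine MeasurableSet.inter ?_ ?_ <;> split_ifs <;> simp [ht, ht']
  · ext w
    simp only [Set.mem_inter_iff, Set.mem_pi, Finset.coe_union, Set.mem_union, Finset.mem_coe]
    constructor
    · rintro ⟨h, h'⟩ i -
      constructor <;> split_ifs with hi <;> simp_all
    · intro h
      refine ⟨fun i hi => ?_, fun i hi => ?_⟩
      · have := (h i (Or.inl hi)).1; rwa [if_pos hi] at this
      · have := (h i (Or.inr hi)).2; rwa [if_pos hi] at this

/-- The whole space is a box. -/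
def spanningBoxes (P : Measure (ι → X)) [IsProbabilityMeasure P] :
    P.FiniteSpanningSetsIn (boxes ι X) where
  set _ := Set.univ
  set_mem _ := ⟨∅, fun _ => Set.univ, fun _ => MeasurableSet.univ, by simp⟩
  finite _ := measure_lt_top _ _
  spanning := Set.iUnion_const _

lemma infinitePi_map_unzip (μ : ι → Measure X) (ν : ι → Measure Y)
    [∀ i, IsProbabilityMeasure (μ i)] [∀ i, IsProbabilityMeasure (ν i)] :
    (infinitePi fun i => (μ i).prod (ν i)).map (fun w => (fun i => (w i).1, fun i => (w i).2)) =
      (infinitePi μ).prod (infinitePi ν) := by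
  classical
  refine (Measure.prod_eq_generateFrom generateFrom_boxes generateFrom_boxes isPiSystem_boxes
    isPiSystem_boxes (spanningBoxes _) (spanningBoxes _) ?_).symm
  rintro _ ⟨s, t, ht, rfl⟩ _ ⟨s', t', ht', rfl⟩
  have hm : Measurable fun w : ι → X × Y => (fun i => (w i).1, fun i => (w i).2) := by fun_prop
  rw [map_apply hm ((MeasurableSet.pi s.countable_toSet fun i _ => ht i).prod
    (MeasurableSet.pi s'.countable_toSet fun i _ => ht' i))]
  have e : (fun w : ι → X × Y => ((fun i => (w i).1 : ι → X), (fun i => (w i).2 : ι → Y))) ⁻¹'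
      ((Set.pi s t) ×ˢ (Set.pi s' t')) = Set.pi ((s ∪ s' : Finset ι) : Set ι) (fun i =>
        (if i ∈ s then t i else Set.univ) ×ˢ (if i ∈ s' then t' i else Set.univ)) := by
    ext w
    simp only [Set.mem_preimage, Set.mem_prod, Set.mem_pi, Finset.coe_union, Set.mem_union,
      Finset.mem_coe]
    constructor
    · rintro ⟨h, h'⟩ i -
      constructor <;> split_ifs with hi <;> simp_all
    · intro h
      refine ⟨fun i hi => ?_, fun i hi => ?_⟩
      · have := (h i (Or.inl hi)).1; rwa [if_pos hi] at this
      · have := (h i (Or.inr hi)).2; rwa [if_pos hi] at this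
  rw [e, infinitePi_pi, infinitePi_pi _ fun i _ => ht i, infinitePi_pi _ fun i _ => ht' i]
  · simp only [prod_prod, Finset.prod_mul_distrib]
    congr 1
    · rw [← Finset.prod_subset Finset.subset_union_left]
      · exact Finset.prod_congr rfl fun i hi => by rw [if_pos hi]
      · intro i _ hi; rw [if_neg hi, measure_univ]
    · rw [← Finset.prod_subset Finset.subset_union_right]
      · exact Finset.prod_congr rfl fun i hi => by rw [if_pos hi]
      · intro i _ hi; rw [if_neg hi, measure_univ]
  · intro i _
    refine MeasurableSet.prod ?_ ?_ <;> split_ifs <;> simp [ht, ht']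

lemma infinitePi_map_zip (μ : ι → Measure X) (ν : ι → Measure Y)
    [∀ i, IsProbabilityMeasure (μ i)] [∀ i, IsProbabilityMeasure (ν i)] :
    ((infinitePi μ).prod (infinitePi ν)).map (fun z i => (z.1 i, z.2 i)) =
      infinitePi fun i => (μ i).prod (ν i) := by
  rw [← infinitePi_map_unzip, map_map (by fun_prop) (by fun_prop)]
  exact Measure.map_id

lemma infinitePi_option (μ : Option α → Measure X) [∀ i, IsProbabilityMeasure (μ i)] :
    (infinitePi μ).map (fun w => (w none, fun a => w (some a))) =
      (μ none).prod (infinitePi fun a => μ (some a)) := by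
  classical
  have hm : Measurable fun (z : X × (α → X)) (o : Option α) => o.elim z.1 z.2 := by
    refine measurable_pi_lambda _ fun o => ?_
    cases o with
    | none => exact measurable_fst
    | some a => exact (measurable_pi_apply a).comp measurable_snd
  have key : ((μ none).prod (infinitePi fun a => μ (some a))).map
      (fun (z : X × (α → X)) (o : Option α) => o.elim z.1 z.2) = infinitePi μ := by
    refine eq_infinitePi μ fun s t ht => ?_
    rw [map_apply hm (MeasurableSet.pi s.countable_toSet fun i _ => ht i)]
    have e : (fun (z : X × (α → X)) (o : Option α) => o.elim z.1 z.2) ⁻¹' (Set.pi s t) =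
        (if none ∈ s then t none else Set.univ) ×ˢ
          (Set.pi (Finset.eraseNone s : Set α) fun a => t (some a)) := by
      ext z
      simp only [Set.mem_preimage, Set.mem_pi, Finset.mem_coe, Set.mem_prod,
        Finset.mem_eraseNone]
      constructor
      · intro h
        refine ⟨?_, fun a ha => h (some a) ha⟩
        split_ifs with hn
        · exact h none hn
        · trivial
      · rintro ⟨h, h'⟩ o ho
        cases o with
        | none => rwa [if_pos ho] at h
        | some a => exact h' a ho
    rw [e, prod_prod, infinitePi_pi _ fun i _ => ht _]
    by_cases hn : none ∈ s
    · have : s = Finset.insertNone (Finset.eraseNone s) := by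
        simp [Finset.insertNone_eraseNone, hn]
      conv_rhs => rw [this]
      rw [if_pos hn, Finset.prod_insertNone]
    · have : s = (Finset.eraseNone s).map Function.Embedding.some := by
        rw [Finset.map_some_eraseNone, Finset.erase_eq_of_notMem hn]
      conv_rhs => rw [this]
      rw [if_neg hn, Finset.prod_map, measure_univ, one_mul]
      rfl
  rw [← key, map_map (by fun_prop) hm]
  exact Measure.map_id

/-- One coordinate and a disjoint block of coordinates of an infinite product. -/
lemma infinitePi_map_point_block (μ : ι → Measure X) [∀ i, IsProbabilityMeasure (μ i)] (i : ι)
    {f : α → ι} (hf : Function.Injective f) (hi : ∀ a, f a ≠ i) :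
    (infinitePi μ).map (fun w => (w i, fun a => w (f a))) =
      (μ i).prod (infinitePi fun a => μ (f a)) := by
  have hinj : Function.Injective fun o : Option α => o.elim i f := by
    rintro (_ | a) (_ | b) h
    · rfl
    · exact absurd h.symm (hi b)
    · exact absurd h (hi a)
    · exact congrArg some (hf h)
  have h1 := map_infinitePi_infinitePi_of_inj (P := μ) hinj
  have h2 := infinitePi_option (fun o : Option α => μ (o.elim i f))
  rw [← h1, map_map (by fun_prop) (by fun_prop)] at h2
  exact h2

lemma append_singleton_injective :
    Function.Injective fun a : ℕ × List ℕ => a.2 ++ [a.1] := by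
  rintro ⟨j, q⟩ ⟨j', q'⟩ h
  simp only [List.append_singleton_inj] at h
  exact Prod.ext h.2 h.1

/-- The label at the root and the subtrees at the children of the root of a randomly labelled
tree. -/
lemma infinitePi_list (μ : List ℕ → Measure X) [∀ q, IsProbabilityMeasure (μ q)] :
    (infinitePi μ).map (fun w => (w [], fun (j : ℕ) (q : List ℕ) => w (q ++ [j]))) =
      (μ []).prod (infinitePi fun j => infinitePi fun q => μ (q ++ [j])) := by
  have h := infinitePi_map_point_block μ [] append_singleton_injective (by simp)
  have h2 := infinitePi_map_curry (fun (j : ℕ) (q : List ℕ) => μ (q ++ [j]))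
  rw [← h2]
  have e : (μ []).prod ((infinitePi fun a : ℕ × List ℕ => μ (a.2 ++ [a.1])).map
      (MeasurableEquiv.curry ℕ (List ℕ) X)) =
      ((μ []).prod (infinitePi fun a : ℕ × List ℕ => μ (a.2 ++ [a.1]))).map
        (Prod.map id (MeasurableEquiv.curry ℕ (List ℕ) X)) := by
    rw [← map_prod_map _ _ measurable_id (by fun_prop), Measure.map_id]
  rw [e, ← h, map_map (by fun_prop) (by fun_prop)]
  rfl

/-- The first term and the remaining terms of an i.i.d. sequence. -/
lemma infinitePi_nat (μ : Measure X) [IsProbabilityMeasure μ] :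
    (infinitePi fun _ : ℕ => μ).map (fun w => (w 0, fun k => w (k + 1))) =
      μ.prod (infinitePi fun _ : ℕ => μ) :=
  infinitePi_map_point_block (fun _ : ℕ => μ) 0 (add_left_injective 1) (by simp)

/-- The values of an i.i.d. family at distinct indices form an i.i.d. family, as far as a function
of the coordinates in `A` can see. -/
lemma infinitePi_map_injOn {κ W : Type*} [MeasurableSpace W] (μ : Measure X)
    [IsProbabilityMeasure μ] {A : Set α} {f : α → κ} (hf : Set.InjOn f A) {F : (α → X) → W}
    (hF : Measurable F) (hdep : ∀ w w', (∀ a ∈ A, w a = w' a) → F w = F w') :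
    (infinitePi fun _ : κ => μ).map (fun w => F fun a => w (f a)) =
      (infinitePi fun _ : α => μ).map F := by
  classical
  have : Nonempty X := nonempty_of_isProbabilityMeasure μ
  let x₀ : X := Classical.arbitrary X
  let ext : (A → X) → α → X := fun w a => if h : a ∈ A then w ⟨a, h⟩ else x₀
  have hext : Measurable ext := by
    refine measurable_pi_lambda _ fun a => ?_
    by_cases h : a ∈ A
    · simp only [ext, dif_pos h]; fun_prop
    · simp only [ext, dif_neg h]; fun_prop
  have h1 : (fun w : κ → X => F fun a => w (f a)) =
      (fun w => F (ext w)) ∘ fun w (a : A) => w (f a) := by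
    funext w
    exact hdep _ _ fun a ha => by simp [ext, ha]
  have h2 : F = (fun w => F (ext w)) ∘ fun w (a : A) => w a := by
    funext w
    exact hdep _ _ fun a ha => by simp [ext, ha]
  rw [h1]
  conv_rhs => rw [h2]
  have hFe : Measurable fun w => F (ext w) := hF.comp hext
  rw [← map_map hFe (by fun_prop), ← map_map hFe (by fun_prop),
    map_infinitePi_infinitePi_of_inj (P := fun _ : κ => μ) (f := fun a : A => f a)
      (fun a b h => Subtype.ext (hf a.2 b.2 h)),
    map_infinitePi_infinitePi_of_inj (P := fun _ : α => μ) (f := fun a : A => (a : α))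
      Subtype.val_injective]

end InfinitePi

/-! ### Measurability and moment bounds for one application of the maps -/

section Bag

variable {Ξ ι κ : Type*} [Fintype ι] [Fintype κ]

lemma bag_equiv (e : κ ≃ ι) (v : ι → ℝ) (w : ι → Ξ) :
    bag (fun k => v (e k)) (fun k => w (e k)) = bag v w := by
  unfold bag
  rw [← Multiset.map_univ_val_equiv e, Multiset.map_map]
  rfl

end Bag

section Maps

variable {S Z Ξ : Type*} [MeasurableSpace S] [MeasurableSpace Z] [MeasurableSpace Ξ]
  (M : Recursion S Z Ξ)

/-- `Φ(x, ζ, {u_j, ξ_j : j < N})` as a function of `(N, x)`, the noise, and a sequence `u`. -/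
def Recursion.app (y : ℕ × Mark S) (n : Z × (ℕ → Ξ)) (u : ℕ → ℝ) : ℝ :=
  M.Φ y.2 n.1 (bag (fun j : Fin y.1 => u j) (fun j => n.2 j))

/-- The law of the noise at a node of a tree and on all potential edges from its children. -/
def Recursion.nodeNoise : Measure (Z × (ℕ → Ξ)) :=
  M.vertexNoise.prod (Measure.infinitePi fun _ : ℕ => M.edgeNoise)

instance : IsProbabilityMeasure M.nodeNoise := by
  unfold Recursion.nodeNoise; infer_instance

lemma Recursion.measurable_Φ_fintype {ι Ω : Type*} [Fintype ι] [MeasurableSpace Ω]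
    {x : Ω → Mark S} {z : Ω → Z} {v : Ω → ι → ℝ} {ξ : Ω → ι → Ξ} (hx : Measurable x)
    (hz : Measurable z) (hv : Measurable v) (hξ : Measurable ξ) :
    Measurable fun ω => M.Φ (x ω) (z ω) (bag (v ω) (ξ ω)) := by
  let e := (Fintype.equivFin ι).symm
  have : (fun ω => M.Φ (x ω) (z ω) (bag (v ω) (ξ ω))) = fun ω =>
      M.Φ (x ω) (z ω) (bag (fun k => v ω (e k)) (fun k => ξ ω (e k))) := by
    funext ω; rw [bag_equiv]
  rw [this]
  exact (M.measurable_Φ _).comp (hx.prodMk (hz.prodMk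
    ((show Measurable fun ω k => v ω (e k) by fun_prop).prodMk
      (show Measurable fun ω k => ξ ω (e k) by fun_prop))))

lemma Recursion.measurable_app :
    Measurable fun w : (ℕ × Mark S) × (Z × (ℕ → Ξ)) × (ℕ → ℝ) => M.app w.1 w.2.1 w.2.2 := by
  have h : Measurable fun w : ℕ × (Mark S × (Z × (ℕ → Ξ)) × (ℕ → ℝ)) =>
      M.app (w.1, w.2.1) w.2.2.1 w.2.2.2 := by
    refine measurable_from_prod_countable_right fun m => ?_
    exact M.measurable_Φ_fintype (by fun_prop) (by fun_prop)
      (v := fun (w : Mark S × (Z × (ℕ → Ξ)) × (ℕ → ℝ)) (j : Fin m) => w.2.2 j)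
      (ξ := fun (w : Mark S × (Z × (ℕ → Ξ)) × (ℕ → ℝ)) (j : Fin m) => w.2.1.2 j)
      (by fun_prop) (by fun_prop)
  exact h.comp (g := fun w : ℕ × (Mark S × (Z × (ℕ → Ξ)) × (ℕ → ℝ)) =>
      M.app (w.1, w.2.1) w.2.2.1 w.2.2.2)
    (f := fun w : (ℕ × Mark S) × (Z × (ℕ → Ξ)) × (ℕ → ℝ) => (w.1.1, (w.1.2, w.2.1, w.2.2)))
    (by fun_prop)

lemma measurable_sum_range {Ω : Type*} [MeasurableSpace Ω] {N : Ω → ℕ} (hN : Measurable N)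
    {f : Ω → ℕ → ℝ≥0∞} (hf : Measurable f) :
    Measurable fun ω => ∑ j ∈ Finset.range (N ω), f ω j := by
  have h : Measurable fun w : ℕ × Ω => ∑ j ∈ Finset.range w.1, f w.2 j :=
    measurable_from_prod_countable_right fun m =>
      Finset.measurable_sum (Finset.range m) fun j _ => (measurable_pi_apply j).comp hf
  exact h.comp (hN.prodMk measurable_id)

variable {p : ℝ≥0∞}

/-- The `L^p` bounds in the assumptions, transported along measure preserving maps. -/
lemma lqn_le_of_memLp [hp1 : Fact (1 ≤ p)] (hp : p ≠ ∞) {Ω Ω' : Type*} [MeasurableSpace Ω]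
    [MeasurableSpace Ω'] {P : Measure Ω} {P' : Measure Ω'} {φ : Ω → Ω'}
    (hφ : MeasurePreserving φ P P') {f : Ω' → ℝ} (hf : Measurable f) {c : ℝ}
    (h : MemLp f p P' ∧ (eLpNorm f p P').toReal ≤ c) :
    lqn p.toReal P (fun ω => ‖f (φ ω)‖ₑ) ≤ ENNReal.ofReal c := by
  rw [← lqn_map hφ.measurable hf.enorm, hφ.map_eq, ← lqn_eq_eLpNorm hp,
    ← ENNReal.ofReal_toReal h.1.eLpNorm_ne_top]
  exact ENNReal.ofReal_le_ofReal h.2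

lemma ofReal_mul_sum_abs {ι : Type*} [Fintype ι] (s : ℝ) (v : ι → ℝ) :
    ENNReal.ofReal (s * ∑ j, |v j|) = ENNReal.ofReal s * ∑ j, ‖v j‖ₑ := by
  rw [ENNReal.ofReal_mul' (by positivity), ENNReal.ofReal_sum_of_nonneg fun _ _ => abs_nonneg _]
  simp only [← Real.norm_eq_abs, ofReal_norm]

lemma ofReal_mul_sum_abs_add {ι : Type*} [Fintype ι] (s b : ℝ) (v : ι → ℝ) :
    ENNReal.ofReal ((∑ j, s * |v j|) + b) ≤
      ENNReal.ofReal s * ∑ j, ‖v j‖ₑ + ENNReal.ofReal b := by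
  rw [← Finset.mul_sum, ← ofReal_mul_sum_abs]
  exact ENNReal.ofReal_add_le

variable {M}

lemma Recursion.LipschitzAt.lqn_le [Fact (1 ≤ p)] (hp : p ≠ ∞) {s : ℝ} {m : ℕ} {x : Mark S}
    (h : M.LipschitzAt p s m x) {Ω : Type*} [MeasurableSpace Ω] {P : Measure Ω}
    {φ : Ω → Z × (Fin m → Ξ)} (hφ : MeasurePreserving φ P (M.localNoise m)) (v w : Fin m → ℝ) :
    lqn p.toReal P (fun ω => ‖M.Φ x (φ ω).1 (bag v (φ ω).2) - M.Φ x (φ ω).1 (bag w (φ ω).2)‖ₑ) ≤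
      ENNReal.ofReal s * ∑ j, ‖v j - w j‖ₑ := by
  rw [← ofReal_mul_sum_abs]
  refine lqn_le_of_memLp hp hφ (f := fun e => M.Φ x e.1 (bag v e.2) - M.Φ x e.1 (bag w e.2))
    (Measurable.sub ?_ ?_) (h v w)
  all_goals exact M.measurable_Φ_fintype (by fun_prop) (by fun_prop) (by fun_prop) (by fun_prop)

lemma Recursion.GrowthAt.lqn_le [Fact (1 ≤ p)] (hp : p ≠ ∞) {s b : ℝ} {m : ℕ} {x : Mark S}
    (h : M.GrowthAt p s b m x) {Ω : Type*} [MeasurableSpace Ω] {P : Measure Ω}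
    {φ : Ω → Z × (Fin m → Ξ)} (hφ : MeasurePreserving φ P (M.localNoise m)) (v : Fin m → ℝ) :
    lqn p.toReal P (fun ω => ‖M.Φ x (φ ω).1 (bag v (φ ω).2)‖ₑ) ≤
      ENNReal.ofReal s * ∑ j, ‖v j‖ₑ + ENNReal.ofReal b := by
  refine le_trans ?_ (ofReal_mul_sum_abs_add s b v)
  refine lqn_le_of_memLp hp hφ (f := fun e => M.Φ x e.1 (bag v e.2)) ?_ (h v)
  exact M.measurable_Φ_fintype (by fun_prop) (by fun_prop) (by fun_prop) (by fun_prop)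

variable (M) in
lemma Recursion.measurePreserving_nodeNoise (m : ℕ) :
    MeasurePreserving (fun n : Z × (ℕ → Ξ) => (n.1, fun j : Fin m => n.2 j)) M.nodeNoise
      (M.localNoise m) := by
  refine MeasurePreserving.prod (f := id) (g := fun (w : ℕ → Ξ) (j : Fin m) => w j)
    (MeasurePreserving.id _) ⟨by fun_prop, ?_⟩
  rw [Measure.map_infinitePi_infinitePi_of_inj (P := fun _ : ℕ => M.edgeNoise)
    (f := fun j : Fin m => (j : ℕ)) Fin.val_injective, Measure.infinitePi_eq_pi]

lemma Recursion.LipschitzAt.app_le [Fact (1 ≤ p)] (hp : p ≠ ∞) {s : ℝ} {y : ℕ × Mark S}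
    (h : M.LipschitzAt p s y.1 y.2) (u w : ℕ → ℝ) :
    lqn p.toReal M.nodeNoise (fun n => ‖M.app y n u - M.app y n w‖ₑ) ≤
      ENNReal.ofReal s * ∑ j ∈ Finset.range y.1, ‖u j - w j‖ₑ := by
  have := h.lqn_le hp (M.measurePreserving_nodeNoise y.1) (fun j => u j) (fun j => w j)
  rwa [Fin.sum_univ_eq_sum_range (fun j => ‖u j - w j‖ₑ)] at this

lemma Recursion.GrowthAt.app_le [Fact (1 ≤ p)] (hp : p ≠ ∞) {s b : ℝ} {y : ℕ × Mark S}
    (h : M.GrowthAt p s b y.1 y.2) (u : ℕ → ℝ) :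
    lqn p.toReal M.nodeNoise (fun n => ‖M.app y n u‖ₑ) ≤
      ENNReal.ofReal s * ∑ j ∈ Finset.range y.1, ‖u j‖ₑ + ENNReal.ofReal b := by
  have := h.lqn_le hp (M.measurePreserving_nodeNoise y.1) (fun j => u j)
  rwa [Fin.sum_univ_eq_sum_range (fun j => ‖u j‖ₑ)] at this

end Maps

/-! ### One step of the chain on a graph -/

section GraphStep

variable {S Z Ξ V : Type*} [MeasurableSpace S] [MeasurableSpace Z] [MeasurableSpace Ξ]
  [Fintype V] (M : Recursion S Z Ξ)

/-- The noise used in one step of the chain. -/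
abbrev StepNoise (V Z Ξ : Type*) : Type _ := (V → Z) × (V × V × ℕ → Ξ)

/-- The law of the noise used in one step of the chain. -/
def Recursion.stepLaw (V : Type*) : Measure (StepNoise V Z Ξ) :=
  (Measure.infinitePi fun _ : V => M.vertexNoise).prod
    (Measure.infinitePi fun _ : V × V × ℕ => M.edgeNoise)

instance : IsProbabilityMeasure (M.stepLaw V) := by
  unfold Recursion.stepLaw; infer_instance

instance : IsProbabilityMeasure (M.noiseLaw V) := by
  unfold Recursion.noiseLaw; infer_instance

/-- One step of the chain. -/
def Recursion.graphStep (G : WDigraph V S) (r : V → ℝ) (n : StepNoise V Z Ξ) (i : V) : ℝ :=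
  M.Φ (mark G i) (n.1 i) (bag (fun a : InEdge G i => M.g (r a.1) (mark G a.1))
    (fun a : InEdge G i => n.2 (a.1, i, (a.2 : ℕ))))

/-- The noises, as the sequence of the noises used in the successive steps. -/
def noiseSeq (e : Noise V Z Ξ) (k : ℕ) : StepNoise V Z Ξ :=
  (fun i => e.1 (k, i), fun a => e.2 (k, a))

lemma measurable_noiseSeq : Measurable (noiseSeq (V := V) (Z := Z) (Ξ := Ξ)) := by
  unfold noiseSeq; fun_prop

lemma Recursion.map_noiseSeq :
    (M.noiseLaw V).map noiseSeq = Measure.infinitePi fun _ : ℕ => M.stepLaw V := by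
  unfold Recursion.stepLaw
  rw [← infinitePi_map_zip,
    ← Measure.infinitePi_map_curry (fun (_ : ℕ) (_ : V) => M.vertexNoise),
    ← Measure.infinitePi_map_curry (fun (_ : ℕ) (_ : V × V × ℕ) => M.edgeNoise),
    Measure.map_prod_map _ _ (by fun_prop) (by fun_prop),
    Measure.map_map (by fun_prop) (by fun_prop)]
  rfl

lemma card_inEdge (G : WDigraph V S) (i : V) : Fintype.card (InEdge G i) = inDeg G i := by
  simp [InEdge, inDeg]

/-- An enumeration of the inbound edges. -/
def inEdgeEquiv (G : WDigraph V S) (i : V) : Fin (inDeg G i) ≃ InEdge G i :=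
  (Fintype.equivFinOfCardEq (card_inEdge G i)).symm

lemma sum_inEdge (G : WDigraph V S) (i : V) (f : V → ℝ≥0∞) :
    ∑ l : Fin (inDeg G i), f (inEdgeEquiv G i l).1 = ∑ j, (G.1 j i : ℝ≥0∞) * f j := by
  rw [Equiv.sum_comp (inEdgeEquiv G i) (fun a => f a.1), Fintype.sum_sigma]
  simp

lemma Recursion.measurePreserving_inEdge (G : WDigraph V S) (i : V) :
    MeasurePreserving (fun n : StepNoise V Z Ξ => (n.1 i, fun l : Fin (inDeg G i) =>
      n.2 ((inEdgeEquiv G i l).1, i, ((inEdgeEquiv G i l).2 : ℕ)))) (M.stepLaw V)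
      (M.localNoise (inDeg G i)) := by
  refine MeasurePreserving.prod (f := fun w : V → Z => w i)
    (g := fun (w : V × V × ℕ → Ξ) (l : Fin (inDeg G i)) =>
      w ((inEdgeEquiv G i l).1, i, ((inEdgeEquiv G i l).2 : ℕ)))
    (measurePreserving_eval_infinitePi (fun _ : V => M.vertexNoise) i) ⟨by fun_prop, ?_⟩
  rw [Measure.map_infinitePi_infinitePi_of_inj (P := fun _ : V × V × ℕ => M.edgeNoise)
    (f := fun l : Fin (inDeg G i) => ((inEdgeEquiv G i l).1, i, ((inEdgeEquiv G i l).2 : ℕ))),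
    Measure.infinitePi_eq_pi]
  intro l l' h
  refine (inEdgeEquiv G i).injective ?_
  simp only [Prod.mk.injEq] at h
  obtain ⟨h1, -, h2⟩ := h
  generalize inEdgeEquiv G i l = a at *
  generalize inEdgeEquiv G i l' = b at *
  obtain ⟨a1, a2⟩ := a
  obtain ⟨b1, b2⟩ := b
  obtain rfl : a1 = b1 := h1
  obtain rfl : a2 = b2 := Fin.ext h2
  rfl

lemma Recursion.graphStep_eq (G : WDigraph V S) (r : V → ℝ) (n : StepNoise V Z Ξ) (i : V) :
    M.graphStep G r n i = M.Φ (mark G i) (n.1 i)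
      (bag (fun l => M.g (r (inEdgeEquiv G i l).1) (mark G (inEdgeEquiv G i l).1))
        (fun l => n.2 ((inEdgeEquiv G i l).1, i, ((inEdgeEquiv G i l).2 : ℕ)))) := by
  unfold Recursion.graphStep
  congr 1
  exact (bag_equiv (inEdgeEquiv G i) (fun a : InEdge G i => M.g (r a.1) (mark G a.1))
    (fun a : InEdge G i => n.2 (a.1, i, (a.2 : ℕ)))).symm

lemma measurable_mark (i : V) : Measurable fun G : WDigraph V S => mark G i := by
  unfold mark inDeg outDeg
  fun_prop

lemma Recursion.measurable_graphStep (hg : Measurable fun w : ℝ × Mark S => M.g w.1 w.2) :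
    Measurable fun w : WDigraph V S × (V → ℝ) × StepNoise V Z Ξ =>
      M.graphStep w.1 w.2.1 w.2.2 := by
  have h : Measurable fun w : (V → V → ℕ) × ((V → S) × (V → ℝ) × StepNoise V Z Ξ) =>
      M.graphStep (w.1, w.2.1) w.2.2.1 w.2.2.2 := by
    refine measurable_from_prod_countable_right fun A => measurable_pi_lambda _ fun i => ?_
    have hm : ∀ j, Measurable fun w : (V → S) × (V → ℝ) × StepNoise V Z Ξ =>
        mark ((A, w.1) : WDigraph V S) j := fun j =>
      (measurable_mark j).comp (f := fun w : (V → S) × (V → ℝ) × StepNoise V Z Ξ =>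
        ((A, w.1) : WDigraph V S)) (by fun_prop)
    refine M.measurable_Φ_fintype (ι := Σ j : V, Fin (A j i)) (hm i)
      (show Measurable fun w : (V → S) × (V → ℝ) × StepNoise V Z Ξ => w.2.2.1 i by fun_prop)
      (measurable_pi_lambda _ fun a => ?_)
      (show Measurable fun (w : (V → S) × (V → ℝ) × StepNoise V Z Ξ) (a : Σ j : V, Fin (A j i)) =>
        w.2.2.2 (a.1, i, (a.2 : ℕ)) by fun_prop)
    exact hg.comp (Measurable.prodMk
      (show Measurable fun w : (V → S) × (V → ℝ) × StepNoise V Z Ξ => w.2.1 a.1 by fun_prop)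
      (hm a.1))
  exact h.comp (g := fun w : (V → V → ℕ) × ((V → S) × (V → ℝ) × StepNoise V Z Ξ) =>
      M.graphStep (w.1, w.2.1) w.2.2.1 w.2.2.2)
    (f := fun w : WDigraph V S × (V → ℝ) × StepNoise V Z Ξ => (w.1.1, (w.1.2, w.2.1, w.2.2)))
    (by fun_prop)

lemma Recursion.graphStep_lipschitz {p : ℝ≥0∞} [Fact (1 ≤ p)] (hp : p ≠ ∞) {σm σp : Mark S → ℝ}
    (hg : ∀ x r r', |M.g r x - M.g r' x| ≤ σp x * |r - r'|) {G : WDigraph V S} {i : V}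
    (h : M.LipschitzAt p (σm (mark G i)) (inDeg G i) (mark G i)) (r r' : V → ℝ) :
    lqn p.toReal (M.stepLaw V) (fun n => ‖M.graphStep G r n i - M.graphStep G r' n i‖ₑ) ≤
      ENNReal.ofReal (σm (mark G i)) * ∑ j, (G.1 j i : ℝ≥0∞) *
        (ENNReal.ofReal (σp (mark G j)) * ‖r j - r' j‖ₑ) := by
  simp only [M.graphStep_eq]
  refine (h.lqn_le hp (M.measurePreserving_inEdge G i) _ _).trans ?_
  rw [← sum_inEdge]
  refine mul_le_mul_right (Finset.sum_le_sum fun l _ => ?_) _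
  rw [← ofReal_norm, ← ofReal_norm, ← ENNReal.ofReal_mul' (norm_nonneg _)]
  exact ENNReal.ofReal_le_ofReal (hg _ _ _)

lemma Recursion.graphStep_growth {p : ℝ≥0∞} [Fact (1 ≤ p)] (hp : p ≠ ∞) {σm β : Mark S → ℝ}
    {G : WDigraph V S} {i : V}
    (h : M.GrowthAt p (σm (mark G i)) (β (mark G i)) (inDeg G i) (mark G i)) (r : V → ℝ) :
    lqn p.toReal (M.stepLaw V) (fun n => ‖M.graphStep G r n i‖ₑ) ≤
      ENNReal.ofReal (σm (mark G i)) * ∑ j, (G.1 j i : ℝ≥0∞) * ‖M.g (r j) (mark G j)‖ₑ +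
        ENNReal.ofReal (β (mark G i)) := by
  simp only [M.graphStep_eq]
  refine (h.lqn_le hp (M.measurePreserving_inEdge G i) _).trans ?_
  rw [← sum_inEdge G i fun j => ‖M.g (r j) (mark G j)‖ₑ]

end GraphStep

/-! ### Iterated random contractions -/

section RandomContraction

variable {E Y : Type*} [NormedAddCommGroup E] [MeasurableSpace E] [BorelSpace E]
  [SecondCountableTopology E] [MeasurableSpace Y]

/-- The law of `F(r, y)` for independent `r` and `y` of laws `m` and `ν`. -/
def pushStep (F : E → Y → E) (ν : Measure Y) (m : Measure E) : Measure E :=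
  (m.prod ν).map fun z => F z.1 z.2

/-- Forward iteration of random maps. -/
def forward (F : E → Y → E) (r : E) (s : ℕ → Y) : ℕ → E
  | 0 => r
  | k + 1 => F (forward F r s k) (s k)

/-- Backward iteration of random maps, started from `0`. -/
def backward (F : E → Y → E) : ℕ → (ℕ → Y) → E
  | 0, _ => 0
  | k + 1, s => F (backward F k fun j => s (j + 1)) (s 0)

/-- The pointwise limit of the backward iteration. -/
def backwardLimit (F : E → Y → E) (s : ℕ → Y) : E := limUnder atTop fun k => backward F k s

variable {F : E → Y → E} {ν : Measure Y} [IsProbabilityMeasure ν]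

lemma isProbabilityMeasure_pushStep (hF : Measurable fun z : E × Y => F z.1 z.2) (m : Measure E)
    [IsProbabilityMeasure m] : IsProbabilityMeasure (pushStep F ν m) :=
  Measure.isProbabilityMeasure_map hF.aemeasurable

lemma isProbabilityMeasure_iterate_pushStep (hF : Measurable fun z : E × Y => F z.1 z.2)
    (m : Measure E) [IsProbabilityMeasure m] (k : ℕ) :
    IsProbabilityMeasure ((pushStep F ν)^[k] m) := by
  induction k with
  | zero => simpa
  | succ k ih =>
    rw [Function.iterate_succ_apply']
    exact isProbabilityMeasure_pushStep hF _

lemma forward_succ (r : E) (s : ℕ → Y) (k : ℕ) :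
    forward F r s (k + 1) = forward F (F r (s 0)) (fun j => s (j + 1)) k := by
  induction k with
  | zero => rfl
  | succ k ih => rw [forward, ih]; rfl

lemma measurable_forward (hF : Measurable fun z : E × Y => F z.1 z.2) (k : ℕ) :
    Measurable fun z : E × (ℕ → Y) => forward F z.1 z.2 k := by
  induction k with
  | zero => exact measurable_fst
  | succ k ih => exact hF.comp (ih.prodMk (by fun_prop))

lemma map_forward (hF : Measurable fun z : E × Y => F z.1 z.2) (m : Measure E)
    [IsProbabilityMeasure m] (k : ℕ) :
    (m.prod (Measure.infinitePi fun _ : ℕ => ν)).map (fun z => forward F z.1 z.2 k) =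
      (pushStep F ν)^[k] m := by
  induction k generalizing m with
  | zero =>
    change (m.prod _).map Prod.fst = m
    simp
  | succ k ih =>
    have := isProbabilityMeasure_pushStep (ν := ν) hF m
    rw [Function.iterate_succ_apply, ← ih, pushStep]
    have hs : Measurable fun w : ℕ → Y => (w 0, fun k => w (k + 1)) := by fun_prop
    have e1 : (((m.prod ν).map fun z => F z.1 z.2).prod (Measure.infinitePi fun _ : ℕ => ν)) =
        (m.prod (Measure.infinitePi fun _ : ℕ => ν)).map
          (fun z => (F z.1 (z.2 0), fun k => z.2 (k + 1))) := by
      have a1 : ((m.prod ν).map fun z => F z.1 z.2).prod (Measure.infinitePi fun _ : ℕ => ν) =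
          ((m.prod ν).prod (Measure.infinitePi fun _ : ℕ => ν)).map
            (Prod.map (fun z => F z.1 z.2) id) := by
        rw [← Measure.map_prod_map _ _ hF measurable_id, Measure.map_id]
      have a2 : (m.prod (Measure.infinitePi fun _ : ℕ => ν)).map
          (Prod.map id fun w => (w 0, fun k => w (k + 1))) =
          m.prod (ν.prod (Measure.infinitePi fun _ : ℕ => ν)) := by
        rw [← Measure.map_prod_map _ _ measurable_id hs, Measure.map_id, infinitePi_nat]
      rw [a1, ← (MeasureTheory.measurePreserving_prodAssoc m ν _).symm.map_eq, ← a2,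
        Measure.map_map (by fun_prop) (by fun_prop), Measure.map_map (by fun_prop) (by fun_prop)]
      rfl
    rw [e1, Measure.map_map (measurable_forward hF k)
      ((show Measurable fun z : E × (ℕ → Y) => F z.1 (z.2 0) from
        hF.comp (f := fun z : E × (ℕ → Y) => (z.1, z.2 0)) (by fun_prop)).prodMk (by fun_prop))]
    refine congrArg (fun f => Measure.map f _) (funext fun z => ?_)
    exact forward_succ _ _ _

variable {q : ℝ} {κ : ℝ≥0∞}

lemma lqn_step_sub_le (hq : 1 ≤ q) (hF : Measurable fun z : E × Y => F z.1 z.2)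
    (hκ : ∀ r r', lqn q ν (fun y => ‖F r y - F r' y‖ₑ) ≤ κ * ‖r - r'‖ₑ)
    {Ω : Type*} [MeasurableSpace Ω] {P : Measure Ω} {X X' : Ω → E}
    (hX : Measurable X) (hX' : Measurable X') :
    lqn q (P.prod ν) (fun z => ‖F (X z.1) z.2 - F (X' z.1) z.2‖ₑ) ≤
      κ * lqn q P (fun ω => ‖X ω - X' ω‖ₑ) := by
  have h1 : Measurable fun z : Ω × Y => F (X z.1) z.2 :=
    hF.comp (f := fun z : Ω × Y => (X z.1, z.2)) (by fun_prop)
  have h2 : Measurable fun z : Ω × Y => F (X' z.1) z.2 :=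
    hF.comp (f := fun z : Ω × Y => (X' z.1, z.2)) (by fun_prop)
  rw [lqn_prod hq (measurable_enorm_sub h1 h2), ← lqn_const_mul hq _ (measurable_enorm_sub hX hX')]
  exact lqn_mono hq fun ω => hκ _ _

lemma measurable_backward (hF : Measurable fun z : E × Y => F z.1 z.2) (k : ℕ) :
    Measurable (backward F k) := by
  induction k with
  | zero => exact measurable_const
  | succ k ih =>
    exact hF.comp ((ih.comp (g := backward F k) (f := fun (s : ℕ → Y) j => s (j + 1))
      (by fun_prop)).prodMk (by fun_prop))

lemma measurable_backwardLimit [CompleteSpace E] (hF : Measurable fun z : E × Y => F z.1 z.2) :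
    Measurable (backwardLimit F) :=
  (StronglyMeasurable.limUnder fun k => (measurable_backward hF k).stronglyMeasurable).measurable

lemma lqn_infinitePi_nat {f : Y × (ℕ → Y) → ℝ≥0∞} (hf : Measurable f) :
    lqn q (Measure.infinitePi fun _ : ℕ => ν) (fun s => f (s 0, fun j => s (j + 1))) =
      lqn q ((Measure.infinitePi fun _ : ℕ => ν).prod ν) (fun z => f (z.2, z.1)) := by
  have h := lqn_map (q := q) (ν := Measure.infinitePi fun _ : ℕ => ν)
    (φ := fun w : ℕ → Y => (w 0, fun k => w (k + 1))) (by fun_prop) hf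
  rw [← h, infinitePi_nat, ← Measure.prod_swap, lqn_map measurable_swap hf]
  rfl

lemma lqn_step_shift_le (hq : 1 ≤ q) (hF : Measurable fun z : E × Y => F z.1 z.2)
    (hκ : ∀ r r', lqn q ν (fun y => ‖F r y - F r' y‖ₑ) ≤ κ * ‖r - r'‖ₑ)
    {X X' : (ℕ → Y) → E} (hX : Measurable X) (hX' : Measurable X') :
    lqn q (Measure.infinitePi fun _ : ℕ => ν)
        (fun s => ‖F (X fun j => s (j + 1)) (s 0) - F (X' fun j => s (j + 1)) (s 0)‖ₑ) ≤
      κ * lqn q (Measure.infinitePi fun _ : ℕ => ν) (fun s => ‖X s - X' s‖ₑ) := by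
  refine le_trans (le_of_eq ?_) (lqn_step_sub_le hq hF hκ hX hX')
  have h1 : Measurable fun z : Y × (ℕ → Y) => F (X z.2) z.1 :=
    hF.comp (f := fun z : Y × (ℕ → Y) => (X z.2, z.1)) (by fun_prop)
  have h2 : Measurable fun z : Y × (ℕ → Y) => F (X' z.2) z.1 :=
    hF.comp (f := fun z : Y × (ℕ → Y) => (X' z.2, z.1)) (by fun_prop)
  exact lqn_infinitePi_nat (measurable_enorm_sub h1 h2)

lemma lqn_forward_sub_le (hq : 1 ≤ q) (hF : Measurable fun z : E × Y => F z.1 z.2)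
    (hκ : ∀ r r', lqn q ν (fun y => ‖F r y - F r' y‖ₑ) ≤ κ * ‖r - r'‖ₑ) (k : ℕ) (r r' : E) :
    lqn q (Measure.infinitePi fun _ : ℕ => ν) (fun s => ‖forward F r s k - forward F r' s k‖ₑ) ≤
      κ ^ k * ‖r - r'‖ₑ := by
  induction k generalizing r r' with
  | zero => simp [forward, lqn_const hq]
  | succ k ih =>
    have hFr : ∀ r, Measurable fun y : Y => F r y := fun r =>
      hF.comp (f := fun y : Y => (r, y)) (by fun_prop)
    have hm : ∀ r, Measurable fun z : Y × (ℕ → Y) => forward F (F r z.1) z.2 k := fun r =>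
      (measurable_forward hF k).comp (f := fun z : Y × (ℕ → Y) => (F r z.1, z.2))
        (((hFr r).comp measurable_fst).prodMk measurable_snd)
    simp only [forward_succ]
    rw [lqn_infinitePi_nat (measurable_enorm_sub (hm r) (hm r'))]
    refine (lqn_prod_symm hq ((measurable_enorm_sub (hm r) (hm r')).comp
        (f := fun z : (ℕ → Y) × Y => (z.2, z.1)) (by fun_prop))).trans_le ?_
    refine (lqn_mono hq fun y => ih (F r y) (F r' y)).trans ?_
    rw [lqn_const_mul hq _ (measurable_enorm_sub (hFr r) (hFr r')), pow_succ, mul_assoc]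
    exact mul_le_mul_right (hκ r r') _

variable [CompleteSpace E] {b : ℝ≥0∞}

lemma backward_geometric (hq : 1 ≤ q) (hF : Measurable fun z : E × Y => F z.1 z.2)
    (hκ : ∀ r r', lqn q ν (fun y => ‖F r y - F r' y‖ₑ) ≤ κ * ‖r - r'‖ₑ) (hκ1 : κ < 1)
    (hb : lqn q ν (fun y => ‖F 0 y‖ₑ) ≤ b) (hb' : b ≠ ∞) (k : ℕ) :
    lqn q (Measure.infinitePi fun _ : ℕ => ν) (fun s => ‖backwardLimit F s - backward F k s‖ₑ) ≤
      κ ^ k * (b * (1 - κ)⁻¹) := by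
  refine (geometric_limit hq (measurable_backward hF) hκ1 hb' (fun k => ?_)).2 k
  induction k with
  | zero =>
    have h0 : Measurable fun y => ‖F 0 y‖ₑ := (hF.comp (f := fun y : Y => (0, y))
      (by fun_prop)).enorm
    have : lqn q (Measure.infinitePi fun _ : ℕ => ν) (fun s => ‖F 0 (s 0)‖ₑ) =
        lqn q ν (fun y => ‖F 0 y‖ₑ) := by
      conv_rhs => rw [← Measure.infinitePi_map_eval (fun _ : ℕ => ν) 0, lqn_map (by fun_prop) h0]
    simpa [backward, this] using hb
  | succ k ih =>
    rw [pow_succ', mul_assoc]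
    exact (lqn_step_shift_le hq hF hκ (measurable_backward hF (k + 1))
      (measurable_backward hF k)).trans (mul_le_mul_right ih _)

/-- The law of the limit of the backward iteration is stationary. -/
lemma pushStep_backwardLimit (hq : 1 ≤ q) (hF : Measurable fun z : E × Y => F z.1 z.2)
    (hκ : ∀ r r', lqn q ν (fun y => ‖F r y - F r' y‖ₑ) ≤ κ * ‖r - r'‖ₑ) (hκ1 : κ < 1)
    (hb : lqn q ν (fun y => ‖F 0 y‖ₑ) ≤ b) (hb' : b ≠ ∞) :
    pushStep F ν ((Measure.infinitePi fun _ : ℕ => ν).map (backwardLimit F)) =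
      (Measure.infinitePi fun _ : ℕ => ν).map (backwardLimit F) := by
  have hL := measurable_backwardLimit hF
  have hFL : Measurable fun s : ℕ → Y => F (backwardLimit F fun j => s (j + 1)) (s 0) :=
    hF.comp (f := fun s : ℕ → Y => (backwardLimit F fun j => s (j + 1), s 0))
      ((hL.comp (by fun_prop)).prodMk (by fun_prop))
  have hae : ∀ᵐ s ∂(Measure.infinitePi fun _ : ℕ => ν),
      backwardLimit F s = F (backwardLimit F fun j => s (j + 1)) (s 0) := by
    have h0 : lqn q (Measure.infinitePi fun _ : ℕ => ν)
        (fun s => ‖backwardLimit F s - F (backwardLimit F fun j => s (j + 1)) (s 0)‖ₑ) = 0 := by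
      have hfin : b * (1 - κ)⁻¹ ≠ ∞ :=
        ENNReal.mul_ne_top hb' (ENNReal.inv_ne_top.2 (tsub_pos_of_lt hκ1).ne')
      refine le_antisymm (ge_of_tendsto' (tendsto_pow_mul_zero hκ1
        (ENNReal.mul_ne_top (b := (2 : ℝ≥0∞)) hfin (by simp))) fun k => ?_) bot_le
      calc _ ≤ lqn q (Measure.infinitePi fun _ : ℕ => ν)
            (fun s => ‖backwardLimit F s - backward F (k + 1) s‖ₑ +
              ‖F (backward F k fun j => s (j + 1)) (s 0) -
                F (backwardLimit F fun j => s (j + 1)) (s 0)‖ₑ) := by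
            refine lqn_mono hq fun s => ?_
            refine le_trans (le_of_eq ?_) (enorm_add_le _ _)
            congr 1
            simp only [backward]
            abel
        _ ≤ κ ^ (k + 1) * (b * (1 - κ)⁻¹) + κ * (κ ^ k * (b * (1 - κ)⁻¹)) := by
            refine (lqn_add_le hq (hL.sub (measurable_backward hF _)).enorm
              (Measurable.enorm (Measurable.sub (measurable_backward hF (k + 1)) hFL))).trans ?_
            refine add_le_add (backward_geometric hq hF hκ hκ1 hb hb' _) ?_
            refine (lqn_step_shift_le hq hF hκ (measurable_backward hF k) hL).trans ?_
            refine mul_le_mul_right ?_ _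
            simpa only [enorm_sub_rev] using backward_geometric hq hF hκ hκ1 hb hb' k
        _ = κ * (κ ^ k * (b * (1 - κ)⁻¹ * 2)) := by ring
        _ ≤ 1 * (κ ^ k * (b * (1 - κ)⁻¹ * 2)) := mul_le_mul_left hκ1.le _
        _ = _ := one_mul _
    rw [← nonpos_iff_eq_zero, lqn_le_iff hq, ENNReal.zero_rpow_of_pos (by positivity),
      nonpos_iff_eq_zero, lintegral_eq_zero_iff ((measurable_enorm_sub hL hFL).pow_const q)] at h0
    filter_upwards [h0] with s hs
    have := (ENNReal.rpow_eq_zero_iff_of_pos (by positivity)).1 hs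
    rwa [enorm_eq_zero, sub_eq_zero] at this
  conv_rhs => rw [Measure.map_congr hae]
  have hFL' : Measurable fun z : Y × (ℕ → Y) => F (backwardLimit F z.2) z.1 :=
    hF.comp (f := fun z : Y × (ℕ → Y) => (backwardLimit F z.2, z.1))
      ((hL.comp measurable_snd).prodMk measurable_fst)
  have h1 : (Measure.infinitePi fun _ : ℕ => ν).map
      (fun s => F (backwardLimit F fun j => s (j + 1)) (s 0)) =
      (ν.prod (Measure.infinitePi fun _ : ℕ => ν)).map
        (fun z => F (backwardLimit F z.2) z.1) := by
    rw [← infinitePi_nat, Measure.map_map hFL' (by fun_prop)]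
    rfl
  rw [h1, ← Measure.prod_swap, Measure.map_map hFL' measurable_swap, pushStep]
  have h2 : ((Measure.infinitePi fun _ : ℕ => ν).map (backwardLimit F)).prod ν =
      ((Measure.infinitePi fun _ : ℕ => ν).prod ν).map (Prod.map (backwardLimit F) id) := by
    rw [← Measure.map_prod_map _ _ hL measurable_id, Measure.map_id]
  rw [h2, Measure.map_map hF (hL.prodMap measurable_id)]
  rfl

lemma lqn_backwardLimit_le (hq : 1 ≤ q) (hF : Measurable fun z : E × Y => F z.1 z.2)
    (hκ : ∀ r r', lqn q ν (fun y => ‖F r y - F r' y‖ₑ) ≤ κ * ‖r - r'‖ₑ) (hκ1 : κ < 1)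
    (hb : lqn q ν (fun y => ‖F 0 y‖ₑ) ≤ b) (hb' : b ≠ ∞) :
    lqn q ((Measure.infinitePi fun _ : ℕ => ν).map (backwardLimit F)) (fun x => ‖x‖ₑ) ≤
      b * (1 - κ)⁻¹ := by
  rw [lqn_map (measurable_backwardLimit hF) measurable_enorm]
  simpa [backward] using backward_geometric hq hF hκ hκ1 hb hb' 0

end RandomContraction

/-! ### The chain on a fixed graph -/

section FixedGraph

variable {S Z Ξ V : Type*} [MeasurableSpace S] [MeasurableSpace Z] [MeasurableSpace Ξ]
  [Fintype V] (M : Recursion S Z Ξ) {p : ℝ≥0∞} [hp1 : Fact (1 ≤ p)]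

lemma one_le_toReal (hp : p ≠ ∞) : 1 ≤ p.toReal := by
  simpa using ENNReal.toReal_mono hp hp1.out

lemma piLp_enorm_rpow (hp : p ≠ ∞) (x : PiLp p fun _ : V => ℝ) :
    ‖x‖ₑ ^ p.toReal = ∑ i, ‖x i‖ₑ ^ p.toReal := by
  have h0 : 0 < p.toReal := zero_lt_one.trans_le (one_le_toReal hp)
  rw [← edist_zero_right, PiLp.edist_eq_sum h0, ← ENNReal.rpow_mul,
    one_div_mul_cancel h0.ne', ENNReal.rpow_one]
  simp [edist_zero_right]

/-- A matrix `(a_i b_j 1(j → i))` with `b ≥ 0` acting on absolute values. -/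
lemma sum_rpow_le_opNorm [DecidableEq V] (hp : p ≠ ∞) (G : WDigraph V S) (a b : V → ℝ)
    (hb : ∀ j, 0 ≤ b j) (w : V → ℝ) :
    ∑ i, (ENNReal.ofReal (a i) *
        ∑ j, (G.1 j i : ℝ≥0∞) * (ENNReal.ofReal (b j) * ‖w j‖ₑ)) ^ p.toReal ≤
      ENNReal.ofReal (opNorm p (Matrix.of fun i j => a i * b j * (G.1 j i : ℝ))) ^ p.toReal *
        ∑ j, ‖w j‖ₑ ^ p.toReal := by
  have h0 : 0 < p.toReal := zero_lt_one.trans_le (one_le_toReal hp)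
  set A : Matrix V V ℝ := Matrix.of fun i j => a i * b j * (G.1 j i : ℝ)
  let x : PiLp p fun _ : V => ℝ := WithLp.toLp p fun j => |w j|
  let L := LinearMap.toContinuousLinearMap (Matrix.toLpLin p p A)
  have hLx : ∀ i, (L x) i = a i * ∑ j, (G.1 j i : ℝ) * (b j * |w j|) := by
    intro i
    have : (L x) i = ∑ j, A i j * |w j| := by
      simp [L, x, Matrix.toLpLin_apply, Matrix.mulVec, dotProduct]
    rw [this, Finset.mul_sum]
    refine Finset.sum_congr rfl fun j _ => ?_
    simp only [A, Matrix.of_apply]; ring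
  have hx : ‖x‖ₑ ^ p.toReal = ∑ j, ‖w j‖ₑ ^ p.toReal := by
    rw [piLp_enorm_rpow hp]; simp [x, Real.enorm_eq_ofReal_abs]
  calc _ ≤ ∑ i, ‖(L x) i‖ₑ ^ p.toReal := by
        refine Finset.sum_le_sum fun i _ => ENNReal.rpow_le_rpow ?_ h0.le
        have : ∑ j, (G.1 j i : ℝ≥0∞) * (ENNReal.ofReal (b j) * ‖w j‖ₑ) =
            ENNReal.ofReal (∑ j, (G.1 j i : ℝ) * (b j * |w j|)) := by
          rw [ENNReal.ofReal_sum_of_nonneg fun j _ => by have := hb j; positivity]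
          refine Finset.sum_congr rfl fun j _ => ?_
          rw [ENNReal.ofReal_mul (by positivity), ENNReal.ofReal_mul (hb j),
            ENNReal.ofReal_natCast, ← Real.norm_eq_abs, ofReal_norm]
        rw [this, ← ENNReal.ofReal_mul' (Finset.sum_nonneg fun j _ => by
          have := hb j; positivity), ← hLx, ← ofReal_norm, Real.norm_eq_abs]
        exact ENNReal.ofReal_le_ofReal (le_abs_self _)
    _ = ‖L x‖ₑ ^ p.toReal := (piLp_enorm_rpow hp _).symm
    _ ≤ (ENNReal.ofReal ‖L‖ * ‖x‖ₑ) ^ p.toReal := by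
        refine ENNReal.rpow_le_rpow ?_ h0.le
        rw [← ofReal_norm, ← ofReal_norm, ← ENNReal.ofReal_mul (norm_nonneg _)]
        exact ENNReal.ofReal_le_ofReal (L.le_opNorm x)
    _ = _ := by rw [ENNReal.mul_rpow_of_nonneg _ _ h0.le, hx]; rfl

/-- One step of the chain, on `ℝ^V` with the norm `‖·‖_p`. -/
def Recursion.graphMap (p : ℝ≥0∞) (G : WDigraph V S) (r : PiLp p fun _ : V => ℝ)
    (n : StepNoise V Z Ξ) : PiLp p fun _ : V => ℝ :=
  WithLp.toLp p (M.graphStep G (WithLp.ofLp r) n)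

lemma Recursion.measurable_graphMap_joint (hg : Measurable fun w : ℝ × Mark S => M.g w.1 w.2) :
    Measurable fun w : WDigraph V S × (PiLp p fun _ : V => ℝ) × StepNoise V Z Ξ =>
      M.graphMap p w.1 w.2.1 w.2.2 := by
  have := (M.measurable_graphStep (V := V) hg).comp
    (f := fun w : WDigraph V S × (PiLp p fun _ : V => ℝ) × StepNoise V Z Ξ =>
      (w.1, WithLp.ofLp w.2.1, w.2.2)) (by fun_prop)
  exact (WithLp.measurable_toLp p _).comp this

lemma Recursion.measurable_graphMap (hg : Measurable fun w : ℝ × Mark S => M.g w.1 w.2)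
    (G : WDigraph V S) :
    Measurable fun w : (PiLp p fun _ : V => ℝ) × StepNoise V Z Ξ => M.graphMap p G w.1 w.2 :=
  (M.measurable_graphMap_joint hg).comp
    (f := fun w : (PiLp p fun _ : V => ℝ) × StepNoise V Z Ξ => (G, w.1, w.2)) (by fun_prop)

lemma Recursion.chain_eq_forward (G : WDigraph V S) (r : PiLp p fun _ : V => ℝ)
    (e : Noise V Z Ξ) (k : ℕ) :
    WithLp.toLp p (M.chain G (WithLp.ofLp r) e k) =
      forward (M.graphMap p G) r (noiseSeq e) k := by
  induction k with
  | zero => rfl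
  | succ k ih =>
    rw [forward, ← ih]
    rfl

lemma Recursion.chainLaw_eq (hg : Measurable fun w : ℝ × Mark S => M.g w.1 w.2)
    (G : WDigraph V S) (m : Measure (PiLp p fun _ : V => ℝ)) [IsProbabilityMeasure m] (k : ℕ) :
    M.chainLaw p G m k = (pushStep (M.graphMap p G) (M.stepLaw V))^[k] m := by
  have hF := M.measurable_graphMap (p := p) hg G
  rw [← map_forward hF, ← M.map_noiseSeq, Recursion.chainLaw]
  have : m.prod ((M.noiseLaw V).map noiseSeq) =
      (m.prod (M.noiseLaw V)).map (Prod.map id noiseSeq) := by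
    rw [← Measure.map_prod_map _ _ measurable_id measurable_noiseSeq, Measure.map_id]
  rw [this, Measure.map_map (measurable_forward hF k)
    (measurable_id.prodMap measurable_noiseSeq)]
  refine congrArg (fun f => Measure.map f _) (funext fun z => ?_)
  exact M.chain_eq_forward G z.1 z.2 k

/-- The stationary law on the graph `G`. -/
def Recursion.stationaryLaw (p : ℝ≥0∞) [Fact (1 ≤ p)] (G : WDigraph V S) :
    Measure (PiLp p fun _ : V => ℝ) :=
  (Measure.infinitePi fun _ : ℕ => M.stepLaw V).map (backwardLimit (M.graphMap p G))

lemma Recursion.measurable_backwardLimit_joint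
    (hg : Measurable fun w : ℝ × Mark S => M.g w.1 w.2) :
    Measurable fun w : WDigraph V S × (ℕ → StepNoise V Z Ξ) =>
      backwardLimit (M.graphMap p w.1) w.2 := by
  have h : ∀ k, Measurable fun w : WDigraph V S × (ℕ → StepNoise V Z Ξ) =>
      backward (M.graphMap p w.1) k w.2 := by
    intro k
    induction k with
    | zero => exact measurable_const
    | succ k ih =>
      have h1 : Measurable fun w : WDigraph V S × (ℕ → StepNoise V Z Ξ) =>
          backward (M.graphMap p w.1) k (fun j => w.2 (j + 1)) :=
        ih.comp (f := fun w : WDigraph V S × (ℕ → StepNoise V Z Ξ) =>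
          (w.1, fun j => w.2 (j + 1))) (by fun_prop)
      exact (M.measurable_graphMap_joint hg).comp (measurable_fst.prodMk (h1.prodMk (by fun_prop)))
  exact (StronglyMeasurable.limUnder fun k => (h k).stronglyMeasurable).measurable

/-- The stationary law as a kernel from the graphs. -/
def Recursion.stationaryKernel (V : Type*) [Fintype V] (p : ℝ≥0∞) [Fact (1 ≤ p)] :
    Kernel (WDigraph V S) (PiLp p fun _ : V => ℝ) :=
  (Kernel.id ×ₖ Kernel.const _ (Measure.infinitePi fun _ : ℕ => M.stepLaw V)).map
    fun w => backwardLimit (M.graphMap p w.1) w.2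

lemma Recursion.stationaryKernel_apply (hg : Measurable fun w : ℝ × Mark S => M.g w.1 w.2)
    (G : WDigraph V S) : M.stationaryKernel V p G = M.stationaryLaw p G := by
  have hL := M.measurable_backwardLimit_joint (V := V) (p := p) hg
  rw [Recursion.stationaryKernel, Kernel.map_apply _ hL, Kernel.prod_apply, Kernel.id_apply,
    Kernel.const_apply, Measure.dirac_prod, Measure.map_map hL (by fun_prop)]
  rfl

lemma Recursion.isMarkovKernel_stationaryKernel
    (hg : Measurable fun w : ℝ × Mark S => M.g w.1 w.2) :
    IsMarkovKernel (M.stationaryKernel V p) :=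
  Kernel.IsMarkovKernel.map _ (M.measurable_backwardLimit_joint hg)

/-- The conditions on a fixed graph. -/
structure Recursion.GraphRegular (M : Recursion S Z Ξ) (p : ℝ≥0∞) [Fact (1 ≤ p)] [DecidableEq V]
    (σm σp β : Mark S → ℝ) (K K₀ : ℝ) (G : WDigraph V S) : Prop where
  lipschitz : ∀ i, M.LipschitzAt p (σm (mark G i)) (inDeg G i) (mark G i)
  growth : ∀ i, M.GrowthAt p (σm (mark G i)) (β (mark G i)) (inDeg G i) (mark G i)
  norm_C : opNorm p (matC σm σp G) ≤ K
  norm_C0 : opNorm p (M.matC0 σm G) ≤ K₀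

lemma nonneg_of_lipschitz {σp : Mark S → ℝ}
    (hg : ∀ x r r', |M.g r x - M.g r' x| ≤ σp x * |r - r'|) (x : Mark S) : 0 ≤ σp x := by
  have := (abs_nonneg _).trans (hg x 1 0)
  simpa using this

variable {M} [DecidableEq V] {σm σp β : Mark S → ℝ} {K K₀ : ℝ} {G : WDigraph V S}

lemma Recursion.GraphRegular.graphMap_lipschitz (hp : p ≠ ∞)
    (hgm : Measurable fun w : ℝ × Mark S => M.g w.1 w.2)
    (hg : ∀ x r r', |M.g r x - M.g r' x| ≤ σp x * |r - r'|)
    (hG : M.GraphRegular p σm σp β K K₀ G) (r r' : PiLp p fun _ : V => ℝ) :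
    lqn p.toReal (M.stepLaw V) (fun n => ‖M.graphMap p G r n - M.graphMap p G r' n‖ₑ) ≤
      ENNReal.ofReal (opNorm p (matC σm σp G)) * ‖r - r'‖ₑ := by
  have hq := one_le_toReal hp
  have h0 : 0 < p.toReal := zero_lt_one.trans_le hq
  rw [lqn_le_iff hq, ENNReal.mul_rpow_of_nonneg _ _ h0.le]
  simp only [piLp_enorm_rpow hp]
  have hm : ∀ (r : V → ℝ) i, Measurable fun n : StepNoise V Z Ξ => M.graphStep G r n i :=
    fun r i => (measurable_pi_apply i).comp ((M.measurable_graphStep hgm).comp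
      (f := fun n : StepNoise V Z Ξ => (G, r, n)) (by fun_prop))
  have : ∀ n : StepNoise V Z Ξ, ∀ i, (M.graphMap p G r n - M.graphMap p G r' n) i =
      M.graphStep G (WithLp.ofLp r) n i - M.graphStep G (WithLp.ofLp r') n i := fun n i => rfl
  simp only [this]
  rw [lintegral_finsetSum _ fun i _ => (measurable_enorm_sub (hm _ i) (hm _ i)).pow_const _]
  refine le_trans (Finset.sum_le_sum fun i _ => ?_) (sum_rpow_le_opNorm hp G
    (fun i => σm (mark G i)) (fun j => σp (mark G j)) (fun j => nonneg_of_lipschitz M hg _)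
    (fun j => (r - r') j))
  exact (lqn_le_iff hq).1 (M.graphStep_lipschitz hp hg (hG.lipschitz i) _ _)

/-- The vector `C⁰ e + β`. -/
def Recursion.drift (M : Recursion S Z Ξ) (p : ℝ≥0∞) (σm β : Mark S → ℝ) (G : WDigraph V S) :
    PiLp p fun _ : V => ℝ :=
  WithLp.toLp p (fun i => (M.matC0 σm G).mulVec 1 i + β (mark G i))

lemma Recursion.GraphRegular.graphMap_zero (hp : p ≠ ∞)
    (hgm : Measurable fun w : ℝ × Mark S => M.g w.1 w.2)
    (hG : M.GraphRegular p σm σp β K K₀ G) :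
    lqn p.toReal (M.stepLaw V) (fun n => ‖M.graphMap p G 0 n‖ₑ) ≤ ‖M.drift p σm β G‖ₑ := by
  have hq := one_le_toReal hp
  have h0 : 0 < p.toReal := zero_lt_one.trans_le hq
  rw [lqn_le_iff hq]
  simp only [piLp_enorm_rpow hp]
  have hm : ∀ i, Measurable fun n : StepNoise V Z Ξ => M.graphMap p G 0 n i :=
    fun i => (measurable_pi_apply i).comp ((M.measurable_graphStep hgm).comp
      (f := fun n : StepNoise V Z Ξ => (G, 0, n)) (by fun_prop))
  rw [lintegral_finsetSum _ fun i _ => (hm i).enorm.pow_const _]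
  refine Finset.sum_le_sum fun i _ => (lqn_le_iff hq).1 ?_
  have h1 : ∀ n, M.graphMap p G 0 n i = M.graphStep G 0 n i := fun n => rfl
  simp only [h1, M.graphStep_eq]
  have h2 := lqn_le_of_memLp hp (M.measurePreserving_inEdge G i)
    (f := fun e => M.Φ (mark G i) e.1 (bag (fun l => M.g ((0 : V → ℝ) (inEdgeEquiv G i l).1)
      (mark G (inEdgeEquiv G i l).1)) e.2))
    (M.measurable_Φ_fintype (by fun_prop) (by fun_prop) (by fun_prop) (by fun_prop))
    (hG.growth i _)
  refine h2.trans ?_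
  rw [← ofReal_norm, Real.norm_eq_abs]
  refine ENNReal.ofReal_le_ofReal (le_trans (le_of_eq ?_) (le_abs_self _))
  simp only [Recursion.drift, Recursion.matC0, Matrix.mulVec, dotProduct, Matrix.of_apply,
    Pi.one_apply, mul_one, Pi.zero_apply]
  congr 1
  rw [Equiv.sum_comp (inEdgeEquiv G i) (fun a => σm (mark G i) * |M.g 0 (mark G a.1)|),
    Fintype.sum_sigma]
  refine Finset.sum_congr rfl fun j _ => ?_
  simp; ring

lemma Recursion.stationaryLaw_stationary (hp : p ≠ ∞)
    (hgm : Measurable fun w : ℝ × Mark S => M.g w.1 w.2)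
    (hg : ∀ x r r', |M.g r x - M.g r' x| ≤ σp x * |r - r'|)
    (hG : M.GraphRegular p σm σp β K K₀ G) (hK : K < 1) :
    pushStep (M.graphMap p G) (M.stepLaw V) (M.stationaryLaw p G) = M.stationaryLaw p G := by
  refine pushStep_backwardLimit (one_le_toReal hp) (M.measurable_graphMap hgm G)
    (hG.graphMap_lipschitz hp hgm hg) ?_ (hG.graphMap_zero hp hgm) enorm_ne_top
  rw [ENNReal.ofReal_lt_one]
  exact hG.norm_C.trans_lt hK

lemma Recursion.lqn_stationaryLaw_le (hp : p ≠ ∞)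
    (hgm : Measurable fun w : ℝ × Mark S => M.g w.1 w.2)
    (hg : ∀ x r r', |M.g r x - M.g r' x| ≤ σp x * |r - r'|)
    (hG : M.GraphRegular p σm σp β K K₀ G) (hK : K < 1) :
    lqn p.toReal (M.stationaryLaw p G) (fun x => ‖x‖ₑ) ≤
      ‖M.drift p σm β G‖ₑ * (1 - ENNReal.ofReal (opNorm p (matC σm σp G)))⁻¹ := by
  refine lqn_backwardLimit_le (one_le_toReal hp) (M.measurable_graphMap hgm G)
    (hG.graphMap_lipschitz hp hgm hg) ?_ (hG.graphMap_zero hp hgm) enorm_ne_top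
  rw [ENNReal.ofReal_lt_one]
  exact hG.norm_C.trans_lt hK

variable (M) in
lemma Recursion.lqn_initialLaw (hp : p ≠ ∞) :
    lqn p.toReal (M.initialLaw p V) (fun x => ‖x‖ₑ) =
      (Fintype.card V : ℝ≥0∞) ^ (1 / p.toReal) * eLpNorm id p M.initial := by
  have hq := one_le_toReal hp
  have h0 : 0 < p.toReal := zero_lt_one.trans_le hq
  rw [Recursion.initialLaw, lqn_map (by fun_prop) measurable_enorm, lqn]
  simp only [piLp_enorm_rpow hp]
  rw [lintegral_finsetSum _ fun i _ => by fun_prop]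
  have : ∀ i : V, ∫⁻ x : V → ℝ, ‖x i‖ₑ ^ p.toReal ∂(Measure.pi fun _ => M.initial) =
      ∫⁻ r, ‖r‖ₑ ^ p.toReal ∂M.initial := fun i =>
    (measurePreserving_eval (fun _ : V => M.initial) i).lintegral_comp
      (f := fun r => ‖r‖ₑ ^ p.toReal) (by fun_prop)
  simp only [this, Finset.sum_const, Finset.card_univ, nsmul_eq_mul]
  rw [ENNReal.mul_rpow_of_nonneg _ _ (by positivity), lqn_eq_eLpNorm hp]
  rfl

instance : IsProbabilityMeasure (M.initialLaw p V) :=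
  Measure.isProbabilityMeasure_map (by fun_prop)

lemma Recursion.isProbabilityMeasure_stationaryLaw
    (hgm : Measurable fun w : ℝ × Mark S => M.g w.1 w.2) :
    IsProbabilityMeasure (M.stationaryLaw p G) :=
  Measure.isProbabilityMeasure_map
    (measurable_backwardLimit (M.measurable_graphMap hgm G)).aemeasurable

/-- Convergence of the chain to its stationary law on a fixed graph. -/
theorem Recursion.GraphRegular.exists_coupling (hp : p ≠ ∞)
    (hgm : Measurable fun w : ℝ × Mark S => M.g w.1 w.2)
    (hg : ∀ x r r', |M.g r x - M.g r' x| ≤ σp x * |r - r'|) (hμ₀ : MemLp id p M.initial)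
    (hG : M.GraphRegular p σm σp β K K₀ G) (hK : K < 1) (k : ℕ) :
    ∃ π : Measure ((PiLp p fun _ : V => ℝ) × (PiLp p fun _ : V => ℝ)),
      π.map Prod.fst = M.chainLaw p G (M.initialLaw p V) k ∧
      π.map Prod.snd = M.stationaryLaw p G ∧
      lqn p.toReal π (fun z => edist z.1 z.2) ≤ ENNReal.ofReal (M.rate p σm σp β G k) := by
  have hq := one_le_toReal hp
  have hF := M.measurable_graphMap (p := p) hgm G
  have := M.isProbabilityMeasure_stationaryLaw (p := p) (G := G) hgm
  set N := Measure.infinitePi fun _ : ℕ => M.stepLaw V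
  set F := M.graphMap p G
  set m := M.initialLaw p V
  set lam := M.stationaryLaw p G
  set κ := ENNReal.ofReal (opNorm p (matC σm σp G)) with hκ
  have hκ1 : κ < 1 := by
    rw [hκ, ENNReal.ofReal_lt_one]
    exact hG.norm_C.trans_lt hK
  have hm1 : Measurable fun z : ((PiLp p fun _ : V => ℝ) × (PiLp p fun _ : V => ℝ)) ×
      (ℕ → StepNoise V Z Ξ) => forward F z.1.1 z.2 k :=
    (measurable_forward hF k).comp (f := fun z : ((PiLp p fun _ : V => ℝ) ×
      (PiLp p fun _ : V => ℝ)) × (ℕ → StepNoise V Z Ξ) => (z.1.1, z.2)) (by fun_prop)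
  have hm2 : Measurable fun z : ((PiLp p fun _ : V => ℝ) × (PiLp p fun _ : V => ℝ)) ×
      (ℕ → StepNoise V Z Ξ) => forward F z.1.2 z.2 k :=
    (measurable_forward hF k).comp (f := fun z : ((PiLp p fun _ : V => ℝ) ×
      (PiLp p fun _ : V => ℝ)) × (ℕ → StepNoise V Z Ξ) => (z.1.2, z.2)) (by fun_prop)
  have hfst : ((m.prod lam).prod N).map (Prod.map Prod.fst id) = m.prod N := by
    rw [← Measure.map_prod_map _ _ measurable_fst measurable_id, Measure.map_id]
    simp
  have hsnd : ((m.prod lam).prod N).map (Prod.map Prod.snd id) = lam.prod N := by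
    rw [← Measure.map_prod_map _ _ measurable_snd measurable_id, Measure.map_id]
    simp
  refine ⟨((m.prod lam).prod N).map fun z => (forward F z.1.1 z.2 k, forward F z.1.2 z.2 k),
    ?_, ?_, ?_⟩
  · rw [Measure.map_map measurable_fst (hm1.prodMk hm2), M.chainLaw_eq hgm, ← map_forward hF,
      ← hfst, Measure.map_map (measurable_forward hF k) (by fun_prop)]
    rfl
  · have hst : ∀ k, (pushStep F (M.stepLaw V))^[k] lam = lam := by
      intro k
      induction k with
      | zero => rfl
      | succ k ih =>
        rw [Function.iterate_succ_apply', ih, M.stationaryLaw_stationary hp hgm hg hG hK]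
    refine Eq.trans (b := (lam.prod N).map fun z => forward F z.1 z.2 k) ?_ ?_
    · rw [Measure.map_map measurable_snd (hm1.prodMk hm2), ← hsnd,
        Measure.map_map (measurable_forward hF k) (by fun_prop)]
      rfl
    · rw [map_forward hF, hst]
  · rw [lqn_map (hm1.prodMk hm2) measurable_edist]
    simp only [edist_eq_enorm_sub]
    rw [lqn_prod hq (measurable_enorm_sub hm1 hm2)]
    calc _ ≤ lqn p.toReal (m.prod lam) (fun z => κ ^ k * (‖z.1‖ₑ + ‖z.2‖ₑ)) :=
          lqn_mono hq fun z => (lqn_forward_sub_le hq hF (hG.graphMap_lipschitz hp hgm hg)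
            k _ _).trans (mul_le_mul_right (enorm_sub_le) _)
      _ ≤ κ ^ k * (lqn p.toReal m (fun x => ‖x‖ₑ) + lqn p.toReal lam (fun x => ‖x‖ₑ)) := by
          rw [lqn_const_mul hq _ (by fun_prop)]
          refine mul_le_mul_right ((lqn_add_le hq (by fun_prop) (by fun_prop)).trans
            (add_le_add (le_of_eq ?_) (le_of_eq ?_))) _
          · rw [← lqn_map (ν := m.prod lam) measurable_fst measurable_enorm]; simp
          · rw [← lqn_map (ν := m.prod lam) measurable_snd measurable_enorm]; simp
      _ ≤ κ ^ k * ((Fintype.card V : ℝ≥0∞) ^ (1 / p.toReal) * eLpNorm id p M.initial +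
            ‖M.drift p σm β G‖ₑ * (1 - κ)⁻¹) := by
          gcongr
          · exact (M.lqn_initialLaw hp).le
          · exact M.lqn_stationaryLaw_le hp hgm hg hG hK
      _ ≤ ENNReal.ofReal (M.rate p σm σp β G k) := by
          have hC : 0 ≤ opNorm p (matC σm σp G) := norm_nonneg _
          have hC1 : 0 < 1 - opNorm p (matC σm σp G) := by linarith [hG.norm_C.trans_lt hK]
          rw [Recursion.rate, ENNReal.ofReal_mul (by positivity), ENNReal.ofReal_pow hC]
          refine mul_le_mul_right ?_ _
          rw [ENNReal.ofReal_add (by positivity) (by positivity)]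
          refine add_le_add ?_ (le_of_eq ?_)
          · rw [mul_assoc, two_mul, ENNReal.ofReal_add (by positivity) (by positivity),
              ENNReal.ofReal_mul (by positivity), ENNReal.ofReal_toReal hμ₀.eLpNorm_ne_top,
              ← ENNReal.ofReal_rpow_of_nonneg (by positivity) (by positivity),
              ENNReal.ofReal_natCast, mul_comm]
            exact le_self_add
          · rw [ENNReal.ofReal_div_of_pos hC1, ENNReal.ofReal_sub _ hC, ENNReal.ofReal_one,
              div_eq_mul_inv, ← ofReal_norm]
            rfl

end FixedGraph

/-! ### Branching recursions -/

section Branching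

variable {S Z Ξ : Type*} [MeasurableSpace S] [MeasurableSpace Z] [MeasurableSpace Ξ]
  (M : Recursion S Z Ξ)

/-- `F(x, ζ, {u_j, ξ_j : j < N})` as a function of `(N, x)`, the noise, and a sequence `u`. -/
def appBy (F : Mark S → Z → Multiset (ℝ × Ξ) → ℝ) (y : ℕ × Mark S) (n : Z × (ℕ → Ξ))
    (u : ℕ → ℝ) : ℝ :=
  F y.2 n.1 (bag (fun j : Fin y.1 => u j) (fun j => n.2 j))

/-- `F` is a measurable function of the mark, the noise and a sequence of inputs. -/
def MeasurableApp (F : Mark S → Z → Multiset (ℝ × Ξ) → ℝ) : Prop :=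
  Measurable fun w : (ℕ × Mark S) × (Z × (ℕ → Ξ)) × (ℕ → ℝ) => appBy F w.1 w.2.1 w.2.2

lemma Recursion.measurableApp_Φ : MeasurableApp M.Φ := M.measurable_app

lemma Recursion.measurableApp_Ψ (hg : Measurable fun w : ℝ × Mark S => M.g w.1 w.2) :
    MeasurableApp M.Ψ :=
  hg.comp (M.measurable_app.prodMk (by fun_prop))

variable {M} {F : Mark S → Z → Multiset (ℝ × Ξ) → ℝ}

lemma MeasurableApp.comp (hF : MeasurableApp F) {Ω : Type*} [MeasurableSpace Ω]
    {y : Ω → ℕ × Mark S} {n : Ω → Z × (ℕ → Ξ)} {u : Ω → ℕ → ℝ} (hy : Measurable y)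
    (hn : Measurable n) (hu : Measurable u) : Measurable fun ω => appBy F (y ω) (n ω) (u ω) :=
  Measurable.comp hF (hy.prodMk (hn.prodMk hu))

variable (M) in
/-- The law of `F(X, ζ, {U_j, ξ_j})` for i.i.d. `U_j = f(ω_j)`. -/
lemma Recursion.branchingLaw_map (hF : MeasurableApp F) (m : Measure (ℕ × Mark S))
    [IsProbabilityMeasure m] {Ω : Type*} [MeasurableSpace Ω] (P : Measure Ω)
    [IsProbabilityMeasure P] {f : Ω → ℝ} (hf : Measurable f) :
    M.branchingLaw F m (P.map f) = ((m.prod M.nodeNoise).prod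
      (Measure.infinitePi fun _ : ℕ => P)).map
        fun z => appBy F z.1.1 z.1.2 (fun j => f (z.2 j)) := by
  have hPf : IsProbabilityMeasure (P.map f) := Measure.isProbabilityMeasure_map hf.aemeasurable
  have h1 : (Measure.infinitePi fun _ : ℕ => P.map f) =
      (Measure.infinitePi fun _ : ℕ => P).map fun w j => f (w j) :=
    (Measure.infinitePi_map_pi (fun _ : ℕ => P) (fun _ => hf)).symm
  have hm1 : Measurable fun z : (ℕ × Mark S) × Z × (ℕ → Ξ) × (ℕ → ℝ) =>
      appBy F z.1 (z.2.1, z.2.2.1) z.2.2.2 := hF.comp (by fun_prop) (by fun_prop) (by fun_prop)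
  have hm2 : Measurable fun w : ℕ → Ω => fun j => f (w j) := by fun_prop
  have h2 : m.prod (M.vertexNoise.prod ((Measure.infinitePi fun _ : ℕ => M.edgeNoise).prod
      (Measure.infinitePi fun _ : ℕ => P.map f))) =
      ((m.prod M.nodeNoise).prod (Measure.infinitePi fun _ : ℕ => P)).map
        fun z => (z.1.1, z.1.2.1, z.1.2.2, fun j => f (z.2 j)) := by
    rw [h1, ← (measurePreserving_prodAssoc M.vertexNoise
      (Measure.infinitePi fun _ : ℕ => M.edgeNoise) _).map_eq]
    have e1 : ∀ Q : Measure ((Z × (ℕ → Ξ)) × (ℕ → ℝ)), IsProbabilityMeasure Q →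
        m.prod (Q.map MeasurableEquiv.prodAssoc) =
        (m.prod Q).map (Prod.map id MeasurableEquiv.prodAssoc) := by
      intro Q hQ
      rw [← Measure.map_prod_map _ _ measurable_id (by fun_prop), Measure.map_id]
    have e0 : IsProbabilityMeasure
        ((Measure.infinitePi fun _ : ℕ => P).map fun w j => f (w j)) :=
      Measure.isProbabilityMeasure_map hm2.aemeasurable
    rw [e1 _ inferInstance]
    change (m.prod (M.nodeNoise.prod _)).map _ = _
    rw [← (measurePreserving_prodAssoc m M.nodeNoise _).map_eq]
    have e2 : (m.prod M.nodeNoise).prod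
        ((Measure.infinitePi fun _ : ℕ => P).map fun w j => f (w j)) =
        ((m.prod M.nodeNoise).prod (Measure.infinitePi fun _ : ℕ => P)).map
          (Prod.map id fun w j => f (w j)) := by
      rw [← Measure.map_prod_map _ _ measurable_id hm2, Measure.map_id]
    rw [e2, Measure.map_map (by fun_prop) (by fun_prop),
      Measure.map_map (by fun_prop) (by fun_prop)]
    rfl
  rw [Recursion.branchingLaw, h2]
  exact Measure.map_map hm1 (by fun_prop)

variable (M) in
lemma Recursion.branchingLaw_eq (hF : MeasurableApp F) (m : Measure (ℕ × Mark S))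
    [IsProbabilityMeasure m] (η : Measure ℝ) [IsProbabilityMeasure η] :
    M.branchingLaw F m η = ((m.prod M.nodeNoise).prod
      (Measure.infinitePi fun _ : ℕ => η)).map fun z => appBy F z.1.1 z.1.2 z.2 := by
  have := M.branchingLaw_map hF m η (f := id) measurable_id
  rwa [Measure.map_id] at this

lemma Recursion.isProbabilityMeasure_branchingLaw (hF : MeasurableApp F)
    (m : Measure (ℕ × Mark S)) [IsProbabilityMeasure m] (η : Measure ℝ) [IsProbabilityMeasure η] :
    IsProbabilityMeasure (M.branchingLaw F m η) := by
  rw [M.branchingLaw_eq hF]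
  exact Measure.isProbabilityMeasure_map
    (hF.comp (by fun_prop) (by fun_prop) (by fun_prop)).aemeasurable

variable {q : ℝ}

lemma lqn_swap (hq : 1 ≤ q) {α β : Type*} [MeasurableSpace α] [MeasurableSpace β] {μ : Measure α}
    {ν : Measure β} [SFinite μ] [SFinite ν] {f : α → β → ℝ≥0∞}
    (hf : Measurable fun z : α × β => f z.1 z.2) :
    lqn q μ (fun x => lqn q ν (fun y => f x y)) = lqn q ν (fun y => lqn q μ (fun x => f x y)) :=
  (lqn_prod hq hf).symm.trans (lqn_prod_symm hq hf)

/-- A bound given the mark and the inputs, integrated over the inputs. -/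
lemma lqn_branching_le (hq : 1 ≤ q) (m : Measure (ℕ × Mark S)) [IsProbabilityMeasure m]
    {Ω : Type*} [MeasurableSpace Ω] {P : Measure Ω} [IsProbabilityMeasure P]
    {h : (ℕ × Mark S) → (Z × (ℕ → Ξ)) → Ω → ℝ≥0∞}
    (hh : Measurable fun z : ((ℕ × Mark S) × (Z × (ℕ → Ξ))) × Ω => h z.1.1 z.1.2 z.2)
    {L b : ℕ × Mark S → ℝ≥0∞} (hL : Measurable L) (hb : Measurable b) {D : Ω → ℕ → ℝ≥0∞}
    (hD : Measurable D) {d : ℝ≥0∞} (hd : ∀ j, lqn q P (fun ω => D ω j) ≤ d)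
    (hle : ∀ᵐ y ∂m, ∀ ω, lqn q M.nodeNoise (fun n => h y n ω) ≤
      L y * ∑ j ∈ Finset.range y.1, D ω j + b y) :
    lqn q ((m.prod M.nodeNoise).prod P) (fun z => h z.1.1 z.1.2 z.2) ≤
      lqn q m (fun y => y.1 * L y) * d + lqn q m b := by
  have hN : Measurable fun y : ℕ × Mark S => (y.1 : ℝ≥0∞) * L y := by fun_prop
  rw [lqn_prod hq hh, lqn_prod hq (measurable_lqn hh), ← lqn_mul_const hq d hN]
  refine le_trans (lqn_mono_ae hq ?_) (lqn_add_le hq (hN.mul_const d) hb)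
  filter_upwards [hle] with y hy
  have hh' : Measurable fun z : (Z × (ℕ → Ξ)) × Ω => h y z.1 z.2 :=
    hh.comp (f := fun z : (Z × (ℕ → Ξ)) × Ω => ((y, z.1), z.2)) (by fun_prop)
  have hDj : ∀ j, Measurable fun ω => D ω j := fun j => by fun_prop
  have hs : Measurable fun ω => ∑ j ∈ Finset.range y.1, D ω j :=
    Finset.measurable_sum _ fun j _ => hDj j
  change lqn q M.nodeNoise (fun n => lqn q P (fun ω => h y n ω)) ≤ _
  rw [lqn_swap hq hh']
  refine (lqn_mono hq hy).trans ((lqn_add_le hq (hs.const_mul _) measurable_const).trans ?_)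
  rw [lqn_const hq, lqn_const_mul hq _ hs]
  refine add_le_add ?_ le_rfl
  rw [mul_right_comm, mul_comm]
  refine mul_le_mul_left ((lqn_sum_le hq _ hDj).trans ?_) _
  refine (Finset.sum_le_sum fun j _ => hd j).trans ?_
  simp

/-- `F` is Lipschitz in its inputs, in the `L^q` sense, with constants `L`. -/
def Recursion.LipBound (M : Recursion S Z Ξ) (q : ℝ) (F : Mark S → Z → Multiset (ℝ × Ξ) → ℝ)
    (m : Measure (ℕ × Mark S)) (L : ℕ × Mark S → ℝ≥0∞) : Prop :=
  ∀ᵐ y ∂m, ∀ u w, lqn q M.nodeNoise (fun n => ‖appBy F y n u - appBy F y n w‖ₑ) ≤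
    L y * ∑ j ∈ Finset.range y.1, ‖u j - w j‖ₑ

lemma Recursion.LipBound.lqn_le (hq : 1 ≤ q) (hF : MeasurableApp F) {m : Measure (ℕ × Mark S)}
    [IsProbabilityMeasure m] {L : ℕ × Mark S → ℝ≥0∞} (hL : Measurable L)
    (h : M.LipBound q F m L) {Ω : Type*} [MeasurableSpace Ω] {P : Measure Ω}
    [IsProbabilityMeasure P] {U U' : Ω → ℕ → ℝ} (hU : Measurable U) (hU' : Measurable U')
    {d : ℝ≥0∞} (hd : ∀ j, lqn q P (fun ω => ‖U ω j - U' ω j‖ₑ) ≤ d) :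
    lqn q ((m.prod M.nodeNoise).prod P)
        (fun z => ‖appBy F z.1.1 z.1.2 (U z.2) - appBy F z.1.1 z.1.2 (U' z.2)‖ₑ) ≤
      lqn q m (fun y => y.1 * L y) * d := by
  have := lqn_branching_le (M := M) (P := P) (b := fun _ => 0) hq m
    (h := fun y n ω => ‖appBy F y n (U ω) - appBy F y n (U' ω)‖ₑ)
    (measurable_enorm_sub (hF.comp (by fun_prop) (by fun_prop) (by fun_prop))
      (hF.comp (by fun_prop) (by fun_prop) (by fun_prop))) hL measurable_const
    (D := fun ω j => ‖U ω j - U' ω j‖ₑ) (by fun_prop) hd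
    (h.mono fun y hy ω => (hy _ _).trans (by simp))
  simpa [lqn_zero hq] using this

/-- One step of the branching recursion applied to a coupling. -/
lemma Recursion.LipBound.exists_coupling (hq : 1 ≤ q) (hF : MeasurableApp F)
    {m : Measure (ℕ × Mark S)} [IsProbabilityMeasure m] {L : ℕ × Mark S → ℝ≥0∞}
    (hL : Measurable L) (h : M.LipBound q F m L) (π : Measure (ℝ × ℝ)) [IsProbabilityMeasure π] :
    ∃ π' : Measure (ℝ × ℝ), IsProbabilityMeasure π' ∧
      π'.map Prod.fst = M.branchingLaw F m (π.map Prod.fst) ∧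
      π'.map Prod.snd = M.branchingLaw F m (π.map Prod.snd) ∧
      lqn q π' (fun z => ‖z.1 - z.2‖ₑ) ≤
        lqn q m (fun y => y.1 * L y) * lqn q π (fun z => ‖z.1 - z.2‖ₑ) := by
  have h1 : Measurable fun z : ((ℕ × Mark S) × (Z × (ℕ → Ξ))) × (ℕ → ℝ × ℝ) =>
      appBy F z.1.1 z.1.2 (fun j => (z.2 j).1) := hF.comp (by fun_prop) (by fun_prop) (by fun_prop)
  have h2 : Measurable fun z : ((ℕ × Mark S) × (Z × (ℕ → Ξ))) × (ℕ → ℝ × ℝ) =>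
      appBy F z.1.1 z.1.2 (fun j => (z.2 j).2) := hF.comp (by fun_prop) (by fun_prop) (by fun_prop)
  refine ⟨((m.prod M.nodeNoise).prod (Measure.infinitePi fun _ : ℕ => π)).map fun z =>
    (appBy F z.1.1 z.1.2 (fun j => (z.2 j).1), appBy F z.1.1 z.1.2 (fun j => (z.2 j).2)),
    Measure.isProbabilityMeasure_map (h1.prodMk h2).aemeasurable, ?_, ?_, ?_⟩
  · rw [Measure.map_map measurable_fst (h1.prodMk h2), M.branchingLaw_map hF m π measurable_fst]
    rfl
  · rw [Measure.map_map measurable_snd (h1.prodMk h2), M.branchingLaw_map hF m π measurable_snd]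
    rfl
  · rw [lqn_map (h1.prodMk h2) (by fun_prop)]
    refine h.lqn_le hq hF hL (P := Measure.infinitePi fun _ : ℕ => π)
      (U := fun w j => (w j).1) (U' := fun w j => (w j).2) (by fun_prop) (by fun_prop) fun j => ?_
    conv_rhs => rw [← Measure.infinitePi_map_eval (fun _ : ℕ => π) j,
      lqn_map (by fun_prop) (by fun_prop)]

end Branching

/-! ### Trees with labels -/

section LabelledTree

variable {S Z Ξ : Type*} [MeasurableSpace S] [MeasurableSpace Z] [MeasurableSpace Ξ]
  (M : Recursion S Z Ξ)

/-- The label of a node: the offspring number and the mark, the noises at the node and on the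
edges from its children, and the initial value. -/
abbrev Label (S Z Ξ : Type*) : Type _ := (ℕ × Mark S) × (Z × (ℕ → Ξ)) × ℝ

/-- The labels on the subtree at the `j`-th child of the root. -/
def subtree {X : Type*} (W : List ℕ → X) (j : ℕ) (q : List ℕ) : X := W (q ++ [j])

/-- The variable `𝒱_∅^(k)` as a function of the labels. -/
def Recursion.val (M : Recursion S Z Ξ) : ℕ → (List ℕ → Label S Z Ξ) → ℝ
  | 0, W => M.g (W []).2.2 (W []).1.2
  | k + 1, W => appBy M.Ψ (W []).1 (W []).2.1 (fun j => M.val k (subtree W j))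

/-- The law of the labels on a delayed tree. -/
def Recursion.labelLaw (root child : Measure (ℕ × Mark S)) : Measure (List ℕ → Label S Z Ξ) :=
  Measure.infinitePi fun q : List ℕ =>
    (if q = [] then root else child).prod (M.nodeNoise.prod M.initial)

lemma isProbabilityMeasure_ite (root child : Measure (ℕ × Mark S)) [IsProbabilityMeasure root]
    [IsProbabilityMeasure child] (q : List ℕ) :
    IsProbabilityMeasure (if q = [] then root else child) := by
  split_ifs <;> infer_instance

attribute [local instance] isProbabilityMeasure_ite

instance (root child : Measure (ℕ × Mark S)) [IsProbabilityMeasure root]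
    [IsProbabilityMeasure child] : IsProbabilityMeasure (M.labelLaw root child) := by
  unfold Recursion.labelLaw; infer_instance

lemma measurable_subtree {X : Type*} [MeasurableSpace X] :
    Measurable fun W : List ℕ → X => subtree W := by
  unfold subtree; fun_prop

variable {M}

lemma Recursion.measurable_val (hg : Measurable fun w : ℝ × Mark S => M.g w.1 w.2) (k : ℕ) :
    Measurable (M.val k) := by
  induction k with
  | zero => exact hg.comp (Measurable.prodMk (by fun_prop) (by fun_prop))
  | succ k ih =>
    refine (M.measurableApp_Ψ hg).comp (by fun_prop) (by fun_prop) ?_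
    exact measurable_pi_lambda _ fun j => ih.comp ((measurable_pi_apply j).comp measurable_subtree)

variable (M) in
/-- The label at the root and the subtrees at its children. -/
lemma Recursion.map_root_subtree (root child : Measure (ℕ × Mark S)) [IsProbabilityMeasure root]
    [IsProbabilityMeasure child] :
    (M.labelLaw root child).map (fun W => (((W []).1, (W []).2.1), subtree W)) =
      (root.prod M.nodeNoise).prod (Measure.infinitePi fun _ : ℕ => M.labelLaw child child) := by
  have h := infinitePi_list (fun q : List ℕ =>
    (if q = [] then root else child).prod (M.nodeNoise.prod M.initial))
  have h1 : (root.prod (M.nodeNoise.prod M.initial)).map (fun e => (e.1, e.2.1)) =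
      root.prod M.nodeNoise := by
    have := Measure.map_prod_map root (M.nodeNoise.prod M.initial)
      (f := id) (g := Prod.fst) measurable_id measurable_fst
    rw [Measure.map_id] at this
    simp only [Measure.map_fst_prod, measure_univ, one_smul] at this
    exact this.symm
  have h2 : (M.labelLaw root child).map (fun W => (W [], subtree W)) =
      (root.prod (M.nodeNoise.prod M.initial)).prod
        (Measure.infinitePi fun _ : ℕ => M.labelLaw child child) := by
    refine h.trans ?_
    simp [Recursion.labelLaw]
  rw [← h1]
  have h3 : ((root.prod (M.nodeNoise.prod M.initial)).map (fun e => (e.1, e.2.1))).prod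
      (Measure.infinitePi fun _ : ℕ => M.labelLaw child child) =
      ((root.prod (M.nodeNoise.prod M.initial)).prod
        (Measure.infinitePi fun _ : ℕ => M.labelLaw child child)).map
          (Prod.map (fun e => (e.1, e.2.1)) id) := by
    rw [← Measure.map_prod_map _ _ (by fun_prop) measurable_id, Measure.map_id]
  rw [h3, ← h2, Measure.map_map (by fun_prop) (Measurable.prodMk (by fun_prop) measurable_subtree)]
  rfl

/-- The law of a function of the root label and of the values of `f` on the subtrees. -/
lemma Recursion.map_appBy_subtree {F : Mark S → Z → Multiset (ℝ × Ξ) → ℝ} (hF : MeasurableApp F)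
    (root child : Measure (ℕ × Mark S)) [IsProbabilityMeasure root] [IsProbabilityMeasure child]
    {f : (List ℕ → Label S Z Ξ) → ℝ} (hf : Measurable f) :
    (M.labelLaw root child).map
        (fun W => appBy F (W []).1 (W []).2.1 (fun j => f (subtree W j))) =
      M.branchingLaw F root ((M.labelLaw child child).map f) := by
  rw [M.branchingLaw_map hF _ _ hf, ← M.map_root_subtree, Measure.map_map
    (hF.comp (by fun_prop) (by fun_prop) (by fun_prop))
    (Measurable.prodMk (by fun_prop) measurable_subtree)]
  rfl

variable {q : ℝ}

lemma Recursion.LipBound.lqn_subtree_le (hq : 1 ≤ q) {F : Mark S → Z → Multiset (ℝ × Ξ) → ℝ}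
    (hF : MeasurableApp F) {root child : Measure (ℕ × Mark S)} [IsProbabilityMeasure root]
    [IsProbabilityMeasure child] {L : ℕ × Mark S → ℝ≥0∞} (hL : Measurable L)
    (h : M.LipBound q F root L) {f f' : (List ℕ → Label S Z Ξ) → ℝ} (hf : Measurable f)
    (hf' : Measurable f') :
    lqn q (M.labelLaw root child) (fun W =>
        ‖appBy F (W []).1 (W []).2.1 (fun j => f (subtree W j)) -
          appBy F (W []).1 (W []).2.1 (fun j => f' (subtree W j))‖ₑ) ≤
      lqn q root (fun y => y.1 * L y) *
        lqn q (M.labelLaw child child) (fun W => ‖f W - f' W‖ₑ) := by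
  have h1 := h.lqn_le hq hF hL (P := Measure.infinitePi fun _ : ℕ => M.labelLaw child child)
    (U := fun w j => f (w j)) (U' := fun w j => f' (w j)) (by fun_prop) (by fun_prop)
    (d := lqn q (M.labelLaw child child) (fun W => ‖f W - f' W‖ₑ)) (fun j => by
      rw [← lqn_map (ν := Measure.infinitePi fun _ : ℕ => M.labelLaw child child)
        (φ := fun w => w j) (f := fun W => ‖f W - f' W‖ₑ) (by fun_prop) (by fun_prop),
        Measure.infinitePi_map_eval])
  refine le_trans (le_of_eq ?_) h1
  rw [← M.map_root_subtree, lqn_map (Measurable.prodMk (by fun_prop) measurable_subtree)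
    (measurable_enorm_sub (hF.comp (by fun_prop) (by fun_prop) (by fun_prop))
      (hF.comp (by fun_prop) (by fun_prop) (by fun_prop)))]

variable {child : Measure (ℕ × Mark S)} [IsProbabilityMeasure child] {L : ℕ × Mark S → ℝ≥0∞}

lemma Recursion.lqn_val_succ_sub_le (hq : 1 ≤ q)
    (hg : Measurable fun w : ℝ × Mark S => M.g w.1 w.2) (hL : Measurable L)
    (h : M.LipBound q M.Ψ child L) (k : ℕ) :
    lqn q (M.labelLaw child child) (fun W => ‖M.val (k + 1) W - M.val k W‖ₑ) ≤
      lqn q child (fun y => y.1 * L y) ^ k *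
        lqn q (M.labelLaw child child) (fun W => ‖M.val 1 W - M.val 0 W‖ₑ) := by
  induction k with
  | zero => simp
  | succ k ih =>
    rw [pow_succ', mul_assoc]
    exact (h.lqn_subtree_le hq (M.measurableApp_Ψ hg) hL (M.measurable_val hg (k + 1))
      (M.measurable_val hg k)).trans (mul_le_mul_right ih _)

/-- The limit of `𝒱_∅^(k)`. -/
def Recursion.valLimit (M : Recursion S Z Ξ) (W : List ℕ → Label S Z Ξ) : ℝ :=
  limUnder atTop fun k => M.val k W

lemma Recursion.measurable_valLimit (hg : Measurable fun w : ℝ × Mark S => M.g w.1 w.2) :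
    Measurable M.valLimit :=
  (StronglyMeasurable.limUnder fun k => (M.measurable_val hg k).stronglyMeasurable).measurable

lemma Recursion.lqn_valLimit_sub_le (hq : 1 ≤ q)
    (hg : Measurable fun w : ℝ × Mark S => M.g w.1 w.2) (hL : Measurable L)
    (h : M.LipBound q M.Ψ child L) (hc : lqn q child (fun y => y.1 * L y) < 1)
    (h0 : lqn q (M.labelLaw child child) (fun W => ‖M.val 1 W - M.val 0 W‖ₑ) ≠ ∞) (k : ℕ) :
    lqn q (M.labelLaw child child) (fun W => ‖M.valLimit W - M.val k W‖ₑ) ≤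
      lqn q child (fun y => y.1 * L y) ^ k *
        (lqn q (M.labelLaw child child) (fun W => ‖M.val 1 W - M.val 0 W‖ₑ) *
          (1 - lqn q child (fun y => y.1 * L y))⁻¹) :=
  (geometric_limit hq (M.measurable_val hg) hc h0 (M.lqn_val_succ_sub_le hq hg hL h)).2 k

lemma Recursion.valLimit_eq (hq : 1 ≤ q)
    (hg : Measurable fun w : ℝ × Mark S => M.g w.1 w.2) (hL : Measurable L)
    (h : M.LipBound q M.Ψ child L) (hc : lqn q child (fun y => y.1 * L y) < 1)
    (h0 : lqn q (M.labelLaw child child) (fun W => ‖M.val 1 W - M.val 0 W‖ₑ) ≠ ∞) :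
    ∀ᵐ W ∂(M.labelLaw child child), M.valLimit W =
      appBy M.Ψ (W []).1 (W []).2.1 (fun j => M.valLimit (subtree W j)) := by
  have hFΨ := M.measurableApp_Ψ hg
  have hv := M.measurable_valLimit hg
  set c := lqn q child (fun y => y.1 * L y)
  set d := lqn q (M.labelLaw child child) (fun W => ‖M.val 1 W - M.val 0 W‖ₑ)
  have hm : ∀ f : (List ℕ → Label S Z Ξ) → ℝ, Measurable f → Measurable
      fun W : List ℕ → Label S Z Ξ =>
        appBy M.Ψ (W []).1 (W []).2.1 (fun j => f (subtree W j)) := fun f hf =>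
    hFΨ.comp (by fun_prop) (by fun_prop)
      (measurable_pi_lambda _ fun j => hf.comp ((measurable_pi_apply j).comp measurable_subtree))
  have hz : lqn q (M.labelLaw child child) (fun W => ‖M.valLimit W -
      appBy M.Ψ (W []).1 (W []).2.1 (fun j => M.valLimit (subtree W j))‖ₑ) = 0 := by
    have hfin : d * (1 - c)⁻¹ ≠ ∞ :=
      ENNReal.mul_ne_top h0 (ENNReal.inv_ne_top.2 (tsub_pos_of_lt hc).ne')
    refine le_antisymm (ge_of_tendsto' (tendsto_pow_mul_zero hc
      (ENNReal.mul_ne_top (b := (2 : ℝ≥0∞)) hfin (by simp))) fun k => ?_) bot_le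
    calc _ ≤ lqn q (M.labelLaw child child) (fun W => ‖M.valLimit W - M.val (k + 1) W‖ₑ +
          ‖appBy M.Ψ (W []).1 (W []).2.1 (fun j => M.val k (subtree W j)) -
            appBy M.Ψ (W []).1 (W []).2.1 (fun j => M.valLimit (subtree W j))‖ₑ) := by
          refine lqn_mono hq fun W => ?_
          refine le_trans (le_of_eq ?_) (enorm_add_le _ _)
          congr 1
          simp only [Recursion.val]
          abel
      _ ≤ c ^ (k + 1) * (d * (1 - c)⁻¹) + c * (c ^ k * (d * (1 - c)⁻¹)) := by
          refine (lqn_add_le hq (measurable_enorm_sub hv (M.measurable_val hg _))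
            (measurable_enorm_sub (hm _ (M.measurable_val hg k)) (hm _ hv))).trans ?_
          refine add_le_add (M.lqn_valLimit_sub_le hq hg hL h hc h0 _) ?_
          refine (h.lqn_subtree_le hq hFΨ hL (M.measurable_val hg k) hv).trans ?_
          refine mul_le_mul_right ?_ _
          exact (lqn_mono hq fun W => (enorm_sub_rev _ _).le).trans
            (M.lqn_valLimit_sub_le hq hg hL h hc h0 k)
      _ = c * (c ^ k * (d * (1 - c)⁻¹ * 2)) := by ring
      _ ≤ 1 * (c ^ k * (d * (1 - c)⁻¹ * 2)) := mul_le_mul_left hc.le _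
      _ = _ := one_mul _
  rw [← nonpos_iff_eq_zero, lqn_le_iff hq, ENNReal.zero_rpow_of_pos (by positivity),
    nonpos_iff_eq_zero,
    lintegral_eq_zero_iff ((measurable_enorm_sub hv (hm _ hv)).pow_const q)] at hz
  filter_upwards [hz] with W hW
  have := (ENNReal.rpow_eq_zero_iff_of_pos (by positivity)).1 hW
  rwa [enorm_eq_zero, sub_eq_zero] at this

/-- The law of the limit solves the distributional equation. -/
lemma Recursion.branchingLaw_valLimit (hq : 1 ≤ q)
    (hg : Measurable fun w : ℝ × Mark S => M.g w.1 w.2) (hL : Measurable L)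
    (h : M.LipBound q M.Ψ child L) (hc : lqn q child (fun y => y.1 * L y) < 1)
    (h0 : lqn q (M.labelLaw child child) (fun W => ‖M.val 1 W - M.val 0 W‖ₑ) ≠ ∞) :
    M.branchingLaw M.Ψ child ((M.labelLaw child child).map M.valLimit) =
      (M.labelLaw child child).map M.valLimit := by
  conv_rhs => rw [Measure.map_congr (M.valLimit_eq hq hg hL h hc h0)]
  exact (M.map_appBy_subtree (M.measurableApp_Ψ hg) child child (M.measurable_valLimit hg)).symm

lemma Recursion.map_val_succ (hg : Measurable fun w : ℝ × Mark S => M.g w.1 w.2) (k : ℕ) :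
    (M.labelLaw child child).map (M.val (k + 1)) =
      M.branchingLaw M.Ψ child ((M.labelLaw child child).map (M.val k)) :=
  M.map_appBy_subtree (M.measurableApp_Ψ hg) child child (M.measurable_val hg k)

/-- The iterates of the distributional recursion approach any of its solutions. -/
lemma Recursion.exists_coupling_val (hq : 1 ≤ q)
    (hg : Measurable fun w : ℝ × Mark S => M.g w.1 w.2) (hL : Measurable L)
    (h : M.LipBound q M.Ψ child L) {η : Measure ℝ} [IsProbabilityMeasure η]
    (hη : M.branchingLaw M.Ψ child η = η) (k : ℕ) :
    ∃ π : Measure (ℝ × ℝ), IsProbabilityMeasure π ∧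
      π.map Prod.fst = (M.labelLaw child child).map (M.val k) ∧ π.map Prod.snd = η ∧
      lqn q π (fun z => ‖z.1 - z.2‖ₑ) ≤ lqn q child (fun y => y.1 * L y) ^ k *
        (lqn q (M.labelLaw child child) (fun W => ‖M.val 0 W‖ₑ) + lqn q η (fun x => ‖x‖ₑ)) := by
  induction k with
  | zero =>
    have : IsProbabilityMeasure ((M.labelLaw child child).map (M.val 0)) :=
      Measure.isProbabilityMeasure_map (M.measurable_val hg 0).aemeasurable
    refine ⟨((M.labelLaw child child).map (M.val 0)).prod η, inferInstance, by simp, by simp, ?_⟩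
    rw [pow_zero, one_mul]
    refine (lqn_mono hq fun z => enorm_sub_le).trans
      ((lqn_add_le hq (by fun_prop) (by fun_prop)).trans (add_le_add (le_of_eq ?_) (le_of_eq ?_)))
    · rw [← lqn_map (f := fun x : ℝ => ‖x‖ₑ) measurable_fst (by fun_prop), Measure.map_fst_prod,
        measure_univ, one_smul, lqn_map (M.measurable_val hg 0) (by fun_prop)]
    · rw [← lqn_map (f := fun x : ℝ => ‖x‖ₑ) measurable_snd (by fun_prop), Measure.map_snd_prod,
        measure_univ, one_smul]
  | succ k ih =>
    obtain ⟨π, hπ, h1, h2, h3⟩ := ih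
    obtain ⟨π', hπ', h1', h2', h3'⟩ := h.exists_coupling hq (M.measurableApp_Ψ hg) hL π
    refine ⟨π', hπ', by rw [h1', h1, M.map_val_succ hg], by rw [h2', h2, hη], ?_⟩
    rw [pow_succ', mul_assoc]
    exact h3'.trans (mul_le_mul_right h3 _)

end LabelledTree

/-! ### The recursion on noisy trees -/

section NoisyTrees

open Measure

variable {S Z Ξ : Type*} [MeasurableSpace S] [MeasurableSpace Z] [MeasurableSpace Ξ]
  (M : Recursion S Z Ξ)

attribute [local instance] isProbabilityMeasure_ite

/-- The labels of the nodes. -/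
def label (z : NoisyTree S Z Ξ × (List ℕ → ℝ)) (q : List ℕ) : Label S Z Ξ :=
  (z.1.1 q, (z.1.2.1 q, fun j => z.1.2.2 (j :: q)), z.2 q)

/-- The noises, collected at the nodes. -/
def nodeNoises (e : (List ℕ → Z) × (List ℕ → Ξ)) (q : List ℕ) : Z × (ℕ → Ξ) :=
  (e.1 q, fun j => e.2 (j :: q))

lemma measurePreserving_zip {ι X Y : Type*} [MeasurableSpace X] [MeasurableSpace Y]
    (μ : ι → Measure X) (ν : ι → Measure Y) [∀ i, IsProbabilityMeasure (μ i)]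
    [∀ i, IsProbabilityMeasure (ν i)] :
    MeasurePreserving (fun (z : (ι → X) × (ι → Y)) i => (z.1 i, z.2 i))
      ((infinitePi μ).prod (infinitePi ν)) (infinitePi fun i => (μ i).prod (ν i)) :=
  ⟨by fun_prop, infinitePi_map_zip μ ν⟩

lemma Recursion.measurePreserving_nodeNoises :
    MeasurePreserving (nodeNoises (Z := Z) (Ξ := Ξ))
      ((infinitePi fun _ : List ℕ => M.vertexNoise).prod
        (infinitePi fun _ : List ℕ => M.edgeNoise))
      (infinitePi fun _ : List ℕ => M.nodeNoise) := by
  have h : MeasurePreserving (fun (ξ : List ℕ → Ξ) (q : List ℕ) (j : ℕ) => ξ (j :: q))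
      (infinitePi fun _ : List ℕ => M.edgeNoise)
      (infinitePi fun _ : List ℕ => infinitePi fun _ : ℕ => M.edgeNoise) := by
    refine ⟨by fun_prop, ?_⟩
    have hinj : Function.Injective fun a : List ℕ × ℕ => a.2 :: a.1 := by
      rintro ⟨q, j⟩ ⟨q', j'⟩ h
      simp only [List.cons.injEq] at h
      exact Prod.ext h.2 h.1
    rw [← infinitePi_map_curry (fun (_ : List ℕ) (_ : ℕ) => M.edgeNoise),
      ← map_infinitePi_infinitePi_of_inj (P := fun _ : List ℕ => M.edgeNoise) hinj,
      map_map (by fun_prop) (by fun_prop)]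
    rfl
  exact (measurePreserving_zip _ _).comp ((MeasurePreserving.id _).prod h)

lemma Recursion.measurePreserving_label (root child : Measure (ℕ × Mark S))
    [IsProbabilityMeasure root] [IsProbabilityMeasure child] :
    MeasurePreserving (label (S := S) (Z := Z) (Ξ := Ξ))
      ((M.noisyTreeLaw root child).prod (infinitePi fun _ : List ℕ => M.initial))
      (M.labelLaw root child) := by
  have : IsProbabilityMeasure (gwLaw root child) := by unfold gwLaw; infer_instance
  have h1 := (measurePreserving_zip (fun _ : List ℕ => M.nodeNoise) fun _ => M.initial).comp
    (M.measurePreserving_nodeNoises.prod (MeasurePreserving.id (infinitePi fun _ => M.initial)))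
  exact (measurePreserving_zip (fun q : List ℕ => if q = [] then root else child)
    fun _ => M.nodeNoise.prod M.initial).comp
      (((MeasurePreserving.id (gwLaw root child)).prod h1).comp
        (measurePreserving_prodAssoc _ _ _))

instance (root child : Measure (ℕ × Mark S)) [IsProbabilityMeasure root]
    [IsProbabilityMeasure child] : IsProbabilityMeasure (gwLaw root child) := by
  unfold gwLaw; infer_instance

instance (root child : Measure (ℕ × Mark S)) [IsProbabilityMeasure root]
    [IsProbabilityMeasure child] : IsProbabilityMeasure (M.noisyTreeLaw root child) := by
  unfold Recursion.noisyTreeLaw; infer_instance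

lemma Recursion.treeV_eq (z : NoisyTree S Z Ξ × (List ℕ → ℝ)) (k : ℕ) (q : List ℕ) :
    M.treeV z.1 z.2 k q = M.val k (fun q' => label z (q' ++ q)) := by
  induction k generalizing q with
  | zero => rfl
  | succ k ih =>
    have hsub : ∀ j, subtree (fun q' => label z (q' ++ q)) j = fun q' => label z (q' ++ j :: q) :=
      fun j => funext fun q' => by simp [subtree]
    simp only [Recursion.treeV, Recursion.treeΦ, ih]
    simp only [Recursion.val, appBy, Recursion.Ψ, hsub]
    rfl

lemma Recursion.treeR_succ (z : NoisyTree S Z Ξ × (List ℕ → ℝ)) (k : ℕ) :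
    M.treeR z.1 z.2 (k + 1) = appBy M.Φ (label z []).1 (label z []).2.1
      (fun j => M.val k (subtree (label z) j)) := by
  simp only [Recursion.treeR, Recursion.treeΦ, M.treeV_eq]
  rfl

lemma Recursion.treeRLaw_succ (hg : Measurable fun w : ℝ × Mark S => M.g w.1 w.2)
    (root child : Measure (ℕ × Mark S)) [IsProbabilityMeasure root] [IsProbabilityMeasure child]
    (k : ℕ) :
    M.treeRLaw root child (k + 1) =
      M.branchingLaw M.Φ root ((M.labelLaw child child).map (M.val k)) := by
  have hv := M.measurable_val hg k
  have hm : Measurable fun W : List ℕ → Label S Z Ξ =>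
      appBy M.Φ (W []).1 (W []).2.1 (fun j => M.val k (subtree W j)) :=
    M.measurableApp_Φ.comp (by fun_prop) (by fun_prop) (measurable_pi_lambda _ fun j =>
      hv.comp ((measurable_pi_apply j).comp measurable_subtree))
  rw [← M.map_appBy_subtree M.measurableApp_Φ root child hv,
    ← (M.measurePreserving_label root child).map_eq,
    Measure.map_map hm (M.measurePreserving_label root child).measurable]
  refine congrArg (fun f => Measure.map f _) (funext fun z => ?_)
  exact M.treeR_succ z k

/-- The same recursion started from `0`. -/
def Recursion.zeroStart : Recursion S Z Ξ :=
  { M with initial := Measure.dirac 0, prob_initial := inferInstance }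

lemma Recursion.treeV_zeroStart (τ : NoisyTree S Z Ξ) (r : List ℕ → ℝ) (k : ℕ) (q : List ℕ) :
    M.zeroStart.treeV τ r k q = M.treeV τ r k q := by
  induction k generalizing q with
  | zero => rfl
  | succ k ih =>
    simp only [Recursion.treeV, Recursion.treeΦ, ih]
    rfl

lemma Recursion.map_label_zero (root child : Measure (ℕ × Mark S))
    [IsProbabilityMeasure root] [IsProbabilityMeasure child] :
    (M.noisyTreeLaw root child).map (fun τ => label (τ, 0)) =
      M.zeroStart.labelLaw root child := by
  have h := (M.zeroStart.measurePreserving_label root child)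
  rw [← h.map_eq]
  have e : (M.zeroStart.noisyTreeLaw root child).prod
      (infinitePi fun _ : List ℕ => M.zeroStart.initial) =
      (M.noisyTreeLaw root child).map fun τ => (τ, (0 : List ℕ → ℝ)) := by
    change (M.noisyTreeLaw root child).prod (infinitePi fun _ : List ℕ => Measure.dirac (0 : ℝ)) = _
    rw [Measure.infinitePi_dirac, Measure.prod_dirac]
    rfl
  rw [e, Measure.map_map h.measurable (by fun_prop)]
  rfl

/-- If the labels of the nodes of a random tree are measurable, then so are the variables
`𝒱_∅^(k)`. -/
lemma Recursion.measurable_treeV_root (hg : Measurable fun w : ℝ × Mark S => M.g w.1 w.2)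
    {Ω : Type*} [MeasurableSpace Ω] {T : Ω → NoisyTree S Z Ξ}
    [Nonempty ((ℕ × Mark S) × Z × (ℕ → Ξ))]
    (hT : ∀ (q : List ℕ) (B : Set ((ℕ × Mark S) × Z × (ℕ → Ξ))), MeasurableSet B →
      MeasurableSet {ω | InTree (T ω).1 q ∧
        ((T ω).1 q, (T ω).2.1 q, fun j => (T ω).2.2 (j :: q)) ∈ B}) (k : ℕ) :
    Measurable fun ω => M.treeV (T ω) 0 k [] := by
  classical
  let d₀ : (ℕ × Mark S) × Z × (ℕ → Ξ) := Classical.arbitrary _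
  let d : List ℕ → Ω → (ℕ × Mark S) × Z × (ℕ → Ξ) := fun q ω =>
    if InTree (T ω).1 q then ((T ω).1 q, (T ω).2.1 q, fun j => (T ω).2.2 (j :: q)) else d₀
  have hIn : ∀ q, MeasurableSet {ω | InTree (T ω).1 q} := fun q => by
    simpa using hT q Set.univ MeasurableSet.univ
  have hd : ∀ q, Measurable (d q) := by
    intro q B hB
    have : d q ⁻¹' B = {ω | InTree (T ω).1 q ∧
        ((T ω).1 q, (T ω).2.1 q, fun j => (T ω).2.2 (j :: q)) ∈ B} ∪
        ({ω | InTree (T ω).1 q}ᶜ ∩ {_ω | d₀ ∈ B}) := by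
      ext ω
      by_cases h : InTree (T ω).1 q <;> simp [d, h]
    rw [this]
    exact (hT q B hB).union ((hIn q).compl.inter (MeasurableSet.const _))
  have key : ∀ q, Measurable fun ω => if InTree (T ω).1 q then M.treeV (T ω) 0 k q else 0 := by
    induction k with
    | zero =>
      intro q
      have : (fun ω => if InTree (T ω).1 q then M.treeV (T ω) 0 0 q else 0) =
          fun ω => if InTree (T ω).1 q then M.g 0 (d q ω).1.2 else 0 := by
        funext ω
        by_cases h : InTree (T ω).1 q <;> simp [d, h, Recursion.treeV]
      rw [this]
      have hgd : Measurable fun ω => M.g 0 (d q ω).1.2 :=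
        hg.comp (measurable_const.prodMk (by have := hd q; fun_prop))
      exact Measurable.ite (hIn q) hgd measurable_const
    | succ k ih =>
      intro q
      have : (fun ω => if InTree (T ω).1 q then M.treeV (T ω) 0 (k + 1) q else 0) =
          fun ω => if InTree (T ω).1 q then appBy M.Ψ (d q ω).1 (d q ω).2
            (fun j => if InTree (T ω).1 (j :: q) then M.treeV (T ω) 0 k (j :: q) else 0)
            else 0 := by
        funext ω
        by_cases h : InTree (T ω).1 q
        · have hdq : d q ω = ((T ω).1 q, (T ω).2.1 q, fun j => (T ω).2.2 (j :: q)) := if_pos h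
          have hv : (fun j : Fin ((T ω).1 q).1 => if InTree (T ω).1 ((j : ℕ) :: q) then
              M.treeV (T ω) 0 k ((j : ℕ) :: q) else 0) =
              fun j : Fin ((T ω).1 q).1 => M.treeV (T ω) 0 k ((j : ℕ) :: q) :=
            funext fun j => if_pos ⟨h, j.2⟩
          rw [if_pos h, if_pos h, hdq]
          simp only [appBy, Recursion.treeV, Recursion.treeΦ, Recursion.Ψ, hv]
        · simp [h]
      rw [this]
      have hq := hd q
      exact Measurable.ite (hIn q) ((M.measurableApp_Ψ hg).comp (by fun_prop) (by fun_prop)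
        (measurable_pi_lambda _ fun j => ih (j :: q))) measurable_const
  simpa [InTree] using key []

/-- The conditions on the maps and on the laws of the labels of the limiting tree. -/
structure Recursion.TreeRegular (M : Recursion S Z Ξ) (p : ℝ≥0∞) (σm σp β : Mark S → ℝ)
    (root child : Measure (ℕ × Mark S)) : Prop where
  measurable_g : Measurable fun w : ℝ × Mark S => M.g w.1 w.2
  measurable_σm : Measurable σm
  measurable_σp : Measurable σp
  measurable_β : Measurable β
  lipschitz_g : ∀ x r r', |M.g r x - M.g r' x| ≤ σp x * |r - r'|
  lipschitz_root : ∀ᵐ y ∂root, M.LipschitzAt p (σm y.2) y.1 y.2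
  lipschitz_child : ∀ᵐ y ∂child, M.LipschitzAt p (σm y.2) y.1 y.2
  growth_root : ∀ᵐ y ∂root, M.GrowthAt p (σm y.2) (β y.2) y.1 y.2
  growth_child : ∀ᵐ y ∂child, M.GrowthAt p (σm y.2) (β y.2) y.1 y.2
  root_σm : MemLp (fun y : ℕ × Mark S => (y.1 : ℝ) * σm y.2) p root
  root_β : MemLp (fun y : ℕ × Mark S => β y.2) p root
  child_σβ : MemLp (fun y : ℕ × Mark S => σp y.2 * β y.2) p child
  child_σp : MemLp (fun y : ℕ × Mark S => σp y.2) p child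
  child_g : MemLp (fun y : ℕ × Mark S => M.g 0 y.2) p child
  initial : MemLp id p M.initial

variable {M} {p : ℝ≥0∞} [hp1 : Fact (1 ≤ p)] {σm σp β : Mark S → ℝ}
  {root child : Measure (ℕ × Mark S)}

lemma Recursion.TreeRegular.zeroStart (h : M.TreeRegular p σm σp β root child) :
    M.zeroStart.TreeRegular p σm σp β root child where
  measurable_g := h.measurable_g
  measurable_σm := h.measurable_σm
  measurable_σp := h.measurable_σp
  measurable_β := h.measurable_β
  lipschitz_g := h.lipschitz_g
  lipschitz_root := h.lipschitz_root
  lipschitz_child := h.lipschitz_child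
  growth_root := h.growth_root
  growth_child := h.growth_child
  root_σm := h.root_σm
  root_β := h.root_β
  child_σβ := h.child_σβ
  child_σp := h.child_σp
  child_g := h.child_g
  initial := by
    change MemLp id p (Measure.dirac (0 : ℝ))
    refine (memLp_congr_ae (f := id) (g := fun _ => (0 : ℝ)) ?_).2 MemLp.zero'
    rw [Filter.EventuallyEq, ae_dirac_eq]
    simp

/-- The Lipschitz constant of `Ψ`. -/
def lipΨ (σm σp : Mark S → ℝ) (y : ℕ × Mark S) : ℝ≥0∞ :=
  ENNReal.ofReal (σp y.2) * ENNReal.ofReal (σm y.2)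

/-- `q`-th moment bounds for one application of `F`. -/
def Recursion.GrowBound (M : Recursion S Z Ξ) (q : ℝ)
    (F : Mark S → Z → Multiset (ℝ × Ξ) → ℝ) (m : Measure (ℕ × Mark S))
    (L b : ℕ × Mark S → ℝ≥0∞) : Prop :=
  ∀ᵐ y ∂m, ∀ u, lqn q M.nodeNoise (fun n => ‖appBy F y n u‖ₑ) ≤
    L y * ∑ j ∈ Finset.range y.1, ‖u j‖ₑ + b y

lemma enorm_g_sub_le (hg : ∀ x r r', |M.g r x - M.g r' x| ≤ σp x * |r - r'|) (x : Mark S)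
    (r r' : ℝ) : ‖M.g r x - M.g r' x‖ₑ ≤ ENNReal.ofReal (σp x) * ‖r - r'‖ₑ := by
  rw [← ofReal_norm, ← ofReal_norm, ← ENNReal.ofReal_mul' (norm_nonneg _)]
  exact ENNReal.ofReal_le_ofReal (hg _ _ _)

lemma enorm_g_le (hg : ∀ x r r', |M.g r x - M.g r' x| ≤ σp x * |r - r'|) (x : Mark S) (r : ℝ) :
    ‖M.g r x‖ₑ ≤ ‖M.g 0 x‖ₑ + ENNReal.ofReal (σp x) * ‖r‖ₑ := by
  have h1 : M.g r x = M.g 0 x + (M.g r x - M.g 0 x) := by ring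
  rw [h1]
  refine (enorm_add_le _ _).trans (add_le_add le_rfl ?_)
  simpa using enorm_g_sub_le hg x r 0

lemma lipΨ_app_le (hp : p ≠ ∞) (h : M.TreeRegular p σm σp β root child) {y : ℕ × Mark S}
    (hy : M.LipschitzAt p (σm y.2) y.1 y.2) (u w : ℕ → ℝ) :
    lqn p.toReal M.nodeNoise (fun n => ‖appBy M.Ψ y n u - appBy M.Ψ y n w‖ₑ) ≤
      lipΨ σm σp y * ∑ j ∈ Finset.range y.1, ‖u j - w j‖ₑ := by
  have hq := one_le_toReal hp
  have hm : ∀ u, Measurable fun n => appBy M.Φ y n u := fun u =>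
    M.measurableApp_Φ.comp measurable_const measurable_id measurable_const
  refine (lqn_mono hq fun n => enorm_g_sub_le h.lipschitz_g y.2 _ _).trans ?_
  refine (lqn_const_mul hq _ (measurable_enorm_sub (hm u) (hm w))).le.trans ?_
  rw [lipΨ, mul_assoc]
  exact mul_le_mul_right (hy.app_le hp u w) _

lemma Recursion.TreeRegular.lipBound_Φ (hp : p ≠ ∞) (h : M.TreeRegular p σm σp β root child) :
    M.LipBound p.toReal M.Φ root (fun y => ENNReal.ofReal (σm y.2)) := by
  filter_upwards [h.lipschitz_root] with y hy u w using hy.app_le hp u w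

lemma Recursion.TreeRegular.lipBound_Ψ (hp : p ≠ ∞) (h : M.TreeRegular p σm σp β root child) :
    M.LipBound p.toReal M.Ψ child (lipΨ σm σp) := by
  filter_upwards [h.lipschitz_child] with y hy u w using lipΨ_app_le hp h hy u w

lemma Recursion.TreeRegular.growBound_Φ (hp : p ≠ ∞) (h : M.TreeRegular p σm σp β root child) :
    M.GrowBound p.toReal M.Φ root (fun y => ENNReal.ofReal (σm y.2))
      (fun y => ENNReal.ofReal (β y.2)) := by
  filter_upwards [h.growth_root] with y hy u using hy.app_le hp u

lemma growthΨ_app_le (hp : p ≠ ∞) (h : M.TreeRegular p σm σp β root child) {y : ℕ × Mark S}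
    (hy : M.GrowthAt p (σm y.2) (β y.2) y.1 y.2) (u : ℕ → ℝ) :
    lqn p.toReal M.nodeNoise (fun n => ‖appBy M.Ψ y n u‖ₑ) ≤
      lipΨ σm σp y * ∑ j ∈ Finset.range y.1, ‖u j‖ₑ +
        (‖M.g 0 y.2‖ₑ + ENNReal.ofReal (σp y.2) * ENNReal.ofReal (β y.2)) := by
  have hq := one_le_toReal hp
  have hm : Measurable fun n => appBy M.Φ y n u :=
    M.measurableApp_Φ.comp measurable_const measurable_id measurable_const
  refine (lqn_mono hq fun n => enorm_g_le h.lipschitz_g y.2 _).trans ?_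
  refine (lqn_add_le hq measurable_const (hm.enorm.const_mul _)).trans ?_
  rw [lqn_const hq, lqn_const_mul hq _ hm.enorm]
  refine (add_le_add le_rfl (mul_le_mul_right (hy.app_le hp u) _)).trans (le_of_eq ?_)
  rw [lipΨ]; ring

lemma Recursion.TreeRegular.growBound_Ψ (hp : p ≠ ∞) (h : M.TreeRegular p σm σp β root child) :
    M.GrowBound p.toReal M.Ψ child (lipΨ σm σp)
      (fun y => ‖M.g 0 y.2‖ₑ + ENNReal.ofReal (σp y.2) * ENNReal.ofReal (β y.2)) := by
  filter_upwards [h.growth_child] with y hy u using growthΨ_app_le hp h hy u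

lemma measurable_lipΨ (h : M.TreeRegular p σm σp β root child) :
    Measurable (lipΨ σm σp : ℕ × Mark S → ℝ≥0∞) := by
  have := h.measurable_σm
  have := h.measurable_σp
  unfold lipΨ; fun_prop

lemma ofReal_le_enorm (x : ℝ) : ENNReal.ofReal x ≤ ‖x‖ₑ := by
  rw [← ofReal_norm]; exact ENNReal.ofReal_le_ofReal (le_abs_self x)

lemma lqn_ne_top_of_memLp (hp : p ≠ ∞) {α : Type*} [MeasurableSpace α] {μ : Measure α} {f : α → ℝ}
    (hf : MemLp f p μ) {g : α → ℝ≥0∞} (hg : ∀ x, g x ≤ ‖f x‖ₑ) : lqn p.toReal μ g ≠ ∞ := by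
  refine ne_top_of_le_ne_top hf.eLpNorm_ne_top ?_
  rw [lqn_eq_eLpNorm hp]
  exact lqn_mono (one_le_toReal hp) hg

variable [IsProbabilityMeasure root] [IsProbabilityMeasure child]

lemma Recursion.TreeRegular.lqn_val_ne_top (hp : p ≠ ∞) (h : M.TreeRegular p σm σp β root child)
    (hc : lqn p.toReal child (fun y => y.1 * lipΨ σm σp y) ≠ ∞) (k : ℕ) :
    lqn p.toReal (M.labelLaw child child) (fun W => ‖M.val k W‖ₑ) ≠ ∞ := by
  have hq := one_le_toReal hp
  have hg := h.measurable_g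
  have hσ := h.measurable_σp
  have hβ := h.measurable_β
  have hg0 : Measurable fun y : ℕ × Mark S => ‖M.g 0 y.2‖ₑ :=
    (hg.comp (f := fun y : ℕ × Mark S => ((0 : ℝ), y.2)) (by fun_prop)).enorm
  have hr : lqn p.toReal M.initial (fun r => ‖r‖ₑ) ≠ ∞ :=
    lqn_ne_top_of_memLp hp h.initial fun _ => le_rfl
  have hgt : lqn p.toReal child (fun y => ‖M.g 0 y.2‖ₑ) ≠ ∞ :=
    lqn_ne_top_of_memLp hp h.child_g fun _ => le_rfl
  have hσt : lqn p.toReal child (fun y => ENNReal.ofReal (σp y.2)) ≠ ∞ :=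
    lqn_ne_top_of_memLp hp h.child_σp fun _ => ofReal_le_enorm _
  have hσβ : lqn p.toReal child
      (fun y => ENNReal.ofReal (σp y.2) * ENNReal.ofReal (β y.2)) ≠ ∞ := by
    refine lqn_ne_top_of_memLp hp h.child_σβ fun y => ?_
    rw [enorm_mul]
    exact mul_le_mul' (ofReal_le_enorm _) (ofReal_le_enorm _)
  induction k with
  | zero =>
    have hm : Measurable fun e : Label S Z Ξ => ‖M.g e.2.2 e.1.2‖ₑ :=
      (hg.comp (f := fun e : Label S Z Ξ => (e.2.2, e.1.2)) (by fun_prop)).enorm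
    have e1 : (M.labelLaw child child).map (fun W => W []) =
        child.prod (M.nodeNoise.prod M.initial) := by
      have := infinitePi_map_eval (fun q : List ℕ =>
        (if q = [] then child else child).prod (M.nodeNoise.prod M.initial)) []
      simpa [Recursion.labelLaw] using this
    have e2 : lqn p.toReal (M.labelLaw child child) (fun W => ‖M.val 0 W‖ₑ) =
        lqn p.toReal (child.prod (M.nodeNoise.prod M.initial))
          (fun e => ‖M.g e.2.2 e.1.2‖ₑ) := by
      rw [← e1, lqn_map (by fun_prop) hm]
      rfl
    rw [e2, lqn_prod hq hm]
    have hm2 : Measurable fun z : (Z × (ℕ → Ξ)) × ℝ => ‖z.2‖ₑ := by fun_prop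
    have hA : lqn p.toReal (M.nodeNoise.prod M.initial) (fun z => ‖z.2‖ₑ) =
        lqn p.toReal M.initial (fun r => ‖r‖ₑ) := by
      rw [← lqn_map (f := fun r : ℝ => ‖r‖ₑ) measurable_snd (by fun_prop), Measure.map_snd_prod,
        measure_univ, one_smul]
    refine ne_top_of_le_ne_top ?_ (lqn_mono hq fun y =>
      (lqn_mono hq fun z : (Z × (ℕ → Ξ)) × ℝ => enorm_g_le h.lipschitz_g y.2 z.2).trans
        (lqn_add_le hq measurable_const (hm2.const_mul _)))
    simp only [lqn_const hq, lqn_const_mul hq _ hm2, hA]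
    refine ne_top_of_le_ne_top ?_ (lqn_add_le hq hg0 (by fun_prop))
    rw [lqn_mul_const hq _ (by fun_prop)]
    exact ENNReal.add_ne_top.2 ⟨hgt, ENNReal.mul_ne_top hσt hr⟩
  | succ k ih =>
    have hv := M.measurable_val hg k
    have hgb := lqn_branching_le hq child (P := infinitePi fun _ : ℕ => M.labelLaw child child)
      (h := fun y n w => ‖appBy M.Ψ y n (fun j => M.val k (w j))‖ₑ)
      (L := lipΨ σm σp)
      (b := fun y => ‖M.g 0 y.2‖ₑ + ENNReal.ofReal (σp y.2) * ENNReal.ofReal (β y.2))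
      (D := fun w j => ‖M.val k (w j)‖ₑ)
      (((M.measurableApp_Ψ hg).comp (by fun_prop) (by fun_prop) (by fun_prop)).enorm)
      (measurable_lipΨ h) (hg0.add (by fun_prop)) (by fun_prop)
      (d := lqn p.toReal (M.labelLaw child child) (fun W => ‖M.val k W‖ₑ)) (fun j => by
        rw [← lqn_map (ν := infinitePi fun _ : ℕ => M.labelLaw child child)
          (φ := fun w => w j) (f := fun W => ‖M.val k W‖ₑ) (by fun_prop) (by fun_prop),
          Measure.infinitePi_map_eval])
      ((h.growBound_Ψ hp).mono fun y hy w => hy _)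
    have e : lqn p.toReal (M.labelLaw child child) (fun W => ‖M.val (k + 1) W‖ₑ) =
        lqn p.toReal ((child.prod M.nodeNoise).prod
          (infinitePi fun _ : ℕ => M.labelLaw child child))
            (fun z => ‖appBy M.Ψ z.1.1 z.1.2 (fun j => M.val k (z.2 j))‖ₑ) := by
      rw [← M.map_root_subtree, lqn_map (Measurable.prodMk (by fun_prop) measurable_subtree)
        (((M.measurableApp_Ψ hg).comp (by fun_prop) (by fun_prop) (by fun_prop)).enorm)]
      rfl
    rw [e]
    refine ne_top_of_le_ne_top ?_ hgb
    refine ENNReal.add_ne_top.2 ⟨ENNReal.mul_ne_top hc ih, ?_⟩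
    exact ne_top_of_le_ne_top (ENNReal.add_ne_top.2 ⟨hgt, hσβ⟩)
      (lqn_add_le hq hg0 (by fun_prop))

lemma Recursion.TreeRegular.lqn_val_sub_ne_top (hp : p ≠ ∞)
    (h : M.TreeRegular p σm σp β root child)
    (hc : lqn p.toReal child (fun y => y.1 * lipΨ σm σp y) ≠ ∞) :
    lqn p.toReal (M.labelLaw child child) (fun W => ‖M.val 1 W - M.val 0 W‖ₑ) ≠ ∞ := by
  have hq := one_le_toReal hp
  refine ne_top_of_le_ne_top (ENNReal.add_ne_top.2 ⟨h.lqn_val_ne_top hp hc 1,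
    h.lqn_val_ne_top hp hc 0⟩) ((lqn_mono hq fun W => enorm_sub_le).trans
      (lqn_add_le hq (M.measurable_val h.measurable_g 1).enorm
        (M.measurable_val h.measurable_g 0).enorm))

/-- The attracting endogenous solution. -/
def Recursion.endogenousLaw (M : Recursion S Z Ξ) (child : Measure (ℕ × Mark S)) : Measure ℝ :=
  (M.zeroStart.labelLaw child child).map M.zeroStart.valLimit

lemma Recursion.TreeRegular.isProbabilityMeasure_endogenousLaw
    (h : M.TreeRegular p σm σp β root child) :
    IsProbabilityMeasure (M.endogenousLaw child) :=
  Measure.isProbabilityMeasure_map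
    (M.zeroStart.measurable_valLimit h.zeroStart.measurable_g).aemeasurable

lemma Recursion.TreeRegular.branchingLaw_endogenousLaw (hp : p ≠ ∞)
    (h : M.TreeRegular p σm σp β root child)
    (hc : lqn p.toReal child (fun y => y.1 * lipΨ σm σp y) < 1) :
    M.branchingLaw M.Ψ child (M.endogenousLaw child) = M.endogenousLaw child :=
  M.zeroStart.branchingLaw_valLimit (one_le_toReal hp) h.zeroStart.measurable_g
    (measurable_lipΨ h) (h.zeroStart.lipBound_Ψ hp) hc
    (h.zeroStart.lqn_val_sub_ne_top hp hc.ne_top)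

lemma Recursion.TreeRegular.lqn_endogenousLaw_ne_top (hp : p ≠ ∞)
    (h : M.TreeRegular p σm σp β root child)
    (hc : lqn p.toReal child (fun y => y.1 * lipΨ σm σp y) < 1) :
    lqn p.toReal (M.endogenousLaw child) (fun x => ‖x‖ₑ) ≠ ∞ := by
  have hq := one_le_toReal hp
  have h' := h.zeroStart
  have hv := M.zeroStart.measurable_valLimit h'.measurable_g
  have hd := h'.lqn_val_sub_ne_top hp hc.ne_top
  have h1 := M.zeroStart.lqn_valLimit_sub_le hq h'.measurable_g (measurable_lipΨ h)
    (h'.lipBound_Ψ hp) hc hd 0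
  rw [Recursion.endogenousLaw, lqn_map hv measurable_enorm]
  refine ne_top_of_le_ne_top ?_ ((lqn_mono hq fun W => ?_).trans (lqn_add_le hq
    (measurable_enorm_sub hv (M.zeroStart.measurable_val h'.measurable_g 0))
      (M.zeroStart.measurable_val h'.measurable_g 0).enorm))
  · refine ENNReal.add_ne_top.2 ⟨ne_top_of_le_ne_top ?_ h1, h'.lqn_val_ne_top hp hc.ne_top 0⟩
    rw [pow_zero, one_mul]
    exact ENNReal.mul_ne_top hd (ENNReal.inv_ne_top.2 (tsub_pos_of_lt hc).ne')
  · refine le_trans (le_of_eq ?_) (enorm_add_le _ _)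
    congr 1; ring

lemma measurable_limUnder_real {α : Type*} (m : MeasurableSpace α) {f : ℕ → α → ℝ}
    (hf : ∀ k, Measurable (f k)) : Measurable fun a => limUnder atTop fun k => f k a :=
  (StronglyMeasurable.limUnder fun k => (hf k).stronglyMeasurable).measurable

/-- The limit on the tree is an attracting endogenous solution. -/
theorem Recursion.TreeRegular.isAttractingEndogenous (hp : p ≠ ∞)
    (h : M.TreeRegular p σm σp β root child)
    (hc : lqn p.toReal child (fun y => y.1 * lipΨ σm σp y) < 1) :
    M.IsAttractingEndogenous p child (M.endogenousLaw child) := by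
  have hq := one_le_toReal hp
  have h' := h.zeroStart
  have hd := h'.lqn_val_sub_ne_top hp hc.ne_top
  have hl : Measurable fun τ : NoisyTree S Z Ξ => label (τ, 0) :=
    (M.measurePreserving_label child child).measurable.comp (by fun_prop)
  have hvl := M.zeroStart.measurable_valLimit h'.measurable_g
  have hvk := M.zeroStart.measurable_val h'.measurable_g
  have hV : ∀ k, (fun τ : NoisyTree S Z Ξ => M.treeV τ 0 k []) =
      fun τ => M.zeroStart.val k (label (τ, 0)) := by
    intro k
    funext τ
    have := M.zeroStart.treeV_eq (τ, 0) k []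
    simp only [List.append_nil] at this
    exact (M.treeV_zeroStart τ 0 k []).symm.trans this
  have hlaw : (M.noisyTreeLaw child child).map (fun τ => M.zeroStart.valLimit (label (τ, 0))) =
      M.endogenousLaw child := by
    rw [Recursion.endogenousLaw, ← M.map_label_zero, Measure.map_map hvl hl]
    rfl
  have hconv : Tendsto (fun k => lqn p.toReal (M.noisyTreeLaw child child)
      (fun τ => ‖M.treeV τ 0 k [] - M.zeroStart.valLimit (label (τ, 0))‖ₑ)) atTop (𝓝 0) := by
    refine tendsto_of_tendsto_of_tendsto_of_le_of_le tendsto_const_nhds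
      (tendsto_pow_mul_zero hc (ENNReal.mul_ne_top hd
        (ENNReal.inv_ne_top.2 (tsub_pos_of_lt hc).ne'))) (fun _ => bot_le) fun k => ?_
    refine le_trans (le_of_eq ?_) (M.zeroStart.lqn_valLimit_sub_le hq h'.measurable_g
      (measurable_lipΨ h) (h'.lipBound_Ψ hp) hc hd k)
    rw [← M.map_label_zero, lqn_map hl (measurable_enorm_sub hvl (hvk k))]
    refine congrArg _ (funext fun τ => ?_)
    rw [enorm_sub_rev, congrFun (hV k) τ]
  have hmeas : ∀ k, Measurable[treeSigma S Z Ξ]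
      fun τ : NoisyTree S Z Ξ => M.treeV τ 0 k [] := by
    intro k
    have : Nonempty ((ℕ × Mark S) × Z × (ℕ → Ξ)) := by
      have := nonempty_of_isProbabilityMeasure child
      have := nonempty_of_isProbabilityMeasure M.vertexNoise
      have := nonempty_of_isProbabilityMeasure M.edgeNoise
      infer_instance
    exact @Recursion.measurable_treeV_root S Z Ξ _ _ _ M h.measurable_g _ (treeSigma S Z Ξ) id this
      (fun q B hB => MeasurableSpace.measurableSet_generateFrom ⟨q, B, hB, rfl⟩) k
  refine ⟨h.isProbabilityMeasure_endogenousLaw, ?_, h.branchingLaw_endogenousLaw hp hc,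
    fun τ => M.zeroStart.valLimit (label (τ, 0)), ?_, hlaw, ?_⟩
  · refine tendsto_of_tendsto_of_tendsto_of_le_of_le tendsto_const_nhds hconv
      (fun _ => bot_le) fun k => ?_
    rw [← hlaw]
    refine (wasserstein_map_le ?_ (hvl.comp hl)).trans ?_
    · rw [hV]; exact (hvk k).comp hl
    · simp only [edist_eq_enorm_sub]; exact le_rfl
  · have e : (fun τ : NoisyTree S Z Ξ => M.zeroStart.valLimit (label (τ, 0))) =
        fun τ => limUnder atTop fun k => M.treeV τ 0 k [] := by
      funext τ
      simp only [Recursion.valLimit]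
      congr 1
      exact funext fun k => (congrFun (hV k) τ).symm
    rw [e]
    exact measurable_limUnder_real (treeSigma S Z Ξ) hmeas
  · simp only [lqn_eq_eLpNorm hp]
    exact hconv

/-- The limit of the laws of `ℛ_∅^(k)`. -/
def Recursion.rootLaw (M : Recursion S Z Ξ) (root child : Measure (ℕ × Mark S)) : Measure ℝ :=
  M.branchingLaw M.Φ root (M.endogenousLaw child)

lemma Recursion.TreeRegular.lqn_root_σm_ne_top (hp : p ≠ ∞)
    (h : M.TreeRegular p σm σp β root child) :
    lqn p.toReal root (fun y => y.1 * ENNReal.ofReal (σm y.2)) ≠ ∞ := by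
  refine lqn_ne_top_of_memLp hp h.root_σm fun y => ?_
  rw [enorm_mul, ← ENNReal.ofReal_natCast]
  exact mul_le_mul' (ofReal_le_enorm _) (ofReal_le_enorm _)

/-- Convergence of the laws of `ℛ_∅^(k)`. -/
theorem Recursion.TreeRegular.tendsto_treeRLaw (hp : p ≠ ∞)
    (h : M.TreeRegular p σm σp β root child)
    (hc : lqn p.toReal child (fun y => y.1 * lipΨ σm σp y) < 1) :
    Tendsto (fun k => wasserstein p (M.treeRLaw root child k) (M.rootLaw root child))
      atTop (𝓝 0) := by
  have hq := one_le_toReal hp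
  have hη := h.isProbabilityMeasure_endogenousLaw
  have hσ := h.measurable_σm
  rw [← tendsto_add_atTop_iff_nat 1]
  have hB : lqn p.toReal root (fun y => y.1 * ENNReal.ofReal (σm y.2)) *
      (lqn p.toReal (M.labelLaw child child) (fun W => ‖M.val 0 W‖ₑ) +
        lqn p.toReal (M.endogenousLaw child) (fun x => ‖x‖ₑ)) ≠ ∞ :=
    ENNReal.mul_ne_top (h.lqn_root_σm_ne_top hp) (ENNReal.add_ne_top.2
      ⟨h.lqn_val_ne_top hp hc.ne_top 0, h.lqn_endogenousLaw_ne_top hp hc⟩)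
  refine tendsto_of_tendsto_of_tendsto_of_le_of_le tendsto_const_nhds
    (tendsto_pow_mul_zero hc hB) (fun _ => bot_le) fun k => ?_
  obtain ⟨π, hπ, h1, h2, h3⟩ := M.exists_coupling_val hq h.measurable_g (measurable_lipΨ h)
    (h.lipBound_Ψ hp) (h.branchingLaw_endogenousLaw hp hc) k
  obtain ⟨π', hπ', h1', h2', h3'⟩ := (h.lipBound_Φ hp).exists_coupling hq M.measurableApp_Φ
    (by fun_prop) π
  refine (wasserstein_le π' (h1'.trans ?_) (h2'.trans ?_)).trans ?_
  · rw [h1, M.treeRLaw_succ h.measurable_g]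
  · rw [h2, Recursion.rootLaw]
  · simp only [edist_eq_enorm_sub]
    refine h3'.trans ((mul_le_mul_right h3 _).trans (le_of_eq ?_))
    ring

lemma Recursion.TreeRegular.isProbabilityMeasure_rootLaw
    (h : M.TreeRegular p σm σp β root child) : IsProbabilityMeasure (M.rootLaw root child) := by
  have := h.isProbabilityMeasure_endogenousLaw
  exact Recursion.isProbabilityMeasure_branchingLaw M.measurableApp_Φ root _

lemma Recursion.TreeRegular.lqn_treeRLaw_ne_top (hp : p ≠ ∞)
    (h : M.TreeRegular p σm σp β root child)
    (hc : lqn p.toReal child (fun y => y.1 * lipΨ σm σp y) ≠ ∞) (k : ℕ) :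
    lqn p.toReal (M.treeRLaw root child (k + 1)) (fun x => ‖x‖ₑ) ≠ ∞ := by
  have hq := one_le_toReal hp
  have hg := h.measurable_g
  have hβ := h.measurable_β
  have hσ := h.measurable_σm
  have hv := M.measurable_val hg k
  have hm : Measurable fun z : ((ℕ × Mark S) × (Z × (ℕ → Ξ))) × (ℕ → List ℕ → Label S Z Ξ) =>
      appBy M.Φ z.1.1 z.1.2 (fun j => M.val k (z.2 j)) :=
    M.measurableApp_Φ.comp (by fun_prop) (by fun_prop) (by fun_prop)
  rw [M.treeRLaw_succ hg, M.branchingLaw_map M.measurableApp_Φ _ _ hv,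
    lqn_map hm measurable_enorm]
  refine ne_top_of_le_ne_top ?_ (lqn_branching_le hq root
    (P := infinitePi fun _ : ℕ => M.labelLaw child child)
    (h := fun y n w => ‖appBy M.Φ y n (fun j => M.val k (w j))‖ₑ)
    (L := fun y => ENNReal.ofReal (σm y.2)) (b := fun y => ENNReal.ofReal (β y.2))
    (D := fun w j => ‖M.val k (w j)‖ₑ) hm.enorm (by fun_prop) (by fun_prop) (by fun_prop)
    (d := lqn p.toReal (M.labelLaw child child) (fun W => ‖M.val k W‖ₑ)) (fun j => by
      rw [← lqn_map (ν := infinitePi fun _ : ℕ => M.labelLaw child child)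
        (φ := fun w => w j) (f := fun W => ‖M.val k W‖ₑ) (by fun_prop) (by fun_prop),
        Measure.infinitePi_map_eval])
    ((h.growBound_Φ hp).mono fun y hy w => hy _))
  exact ENNReal.add_ne_top.2 ⟨ENNReal.mul_ne_top (h.lqn_root_σm_ne_top hp)
    (h.lqn_val_ne_top hp hc k), lqn_ne_top_of_memLp hp h.root_β fun _ => ofReal_le_enorm _⟩

end NoisyTrees

/-! ### Uniform integrability along the graph sequence -/

section UniformIntegrability

variable {S : Type*} [MeasurableSpace S] (G : GraphSeq S)

lemma GraphSeq.measurable_attr (n : ℕ) : Measurable (G.attr n) :=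
  measurable_snd.comp (G.measurable_graph n)

lemma GraphSeq.measurable_at_I {X : Type*} [MeasurableSpace X] {n : ℕ}
    {w : WDigraph (Vert n) S → Vert n → X} (hw : ∀ i, Measurable fun H => w H i) :
    Measurable fun ω => w (G.graph n ω) (G.I n ω) := by
  have h : Measurable fun z : WDigraph (Vert n) S × Vert n => w z.1 z.2 :=
    measurable_from_prod_countable_left hw
  exact h.comp ((G.measurable_graph n).prodMk (G.measurable_I n))

lemma GraphSeq.lintegral_at_I {n : ℕ} {w : WDigraph (Vert n) S → Vert n → ℝ≥0∞}
    (hw : ∀ i, Measurable fun H => w H i) :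
    ∫⁻ ω, w (G.graph n ω) (G.I n ω) ∂G.P n =
      ((n : ℝ≥0∞) + 1)⁻¹ * ∫⁻ ω, ∑ i, w (G.graph n ω) i ∂G.P n := by
  have h : Measurable fun z : Vert n × WDigraph (Vert n) S => w z.2 z.1 :=
    measurable_from_prod_countable_right hw
  have hI := G.measurable_I n
  have hg := G.measurable_graph n
  have e := (indepFun_iff_map_prod_eq_prod_map_map hI.aemeasurable hg.aemeasurable).1 (G.indep_I n)
  have : IsProbabilityMeasure ((G.P n).map (G.graph n)) :=
    Measure.isProbabilityMeasure_map hg.aemeasurable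
  calc ∫⁻ ω, w (G.graph n ω) (G.I n ω) ∂G.P n
      = ∫⁻ z, w z.2 z.1 ∂(G.P n).map (fun ω => (G.I n ω, G.graph n ω)) :=
        (lintegral_map h (hI.prodMk hg)).symm
    _ = ∑ i, (∫⁻ ω, w (G.graph n ω) i ∂G.P n) * ((n : ℝ≥0∞) + 1)⁻¹ := by
        rw [e, lintegral_prod _ h.aemeasurable, lintegral_fintype]
        refine Finset.sum_congr rfl fun i _ => ?_
        rw [lintegral_map (hw i) hg, Measure.map_apply hI (measurableSet_singleton i),
          G.uniform_I]
    _ = _ := by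
        rw [lintegral_finsetSum _ fun i _ =>
          (show Measurable fun ω => w (G.graph n ω) i from (hw i).comp hg),
          ← Finset.sum_mul, mul_comm]

/-- The restriction of the law to attributes in `J`. -/
def GraphSeq.onAttr (n : ℕ) (J : Set (Vert n → S)) : Measure (G.Ω n) :=
  (G.P n).restrict (G.attr n ⁻¹' J)

lemma GraphSeq.lintegral_onAttr_at_I {n : ℕ} {J : Set (Vert n → S)} (hJ : MeasurableSet J)
    {w : WDigraph (Vert n) S → Vert n → ℝ≥0∞} (hw : ∀ i, Measurable fun H => w H i) :
    ∫⁻ ω, w (G.graph n ω) (G.I n ω) ∂G.onAttr n J =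
      ((n : ℝ≥0∞) + 1)⁻¹ * ∫⁻ ω, ∑ i, w (G.graph n ω) i ∂G.onAttr n J := by
  have hA : MeasurableSet (G.attr n ⁻¹' J) := G.measurable_attr n hJ
  have hJ' : MeasurableSet {H : WDigraph (Vert n) S | H.2 ∈ J} := measurable_snd hJ
  rw [GraphSeq.onAttr, ← lintegral_indicator hA, ← lintegral_indicator hA]
  have h := G.lintegral_at_I (n := n)
    (w := fun H i => Set.indicator {H : WDigraph (Vert n) S | H.2 ∈ J} (fun H => w H i) H)
    fun i => (hw i).indicator hJ'
  refine (Eq.trans ?_ h).trans ?_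
  · refine lintegral_congr fun ω => ?_
    by_cases hω : G.attr n ω ∈ J
    · rw [Set.indicator_of_mem (by exact hω), Set.indicator_of_mem (by exact hω)]
    · rw [Set.indicator_of_notMem (by exact hω), Set.indicator_of_notMem (by exact hω)]
  · congr 1
    refine lintegral_congr fun ω => ?_
    by_cases hω : G.attr n ω ∈ J
    · rw [Set.indicator_of_mem (by exact hω)]
      exact Finset.sum_congr rfl fun i _ => Set.indicator_of_mem (by exact hω) _
    · rw [Set.indicator_of_notMem (by exact hω)]
      exact Finset.sum_eq_zero fun i _ => Set.indicator_of_notMem (by exact hω) _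

/-- Uniform integrability, in probability, of the conditional `q`-th moments of `w_I` given the
attributes. -/
def GraphSeq.UnifInt (q : ℝ) (w : ∀ n, WDigraph (Vert n) S → Vert n → ℝ≥0∞) : Prop :=
  ∀ δ : ℝ≥0∞, 0 < δ → ∃ m : ℕ, ∀ᶠ n in atTop, ∃ J : Set (Vert n → S), MeasurableSet J ∧
    G.P n {ω | G.attr n ω ∉ J} ≤ δ ∧
    lqn q (G.onAttr n J) (fun ω => w n (G.graph n ω) (G.I n ω) - m) ≤ δ

variable {G} {q : ℝ} {w w' : ∀ n, WDigraph (Vert n) S → Vert n → ℝ≥0∞}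

lemma GraphSeq.onAttr_mono {n : ℕ} {J J' : Set (Vert n → S)} (h : J ⊆ J')
    (f : G.Ω n → ℝ≥0∞) (hq : 1 ≤ q) : lqn q (G.onAttr n J) f ≤ lqn q (G.onAttr n J') f := by
  rw [lqn_le_iff hq, lqn_rpow hq]
  exact lintegral_mono' (Measure.restrict_mono (Set.preimage_mono h) le_rfl) le_rfl

lemma GraphSeq.measure_notMem_inter {n : ℕ} (J J' : Set (Vert n → S)) :
    G.P n {ω | G.attr n ω ∉ J ∩ J'} ≤
      G.P n {ω | G.attr n ω ∉ J} + G.P n {ω | G.attr n ω ∉ J'} := by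
  refine (measure_mono fun ω hω => ?_).trans (measure_union_le _ _)
  by_contra h
  simp only [Set.mem_union, Set.mem_ofPred_eq, not_or, not_not] at h
  exact hω h

lemma GraphSeq.UnifInt.mono (hq : 1 ≤ q) (hw : G.UnifInt q w)
    (h : ∀ n, ∀ᵐ ω ∂G.P n, ∀ i, w' n (G.graph n ω) i ≤ w n (G.graph n ω) i) : G.UnifInt q w' := by
  intro δ hδ
  obtain ⟨m, hm⟩ := hw δ hδ
  refine ⟨m, hm.mono fun n ⟨J, hJ, h1, h2⟩ => ⟨J, hJ, h1, (lqn_mono_ae hq ?_).trans h2⟩⟩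
  filter_upwards [ae_restrict_of_ae (h n)] with ω hω
  exact tsub_le_tsub_right (hω _) _

lemma GraphSeq.UnifInt.add (hq : 1 ≤ q) (hw : G.UnifInt q w) (hw' : G.UnifInt q w')
    (hm : ∀ n i, Measurable fun H => w n H i) (hm' : ∀ n i, Measurable fun H => w' n H i) :
    G.UnifInt q fun n H i => w n H i + w' n H i := by
  intro δ hδ
  obtain ⟨m, h⟩ := hw (δ / 2) (ENNReal.half_pos hδ.ne')
  obtain ⟨m', h'⟩ := hw' (δ / 2) (ENNReal.half_pos hδ.ne')
  refine ⟨m + m', ?_⟩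
  filter_upwards [h, h'] with n ⟨J, hJ, h1, h2⟩ ⟨J', hJ', h1', h2'⟩
  refine ⟨J ∩ J', hJ.inter hJ', (G.measure_notMem_inter J J').trans
    ((add_le_add h1 h1').trans (ENNReal.add_halves δ).le), ?_⟩
  calc _ ≤ lqn q (G.onAttr n (J ∩ J')) (fun ω => (w n (G.graph n ω) (G.I n ω) - m) +
        (w' n (G.graph n ω) (G.I n ω) - m')) := lqn_mono hq fun ω => by
          push_cast; exact add_tsub_add_le_tsub_add_tsub
    _ ≤ _ := lqn_add_le hq ((G.measurable_at_I (hm n)).sub_const _)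
        ((G.measurable_at_I (hm' n)).sub_const _)
    _ ≤ δ / 2 + δ / 2 := add_le_add ((onAttr_mono Set.inter_subset_left _ hq).trans h2)
        ((onAttr_mono Set.inter_subset_right _ hq).trans h2')
    _ = δ := ENNReal.add_halves δ

lemma GraphSeq.UnifInt.const (hq : 1 ≤ q) (m : ℕ) : G.UnifInt q fun _ _ _ => m := by
  intro δ hδ
  refine ⟨m, Eventually.of_forall fun n => ⟨Set.univ, MeasurableSet.univ, by simp, ?_⟩⟩
  simp only [tsub_self]
  rw [lqn_zero hq]
  exact zero_le

/-- The action of the matrix `a(X_i) b(X_j) 1(j → i)` on a nonnegative vector. -/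
def edgeSum {V : Type*} [Fintype V] (a b : Mark S → ℝ) (H : WDigraph V S) (w : V → ℝ≥0∞) (i : V) :
    ℝ≥0∞ :=
  ENNReal.ofReal (a (mark H i)) * ∑ j, (H.1 j i : ℝ≥0∞) * (ENNReal.ofReal (b (mark H j)) * w j)

lemma measurable_edgeSum {V : Type*} [Fintype V] {a b : Mark S → ℝ} (ha : Measurable a)
    (hb : Measurable b) {w : WDigraph V S → V → ℝ≥0∞} (hw : ∀ i, Measurable fun H => w H i) (i : V) :
    Measurable fun H : WDigraph V S => edgeSum a b H (w H) i := by
  have hm : ∀ i, Measurable fun H : WDigraph V S => mark H i := measurable_mark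
  have hc : ∀ j, Measurable fun H : WDigraph V S => (H.1 j i : ℝ≥0∞) := fun j =>
    (measurable_from_top (f := fun k : ℕ => (k : ℝ≥0∞))).comp (by fun_prop)
  unfold edgeSum
  exact ((ha.comp (hm i)).ennreal_ofReal).mul (Finset.measurable_fun_sum _ fun j _ =>
    (hc j).mul (((hb.comp (hm j)).ennreal_ofReal).mul (hw j)))

variable {p : ℝ≥0∞} [hp1 : Fact (1 ≤ p)]

lemma lqn_edgeSum_le (hp : p ≠ ∞) {a b : Mark S → ℝ} (ha : Measurable a) (hb : Measurable b)
    (hb0 : ∀ x, 0 ≤ b x) {K : ℝ} {n : ℕ}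
    (hK : ∀ᵐ ω ∂G.P n, opNorm p (Matrix.of fun i j : Vert n => a (mark (G.graph n ω) i) *
      b (mark (G.graph n ω) j) * ((G.graph n ω).1 j i : ℝ)) ≤ K)
    {w : WDigraph (Vert n) S → Vert n → ℝ≥0∞} (hw : ∀ i, Measurable fun H => w H i)
    (hf : ∀ᵐ ω ∂G.P n, ∀ i, w (G.graph n ω) i ≠ ∞) {J : Set (Vert n → S)} (hJ : MeasurableSet J) :
    lqn p.toReal (G.onAttr n J) (fun ω => edgeSum a b (G.graph n ω) (w (G.graph n ω)) (G.I n ω)) ≤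
      ENNReal.ofReal K * lqn p.toReal (G.onAttr n J) (fun ω => w (G.graph n ω) (G.I n ω)) := by
  have hq := one_le_toReal hp
  have h0 : 0 ≤ p.toReal := zero_le_one.trans hq
  rw [lqn_le_iff hq, ENNReal.mul_rpow_of_nonneg _ _ h0, lqn_rpow hq,
    G.lintegral_onAttr_at_I hJ
      (w := fun H i => edgeSum a b H (w H) i ^ p.toReal)
      (fun i => (measurable_edgeSum ha hb hw i).pow_const _),
    G.lintegral_onAttr_at_I hJ (w := fun H i => w H i ^ p.toReal)
      (fun i => (hw i).pow_const _), mul_left_comm,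
    ← lintegral_const_mul _ (Finset.measurable_fun_sum _ fun i _ =>
      (show Measurable fun ω => w (G.graph n ω) i from
        (hw i).comp (G.measurable_graph n)).pow_const _)]
  refine mul_le_mul_right (lintegral_mono_ae ?_) _
  filter_upwards [ae_restrict_of_ae hK, ae_restrict_of_ae hf] with ω h1 h2
  have e : ∀ j, w (G.graph n ω) j = ‖(w (G.graph n ω) j).toReal‖ₑ := fun j => by
    rw [Real.enorm_of_nonneg ENNReal.toReal_nonneg, ENNReal.ofReal_toReal (h2 j)]
  have := sum_rpow_le_opNorm hp (G.graph n ω) (fun i => a (mark (G.graph n ω) i))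
    (fun i => b (mark (G.graph n ω) i)) (fun j => hb0 _) fun j => (w (G.graph n ω) j).toReal
  simp only [← e] at this
  exact this.trans (mul_le_mul_left (ENNReal.rpow_le_rpow (ENNReal.ofReal_le_ofReal h1) h0) _)

/-- Tightness of `b(X_I)`. -/
def GraphSeq.Tight (G : GraphSeq S) (b : Mark S → ℝ) : Prop :=
  ∀ δ : ℝ≥0∞, 0 < δ → ∃ L : ℕ, ∀ᶠ n in atTop, G.P n {ω | (L : ℝ) < b (G.markI n ω)} ≤ δ

lemma lqn_indicator_one_le (hq : 1 ≤ q) {α : Type*} [MeasurableSpace α] {μ : Measure α}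
    {A : Set α} (hA : MeasurableSet A) :
    lqn q μ (A.indicator 1) = μ A ^ (1 / q) := by
  have h0 : 0 < q := by positivity
  have : ∀ x, (A.indicator (1 : α → ℝ≥0∞) x) ^ q = A.indicator 1 x := fun x => by
    by_cases h : x ∈ A <;> simp [h, h0]
  simp only [lqn, this, lintegral_indicator_one hA]

lemma exists_pos_mul_le {c δ : ℝ≥0∞} (hc : c ≠ ∞) (hδ : 0 < δ) :
    ∃ η : ℝ≥0∞, 0 < η ∧ η ≤ δ ∧ c * η ≤ δ := by
  obtain ⟨η, h0, h⟩ := ENNReal.exists_nnreal_pos_mul_lt hc hδ.ne'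
  refine ⟨min η δ, lt_min (by exact_mod_cast h0) hδ, min_le_right _ _, ?_⟩
  rw [mul_comm]
  exact (mul_le_mul_left (min_le_left _ _) _).trans h.le

lemma edgeSum_truncate_le {V : Type*} [Fintype V] (a b : Mark S → ℝ) (H : WDigraph V S)
    (w : V → ℝ≥0∞) (m L : ℕ) (i : V) :
    edgeSum a b H w i ≤ edgeSum a b H (fun j => w j - m) i +
      (m * L : ℕ) * (ENNReal.ofReal (a (mark H i)) * (inDeg H i : ℝ≥0∞)) +
      m * edgeSum a b H (fun j => {x | (L : ℝ) < b x}.indicator 1 (mark H j)) i := by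
  have h : ∀ j, ENNReal.ofReal (b (mark H j)) * w j ≤ ENNReal.ofReal (b (mark H j)) * (w j - m) +
      (m * L : ℕ) + m * (ENNReal.ofReal (b (mark H j)) *
        {x | (L : ℝ) < b x}.indicator 1 (mark H j)) := by
    intro j
    have h1 : ENNReal.ofReal (b (mark H j)) ≤ L + ENNReal.ofReal (b (mark H j)) *
        {x | (L : ℝ) < b x}.indicator 1 (mark H j) := by
      by_cases hL : (L : ℝ) < b (mark H j)
      · rw [Set.indicator_of_mem (by exact hL)]
        simp
      · refine le_add_right ?_
        rw [← ENNReal.ofReal_natCast]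
        exact ENNReal.ofReal_le_ofReal (not_lt.1 hL)
    calc ENNReal.ofReal (b (mark H j)) * w j
        ≤ ENNReal.ofReal (b (mark H j)) * ((w j - m) + m) := mul_le_mul_right le_tsub_add _
      _ = ENNReal.ofReal (b (mark H j)) * (w j - m) + m * ENNReal.ofReal (b (mark H j)) := by ring
      _ ≤ _ := by
        rw [add_assoc]
        refine add_le_add le_rfl ((mul_le_mul_right h1 _).trans (le_of_eq ?_))
        push_cast; ring
  unfold edgeSum
  refine (mul_le_mul_right (Finset.sum_le_sum fun j _ => mul_le_mul_right (h j) _) _).trans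
    (le_of_eq ?_)
  simp only [mul_add, Finset.sum_add_distrib, inDeg]
  congr 1
  · congr 1
    rw [← Finset.sum_mul]
    push_cast
    ring
  · rw [mul_left_comm, Finset.mul_sum (a := (m : ℝ≥0∞))]
    congr 1
    exact Finset.sum_congr rfl fun j _ => by ring

theorem GraphSeq.UnifInt.edgeSum_vec (hp : p ≠ ∞) {a b : Mark S → ℝ} (ha : Measurable a)
    (hb : Measurable b) (hb0 : ∀ x, 0 ≤ b x) {K : ℝ}
    (hK : ∀ n, ∀ᵐ ω ∂G.P n, opNorm p (Matrix.of fun i j : Vert n => a (mark (G.graph n ω) i) *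
      b (mark (G.graph n ω) j) * ((G.graph n ω).1 j i : ℝ)) ≤ K)
    (hbt : G.Tight b)
    (had : G.UnifInt p.toReal fun _ H i => ENNReal.ofReal (a (mark H i)) * (inDeg H i : ℝ≥0∞))
    (hw : ∀ n i, Measurable fun H => w n H i) (hf : ∀ n H i, w n H i ≠ ∞)
    (hwu : G.UnifInt p.toReal w) :
    G.UnifInt p.toReal fun n H i => edgeSum a b H (w n H) i := by
  have hq := one_le_toReal hp
  have h0 : 0 < p.toReal := zero_lt_one.trans_le hq
  intro δ hδ
  have hd : 0 < δ / 3 := ENNReal.div_pos hδ.ne' (by simp)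
  have hdδ : δ / 3 ≤ δ := ENNReal.div_le_of_le_mul (le_mul_of_one_le_right' (by norm_num))
  have hJδ : δ / 3 + δ / 3 ≤ δ := le_trans le_self_add (ENNReal.add_thirds δ).le
  obtain ⟨η, hη, hηd, hηK⟩ := exists_pos_mul_le (c := ENNReal.ofReal K) ENNReal.ofReal_ne_top hd
  obtain ⟨m, hm⟩ := hwu η hη
  obtain ⟨η', hη', -, hηK'⟩ := exists_pos_mul_le (c := m * ENNReal.ofReal K)
    (ENNReal.mul_ne_top (ENNReal.natCast_ne_top m) ENNReal.ofReal_ne_top) hd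
  obtain ⟨L, hL⟩ := hbt (min η' 1 ^ p.toReal) (ENNReal.rpow_pos (lt_min hη' one_pos)
    (ne_top_of_le_ne_top ENNReal.one_ne_top (min_le_right _ _)))
  obtain ⟨η₂, hη₂, hηd₂, hηK₂⟩ := exists_pos_mul_le (c := (m * L : ℕ))
    (ENNReal.natCast_ne_top _) hd
  obtain ⟨N, hN⟩ := had η₂ hη₂
  refine ⟨m * L * N, ?_⟩
  filter_upwards [hm, hL, hN] with n ⟨J, hJ, h1, h2⟩ hLn ⟨J', hJ', h1', h2'⟩
  refine ⟨J ∩ J', hJ.inter hJ', (G.measure_notMem_inter J J').trans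
    ((add_le_add (h1.trans hηd) (h1'.trans hηd₂)).trans hJδ), ?_⟩
  have hmark : ∀ i : Vert n, Measurable fun H : WDigraph (Vert n) S => mark H i := measurable_mark
  have hset : MeasurableSet {x | (L : ℝ) < b x} := measurableSet_lt measurable_const hb
  have hind : ∀ i : Vert n, Measurable fun H : WDigraph (Vert n) S =>
      ({x | (L : ℝ) < b x}.indicator 1 (mark H i) : ℝ≥0∞) := fun i =>
    (measurable_one.indicator hset).comp (hmark i)
  have hdeg : ∀ i : Vert n, Measurable fun H : WDigraph (Vert n) S =>
      ENNReal.ofReal (a (mark H i)) * (inDeg H i : ℝ≥0∞) := fun i =>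
    ((ha.comp (hmark i)).ennreal_ofReal).mul
      ((measurable_from_top (f := fun k : ℕ => (k : ℝ≥0∞))).comp (measurable_fst.comp (hmark i)))
  have m1 := G.measurable_at_I (measurable_edgeSum ha hb fun i => (hw n i).sub_const (m : ℝ≥0∞))
  have m2 := (G.measurable_at_I hdeg).sub_const (N : ℝ≥0∞)
  have m3 := G.measurable_at_I (measurable_edgeSum ha hb hind)
  have hJJ := hJ.inter hJ'
  calc _ ≤ lqn p.toReal (G.onAttr n (J ∩ J')) (fun ω =>
        (edgeSum a b (G.graph n ω) (fun j => w n (G.graph n ω) j - m) (G.I n ω) +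
        (m * L : ℕ) * (ENNReal.ofReal (a (mark (G.graph n ω) (G.I n ω))) *
          (inDeg (G.graph n ω) (G.I n ω) : ℝ≥0∞) - N)) +
        m * edgeSum a b (G.graph n ω)
          (fun j => {x | (L : ℝ) < b x}.indicator 1 (mark (G.graph n ω) j)) (G.I n ω)) := by
        refine lqn_mono hq fun ω => ?_
        refine (tsub_le_tsub_right (edgeSum_truncate_le a b _ _ m L _) _).trans ?_
        rw [tsub_le_iff_right]
        have e : ((m * L * N : ℕ) : ℝ≥0∞) = (m * L : ℕ) * (N : ℝ≥0∞) := by push_cast; ring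
        rw [e]
        calc _ ≤ edgeSum a b (G.graph n ω) (fun j => w n (G.graph n ω) j - m) (G.I n ω) +
              (m * L : ℕ) * ((ENNReal.ofReal (a (mark (G.graph n ω) (G.I n ω))) *
                (inDeg (G.graph n ω) (G.I n ω) : ℝ≥0∞) - N) + N) +
              m * edgeSum a b (G.graph n ω)
                (fun j => {x | (L : ℝ) < b x}.indicator 1 (mark (G.graph n ω) j)) (G.I n ω) := by
              gcongr
              exact le_tsub_add
          _ = _ := by ring
    _ ≤ δ / 3 + δ / 3 + δ / 3 := by
        refine (lqn_add_le hq (m1.add (m2.const_mul _)) (m3.const_mul _)).trans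
          (add_le_add ((lqn_add_le hq m1 (m2.const_mul _)).trans (add_le_add ?_ ?_)) ?_)
        · refine (lqn_edgeSum_le hp ha hb hb0 (hK n) (fun i => (hw n i).sub_const (m : ℝ≥0∞))
            (Eventually.of_forall fun ω i => ENNReal.sub_ne_top (hf n _ i)) hJJ).trans ?_
          exact (mul_le_mul_right ((onAttr_mono Set.inter_subset_left _ hq).trans h2) _).trans hηK
        · rw [lqn_const_mul hq _ m2]
          exact (mul_le_mul_right ((onAttr_mono Set.inter_subset_right _ hq).trans h2') _).trans
            hηK₂
        · rw [lqn_const_mul hq _ m3]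
          refine (mul_le_mul_right (lqn_edgeSum_le hp ha hb hb0 (hK n) hind
            (Eventually.of_forall fun ω i => ?_) hJJ) _).trans ?_
          · by_cases h : mark (G.graph n ω) i ∈ {x | (L : ℝ) < b x} <;> simp [h]
          rw [← mul_assoc]
          refine (mul_le_mul_right ?_ _).trans hηK'
          refine le_trans ?_ (min_le_left η' 1)
          have hA : MeasurableSet {ω | (L : ℝ) < b (G.markI n ω)} :=
            measurableSet_lt measurable_const (hb.comp (G.measurable_at_I hmark))
          have e : (fun ω => ({x | (L : ℝ) < b x}.indicator 1
              (mark (G.graph n ω) (G.I n ω)) : ℝ≥0∞)) =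
              {ω | (L : ℝ) < b (G.markI n ω)}.indicator 1 := rfl
          rw [e, lqn_indicator_one_le hq hA, one_div, ENNReal.rpow_inv_le_iff h0]
          exact (Measure.restrict_apply_le _ _).trans hLn
    _ = δ := ENNReal.add_thirds δ

end UniformIntegrability

/-! ### Conditional laws given the attributes -/

section ConditionalLaws

lemma condDistrib_eq_of_map_eq {Ω Ω' α E : Type*} [MeasurableSpace Ω] [MeasurableSpace Ω']
    [MeasurableSpace α] [MeasurableSpace E] [StandardBorelSpace E] [Nonempty E] {P : Measure Ω}
    {P' : Measure Ω'} [IsFiniteMeasure P] [IsFiniteMeasure P'] {a : Ω → α} {a' : Ω' → α}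
    {Y : Ω → E} {Y' : Ω' → E}
    (h : P.map (fun ω => (a ω, Y ω)) = P'.map (fun ω => (a' ω, Y' ω))) :
    condDistrib Y a P = condDistrib Y' a' P' := by
  rw [condDistrib, condDistrib]
  congr 1

lemma setLIntegral_condDistrib {Ω α E : Type*} [MeasurableSpace Ω]
    [MeasurableSpace α] [MeasurableSpace E] [StandardBorelSpace E] [Nonempty E] {P : Measure Ω}
    [IsFiniteMeasure P] {a : Ω → α} (ha : Measurable a) {Y : Ω → E} (hY : Measurable Y)
    {f : E → ℝ≥0∞} (hf : Measurable f) {J : Set α} (hJ : MeasurableSet J) :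
    ∫⁻ x in J, ∫⁻ y, f y ∂condDistrib Y a P x ∂P.map a = ∫⁻ ω in a ⁻¹' J, f (Y ω) ∂P := by
  have h1 := Measure.setLIntegral_compProd (μ := P.map a) (κ := condDistrib Y a P)
    (f := fun z => f z.2) (by fun_prop) hJ MeasurableSet.univ
  simp only [Measure.restrict_univ] at h1
  rw [← h1, compProd_map_condDistrib hY.aemeasurable,
    setLIntegral_map (hJ.prod MeasurableSet.univ) (by fun_prop) (ha.prodMk hY)]
  congr 2
  ext ω
  simp

lemma measurable_lqn_kernel {α E : Type*} [MeasurableSpace α] [MeasurableSpace E] {q : ℝ}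
    (κ : Kernel α E) {f : E → ℝ≥0∞} (hf : Measurable f) : Measurable fun x => lqn q (κ x) f :=
  ((hf.pow_const q).lintegral_kernel).pow_const _

variable {p : ℝ≥0∞} [hp1 : Fact (1 ≤ p)]

lemma ae_wasserstein_condDistrib_le {Ω α : Type*} [MeasurableSpace Ω]
    [MeasurableSpace α] {P : Measure Ω} [IsProbabilityMeasure P] {a : Ω → α}
    {A B : Ω → ℝ} (hA : Measurable A) (hB : Measurable B) :
    ∀ᵐ x ∂P.map a, wasserstein p (condDistrib A a P x) (condDistrib B a P x) ≤
      lqn p.toReal (condDistrib (fun ω => (A ω, B ω)) a P x) fun z => edist z.1 z.2 := by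
  have h1 : condDistrib A a P =ᵐ[P.map a] _ :=
    condDistrib_comp (μ := P) (Y := fun ω => (A ω, B ω)) a (by fun_prop) measurable_fst
  have h2 : condDistrib B a P =ᵐ[P.map a] _ :=
    condDistrib_comp (μ := P) (Y := fun ω => (A ω, B ω)) a (by fun_prop) measurable_snd
  filter_upwards [h1, h2] with x e1 e2
  refine wasserstein_le _ ?_ ?_
  · rw [← Kernel.map_apply _ measurable_fst, ← e1]
  · rw [← Kernel.map_apply _ measurable_snd, ← e2]

/-- A conditional coupling bounds the Wasserstein distance of the conditional laws, in
probability. -/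
lemma measure_wasserstein_condDistrib_le (hp : p ≠ ∞) {Ω Ω' α : Type*} [MeasurableSpace Ω]
    [MeasurableSpace Ω'] [MeasurableSpace α] {P : Measure Ω} [IsProbabilityMeasure P] {a : Ω → α}
    (ha : Measurable a) {A B : Ω → ℝ} (hA : Measurable A) (hB : Measurable B)
    {P' : Measure Ω'} {a' : Ω' → α} (ha' : Measurable a') (hmap : P.map a = P'.map a')
    {J : Set α} (hJ : MeasurableSet J) {ε : ℝ≥0∞} (h0 : ε ≠ 0) (ht : ε ≠ ∞) :
    P' {ω | ε ≤ wasserstein p (condDistrib A a P (a' ω)) (condDistrib B a P (a' ω))} ≤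
      P' {ω | a' ω ∉ J} +
        (lqn p.toReal (P.restrict (a ⁻¹' J)) (fun ω => edist (A ω) (B ω)) / ε) ^ p.toReal := by
  have hq := one_le_toReal hp
  have hq0 : 0 < p.toReal := zero_lt_one.trans_le hq
  set κ := condDistrib (fun ω => (A ω, B ω)) a P
  have hκ : Measurable fun x => lqn p.toReal (κ x) fun z => edist z.1 z.2 :=
    measurable_lqn_kernel κ measurable_edist
  set D : Set α := {x | ε ≤ wasserstein p (condDistrib A a P x) (condDistrib B a P x)}
  have hD : P.map a D ≤ P.map a Jᶜ + P.map a (J ∩ {x | ε ≤ lqn p.toReal (κ x)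
      fun z => edist z.1 z.2}) := by
    refine (measure_mono_ae ?_).trans (measure_union_le _ _)
    filter_upwards [ae_wasserstein_condDistrib_le (p := p) (a := a) (P := P) hA hB] with x hx hxD
    by_cases hJx : x ∈ J
    · exact Or.inr ⟨hJx, le_trans hxD hx⟩
    · exact Or.inl hJx
  have hM : P.map a (J ∩ {x | ε ≤ lqn p.toReal (κ x) fun z => edist z.1 z.2}) ≤
      (lqn p.toReal (P.restrict (a ⁻¹' J)) (fun ω => edist (A ω) (B ω)) / ε) ^ p.toReal := by
    have e : (lqn p.toReal (P.restrict (a ⁻¹' J)) fun ω => edist (A ω) (B ω)) ^ p.toReal =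
        ∫⁻ x in J, (lqn p.toReal (κ x) fun z => edist z.1 z.2) ^ p.toReal ∂P.map a := by
      simp only [lqn_rpow hq]
      exact (setLIntegral_condDistrib ha (hA.prodMk hB)
        (f := fun z : ℝ × ℝ => edist z.1 z.2 ^ p.toReal) (by fun_prop) hJ).symm
    rw [ENNReal.div_rpow_of_nonneg _ _ hq0.le, e, Set.inter_comm,
      ← Measure.restrict_apply (measurableSet_le measurable_const hκ)]
    refine (measure_mono fun x hx => ?_).trans
      (meas_ge_le_lintegral_div (hκ.pow_const p.toReal).aemeasurable
      (ENNReal.rpow_pos (pos_iff_ne_zero.2 h0) ht).ne' (ENNReal.rpow_ne_top_of_nonneg hq0.le ht))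
    exact ENNReal.rpow_le_rpow hx hq0.le
  calc P' (a' ⁻¹' D) ≤ P'.map a' D := Measure.le_map_apply ha'.aemeasurable _
    _ = P.map a D := by rw [hmap]
    _ ≤ _ := hD.trans (add_le_add (le_of_eq ?_) hM)
  rw [hmap, Measure.map_apply ha' hJ.compl]
  rfl

variable {S : Type*} [MeasurableSpace S] {G : GraphSeq S}

/-- Convergence of the conditional laws in `d_p` implies uniform integrability. -/
lemma GraphSeq.unifInt_of_tendsto (hp : p ≠ ∞) {φ : Mark S → ℝ} (hφ : Measurable φ) {ρ : Measure ℝ}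
    (hρ : lqn p.toReal ρ (fun x => ‖x‖ₑ) ≠ ∞)
    (h : TendstoZeroInProb G.P fun n ω => wasserstein p (G.markILaw φ n ω) ρ) :
    G.UnifInt p.toReal fun _ H i => ‖φ (mark H i)‖ₑ := by
  have hq := one_le_toReal hp
  have hq0 : 0 < p.toReal := zero_lt_one.trans_le hq
  intro δ hδ
  have hδ2 := ENNReal.half_pos hδ.ne'
  obtain ⟨m, hm⟩ := ((tendsto_lqn_tail hq measurable_enorm hρ).eventually
    (gt_mem_nhds hδ2)).exists
  refine ⟨m, ?_⟩
  filter_upwards [(h (δ / 2) hδ2).eventually (ge_mem_nhds hδ)] with n hn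
  have hmI : Measurable fun ω => φ (G.markI n ω) :=
    hφ.comp (G.measurable_at_I (fun i => measurable_mark i))
  set κ := condDistrib (fun ω => φ (G.markI n ω)) (G.attr n) (G.P n)
  have hf : Measurable fun x : ℝ => ‖x‖ₑ - (m : ℝ≥0∞) := by fun_prop
  have hJ : MeasurableSet {x | lqn p.toReal (κ x) (fun x => ‖x‖ₑ - m) ≤ δ} :=
    measurableSet_le (measurable_lqn_kernel κ hf) measurable_const
  refine ⟨_, hJ, (measure_mono fun ω hω => ?_).trans hn, ?_⟩
  · by_contra hc
    refine hω ?_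
    obtain ⟨π, h1, h2, h3⟩ := exists_coupling_lt (not_le.1 hc)
    have e1 : lqn p.toReal (κ (G.attr n ω)) (fun x => ‖x‖ₑ - m) =
        lqn p.toReal π fun z => ‖z.1‖ₑ - m := by
      rw [← lqn_map (f := fun x : ℝ => ‖x‖ₑ - (m : ℝ≥0∞)) measurable_fst hf, h1]
      rfl
    change lqn p.toReal (κ (G.attr n ω)) (fun x => ‖x‖ₑ - m) ≤ δ
    rw [e1]
    calc _ ≤ lqn p.toReal π fun z => edist z.1 z.2 + (‖z.2‖ₑ - m) := lqn_mono hq fun z => by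
            rw [tsub_le_iff_right, add_assoc, edist_eq_enorm_sub]
            refine le_trans ?_ (add_le_add le_rfl le_tsub_add)
            refine le_trans (le_of_eq ?_) (enorm_add_le _ _)
            congr 1; ring
      _ ≤ δ / 2 + δ / 2 := (lqn_add_le hq measurable_edist
            (show Measurable fun z : ℝ × ℝ => ‖z.2‖ₑ - (m : ℝ≥0∞) by fun_prop)).trans
          (add_le_add h3.le (by
            rw [← lqn_map (f := fun x : ℝ => ‖x‖ₑ - (m : ℝ≥0∞)) measurable_snd hf, h2]
            exact hm.le))
      _ = δ := ENNReal.add_halves δ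
  · rw [lqn_le_iff hq, GraphSeq.onAttr]
    have := setLIntegral_condDistrib (P := G.P n) (G.measurable_attr n) hmI
      (f := fun x : ℝ => (‖x‖ₑ - (m : ℝ≥0∞)) ^ p.toReal) (hf.pow_const _) hJ
    refine this.symm.le.trans ?_
    calc _ ≤ ∫⁻ x in {x | lqn p.toReal (κ x) (fun x => ‖x‖ₑ - m) ≤ δ}, δ ^ p.toReal
          ∂(G.P n).map (G.attr n) := setLIntegral_mono measurable_const fun x hx =>
            (lqn_le_iff hq).1 hx
      _ ≤ δ ^ p.toReal := by
          rw [setLIntegral_const]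
          have : IsProbabilityMeasure ((G.P n).map (G.attr n)) :=
            Measure.isProbabilityMeasure_map (G.measurable_attr n).aemeasurable
          exact mul_le_of_le_one_right' prob_le_one

end ConditionalLaws

section InProbability

lemma tendsto_lintegral_of_inProb {Ω : ℕ → Type*} [∀ n, MeasurableSpace (Ω n)]
    {P : ∀ n, Measure (Ω n)} [∀ n, IsProbabilityMeasure (P n)] {Y : ∀ n, Ω n → ℝ≥0∞}
    (h : TendstoZeroInProb P Y) (h1 : ∀ n, ∀ᵐ ω ∂P n, Y n ω ≤ 1) :
    Tendsto (fun n => ∫⁻ ω, Y n ω ∂P n) atTop (𝓝 0) := by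
  rw [ENNReal.tendsto_nhds_zero]
  intro ε hε
  have h2 := ENNReal.half_pos hε.ne'
  filter_upwards [(h (ε / 2) h2).eventually (ge_mem_nhds h2)] with n hn
  set A := toMeasurable (P n) {ω | ε / 2 ≤ Y n ω}
  calc ∫⁻ ω, Y n ω ∂P n ≤ ∫⁻ ω, ε / 2 + A.indicator 1 ω ∂P n := by
        refine lintegral_mono_ae ?_
        filter_upwards [h1 n] with ω hω
        by_cases hA : ε / 2 ≤ Y n ω
        · rw [Set.indicator_of_mem (show ω ∈ A from subset_toMeasurable _ _ hA)]
          exact le_add_left hω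
        · exact le_add_right (not_le.1 hA).le
    _ = ε / 2 + P n A := by
        rw [lintegral_add_left measurable_const, lintegral_const, measure_univ, mul_one,
          lintegral_indicator_one (measurableSet_toMeasurable _ _)]
    _ ≤ ε / 2 + ε / 2 := add_le_add le_rfl (by rwa [measure_toMeasurable])
    _ = ε := ENNReal.add_halves ε

variable {S : Type*} [MeasurableSpace S] {G : GraphSeq S}

lemma GraphSeq.𝓕_le (n : ℕ) : G.𝓕 n ≤ G.mΩ n := (G.measurable_attr n).comap_le

lemma GraphSeq.condLExp_indicator_le (n : ℕ) (A : Set (G.Ω n)) :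
    ∀ᵐ ω ∂G.P n, condLExp (G.𝓕 n) (G.P n) (A.indicator 1) ω ≤ 1 := by
  have h : condLExp (G.𝓕 n) (G.P n) (A.indicator 1) ≤ᵐ[G.P n] condLExp (G.𝓕 n) (G.P n) 1 :=
    condLExp_mono (Eventually.of_forall fun ω => Set.indicator_le_self' (by simp) ω)
  rw [condLExp_one (𝓕_le n)] at h
  exact h

lemma GraphSeq.tendsto_measure_of_condLExp {A : ∀ n, Set (G.Ω n)} (hA : ∀ n, MeasurableSet (A n))
    (h : TendstoZeroInProb G.P fun n => condLExp (G.𝓕 n) (G.P n) ((A n).indicator 1)) :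
    Tendsto (fun n => G.P n (A n)) atTop (𝓝 0) := by
  refine (tendsto_lintegral_of_inProb h fun n => G.condLExp_indicator_le n _).congr fun n => ?_
  rw [lintegral_condLExp (𝓕_le n), lintegral_indicator_one (hA n)]

lemma GraphSeq.tendsto_measure_compl_of_condLExp {A : ∀ n, Set (G.Ω n)}
    (hA : ∀ n, MeasurableSet (A n))
    (h : TendstoZeroInProb G.P fun n ω => 1 - condLExp (G.𝓕 n) (G.P n) ((A n).indicator 1) ω) :
    Tendsto (fun n => G.P n (A n)ᶜ) atTop (𝓝 0) := by
  refine (tendsto_lintegral_of_inProb h fun n => Eventually.of_forall fun ω => tsub_le_self).congr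
    fun n => ?_
  rw [lintegral_sub (measurable_condLExp' _ _ _) (by
    rw [lintegral_condLExp (𝓕_le n), lintegral_indicator_one (hA n)]; exact measure_ne_top _ _)
    (G.condLExp_indicator_le n _), lintegral_condLExp (𝓕_le n), lintegral_indicator_one (hA n),
    lintegral_one, prob_compl_eq_one_sub (hA n), measure_univ]

end InProbability

/-! ### Measurability of the coupling events -/

section Events

variable {S : Type*} [MeasurableSpace S]

lemma measurable_inTree (q : List ℕ) : Measurable fun t : Tree S => InTree t q := by
  induction q with
  | nil => exact measurable_const
  | cons j q ih =>
    refine ih.and ?_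
    have h : Measurable fun t : Tree S => (t q).1 := by fun_prop
    exact (measurable_from_top (f := fun N : ℕ => j < N)).comp h

lemma measurable_mem_treeBall (k : ℕ) (q : List ℕ) :
    Measurable fun t : Tree S => q ∈ treeBall t k :=
  (measurable_inTree q).and measurable_const

section

variable {V : Type*} [Fintype V]

lemma measurable_mem_sphere (i j : V) (r : ℕ) :
    Measurable fun H : WDigraph V S => j ∈ sphere H i r := by
  induction r generalizing j with
  | zero => exact measurable_const
  | succ r ih =>
    refine Measurable.exists fun l => (ih l).and ?_
    have h : Measurable fun H : WDigraph V S => H.1 j l := by fun_prop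
    exact (measurable_from_top (f := fun N : ℕ => 0 < N)).comp h

lemma measurable_mem_inBall (i j : V) (k : ℕ) :
    Measurable fun H : WDigraph V S => j ∈ inBall H i k :=
  Measurable.exists fun r => Measurable.and measurable_const (measurable_mem_sphere i j r)

variable [MeasurableSpace V] [DiscreteMeasurableSpace V]

lemma measurable_vertex {Ω X : Type*} [MeasurableSpace Ω] [MeasurableSpace X]
    {H : Ω → WDigraph V S} (hH : Measurable H) {v : Ω → V} (hv : Measurable v)
    {f : WDigraph V S → V → X} (hf : ∀ i, Measurable fun H => f H i) :
    Measurable fun ω => f (H ω) (v ω) :=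
  (measurable_from_prod_countable_left (f := fun z : WDigraph V S × V => f z.1 z.2) hf).comp
    (hH.prodMk hv)

lemma measurableSet_isTreeIso {Ω : Type*} [MeasurableSpace Ω] {H : Ω → WDigraph V S}
    (hH : Measurable H) {i : Ω → V} (hi : Measurable i) {t : Ω → Tree S} (ht : Measurable t)
    {θ : Ω → List ℕ → V} (hθ : Measurable θ) (k : ℕ) :
    MeasurableSet {ω | IsTreeIso (H ω) (i ω) (t ω) k (θ ω)} := by
  have hθq : ∀ q, Measurable fun ω => θ ω q := fun q => (measurable_pi_apply q).comp hθ
  have hball : ∀ q, Measurable fun ω => q ∈ treeBall (t ω) k := fun q =>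
    (measurable_mem_treeBall k q).comp ht
  have hin : ∀ {v : Ω → V}, Measurable v → Measurable fun ω => v ω ∈ inBall (H ω) (i ω) k := by
    intro v hv
    exact (measurable_from_prod_countable_left
      (f := fun z : WDigraph V S × (V × V) => z.2.2 ∈ inBall z.1 z.2.1 k)
      fun y => measurable_mem_inBall y.1 y.2 k).comp (hH.prodMk (hi.prodMk hv))
  have hedge : ∀ q q', Measurable fun ω => (H ω).1 (θ ω q) (θ ω q') := fun q q' =>
    (measurable_from_prod_countable_left
      (f := fun z : WDigraph V S × (V × V) => z.1.1 z.2.1 z.2.2)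
      fun y => (show Measurable fun H : WDigraph V S => H.1 y.1 y.2 by fun_prop)).comp
      (hH.prodMk ((hθq q).prodMk (hθq q')))
  have heq : ∀ {v w : Ω → V}, Measurable v → Measurable w → Measurable fun ω => v ω = w ω :=
    fun hv hw => (Measurable.of_discrete (f := fun z : V × V => z.1 = z.2)).comp (hv.prodMk hw)
  refine measurableSet_setOfPred.2 (Measurable.and (heq (hθq []) hi) (Measurable.and ?_ ?_))
  · refine Measurable.and (Measurable.forall fun q => (hball q).imp (hin (hθq q)))
      (Measurable.and ?_ ?_)
    · have : (fun ω => Set.InjOn (θ ω) (treeBall (t ω) k)) = fun ω => ∀ q q',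
          q ∈ treeBall (t ω) k → q' ∈ treeBall (t ω) k → θ ω q = θ ω q' → q = q' := by
        funext ω
        exact propext ⟨fun h q q' hq hq' e => h hq hq' e, fun h q hq q' hq' e => h q q' hq hq' e⟩
      rw [this]
      exact Measurable.forall fun q => Measurable.forall fun q' => (hball q).imp
        ((hball q').imp ((heq (hθq q) (hθq q')).imp measurable_const))
    · have : (fun ω => Set.SurjOn (θ ω) (treeBall (t ω) k) (inBall (H ω) (i ω) k)) = fun ω => ∀ v,
          v ∈ inBall (H ω) (i ω) k → ∃ q, q ∈ treeBall (t ω) k ∧ θ ω q = v := rfl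
      rw [this]
      exact Measurable.forall fun v => (hin measurable_const).imp
        (Measurable.exists fun q => (hball q).and (heq (hθq q) measurable_const))
  · refine Measurable.forall fun q => (hball q).imp (Measurable.forall fun q' => (hball q').imp ?_)
    exact (measurable_from_top (f := fun N : ℕ => N = _)).comp (hedge q q')

end

end Events

section Rho

variable {S : Type*} [MetricSpace S]

lemma rho_lt_one {x y : Mark S} (h : rho x y < 1) : x.1 = y.1 ∧ x.2.1 = y.2.1 := by
  have h1 : ∀ a b : ℕ, |(a : ℝ) - b| < 1 → a = b := by
    intro a b h
    have : |((a : ℤ) - b : ℤ)| < 1 := by exact_mod_cast h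
    rw [Int.abs_lt_one_iff] at this
    omega
  have ha := abs_nonneg ((x.1 : ℝ) - y.1)
  have hb := abs_nonneg ((x.2.1 : ℝ) - y.2.1)
  have hc := dist_nonneg (x := x.2.2) (y := y.2.2)
  unfold rho at h
  exact ⟨h1 _ _ (by linarith), h1 _ _ (by linarith)⟩

lemma rho_nonneg (x y : Mark S) : 0 ≤ rho x y := by unfold rho; positivity

lemma rho_comm (x y : Mark S) : rho x y = rho y x := by
  unfold rho; rw [abs_sub_comm, abs_sub_comm (x.2.1 : ℝ), dist_comm]

lemma dist_le_rho (x y : Mark S) : dist x.2.2 y.2.2 ≤ rho x y := by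
  unfold rho
  have ha := abs_nonneg ((x.1 : ℝ) - y.1)
  have hb := abs_nonneg ((x.2.1 : ℝ) - y.2.1)
  linarith

lemma continuous_rho : Continuous fun z : Mark S × Mark S => rho z.1 z.2 := by
  have hc : Continuous fun n : ℕ => (n : ℝ) := continuous_of_discreteTopology
  unfold rho
  fun_prop

/-- A continuous function is continuous with respect to `rho`. -/
lemma exists_rho_lt_of_continuous {X : Type*} [TopologicalSpace X] {b : Mark S → X}
    (hb : Continuous b) (x : Mark S) {U : Set X} (hU : U ∈ 𝓝 (b x)) :
    ∃ r > 0, ∀ x', rho x' x < r → b x' ∈ U := by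
  have h : Continuous fun s : S => b (x.1, x.2.1, s) := by fun_prop
  obtain ⟨r, hr, hr'⟩ := Metric.mem_nhds_iff.1 (h.continuousAt.preimage_mem_nhds (x := x.2.2) hU)
  refine ⟨min r 1, lt_min hr one_pos, fun x' hx' => ?_⟩
  obtain ⟨h1, h2⟩ := rho_lt_one (hx'.trans_le (min_le_right _ _))
  have : x'.2.2 ∈ Metric.ball x.2.2 r :=
    (dist_le_rho x' x).trans_lt (hx'.trans_le (min_le_left _ _))
  have h3 := hr' this
  simp only [Set.mem_preimage, ← h1, ← h2] at h3
  exact h3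

variable [MeasurableSpace S] [BorelSpace S] [TopologicalSpace.SeparableSpace S]

lemma measurable_rho : Measurable fun z : Mark S × Mark S => rho z.1 z.2 := by
  have := UniformSpace.secondCountable_of_separable S
  exact continuous_rho.measurable

lemma measurable_of_continuous_mark {b : Mark S → ℝ} (hb : Continuous b) : Measurable b := by
  have := UniformSpace.secondCountable_of_separable S
  exact hb.measurable

/-- The coupling transfers tightness from the limiting marks. -/
lemma GraphSeq.tight_of_coupling {G : GraphSeq S} {μ : Measure (Mark S)} [IsProbabilityMeasure μ]
    {X : ∀ n, G.Ω n → Mark S} (hX : ∀ n, Measurable (X n)) (hlaw : ∀ n, (G.P n).map (X n) = μ)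
    (h : ∀ ε : ℝ, 0 < ε → ε < 1 →
      Tendsto (fun n => G.P n {ω | ε < rho (G.markI n ω) (X n ω)}) atTop (𝓝 0))
    {b : Mark S → ℝ} (hb : Continuous b) : G.Tight b := by
  have := UniformSpace.secondCountable_of_separable S
  let r : ℕ → ℝ := fun L => 1 / ((L : ℝ) + 1)
  let A : ℕ → Set (Mark S) := fun L => {x | ∃ x', rho x' x < r L ∧ (L : ℝ) < b x'}
  have hAo : ∀ L, IsOpen (A L) := by
    intro L
    have : A L = ⋃ x' ∈ {x' | (L : ℝ) < b x'}, {x | rho x' x < r L} := by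
      ext x; simp [A, and_comm]
    rw [this]
    refine isOpen_biUnion fun x' _ => isOpen_lt ?_ continuous_const
    exact continuous_rho.comp (f := fun x => (x', x)) (by fun_prop)
  have hanti : Antitone A := by
    intro L L' hL x ⟨x', h1, h2⟩
    refine ⟨x', h1.trans_le ?_, lt_of_le_of_lt (by exact_mod_cast hL) h2⟩
    exact one_div_le_one_div_of_le (by positivity) (by gcongr)
  have hempty : ⋂ L, A L = ∅ := by
    refine Set.eq_empty_iff_forall_notMem.2 fun x hx => ?_
    obtain ⟨s, hs, hs'⟩ := exists_rho_lt_of_continuous hb x (Iio_mem_nhds (lt_add_one (b x)))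
    obtain ⟨L1, hL1⟩ := exists_nat_one_div_lt hs
    obtain ⟨L2, hL2⟩ := exists_nat_gt (b x + 1)
    obtain ⟨x', h1, h2⟩ := Set.mem_iInter.1 hx (max L1 L2)
    have h3 : rho x' x < s := by
      refine (h1.trans_le ?_).trans hL1
      exact one_div_le_one_div_of_le (by positivity) (by gcongr; exact le_max_left _ _)
    have h4 : b x' < b x + 1 := hs' x' h3
    have h5 : ((L2 : ℕ) : ℝ) ≤ (max L1 L2 : ℕ) := by exact_mod_cast le_max_right _ _
    linarith
  have hlim : Tendsto (fun L => μ (A L)) atTop (𝓝 0) := by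
    have := tendsto_measure_iInter_atTop (μ := μ)
      (fun L => (hAo L).measurableSet.nullMeasurableSet) hanti ⟨0, measure_ne_top _ _⟩
    rwa [hempty, measure_empty] at this
  intro δ hδ
  have hδ2 := ENNReal.half_pos hδ.ne'
  obtain ⟨L, hL⟩ := (hlim.eventually (ge_mem_nhds hδ2)).exists
  refine ⟨L, ?_⟩
  have hr : 0 < r L / 2 := by positivity
  have hr1 : r L / 2 < 1 := by
    have : r L ≤ 1 := by
      rw [div_le_one (by positivity)]; linarith [(Nat.cast_nonneg L : (0 : ℝ) ≤ L)]
    linarith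
  filter_upwards [(h (r L / 2) hr hr1).eventually (ge_mem_nhds hδ2)] with n hn
  calc G.P n {ω | (L : ℝ) < b (G.markI n ω)}
      ≤ G.P n ({ω | r L / 2 < rho (G.markI n ω) (X n ω)} ∪ X n ⁻¹' A L) := by
        refine measure_mono fun ω hω => ?_
        by_cases hc : r L / 2 < rho (G.markI n ω) (X n ω)
        · exact Or.inl hc
        · exact Or.inr ⟨_, (not_lt.1 hc).trans_lt (by linarith), hω⟩
    _ ≤ δ / 2 + δ / 2 := (measure_union_le _ _).trans (add_le_add hn (by
        rw [← Measure.map_apply (hX n) (hAo L).measurableSet, hlaw]; exact hL))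
    _ = δ := ENNReal.add_halves δ

end Rho

/-! ### Moment bounds for the chain -/

section MomentBound

variable {S Z Ξ : Type*} [MeasurableSpace S] [MeasurableSpace Z] [MeasurableSpace Ξ]
  (M : Recursion S Z Ξ)

/-- The vector `C⁰ e + β` of nonnegative parts. -/
def Recursion.driftBound {V : Type*} [Fintype V] (σm β : Mark S → ℝ) (H : WDigraph V S) (i : V) :
    ℝ≥0∞ :=
  edgeSum σm (fun x => |M.g 0 x|) H (fun _ => 1) i + ENNReal.ofReal (β (mark H i))

/-- Bounds for the `L^p` norms of the components of the chain started from `0`. -/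
def Recursion.momentBound {V : Type*} [Fintype V] (σm σp β : Mark S → ℝ) :
    ℕ → WDigraph V S → V → ℝ≥0∞
  | 0 => fun _ _ => 0
  | k + 1 => fun H i =>
    edgeSum σm σp H (Recursion.momentBound σm σp β k H) i + M.driftBound σm β H i

variable {V : Type*} [Fintype V] {σm σp β : Mark S → ℝ}

lemma Recursion.measurable_driftBound (hg : Measurable fun w : ℝ × Mark S => M.g w.1 w.2)
    (hσm : Measurable σm) (hβ : Measurable β) (i : V) :
    Measurable fun H : WDigraph V S => M.driftBound σm β H i := by
  have hg0 : Measurable fun x => |M.g 0 x| :=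
    continuous_abs.measurable.comp (hg.comp (f := fun x : Mark S => ((0 : ℝ), x)) (by fun_prop))
  exact (measurable_edgeSum hσm hg0 (fun _ => measurable_const) i).add
    (hβ.comp (measurable_mark i)).ennreal_ofReal

lemma Recursion.measurable_momentBound (hg : Measurable fun w : ℝ × Mark S => M.g w.1 w.2)
    (hσm : Measurable σm) (hσp : Measurable σp) (hβ : Measurable β) (k : ℕ) (i : V) :
    Measurable fun H : WDigraph V S => M.momentBound σm σp β k H i := by
  induction k generalizing i with
  | zero => exact measurable_const
  | succ k ih =>
    exact (measurable_edgeSum hσm hσp ih i).add (M.measurable_driftBound hg hσm hβ i)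

lemma edgeSum_ne_top {a b : Mark S → ℝ} {H : WDigraph V S} {w : V → ℝ≥0∞}
    (hw : ∀ j, w j ≠ ∞) (i : V) : edgeSum a b H w i ≠ ∞ :=
  ENNReal.mul_ne_top ENNReal.ofReal_ne_top (ENNReal.sum_ne_top.2 fun j _ =>
    ENNReal.mul_ne_top (ENNReal.natCast_ne_top _) (ENNReal.mul_ne_top ENNReal.ofReal_ne_top (hw j)))

lemma Recursion.momentBound_ne_top (k : ℕ) (H : WDigraph V S) (i : V) :
    M.momentBound σm σp β k H i ≠ ∞ := by
  induction k generalizing i with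
  | zero => exact ENNReal.zero_ne_top
  | succ k ih =>
    exact ENNReal.add_ne_top.2 ⟨edgeSum_ne_top ih i,
      ENNReal.add_ne_top.2 ⟨edgeSum_ne_top (fun _ => ENNReal.one_ne_top) i, ENNReal.ofReal_ne_top⟩⟩

variable {M} {p : ℝ≥0∞} [hp1 : Fact (1 ≤ p)] {G : WDigraph V S}

lemma Recursion.lqn_iterate_le (hp : p ≠ ∞) (hgm : Measurable fun w : ℝ × Mark S => M.g w.1 w.2)
    (hg : ∀ x r r', |M.g r x - M.g r' x| ≤ σp x * |r - r'|)
    (hG : ∀ i, M.GrowthAt p (σm (mark G i)) (β (mark G i)) (inDeg G i) (mark G i)) (k : ℕ) (i : V) :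
    lqn p.toReal ((pushStep (M.graphMap p G) (M.stepLaw V))^[k] (Measure.dirac 0))
      (fun x => ‖x i‖ₑ) ≤ M.momentBound σm σp β k G i := by
  have hq := one_le_toReal hp
  have hF := M.measurable_graphMap (p := p) hgm G
  induction k generalizing i with
  | zero =>
    have : lqn p.toReal (Measure.dirac (0 : PiLp p fun _ : V => ℝ)) (fun x => ‖x i‖ₑ) = 0 := by
      rw [lqn, lintegral_dirac' _ (by fun_prop)]
      have h0 : 0 < p.toReal := zero_lt_one.trans_le hq
      simp [h0]
    exact this.le
  | succ k ih =>
    rw [Function.iterate_succ_apply', pushStep]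
    set m := (pushStep (M.graphMap p G) (M.stepLaw V))^[k] (Measure.dirac 0)
    have : IsProbabilityMeasure m := isProbabilityMeasure_iterate_pushStep hF _ k
    have hFi : Measurable fun z : (PiLp p fun _ : V => ℝ) × StepNoise V Z Ξ =>
        ‖M.graphMap p G z.1 z.2 i‖ₑ :=
      Measurable.enorm ((show Measurable fun x : PiLp p fun _ : V => ℝ => x i by fun_prop).comp hF)
    have hgj : ∀ j, Measurable fun r : PiLp p fun _ : V => ℝ => ‖M.g (r j) (mark G j)‖ₑ := fun j =>
      (hgm.comp (f := fun r : PiLp p fun _ : V => ℝ => (r j, mark G j)) (by fun_prop)).enorm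
    rw [lqn_map hF (by fun_prop), lqn_prod hq hFi]
    calc _ ≤ lqn p.toReal m (fun r => ENNReal.ofReal (σm (mark G i)) *
          ∑ j, (G.1 j i : ℝ≥0∞) * ‖M.g (r j) (mark G j)‖ₑ + ENNReal.ofReal (β (mark G i))) :=
          lqn_mono hq fun r => M.graphStep_growth hp (hG i) (WithLp.ofLp r)
      _ ≤ ENNReal.ofReal (σm (mark G i)) * ∑ j, (G.1 j i : ℝ≥0∞) *
          (‖M.g 0 (mark G j)‖ₑ + ENNReal.ofReal (σp (mark G j)) * M.momentBound σm σp β k G j) +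
          ENNReal.ofReal (β (mark G i)) := by
          have hs : Measurable fun r : PiLp p fun _ : V => ℝ =>
              ∑ j, (G.1 j i : ℝ≥0∞) * ‖M.g (r j) (mark G j)‖ₑ :=
            Finset.measurable_fun_sum _ fun j _ => (hgj j).const_mul _
          refine (lqn_add_le hq (hs.const_mul _) measurable_const).trans
            (add_le_add ?_ (lqn_const hq _).le)
          rw [lqn_const_mul hq _ hs]
          refine mul_le_mul_right ((lqn_sum_le hq _ fun j => (hgj j).const_mul _).trans
            (Finset.sum_le_sum fun j _ => ?_)) _
          rw [lqn_const_mul hq _ (hgj j)]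
          refine mul_le_mul_right ((lqn_mono hq fun r => enorm_g_le hg _ _).trans
            ((lqn_add_le hq measurable_const (by fun_prop)).trans
              (add_le_add (lqn_const hq _).le ?_))) _
          rw [lqn_const_mul hq _ (by fun_prop)]
          exact mul_le_mul_right (ih j) _
      _ = _ := by
          simp only [Recursion.momentBound, Recursion.driftBound, edgeSum, mul_one]
          rw [← add_assoc, ← mul_add, ← Finset.sum_add_distrib]
          congr 2
          refine Finset.sum_congr rfl fun j _ => ?_
          rw [← Real.norm_eq_abs, ofReal_norm, mul_add, add_comm]

lemma Recursion.measurable_chain (hgm : Measurable fun w : ℝ × Mark S => M.g w.1 w.2) (k : ℕ) :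
    Measurable fun z : WDigraph V S × (V → ℝ) × Noise V Z Ξ => M.chain z.1 z.2.1 z.2.2 k := by
  induction k with
  | zero => exact measurable_fst.comp measurable_snd
  | succ k ih =>
    have hn : Measurable fun z : WDigraph V S × (V → ℝ) × Noise V Z Ξ => noiseSeq z.2.2 k :=
      (measurable_pi_apply k).comp (measurable_noiseSeq.comp (by fun_prop))
    exact (M.measurable_graphStep hgm).comp (measurable_fst.prodMk (ih.prodMk hn))

lemma Recursion.lqn_chain_le (hp : p ≠ ∞) (hgm : Measurable fun w : ℝ × Mark S => M.g w.1 w.2)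
    (hg : ∀ x r r', |M.g r x - M.g r' x| ≤ σp x * |r - r'|)
    (hG : ∀ i, M.GrowthAt p (σm (mark G i)) (β (mark G i)) (inDeg G i) (mark G i)) (k : ℕ) (i : V) :
    lqn p.toReal (M.noiseLaw V) (fun e => ‖M.chain G 0 e k i‖ₑ) ≤ M.momentBound σm σp β k G i := by
  refine le_trans (le_of_eq ?_) (Recursion.lqn_iterate_le hp hgm hg hG k i)
  have hc : Measurable fun z : (PiLp p fun _ : V => ℝ) × Noise V Z Ξ =>
      WithLp.toLp p (M.chain G (WithLp.ofLp z.1) z.2 k) :=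
    (WithLp.measurable_toLp p _).comp ((M.measurable_chain hgm k).comp
      (f := fun z : (PiLp p fun _ : V => ℝ) × Noise V Z Ξ => (G, WithLp.ofLp z.1, z.2))
      (by fun_prop))
  rw [← M.chainLaw_eq hgm, Recursion.chainLaw, Measure.dirac_prod,
    Measure.map_map hc (by fun_prop), lqn_map (hc.comp (by fun_prop)) (by fun_prop)]
  rfl

end MomentBound

/-! ### Perturbation of the marks of a tree -/

section Perturbation

open Measure

variable {S Z Ξ : Type*} [MeasurableSpace S] [MeasurableSpace Z] [MeasurableSpace Ξ]
  (M : Recursion S Z Ξ) (p : ℝ≥0∞) (σm σp β : Mark S → ℝ) (H Q : ℝ≥0∞)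

/-- The maps at the mark `x'` are `e`-close to those at the mark `x`. -/
structure Recursion.Modulus (e : ℝ≥0∞) (x' x : Mark S) : Prop where
  Φ_le : ∀ u : ℕ → ℝ, lqn p.toReal M.nodeNoise
      (fun n => ‖appBy M.Φ (x.1, x') n u - appBy M.Φ (x.1, x) n u‖ₑ) ≤
    e * (H * (1 + (ENNReal.ofReal (σm x) * ∑ j ∈ Finset.range x.1, ‖u j‖ₑ +
      ENNReal.ofReal (β x))))
  g_le : ∀ r, ‖M.g r x' - M.g r x‖ₑ ≤ e * (Q * (1 + ENNReal.ofReal (σp x) * ‖r‖ₑ))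

/-- Closeness of the labels of corresponding nodes, with the conditions on the maps at the second
node. -/
structure Recursion.NodeClose (e : ℝ≥0∞) (y' y : ℕ × Mark S) : Prop where
  fst_eq : y'.1 = y.1
  degree_eq : y.1 = y.2.1
  modulus : M.Modulus p σm σp β H Q e y'.2 y.2
  lipschitz : M.LipschitzAt p (σm y.2) y.1 y.2
  growth : M.GrowthAt p (σm y.2) (β y.2) y.1 y.2

/-- Closeness of two trees up to generation `k`. -/
def Recursion.TreeClose (e : ℝ≥0∞) : ℕ → Tree S → Tree S → Prop
  | 0, t', t => M.Modulus p σm σp β H Q e (t' []).2 (t []).2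
  | k + 1, t', t => M.NodeClose p σm σp β H Q e (t' []) (t []) ∧
    ∀ j < (t []).1, Recursion.TreeClose e k (subtree t' j) (subtree t j)

lemma inTree_subtree {t : Tree S} {j : ℕ} (hj : j < (t []).1) (q : List ℕ) :
    InTree (subtree t j) q ↔ InTree t (q ++ [j]) := by
  induction q with
  | nil => simp [InTree, hj]
  | cons l q ih => simp [InTree, ih, subtree]

lemma Recursion.treeClose_of_forall {e : ℝ≥0∞} (k : ℕ) {t' t : Tree S}
    (h1 : ∀ q, InTree t q → q.length < k → M.NodeClose p σm σp β H Q e (t' q) (t q))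
    (h2 : ∀ q, InTree t q → q.length = k → M.Modulus p σm σp β H Q e (t' q).2 (t q).2) :
    M.TreeClose p σm σp β H Q e k t' t := by
  induction k generalizing t t' with
  | zero => exact h2 [] trivial rfl
  | succ k ih =>
    refine ⟨h1 [] trivial (Nat.succ_pos k), fun j hj => ih (fun q hq hk => ?_) fun q hq hk => ?_⟩
    · exact h1 (q ++ [j]) ((inTree_subtree hj q).1 hq) (by simpa using hk)
    · exact h2 (q ++ [j]) ((inTree_subtree hj q).1 hq) (by simpa using hk)

/-- The bound on the error made by one application of `Φ`. -/
def stepErr (y : ℕ × Mark S) (u d : ℕ → ℝ≥0∞) : ℝ≥0∞ :=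
  H * (1 + (ENNReal.ofReal (σm y.2) * ∑ j ∈ Finset.range y.1, (u j + d j) +
    ENNReal.ofReal (β y.2))) + ENNReal.ofReal (σm y.2) * ∑ j ∈ Finset.range y.1, d j

/-- The bound on the `L^p` norm of one application of `Φ`. -/
def stepBound (y : ℕ × Mark S) (u : ℕ → ℝ≥0∞) : ℝ≥0∞ :=
  ENNReal.ofReal (σm y.2) * ∑ j ∈ Finset.range y.1, u j + ENNReal.ofReal (β y.2)

/-- Bounds on the `L^p` norms of the `𝒱_∅^(k)` on a fixed tree. -/
def Recursion.treeBound : ℕ → Tree S → ℝ≥0∞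
  | 0, t => ‖M.g 0 (t []).2‖ₑ
  | k + 1, t => ‖M.g 0 (t []).2‖ₑ + ENNReal.ofReal (σp (t []).2) *
      stepBound σm β (t []) (fun j => Recursion.treeBound k (subtree t j))

/-- Bounds on the errors for the `𝒱_∅^(k)` on a fixed tree. -/
def Recursion.treeErr : ℕ → Tree S → ℝ≥0∞
  | 0, _ => Q
  | k + 1, t =>
    let u := fun j => M.treeBound σm σp β k (subtree t j)
    let A := stepErr σm β H (t []) u (fun j => Recursion.treeErr k (subtree t j))
    Q * (1 + ENNReal.ofReal (σp (t []).2) * (stepBound σm β (t []) u + A)) +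
      ENNReal.ofReal (σp (t []).2) * A

/-- The bound on the error for `ℛ_∅^(k+1)` on a fixed tree. -/
def Recursion.rootErr (k : ℕ) (t : Tree S) : ℝ≥0∞ :=
  stepErr σm β H (t []) (fun j => M.treeBound σm σp β k (subtree t j))
    (fun j => M.treeErr σm σp β H Q k (subtree t j))

variable {M p σm σp β H Q}

lemma stepBound_ne_top {y : ℕ × Mark S} {u : ℕ → ℝ≥0∞} (hu : ∀ j, u j ≠ ∞) :
    stepBound σm β y u ≠ ∞ :=
  ENNReal.add_ne_top.2 ⟨ENNReal.mul_ne_top ENNReal.ofReal_ne_top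
    (ENNReal.sum_ne_top.2 fun j _ => hu j), ENNReal.ofReal_ne_top⟩

lemma stepErr_ne_top (hH : H ≠ ∞) {y : ℕ × Mark S} {u d : ℕ → ℝ≥0∞} (hu : ∀ j, u j ≠ ∞)
    (hd : ∀ j, d j ≠ ∞) : stepErr σm β H y u d ≠ ∞ :=
  ENNReal.add_ne_top.2 ⟨ENNReal.mul_ne_top hH (ENNReal.add_ne_top.2 ⟨ENNReal.one_ne_top,
    stepBound_ne_top fun j => ENNReal.add_ne_top.2 ⟨hu j, hd j⟩⟩),
    ENNReal.mul_ne_top ENNReal.ofReal_ne_top (ENNReal.sum_ne_top.2 fun j _ => hd j)⟩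

lemma Recursion.treeBound_ne_top (k : ℕ) (t : Tree S) : M.treeBound σm σp β k t ≠ ∞ := by
  induction k generalizing t with
  | zero => exact enorm_ne_top
  | succ k ih =>
    exact ENNReal.add_ne_top.2 ⟨enorm_ne_top, ENNReal.mul_ne_top ENNReal.ofReal_ne_top
      (stepBound_ne_top fun j => ih _)⟩

lemma Recursion.treeErr_ne_top (hH : H ≠ ∞) (hQ : Q ≠ ∞) (k : ℕ) (t : Tree S) :
    M.treeErr σm σp β H Q k t ≠ ∞ := by
  induction k generalizing t with
  | zero => exact hQ
  | succ k ih =>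
    have h1 := stepErr_ne_top (σm := σm) (β := β) (y := t []) hH
      (fun j => M.treeBound_ne_top (σm := σm) (σp := σp) (β := β) k (subtree t j))
      (fun j => ih (subtree t j))
    refine ENNReal.add_ne_top.2 ⟨ENNReal.mul_ne_top hQ (ENNReal.add_ne_top.2
      ⟨ENNReal.one_ne_top, ENNReal.mul_ne_top ENNReal.ofReal_ne_top (ENNReal.add_ne_top.2
        ⟨stepBound_ne_top fun j => M.treeBound_ne_top _ _, h1⟩)⟩),
      ENNReal.mul_ne_top ENNReal.ofReal_ne_top h1⟩

lemma Recursion.rootErr_ne_top (hH : H ≠ ∞) (hQ : Q ≠ ∞) (k : ℕ) (t : Tree S) :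
    M.rootErr σm σp β H Q k t ≠ ∞ :=
  stepErr_ne_top hH (fun _ => M.treeBound_ne_top _ _) fun _ => treeErr_ne_top hH hQ _ _

lemma measurable_stepBound (hσm : Measurable σm) (hβ : Measurable β) {Ω : Type*}
    [MeasurableSpace Ω] {y : Ω → ℕ × Mark S} (hy : Measurable y) {u : Ω → ℕ → ℝ≥0∞}
    (hu : Measurable u) : Measurable fun ω => stepBound σm β (y ω) (u ω) := by
  have := measurable_sum_range (measurable_fst.comp hy) hu
  unfold stepBound
  exact (Measurable.mul (by fun_prop) this).add (by fun_prop)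

lemma measurable_stepErr (hσm : Measurable σm) (hβ : Measurable β) {Ω : Type*}
    [MeasurableSpace Ω] {y : Ω → ℕ × Mark S} (hy : Measurable y) {u d : Ω → ℕ → ℝ≥0∞}
    (hu : Measurable u) (hd : Measurable d) :
    Measurable fun ω => stepErr σm β H (y ω) (u ω) (d ω) := by
  have h1 := measurable_stepBound hσm hβ hy (u := fun ω j => u ω j + d ω j) (by fun_prop)
  have h2 := measurable_sum_range (measurable_fst.comp hy) hd
  unfold stepErr
  exact (Measurable.const_mul (measurable_const.add h1) _).add (Measurable.mul (by fun_prop) h2)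

lemma measurable_comp_subtree {X Y : Type*} [MeasurableSpace X] [MeasurableSpace Y]
    {f : (List ℕ → X) → Y} (hf : Measurable f) :
    Measurable fun (t : List ℕ → X) (j : ℕ) => f (subtree t j) :=
  measurable_pi_lambda _ fun j => hf.comp ((measurable_pi_apply j).comp measurable_subtree)

lemma Recursion.measurable_treeBound (hg : Measurable fun w : ℝ × Mark S => M.g w.1 w.2)
    (hσm : Measurable σm) (hσp : Measurable σp) (hβ : Measurable β) (k : ℕ) :
    Measurable (M.treeBound σm σp β k) := by
  have hg0 : Measurable fun t : Tree S => ‖M.g 0 (t []).2‖ₑ :=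
    (hg.comp (f := fun t : Tree S => ((0 : ℝ), (t []).2)) (by fun_prop)).enorm
  induction k with
  | zero => exact hg0
  | succ k ih =>
    exact hg0.add (Measurable.mul (by fun_prop)
      (measurable_stepBound hσm hβ (by fun_prop) (measurable_comp_subtree ih)))

lemma Recursion.measurable_treeErr (hg : Measurable fun w : ℝ × Mark S => M.g w.1 w.2)
    (hσm : Measurable σm) (hσp : Measurable σp) (hβ : Measurable β) (k : ℕ) :
    Measurable (M.treeErr σm σp β H Q k) := by
  induction k with
  | zero => exact measurable_const
  | succ k ih =>
    have hu := measurable_comp_subtree (Recursion.measurable_treeBound (M := M) hg hσm hσp hβ k)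
    have hA := measurable_stepErr (H := H) hσm hβ (y := fun t : Tree S => t []) (by fun_prop) hu
      (measurable_comp_subtree ih)
    have hB := measurable_stepBound hσm hβ (y := fun t : Tree S => t []) (by fun_prop) hu
    have hs : Measurable fun t : Tree S => ENNReal.ofReal (σp (t []).2) := by fun_prop
    exact ((measurable_const.add (hs.mul (hB.add hA))).const_mul _).add (hs.mul hA)

lemma Recursion.measurable_rootErr (hg : Measurable fun w : ℝ × Mark S => M.g w.1 w.2)
    (hσm : Measurable σm) (hσp : Measurable σp) (hβ : Measurable β) (k : ℕ) :
    Measurable (M.rootErr σm σp β H Q k) :=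
  measurable_stepErr hσm hβ (by fun_prop)
    (measurable_comp_subtree (Recursion.measurable_treeBound hg hσm hσp hβ k))
    (measurable_comp_subtree (Recursion.measurable_treeErr hg hσm hσp hβ k))

section Step

variable {Ω : Type*} [MeasurableSpace Ω] {P : Measure Ω} [IsProbabilityMeasure P]

/-- A bound given the inputs, integrated over the inputs. -/
lemma lqn_inputs_le {q : ℝ} (hq : 1 ≤ q) {ν : Measure (Z × (ℕ → Ξ))} [IsProbabilityMeasure ν]
    {h : (Z × (ℕ → Ξ)) × Ω → ℝ≥0∞} (hh : Measurable h) {L b : ℝ≥0∞} {N : ℕ} {D : Ω → ℕ → ℝ≥0∞}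
    (hD : Measurable D) {d : ℕ → ℝ≥0∞} (hd : ∀ j < N, lqn q P (fun ω => D ω j) ≤ d j)
    (hle : ∀ ω, lqn q ν (fun n => h (n, ω)) ≤ L * ∑ j ∈ Finset.range N, D ω j + b) :
    lqn q (ν.prod P) h ≤ L * ∑ j ∈ Finset.range N, d j + b := by
  have hDj : ∀ j, Measurable fun ω => D ω j := fun j => by fun_prop
  have hs : Measurable fun ω => ∑ j ∈ Finset.range N, D ω j :=
    Finset.measurable_sum _ fun j _ => hDj j
  rw [lqn_prod_symm hq hh]
  refine (lqn_mono hq hle).trans ((lqn_add_le hq (hs.const_mul _) measurable_const).trans ?_)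
  rw [lqn_const hq, lqn_const_mul hq _ hs]
  refine add_le_add (mul_le_mul_right ((lqn_sum_le hq _ hDj).trans ?_) _) le_rfl
  exact Finset.sum_le_sum fun j hj => hd j (Finset.mem_range.1 hj)

variable [hp1 : Fact (1 ≤ p)]

lemma lqn_stepBound (hp : p ≠ ∞) {y : ℕ × Mark S} (hy : M.GrowthAt p (σm y.2) (β y.2) y.1 y.2)
    {v : Ω → ℕ → ℝ} (hv : Measurable v) {u : ℕ → ℝ≥0∞}
    (hu : ∀ j < y.1, lqn p.toReal P (fun ω => ‖v ω j‖ₑ) ≤ u j) :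
    lqn p.toReal (M.nodeNoise.prod P) (fun z => ‖appBy M.Φ y z.1 (v z.2)‖ₑ) ≤
      stepBound σm β y u :=
  lqn_inputs_le (one_le_toReal hp)
    (M.measurableApp_Φ.comp (by fun_prop) (by fun_prop) (by fun_prop)).enorm
    (D := fun ω j => ‖v ω j‖ₑ) (by fun_prop) hu fun ω => hy.app_le hp (v ω)

lemma lqn_stepErr (hp : p ≠ ∞) {e : ℝ≥0∞} (he : e ≤ 1) {y' y : ℕ × Mark S}
    (hy : M.NodeClose p σm σp β H Q e y' y) {v' v : Ω → ℕ → ℝ} (hv' : Measurable v')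
    (hv : Measurable v) {u d : ℕ → ℝ≥0∞}
    (hu : ∀ j < y.1, lqn p.toReal P (fun ω => ‖v ω j‖ₑ) ≤ u j)
    (hd : ∀ j < y.1, lqn p.toReal P (fun ω => ‖v' ω j - v ω j‖ₑ) ≤ e * d j) :
    lqn p.toReal (M.nodeNoise.prod P)
        (fun z => ‖appBy M.Φ y' z.1 (v' z.2) - appBy M.Φ y z.1 (v z.2)‖ₑ) ≤
      e * stepErr σm β H y u d := by
  have hq := one_le_toReal hp
  have ey' : y' = (y.2.1, y'.2) := Prod.ext (hy.fst_eq.trans hy.degree_eq) rfl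
  have ey : y = (y.2.1, y.2) := Prod.ext hy.degree_eq rfl
  have happ : ∀ y : ℕ × Mark S, ∀ u, Measurable fun n : Z × (ℕ → Ξ) => appBy M.Φ y n u :=
    fun y u => M.measurableApp_Φ.comp (by fun_prop) (by fun_prop) (by fun_prop)
  have hm : Measurable fun z : (Z × (ℕ → Ξ)) × Ω =>
      ‖appBy M.Φ y' z.1 (v' z.2) - appBy M.Φ y z.1 (v z.2)‖ₑ :=
    measurable_enorm_sub (M.measurableApp_Φ.comp (by fun_prop) (by fun_prop) (by fun_prop))
      (M.measurableApp_Φ.comp (by fun_prop) (by fun_prop) (by fun_prop))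
  have hv'j : ∀ j < y.1, lqn p.toReal P (fun ω => ‖v' ω j‖ₑ) ≤ u j + d j := by
    intro j hj
    calc _ ≤ lqn p.toReal P (fun ω => ‖v ω j‖ₑ + ‖v' ω j - v ω j‖ₑ) := lqn_mono hq fun ω => by
          refine le_trans (le_of_eq ?_) (enorm_add_le _ _)
          congr 1; ring
      _ ≤ _ := (lqn_add_le hq (by fun_prop) (by fun_prop)).trans (add_le_add (hu j hj)
          ((hd j hj).trans (mul_le_of_le_one_left' he)))
  refine (lqn_inputs_le hq (N := y.1) hm (D := fun ω j => e * H * ‖v' ω j‖ₑ + ‖v' ω j - v ω j‖ₑ)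
    (L := ENNReal.ofReal (σm y.2)) (b := e * (H * (1 + ENNReal.ofReal (β y.2))))
    (d := fun j => e * H * (u j + d j) + e * d j) (by fun_prop) (fun j hj => ?_)
    fun ω => ?_).trans (le_of_eq ?_)
  · refine (lqn_add_le hq (by fun_prop) (by fun_prop)).trans (add_le_add ?_ (hd j hj))
    rw [lqn_const_mul hq _ (by fun_prop)]
    exact mul_le_mul_right (hv'j j hj) _
  · calc _ ≤ lqn p.toReal M.nodeNoise (fun n =>
          ‖appBy M.Φ y' n (v' ω) - appBy M.Φ y n (v' ω)‖ₑ +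
            ‖appBy M.Φ y n (v' ω) - appBy M.Φ y n (v ω)‖ₑ) := lqn_mono hq fun n => by
          refine le_trans (le_of_eq ?_) (enorm_add_le _ _)
          congr 1; ring
      _ ≤ _ := (lqn_add_le hq (measurable_enorm_sub (happ _ _) (happ _ _))
          (measurable_enorm_sub (happ _ _) (happ _ _))).trans
          (add_le_add (b := e * (H * (1 + (ENNReal.ofReal (σm y.2) *
            ∑ j ∈ Finset.range y.1, ‖v' ω j‖ₑ + ENNReal.ofReal (β y.2))))) (by
              have := hy.modulus.Φ_le (v' ω)
              rwa [← ey', ← ey, ← hy.degree_eq] at this) (hy.lipschitz.app_le hp _ _))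
      _ = _ := by
          simp only [Finset.sum_add_distrib, ← Finset.mul_sum]
          ring
  · simp only [stepErr, Finset.sum_add_distrib, ← Finset.mul_sum]
    ring

end Step

/-- `𝒱_∅^(k)` on a fixed tree, started from `0`. -/
def Recursion.valOn (M : Recursion S Z Ξ) (t : Tree S) (k : ℕ) (N : List ℕ → Z × (ℕ → Ξ)) : ℝ :=
  M.val k fun q => (t q, N q, (0 : ℝ))

variable (M) in
lemma Recursion.measurePreserving_root_subtree :
    MeasurePreserving (fun N : List ℕ → Z × (ℕ → Ξ) => (N [], subtree N))
      (infinitePi fun _ : List ℕ => M.nodeNoise)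
      (M.nodeNoise.prod (infinitePi fun _ : ℕ => infinitePi fun _ : List ℕ => M.nodeNoise)) :=
  ⟨Measurable.prodMk (by fun_prop) measurable_subtree,
    infinitePi_list fun _ : List ℕ => M.nodeNoise⟩

lemma Recursion.measurable_valOn (hg : Measurable fun w : ℝ × Mark S => M.g w.1 w.2) (t : Tree S)
    (k : ℕ) : Measurable (M.valOn t k) :=
  (M.measurable_val hg k).comp (by fun_prop)

variable [hp1 : Fact (1 ≤ p)]

lemma lqn_eval {q : ℝ} {X : Type*} [MeasurableSpace X] {ν : Measure X} [IsProbabilityMeasure ν]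
    (j : ℕ) {f : X → ℝ≥0∞} (hf : Measurable f) :
    lqn q (infinitePi fun _ : ℕ => ν) (fun w => f (w j)) = lqn q ν f := by
  rw [← lqn_map (ν := infinitePi fun _ : ℕ => ν) (φ := fun w => w j) (by fun_prop) hf,
    Measure.infinitePi_map_eval]

lemma Recursion.measurable_root_appBy (hgm : Measurable fun w : ℝ × Mark S => M.g w.1 w.2)
    (t : Tree S) (k : ℕ) : Measurable fun N : List ℕ → Z × (ℕ → Ξ) =>
      appBy M.Φ (t []) (N []) (fun j => M.valOn (subtree t j) k (subtree N j)) :=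
  M.measurableApp_Φ.comp (by fun_prop) (by fun_prop) (measurable_pi_lambda _ fun j =>
    (M.measurable_valOn hgm _ k).comp ((measurable_pi_apply j).comp measurable_subtree))

lemma lqn_root_le (hp : p ≠ ∞) (hgm : Measurable fun w : ℝ × Mark S => M.g w.1 w.2) (k : ℕ)
    {t : Tree S} (ht : M.GrowthAt p (σm (t []).2) (β (t []).2) (t []).1 (t []).2)
    {u : ℕ → ℝ≥0∞} (hu : ∀ j < (t []).1, lqn p.toReal (infinitePi fun _ : List ℕ => M.nodeNoise)
      (fun N => ‖M.valOn (subtree t j) k N‖ₑ) ≤ u j) :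
    lqn p.toReal (infinitePi fun _ : List ℕ => M.nodeNoise) (fun N =>
      ‖appBy M.Φ (t []) (N []) (fun j => M.valOn (subtree t j) k (subtree N j))‖ₑ) ≤
      stepBound σm β (t []) u := by
  have hv : Measurable fun (w : ℕ → List ℕ → Z × (ℕ → Ξ)) (j : ℕ) =>
      M.valOn (subtree t j) k (w j) := measurable_pi_lambda _ fun j =>
    (M.measurable_valOn hgm _ k).comp (by fun_prop)
  have hΦ : Measurable fun z : (Z × (ℕ → Ξ)) × (ℕ → List ℕ → Z × (ℕ → Ξ)) =>
      appBy M.Φ (t []) z.1 (fun j => M.valOn (subtree t j) k (z.2 j)) :=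
    M.measurableApp_Φ.comp (by fun_prop) (by fun_prop) (hv.comp measurable_snd)
  have hstep := lqn_stepBound (M := M)
    (P := infinitePi fun _ : ℕ => infinitePi fun _ : List ℕ => M.nodeNoise) hp ht hv
    (u := u) fun j hj => by
      rw [lqn_eval j (M.measurable_valOn hgm (subtree t j) k).enorm]
      exact hu j hj
  rwa [← (M.measurePreserving_root_subtree).map_eq, lqn_map
    M.measurePreserving_root_subtree.measurable hΦ.enorm] at hstep

lemma lqn_valOn_le (hp : p ≠ ∞) (hgm : Measurable fun w : ℝ × Mark S => M.g w.1 w.2)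
    (hg : ∀ x r r', |M.g r x - M.g r' x| ≤ σp x * |r - r'|) {e : ℝ≥0∞} (k : ℕ)
    {t' t : Tree S} (h : M.TreeClose p σm σp β H Q e k t' t) :
    lqn p.toReal (infinitePi fun _ : List ℕ => M.nodeNoise) (fun N => ‖M.valOn t k N‖ₑ) ≤
      M.treeBound σm σp β k t := by
  have hq := one_le_toReal hp
  induction k generalizing t' t with
  | zero => exact (lqn_const hq _).le
  | succ k ih =>
    have hstep := lqn_root_le hp hgm k h.1.growth fun j hj => ih (h.2 j hj)
    have hm := (M.measurable_root_appBy hgm t k).enorm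
    have e1 : ∀ N, M.valOn t (k + 1) N = M.g (appBy M.Φ (t []) (N [])
        (fun j => M.valOn (subtree t j) k (subtree N j))) (t []).2 := fun N => rfl
    simp only [e1]
    refine (lqn_mono hq fun N => enorm_g_le hg _ _).trans
      ((lqn_add_le hq measurable_const (hm.const_mul _)).trans
        (add_le_add (lqn_const hq _).le ?_))
    rw [lqn_const_mul hq _ hm]
    exact mul_le_mul_right hstep _

/-- The error made by one application of `Φ` at the root. -/
lemma lqn_root_sub_le (hp : p ≠ ∞) (hgm : Measurable fun w : ℝ × Mark S => M.g w.1 w.2)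
    (hg : ∀ x r r', |M.g r x - M.g r' x| ≤ σp x * |r - r'|) {e : ℝ≥0∞} (he : e ≤ 1) (k : ℕ)
    {t' t : Tree S} (h : M.TreeClose p σm σp β H Q e (k + 1) t' t) {d : ℕ → ℝ≥0∞}
    (hd : ∀ j < (t []).1, lqn p.toReal (infinitePi fun _ : List ℕ => M.nodeNoise)
      (fun N => ‖M.valOn (subtree t' j) k N - M.valOn (subtree t j) k N‖ₑ) ≤ e * d j) :
    lqn p.toReal (infinitePi fun _ : List ℕ => M.nodeNoise) (fun N =>
      ‖appBy M.Φ (t' []) (N []) (fun j => M.valOn (subtree t' j) k (subtree N j)) -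
        appBy M.Φ (t []) (N []) (fun j => M.valOn (subtree t j) k (subtree N j))‖ₑ) ≤
      e * stepErr σm β H (t []) (fun j => M.treeBound σm σp β k (subtree t j)) d := by
  have hv : ∀ t : Tree S, Measurable fun (w : ℕ → List ℕ → Z × (ℕ → Ξ)) (j : ℕ) =>
      M.valOn (subtree t j) k (w j) := fun t => measurable_pi_lambda _ fun j =>
    (M.measurable_valOn hgm _ k).comp (by fun_prop)
  have hΦ : ∀ t : Tree S, Measurable fun z : (Z × (ℕ → Ξ)) × (ℕ → List ℕ → Z × (ℕ → Ξ)) =>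
      appBy M.Φ (t []) z.1 (fun j => M.valOn (subtree t j) k (z.2 j)) := fun t =>
    M.measurableApp_Φ.comp (by fun_prop) (by fun_prop) ((hv t).comp measurable_snd)
  have hstep := lqn_stepErr (M := M)
    (P := infinitePi fun _ : ℕ => infinitePi fun _ : List ℕ => M.nodeNoise) hp he h.1 (hv t') (hv t)
    (u := fun j => M.treeBound σm σp β k (subtree t j)) (d := d) (fun j hj => by
      rw [lqn_eval j (M.measurable_valOn hgm (subtree t j) k).enorm]
      exact lqn_valOn_le hp hgm hg k (h.2 j hj)) (fun j hj => by
      rw [lqn_eval j (measurable_enorm_sub (M.measurable_valOn hgm (subtree t' j) k)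
        (M.measurable_valOn hgm (subtree t j) k))]
      exact hd j hj)
  rwa [← (M.measurePreserving_root_subtree).map_eq, lqn_map
    M.measurePreserving_root_subtree.measurable (measurable_enorm_sub (hΦ t') (hΦ t))] at hstep

lemma lqn_valOn_sub_le (hp : p ≠ ∞) (hgm : Measurable fun w : ℝ × Mark S => M.g w.1 w.2)
    (hg : ∀ x r r', |M.g r x - M.g r' x| ≤ σp x * |r - r'|) {e : ℝ≥0∞} (he : e ≤ 1) (k : ℕ)
    {t' t : Tree S} (h : M.TreeClose p σm σp β H Q e k t' t) :
    lqn p.toReal (infinitePi fun _ : List ℕ => M.nodeNoise)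
      (fun N => ‖M.valOn t' k N - M.valOn t k N‖ₑ) ≤ e * M.treeErr σm σp β H Q k t := by
  have hq := one_le_toReal hp
  induction k generalizing t' t with
  | zero =>
    refine (lqn_const hq _).le.trans ((h.g_le 0).trans (le_of_eq ?_))
    simp [Recursion.treeErr]
  | succ k ih =>
    have hroot := lqn_root_sub_le hp hgm hg he k h
      (d := fun j => M.treeErr σm σp β H Q k (subtree t j)) fun j hj => ih (h.2 j hj)
    set A' := fun N : List ℕ → Z × (ℕ → Ξ) =>
      appBy M.Φ (t' []) (N []) (fun j => M.valOn (subtree t' j) k (subtree N j))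
    set A := fun N : List ℕ → Z × (ℕ → Ξ) =>
      appBy M.Φ (t []) (N []) (fun j => M.valOn (subtree t j) k (subtree N j))
    set E := stepErr σm β H (t []) (fun j => M.treeBound σm σp β k (subtree t j))
      (fun j => M.treeErr σm σp β H Q k (subtree t j))
    set B := stepBound σm β (t []) (fun j => M.treeBound σm σp β k (subtree t j))
    have hA' : Measurable A' := M.measurable_root_appBy hgm t' k
    have hA : Measurable A := M.measurable_root_appBy hgm t k
    have hdiff : Measurable fun N => ‖A' N - A N‖ₑ := measurable_enorm_sub hA' hA
    have hAB : lqn p.toReal (infinitePi fun _ : List ℕ => M.nodeNoise) (fun N => ‖A N‖ₑ) ≤ B :=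
      lqn_root_le hp hgm k h.1.growth fun j hj => lqn_valOn_le hp hgm hg k (h.2 j hj)
    have e1 : ∀ N, M.valOn t (k + 1) N = M.g (A N) (t []).2 := fun N => rfl
    have e2 : ∀ N, M.valOn t' (k + 1) N = M.g (A' N) (t' []).2 := fun N => rfl
    have hsum : Measurable fun N => ‖A N‖ₑ + ‖A' N - A N‖ₑ := hA.enorm.add hdiff
    simp only [e1, e2]
    calc _ ≤ lqn p.toReal (infinitePi fun _ : List ℕ => M.nodeNoise) (fun N =>
          e * Q * (1 + ENNReal.ofReal (σp (t []).2) * (‖A N‖ₑ + ‖A' N - A N‖ₑ)) +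
            ENNReal.ofReal (σp (t []).2) * ‖A' N - A N‖ₑ) := lqn_mono hq fun N => by
          have h1 : ‖A' N‖ₑ ≤ ‖A N‖ₑ + ‖A' N - A N‖ₑ := by
            refine le_trans (le_of_eq ?_) (enorm_add_le _ _)
            congr 1; ring
          have h2 : M.g (A' N) (t' []).2 - M.g (A N) (t []).2 =
              (M.g (A' N) (t' []).2 - M.g (A' N) (t []).2) +
                (M.g (A' N) (t []).2 - M.g (A N) (t []).2) := by ring
          rw [h2, mul_assoc]
          refine (enorm_add_le _ _).trans (add_le_add ((h.1.modulus.g_le _).trans ?_)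
            (enorm_g_sub_le hg _ _ _))
          gcongr
      _ ≤ e * Q * (1 + ENNReal.ofReal (σp (t []).2) * (B + e * E)) +
            ENNReal.ofReal (σp (t []).2) * (e * E) := by
          have hm1 : Measurable fun N => 1 + ENNReal.ofReal (σp (t []).2) *
              (‖A N‖ₑ + ‖A' N - A N‖ₑ) := measurable_const.add (hsum.const_mul _)
          refine (lqn_add_le hq (hm1.const_mul _) (hdiff.const_mul _)).trans (add_le_add ?_ ?_)
          · rw [lqn_const_mul hq _ hm1]
            refine mul_le_mul_right ((lqn_add_le hq measurable_const (hsum.const_mul _)).trans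
              (add_le_add (lqn_const hq _).le ?_)) _
            rw [lqn_const_mul hq _ hsum]
            exact mul_le_mul_right ((lqn_add_le hq hA.enorm hdiff).trans
              (add_le_add hAB hroot)) _
          · rw [lqn_const_mul hq _ hdiff]
            exact mul_le_mul_right hroot _
      _ ≤ e * Q * (1 + ENNReal.ofReal (σp (t []).2) * (B + E)) +
            ENNReal.ofReal (σp (t []).2) * (e * E) := by
          gcongr
          exact mul_le_of_le_one_left' he
      _ = e * M.treeErr σm σp β H Q (k + 1) t := by
          simp only [Recursion.treeErr]
          ring

/-- The law of the noises on a tree. -/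
def Recursion.treeNoise (M : Recursion S Z Ξ) : Measure ((List ℕ → Z) × (List ℕ → Ξ)) :=
  (infinitePi fun _ : List ℕ => M.vertexNoise).prod (infinitePi fun _ : List ℕ => M.edgeNoise)

instance : IsProbabilityMeasure M.treeNoise := by unfold Recursion.treeNoise; infer_instance

/-- The effect of a perturbation of the marks on `ℛ_∅^(k+1)`. -/
theorem lqn_treeR_sub_le (hp : p ≠ ∞) (hgm : Measurable fun w : ℝ × Mark S => M.g w.1 w.2)
    (hg : ∀ x r r', |M.g r x - M.g r' x| ≤ σp x * |r - r'|) {e : ℝ≥0∞} (he : e ≤ 1) (k : ℕ)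
    {t' t : Tree S} (h : M.TreeClose p σm σp β H Q e (k + 1) t' t) :
    lqn p.toReal M.treeNoise
      (fun w => ‖M.treeR (t', w) 0 (k + 1) - M.treeR (t, w) 0 (k + 1)‖ₑ) ≤
        e * M.rootErr σm σp β H Q k t := by
  have hroot := lqn_root_sub_le hp hgm hg he k h
    (d := fun j => M.treeErr σm σp β H Q k (subtree t j)) fun j hj =>
      lqn_valOn_sub_le hp hgm hg he k (h.2 j hj)
  rw [← M.measurePreserving_nodeNoises.map_eq, lqn_map
    M.measurePreserving_nodeNoises.measurable (measurable_enorm_sub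
      (M.measurable_root_appBy hgm t' k) (M.measurable_root_appBy hgm t k))] at hroot
  have e1 : ∀ t w, M.treeR (t, w) 0 (k + 1) = appBy M.Φ (t []) (nodeNoises w [])
      (fun j => M.valOn (subtree t j) k (subtree (nodeNoises w) j)) := fun t w =>
    M.treeR_succ ((t, w), 0) k
  simp only [e1]
  exact hroot

end Perturbation

/-! ### Unfolding the chain on a tree-like neighborhood -/

section Unfold

open Measure

lemma infinitePi_prod_map_injOn {X Y W α β κ ι : Type*} [MeasurableSpace X] [MeasurableSpace Y]
    [MeasurableSpace W] (μ : Measure X) [IsProbabilityMeasure μ] (ν : Measure Y)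
    [IsProbabilityMeasure ν] {A : Set α} {B : Set β} {f : α → κ} {g : β → ι} (hf : Set.InjOn f A)
    (hg : Set.InjOn g B) {F : (α → X) × (β → Y) → W} (hF : Measurable F)
    (hdep : ∀ w w', (∀ a ∈ A, w.1 a = w'.1 a) → (∀ b ∈ B, w.2 b = w'.2 b) → F w = F w') :
    ((infinitePi fun _ : κ => μ).prod (infinitePi fun _ : ι => ν)).map
        (fun w => F (fun a => w.1 (f a), fun b => w.2 (g b))) =
      ((infinitePi fun _ : α => μ).prod (infinitePi fun _ : β => ν)).map F := by
  classical
  have hX := nonempty_of_isProbabilityMeasure μ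
  have hY := nonempty_of_isProbabilityMeasure ν
  let r : (α → X) → α → X := fun w a => if a ∈ A then w a else Classical.arbitrary X
  let s : (β → Y) → β → Y := fun w b => if b ∈ B then w b else Classical.arbitrary Y
  have hr : Measurable r := measurable_pi_lambda _ fun a => by
    by_cases h : a ∈ A <;> simp only [r, h, if_true, if_false] <;> fun_prop
  have hs : Measurable s := measurable_pi_lambda _ fun b => by
    by_cases h : b ∈ B <;> simp only [s, h, if_true, if_false] <;> fun_prop
  have h1 := infinitePi_map_injOn μ hf hr fun w w' h => funext fun a => by
    by_cases ha : a ∈ A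
    · simp [r, ha, h a ha]
    · simp [r, ha]
  have h2 := infinitePi_map_injOn ν hg hs fun w w' h => funext fun b => by
    by_cases hb : b ∈ B
    · simp [s, hb, h b hb]
    · simp [s, hb]
  have e1 : (fun w : (κ → X) × (ι → Y) => F (fun a => w.1 (f a), fun b => w.2 (g b))) =
      F ∘ Prod.map (fun w => r fun a => w (f a)) (fun w => s fun b => w (g b)) := by
    funext w
    exact hdep _ _ (fun a ha => by simp [r, ha]) fun b hb => by simp [s, hb]
  have e2 : F = F ∘ Prod.map r s := by
    funext w
    exact hdep _ _ (fun a ha => by simp [r, ha]) fun b hb => by simp [s, hb]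
  rw [e1]
  conv_rhs => rw [e2]
  rw [← map_map hF (by fun_prop), ← map_map hF (by fun_prop),
    ← map_prod_map _ _ (by fun_prop) (by fun_prop), ← map_prod_map _ _ hr hs, h1, h2]

variable {S Z Ξ V : Type*} [MeasurableSpace S] [MeasurableSpace Z] [MeasurableSpace Ξ]
  [Fintype V] {M : Recursion S Z Ξ} {G : WDigraph V S} {i : V} {t : Tree S} {k : ℕ}
  {θ : List ℕ → V}

namespace IsTreeIso

lemma edge_eq_one (h : IsTreeIso G i t k θ) {q : List ℕ} {j : ℕ} (hq : InTree t (j :: q))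
    (hk : q.length < k) : G.1 (θ (j :: q)) (θ q) = 1 := by
  rw [h.2.2 (j :: q) ⟨hq, hk⟩ q ⟨hq.1, hk.le⟩, if_pos ⟨j, rfl⟩]

lemma mem_sphere (h : IsTreeIso G i t k θ) {q : List ℕ} (hq : InTree t q) (hk : q.length ≤ k) :
    θ q ∈ sphere G i q.length := by
  induction q with
  | nil => exact h.1
  | cons j q ih =>
    refine ⟨θ q, ih hq.1 (Nat.le_of_succ_le hk), ?_⟩
    rw [h.edge_eq_one hq hk]
    exact Nat.one_pos

lemma exists_child (h : IsTreeIso G i t k θ) {q : List ℕ} (hq : InTree t q) (hk : q.length < k)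
    {v : V} (hv : 0 < G.1 v (θ q)) : ∃ j < (t q).1, θ (j :: q) = v := by
  have hvB : v ∈ inBall G i k :=
    ⟨q.length + 1, hk, θ q, h.mem_sphere hq hk.le, hv⟩
  obtain ⟨q', hq', rfl⟩ := h.2.1.surjOn hvB
  rw [h.2.2 q' hq' q ⟨hq, hk.le⟩] at hv
  split_ifs at hv with hj
  · obtain ⟨j, rfl⟩ := hj
    exact ⟨j, hq'.1.2, rfl⟩
  · exact absurd hv (lt_irrefl 0)

/-- The children of a node correspond to the inbound edges of its image. -/
def childEquiv (h : IsTreeIso G i t k θ) {q : List ℕ} (hq : InTree t q) (hk : q.length < k) :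
    Fin (t q).1 ≃ InEdge G (θ q) :=
  Equiv.ofBijective (fun j => ⟨θ ((j : ℕ) :: q), ⟨0, by
    rw [h.edge_eq_one ⟨hq, j.2⟩ hk]; exact Nat.one_pos⟩⟩) (by
    constructor
    · intro j j' e
      have e1 : θ ((j : ℕ) :: q) = θ ((j' : ℕ) :: q) := congrArg Sigma.fst e
      have := h.2.1.injOn (show (j : ℕ) :: q ∈ treeBall t k from ⟨⟨hq, j.2⟩, hk⟩)
        (show (j' : ℕ) :: q ∈ treeBall t k from ⟨⟨hq, j'.2⟩, hk⟩) e1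
      exact Fin.ext (List.cons.inj this).1
    · rintro ⟨v, l⟩
      obtain ⟨j, hj, rfl⟩ := h.exists_child hq hk (Nat.zero_lt_of_lt l.2)
      refine ⟨⟨j, hj⟩, ?_⟩
      have := l.2
      have h1 := h.edge_eq_one (j := j) ⟨hq, hj⟩ hk
      simp only [Sigma.mk.injEq, heq_eq_eq, true_and]
      exact Fin.ext (by simp only; omega))

lemma inDeg_eq (h : IsTreeIso G i t k θ) {q : List ℕ} (hq : InTree t q) (hk : q.length < k) :
    inDeg G (θ q) = (t q).1 := by
  rw [← card_inEdge, ← Fintype.card_congr (h.childEquiv hq hk), Fintype.card_fin]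

end IsTreeIso

/-- The tree with the marks of the corresponding vertices. -/
def graphTree (G : WDigraph V S) (t : Tree S) (θ : List ℕ → V) : Tree S :=
  fun q => ((t q).1, mark G (θ q))

lemma inTree_graphTree (q : List ℕ) : InTree (graphTree G t θ) q ↔ InTree t q := by
  induction q with
  | nil => rfl
  | cons j q ih => simp [InTree, ih, graphTree]

/-- The noises of the graph that act on the nodes and edges of the tree. -/
def pullNoise (k : ℕ) (θ : List ℕ → V) (e : Noise V Z Ξ) : (List ℕ → Z) × (List ℕ → Ξ) :=
  (fun q => e.1 (k - 1 - q.length, θ q), fun q => e.2 (k - q.length, θ q, θ q.tail, 0))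

lemma IsTreeIso.chain_succ (h : IsTreeIso G i t k θ) (e : Noise V Z Ξ) {s : ℕ} {q : List ℕ}
    (hq : InTree t q) (hk : q.length + (s + 1) = k)
    (ih : ∀ q, InTree t q → q.length + s = k → M.g (M.chain G 0 e s (θ q)) (mark G (θ q)) =
      M.treeV (graphTree G t θ, pullNoise k θ e) 0 s q) :
    M.chain G 0 e (s + 1) (θ q) = M.treeΦ (graphTree G t θ, pullNoise k θ e)
      (M.treeV (graphTree G t θ, pullNoise k θ e) 0 s) q := by
  have hqk : q.length < k := by omega
  simp only [Recursion.chain]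
  rw [← bag_equiv (h.childEquiv hq hqk)]
  have e1 : k - 1 - q.length = s := by omega
  have e2 : k - (q.length + 1) = s := by omega
  unfold Recursion.treeΦ
  simp only [pullNoise, List.length_cons, List.tail_cons, e1, e2]
  congr 2
  funext j
  exact ih (j :: q) ⟨hq, j.2⟩ (by simp only [List.length_cons]; omega)

lemma IsTreeIso.g_chain_eq (h : IsTreeIso G i t k θ) (e : Noise V Z Ξ) (s : ℕ) (q : List ℕ)
    (hq : InTree t q) (hk : q.length + s = k) :
    M.g (M.chain G 0 e s (θ q)) (mark G (θ q)) =
      M.treeV (graphTree G t θ, pullNoise k θ e) 0 s q := by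
  induction s generalizing q with
  | zero => rfl
  | succ s ih => rw [h.chain_succ e hq hk ih]; rfl

lemma IsTreeIso.chain_eq_treeR (h : IsTreeIso G i t (k + 1) θ) (e : Noise V Z Ξ) :
    M.chain G 0 e (k + 1) i = M.treeR (graphTree G t θ, pullNoise (k + 1) θ e) 0 (k + 1) := by
  have := h.chain_succ (M := M) e (s := k) (q := []) trivial (by simp)
    fun q hq hk => h.g_chain_eq e k q hq hk
  rwa [h.1] at this

lemma Recursion.treeV_congr {w w' : (List ℕ → Z) × (List ℕ → Ξ)}
    (h1 : ∀ q, InTree t q → q.length < k → w.1 q = w'.1 q)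
    (h2 : ∀ q, InTree t q → q ≠ [] → q.length ≤ k → w.2 q = w'.2 q) (s : ℕ) (q : List ℕ)
    (hq : InTree t q) (hk : q.length + s ≤ k) :
    M.treeV (t, w) 0 s q = M.treeV (t, w') 0 s q := by
  induction s generalizing q with
  | zero => rfl
  | succ s ih =>
    simp only [Recursion.treeV, Recursion.treeΦ]
    rw [h1 q hq (by omega)]
    congr 3
    · funext j
      exact ih (j :: q) ⟨hq, j.2⟩ (by simp only [List.length_cons]; omega)
    · funext j
      exact h2 (j :: q) ⟨hq, j.2⟩ (List.cons_ne_nil _ _) (by simp only [List.length_cons]; omega)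

lemma Recursion.treeR_congr {w w' : (List ℕ → Z) × (List ℕ → Ξ)}
    (h1 : ∀ q, InTree t q → q.length < k + 1 → w.1 q = w'.1 q)
    (h2 : ∀ q, InTree t q → q ≠ [] → q.length ≤ k + 1 → w.2 q = w'.2 q) :
    M.treeR (t, w) 0 (k + 1) = M.treeR (t, w') 0 (k + 1) := by
  simp only [Recursion.treeR, Recursion.treeΦ]
  rw [h1 [] trivial (Nat.succ_pos k)]
  congr 2
  · funext j
    exact Recursion.treeV_congr h1 h2 k [(j : ℕ)] ⟨trivial, j.2⟩ (by simp [add_comm])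
  · funext j
    exact h2 [(j : ℕ)] ⟨trivial, j.2⟩ (List.cons_ne_nil _ _) (by simp)

lemma Recursion.measurable_treeR_succ (hg : Measurable fun w : ℝ × Mark S => M.g w.1 w.2) (k : ℕ) :
    Measurable fun z : NoisyTree S Z Ξ × (List ℕ → ℝ) => M.treeR z.1 z.2 (k + 1) := by
  have hl : Measurable (label (S := S) (Z := Z) (Ξ := Ξ)) := by unfold label; fun_prop
  have hs : Measurable fun (z : NoisyTree S Z Ξ × (List ℕ → ℝ)) (j : ℕ) =>
      M.val k (subtree (label z) j) :=
    (measurable_comp_subtree (M.measurable_val hg k)).comp hl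
  have h := M.measurableApp_Φ.comp (y := fun z : NoisyTree S Z Ξ × (List ℕ → ℝ) => (label z []).1)
    (n := fun z => (label z []).2.1) (by fun_prop) (by fun_prop) hs
  convert h using 2
  exact M.treeR_succ _ k

/-- On a tree-like neighborhood, the chain has the law of the recursion on the tree. -/
theorem IsTreeIso.map_chain (h : IsTreeIso G i t (k + 1) θ)
    (hg : Measurable fun w : ℝ × Mark S => M.g w.1 w.2) :
    M.treeNoise.map (fun w => M.treeR (graphTree G t θ, w) 0 (k + 1)) =
      (M.noiseLaw V).map fun e => M.chain G 0 e (k + 1) i := by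
  simp only [h.chain_eq_treeR]
  refine (infinitePi_prod_map_injOn M.vertexNoise M.edgeNoise
    (A := {q | InTree t q ∧ q.length < k + 1}) (B := {q | InTree t q ∧ q ≠ [] ∧ q.length ≤ k + 1})
    (f := fun q => (k + 1 - 1 - q.length, θ q))
    (g := fun q => (k + 1 - q.length, θ q, θ q.tail, 0)) ?_ ?_
    (F := fun w => M.treeR (graphTree G t θ, w) 0 (k + 1)) ?_ ?_).symm
  · intro q hq q' hq' e
    exact h.2.1.injOn (show q ∈ treeBall t (k + 1) from ⟨hq.1, hq.2.le⟩)
      (show q' ∈ treeBall t (k + 1) from ⟨hq'.1, hq'.2.le⟩) (congrArg Prod.snd e)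
  · intro q hq q' hq' e
    exact h.2.1.injOn (show q ∈ treeBall t (k + 1) from ⟨hq.1, hq.2.2⟩)
      (show q' ∈ treeBall t (k + 1) from ⟨hq'.1, hq'.2.2⟩)
      (congrArg (fun z => z.2.1) e)
  · exact (Recursion.measurable_treeR_succ hg k).comp
      (f := fun w => ((graphTree G t θ, w), (0 : List ℕ → ℝ))) (by fun_prop)
  · intro w w' h1 h2
    exact Recursion.treeR_congr (fun q hq hk => h1 q ⟨(inTree_graphTree q).1 hq, hk⟩)
      fun q hq h0 hk => h2 q ⟨(inTree_graphTree q).1 hq, h0, hk⟩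

end Unfold

/-! ### Consequences of the assumptions on the maps -/

section Assumptions

variable {S Z Ξ : Type*} [MetricSpace S] [MeasurableSpace S] [MeasurableSpace Z]
  [MeasurableSpace Ξ] {M : Recursion S Z Ξ} {p : ℝ≥0∞} [hp1 : Fact (1 ≤ p)]
  {σm σp β : Mark S → ℝ} {K K₀ : ℝ} {G : GraphSeq S} {root child : Measure (ℕ × Mark S)}

lemma Recursion.Regular.continuous_g (hM : M.Regular p σm σp β K K₀ G root child) (r : ℝ) :
    Continuous fun x => M.g r x := by
  obtain ⟨H, Q, α, γ, hH, hQ, hα, hγ, h⟩ := hM.continuity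
  refine continuous_iff_continuousAt.2 fun x => ?_
  have hc : Continuous fun x' => rho x x' :=
    continuous_rho.comp (f := fun x' => (x, x')) (by fun_prop)
  have h0 : rho x x = 0 := by simp [rho]
  have hlim : Tendsto (fun x' => Q * max 1 (σp x * |r|) * rho x x' ^ γ) (𝓝 x) (𝓝 0) := by
    have : ContinuousAt (fun x' => Q * max 1 (σp x * |r|) * rho x x' ^ γ) x :=
      (hc.continuousAt.rpow_const (Or.inr hγ.le)).const_mul _
    have h1 := this.tendsto
    simpa [h0, Real.zero_rpow hγ.ne'] using h1
  rw [ContinuousAt, tendsto_iff_dist_tendsto_zero]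
  refine squeeze_zero' (Eventually.of_forall fun _ => dist_nonneg) ?_ hlim
  have hlt : ∀ᶠ x' in 𝓝 x, rho x x' < 1 := 
    hc.continuousAt.eventually_lt_const (show rho x x < 1 by rw [h0]; exact one_pos)
  filter_upwards [hlt] with x' hx'
  rw [dist_comm, Real.dist_eq]
  exact (h x x' hx').2 r

variable [BorelSpace S] [TopologicalSpace.SeparableSpace S]

lemma Recursion.Regular.measurable_g (hM : M.Regular p σm σp β K K₀ G root child) :
    Measurable fun w : ℝ × Mark S => M.g w.1 w.2 := by
  refine measurable_uncurry_of_continuous_of_measurable (u := M.g) (fun x => ?_) fun r =>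
    measurable_of_continuous_mark (hM.continuous_g r)
  have : LipschitzWith (Real.toNNReal (σp x)) fun r => M.g r x := by
    refine LipschitzWith.of_dist_le_mul fun r r' => ?_
    rw [Real.coe_toNNReal _ (nonneg_of_lipschitz M hM.lipschitz_g x)]
    exact hM.lipschitz_g x r r'
  exact this.continuous

lemma Recursion.Regular.treeRegular (hM : M.Regular p σm σp β K K₀ G root child)
    (hG : G.Regular M p σm σp β root child) (hμ₀ : MemLp id p M.initial) :
    M.TreeRegular p σm σp β root child where
  measurable_g := hM.measurable_g
  measurable_σm := measurable_of_continuous_mark hM.continuous_σm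
  measurable_σp := measurable_of_continuous_mark hM.continuous_σp
  measurable_β := measurable_of_continuous_mark hM.continuous_β
  lipschitz_g := hM.lipschitz_g
  lipschitz_root := hM.lipschitz_root
  lipschitz_child := hM.lipschitz_child
  growth_root := hM.growth_root
  growth_child := hM.growth_child
  root_σm := hG.root_σm
  root_β := hG.root_β
  child_σβ := hG.child_σβ
  child_σp := hG.child_σp
  child_g := hG.child_g
  initial := hμ₀

lemma Recursion.Regular.ae_graphRegular (hM : M.Regular p σm σp β K K₀ G root child) (n : ℕ) :
    ∀ᵐ ω ∂G.P n, M.GraphRegular p σm σp β K K₀ (G.graph n ω) := by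
  filter_upwards [hM.lipschitz_graph n, hM.growth_graph n, hM.norm_C n, hM.norm_C0 n]
    with ω h1 h2 h3 h4 using ⟨h1, h2, h3, h4⟩

/-- The contraction constant of the tree recursion. -/
lemma lqn_lipΨ_lt_one (hp : p ≠ ∞)
    (h : eLpNorm (fun y : ℕ × Mark S => (y.1 : ℝ) * σm y.2 * σp y.2) p child < 1) :
    lqn p.toReal child (fun y => y.1 * lipΨ σm σp y) < 1 := by
  rw [lqn_eq_eLpNorm hp] at h
  refine lt_of_le_of_lt (lqn_mono (one_le_toReal hp) fun y => ?_) h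
  rw [enorm_mul, enorm_mul, lipΨ, mul_assoc, mul_comm (ENNReal.ofReal (σp y.2))]
  refine mul_le_mul' (le_of_eq ?_) (mul_le_mul' (ofReal_le_enorm _) (ofReal_le_enorm _))
  rw [Real.enorm_of_nonneg (Nat.cast_nonneg _), ENNReal.ofReal_natCast]

/-- The maps at close marks are close. -/
lemma Recursion.Regular.exists_modulus (hp : p ≠ ∞)
    (hM : M.Regular p σm σp β K K₀ G root child) :
    ∃ H Q : ℝ≥0∞, H ≠ ∞ ∧ Q ≠ ∞ ∧ ∀ e : ℝ≥0∞, 0 < e → ∃ ε : ℝ, 0 < ε ∧ ε < 1 ∧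
      ∀ x' x : Mark S, rho x' x ≤ ε → M.Modulus p σm σp β H Q e x' x := by
  obtain ⟨H, Q, α, γ, hH, hQ, hα, hγ, h⟩ := hM.continuity
  refine ⟨ENNReal.ofReal H, ENNReal.ofReal Q, ENNReal.ofReal_ne_top, ENNReal.ofReal_ne_top,
    fun e he => ?_⟩
  have hlim : ∀ a : ℝ, 0 < a → ∀ᶠ ε : ℝ in 𝓝[>] 0, ENNReal.ofReal (ε ^ a) ≤ e := by
    intro a ha
    have h1 : Tendsto (fun ε : ℝ => ENNReal.ofReal (ε ^ a)) (𝓝 0) (𝓝 0) := by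
      have := (ENNReal.continuous_ofReal.comp
        (Real.continuous_rpow_const ha.le)).tendsto (0 : ℝ)
      simpa [Real.zero_rpow ha.ne', Function.comp_def] using this
    exact (h1.mono_left nhdsWithin_le_nhds).eventually (ge_mem_nhds he)
  have h1 : ∀ᶠ ε : ℝ in 𝓝[>] 0, ε < 1 := nhdsWithin_le_nhds (Iio_mem_nhds one_pos)
  obtain ⟨ε, h2, h3, h4, h5⟩ :=
    ((hlim α hα).and ((hlim γ hγ).and (h1.and self_mem_nhdsWithin))).exists
  refine ⟨ε, h5, h4, fun x' x hx => ?_⟩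
  rw [rho_comm] at hx
  have hr := rho_nonneg x x'
  obtain ⟨hΦ, hg⟩ := h x x' (hx.trans_lt h4)
  have hmax : ∀ a : ℝ, ENNReal.ofReal (max 1 a) ≤ 1 + ENNReal.ofReal a := fun a => by
    rcases le_total 1 a with h | h
    · rw [max_eq_right h]; exact le_add_self
    · rw [max_eq_left h, ENNReal.ofReal_one]; exact le_self_add
  have hmax0 : ∀ a : ℝ, (0 : ℝ) ≤ max 1 a := fun a => zero_le_one.trans (le_max_left _ _)
  have key : ∀ (c a d b : ℝ), 0 ≤ c → rho x x' ^ d ≤ ε ^ d → ENNReal.ofReal (ε ^ d) ≤ e →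
      b ≤ c * max 1 a * rho x x' ^ d →
      ENNReal.ofReal b ≤ e * (ENNReal.ofReal c * (1 + ENNReal.ofReal a)) := by
    intro c a d b hc hd hd' hb
    refine (ENNReal.ofReal_le_ofReal hb).trans ?_
    rw [ENNReal.ofReal_mul (mul_nonneg hc (hmax0 a)), ENNReal.ofReal_mul hc, mul_comm]
    exact mul_le_mul' ((ENNReal.ofReal_le_ofReal hd).trans hd') (mul_le_mul_right (hmax a) _)
  have hα' : rho x x' ^ α ≤ ε ^ α := Real.rpow_le_rpow hr hx hα.le
  have hγ' : rho x x' ^ γ ≤ ε ^ γ := Real.rpow_le_rpow hr hx hγ.le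
  refine ⟨fun u => ?_, fun r => ?_⟩
  · have h6 := lqn_le_of_memLp hp (M.measurePreserving_nodeNoise x.1)
      (f := fun e : Z × (Fin x.1 → Ξ) => M.Φ x e.1 (bag (fun j : Fin x.1 => u j) e.2) -
        M.Φ x' e.1 (bag (fun j : Fin x.1 => u j) e.2))
      ((M.measurable_Φ_fintype (by fun_prop) (by fun_prop) (by fun_prop) (by fun_prop)).sub
        (M.measurable_Φ_fintype (by fun_prop) (by fun_prop) (by fun_prop) (by fun_prop)))
      ⟨(hΦ _).1, le_rfl⟩
    simp only [enorm_sub_rev (appBy M.Φ (x.1, x') _ u)]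
    refine h6.trans ((key H _ α _ hH.le hα' h2 (hΦ _).2).trans ?_)
    gcongr
    refine (ofReal_mul_sum_abs_add (σm x) (β x) fun j : Fin x.1 => u j).trans ?_
    rw [Fin.sum_univ_eq_sum_range (fun j => ‖u j‖ₑ)]
  · rw [enorm_sub_rev, ← ofReal_norm, Real.norm_eq_abs]
    refine (key Q _ γ _ hQ.le hγ' h3 (hg r)).trans (le_of_eq ?_)
    rw [ENNReal.ofReal_mul (nonneg_of_lipschitz M hM.lipschitz_g x), ← Real.norm_eq_abs,
      ofReal_norm]

end Assumptions

/-! ### Laws of pairs -/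

section Pairs

lemma map_compProd_congr {Ω X X' α E : Type*} [MeasurableSpace Ω] [MeasurableSpace X]
    [MeasurableSpace X'] [MeasurableSpace α] [MeasurableSpace E] {P : Measure Ω}
    [IsProbabilityMeasure P] {κ : Kernel Ω X} [IsMarkovKernel κ] {κ' : Kernel Ω X'}
    [IsMarkovKernel κ'] {a : Ω → α} (ha : Measurable a) {A : Ω → X → E} {A' : Ω → X' → E}
    (hA : Measurable fun z : Ω × X => A z.1 z.2) (hA' : Measurable fun z : Ω × X' => A' z.1 z.2)
    (h : ∀ᵐ ω ∂P, (κ ω).map (A ω) = (κ' ω).map (A' ω)) :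
    (P ⊗ₘ κ).map (fun z => (a z.1, A z.1 z.2)) =
      (P ⊗ₘ κ').map (fun z => (a z.1, A' z.1 z.2)) := by
  refine Measure.ext_of_lintegral _ fun f hf => ?_
  have hm : ∀ ω, Measurable (A ω) := fun ω => hA.comp measurable_prodMk_left
  have hm' : ∀ ω, Measurable (A' ω) := fun ω => hA'.comp measurable_prodMk_left
  have hfa : ∀ ω, Measurable fun y : E => f (a ω, y) := fun ω => hf.comp measurable_prodMk_left
  have h1 : Measurable fun z : Ω × X => (a z.1, A z.1 z.2) :=
    (ha.comp measurable_fst).prodMk hA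
  have h1' : Measurable fun z : Ω × X' => (a z.1, A' z.1 z.2) :=
    (ha.comp measurable_fst).prodMk hA'
  rw [lintegral_map hf h1, lintegral_map hf h1',
    Measure.lintegral_compProd (show Measurable fun z => f (a z.1, A z.1 z.2) from hf.comp h1),
    Measure.lintegral_compProd (show Measurable fun z => f (a z.1, A' z.1 z.2) from hf.comp h1')]
  refine lintegral_congr_ae ?_
  filter_upwards [h] with ω hω
  change ∫⁻ x, f (a ω, A ω x) ∂κ ω = ∫⁻ x, f (a ω, A' ω x) ∂κ' ω
  rw [← lintegral_map (hfa ω) (hm ω), hω, lintegral_map (hfa ω) (hm' ω)]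

lemma map_prod_congr {Ω X X' α E : Type*} [MeasurableSpace Ω] [MeasurableSpace X]
    [MeasurableSpace X'] [MeasurableSpace α] [MeasurableSpace E] {P : Measure Ω}
    [IsProbabilityMeasure P] {ν : Measure X} [IsProbabilityMeasure ν] {ν' : Measure X'}
    [IsProbabilityMeasure ν'] {a : Ω → α} (ha : Measurable a) {A : Ω → X → E} {A' : Ω → X' → E}
    (hA : Measurable fun z : Ω × X => A z.1 z.2) (hA' : Measurable fun z : Ω × X' => A' z.1 z.2)
    (h : ∀ᵐ ω ∂P, ν.map (A ω) = ν'.map (A' ω)) :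
    (P.prod ν).map (fun z => (a z.1, A z.1 z.2)) =
      (P.prod ν').map (fun z => (a z.1, A' z.1 z.2)) := by
  have := map_compProd_congr (κ := Kernel.const Ω ν) (κ' := Kernel.const Ω ν') ha hA hA'
    (by simpa using h)
  simpa only [Measure.compProd_const] using this

/-- A function of an independent variable has a constant conditional law. -/
lemma condDistrib_of_indep {Ω X T α : Type*} [MeasurableSpace Ω] [MeasurableSpace X]
    [MeasurableSpace T] [MeasurableSpace α] {P : Measure Ω} [IsProbabilityMeasure P]
    {ν : Measure X} [IsProbabilityMeasure ν] {a : Ω → α} (ha : Measurable a) {t : Ω → T}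
    (ht : Measurable t) (hind : IndepFun t a P) {F : T × X → ℝ} (hF : Measurable F) :
    ∀ᵐ x ∂P.map a, condDistrib (fun z : Ω × X => F (t z.1, z.2)) (fun z => a z.1) (P.prod ν) x =
      ((P.map t).prod ν).map F := by
  have : IsProbabilityMeasure (P.map t) := Measure.isProbabilityMeasure_map ht.aemeasurable
  have hB : Measurable fun z : Ω × X => F (t z.1, z.2) := hF.comp (by fun_prop)
  have : IsProbabilityMeasure (((P.map t).prod ν).map F) :=
    Measure.isProbabilityMeasure_map hF.aemeasurable
  have e1 : (P.prod ν).map (fun z => a z.1) = P.map a := by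
    have := Measure.map_map (μ := P.prod ν) ha measurable_fst
    simp only [Measure.map_fst_prod, measure_univ, one_smul] at this
    exact this.symm
  have h := condDistrib_ae_eq_of_measure_eq_compProd (μ := P.prod ν) (fun z : Ω × X => a z.1)
    (Y := fun z : Ω × X => F (t z.1, z.2)) hB.aemeasurable
    (κ := Kernel.const α (((P.map t).prod ν).map F)) ?_
  · rw [e1] at h
    filter_upwards [h] with x hx
    rw [hx, Kernel.const_apply]
  · rw [e1, Measure.compProd_const]
    have h2 := (indepFun_iff_map_prod_eq_prod_map_map ha.aemeasurable ht.aemeasurable).1 hind.symm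
    have h3 : (P.map a).prod (((P.map t).prod ν).map F) =
        ((P.map a).prod ((P.map t).prod ν)).map (Prod.map id F) := by
      rw [← Measure.map_prod_map _ _ measurable_id hF, Measure.map_id]
    have h4 : (P.map fun ω => (a ω, t ω)).prod ν =
        (P.prod ν).map (Prod.map (fun ω => (a ω, t ω)) id) := by
      rw [← Measure.map_prod_map _ _ (ha.prodMk ht) measurable_id, Measure.map_id]
    rw [h3, ← (measurePreserving_prodAssoc (P.map a) (P.map t) ν).map_eq, ← h2, h4,
      Measure.map_map (measurable_id.prodMap hF) MeasurableEquiv.prodAssoc.measurable,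
      Measure.map_map ((measurable_id.prodMap hF).comp MeasurableEquiv.prodAssoc.measurable)
        ((ha.prodMk ht).prodMap measurable_id)]
    rfl

end Pairs

/-! ### Consequences of the strong coupling -/

section Coupling

variable {S Z Ξ : Type*} [MetricSpace S] [MeasurableSpace S] [MeasurableSpace Z]
  [MeasurableSpace Ξ] [BorelSpace S] [TopologicalSpace.SeparableSpace S]
  {M : Recursion S Z Ξ} {p : ℝ≥0∞} [hp1 : Fact (1 ≤ p)]
  {σm σp β : Mark S → ℝ} {K K₀ : ℝ} {G : GraphSeq S} {root child : Measure (ℕ × Mark S)}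

/-- The marks of the first `k` generations are `ε`-close to those of the tree. -/
def MarksClose {V : Type*} [Fintype V] (H : WDigraph V S) (t : Tree S) (k : ℕ) (θ : List ℕ → V)
    (ε : ℝ) : Prop :=
  ∀ q ∈ treeBall t k, rho (mark H (θ q)) (t q).2 ≤ ε

lemma measurableSet_marksClose {V : Type*} [Fintype V] [MeasurableSpace V]
    [DiscreteMeasurableSpace V] {Ω : Type*} [MeasurableSpace Ω] {H : Ω → WDigraph V S}
    (hH : Measurable H) {t : Ω → Tree S} (ht : Measurable t) {θ : Ω → List ℕ → V}
    (hθ : Measurable θ) (k : ℕ) (ε : ℝ) :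
    MeasurableSet {ω | MarksClose (H ω) (t ω) k (θ ω) ε} := by
  have h3 : ∀ q, Measurable fun ω => rho (mark (H ω) (θ ω q)) (t ω q).2 ≤ ε := by
    intro q
    have h0 : Measurable fun ω => θ ω q := (measurable_pi_apply q).comp hθ
    have h1 : Measurable fun ω => mark (H ω) (θ ω q) :=
      measurable_vertex hH h0 (f := fun H i => mark H i) fun i => measurable_mark i
    have h2 : Measurable fun ω => (t ω q).2 :=
      measurable_snd.comp ((measurable_pi_apply q).comp ht)
    have h5 : Measurable fun ω => rho (mark (H ω) (θ ω q)) (t ω q).2 :=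
      measurable_rho.comp (f := fun ω => (mark (H ω) (θ ω q), (t ω q).2)) (h1.prodMk h2)
    exact (measurableSet_setOfPred.1 (measurableSet_Iic (a := ε))).comp h5
  have h4 : ∀ q, Measurable fun ω => q ∈ treeBall (t ω) k := fun q =>
    (measurable_mem_treeBall k q).comp ht
  exact measurableSet_setOfPred.2 (Measurable.forall fun q => (h4 q).imp (h3 q))

/-- The unconditional form of the strong coupling. -/
lemma GraphSeq.AdmitsStrongCoupling.exists_tendsto (h : G.AdmitsStrongCoupling root child) {k : ℕ}
    (hk : 1 ≤ k) :
    ∃ (T : ∀ n, G.Ω n → Tree S) (θ : ∀ n, G.Ω n → List ℕ → Vert n),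
      (∀ n, Measurable (T n)) ∧ (∀ n, Measurable (θ n)) ∧
      (∀ n, (G.P n).map (T n) = gwLaw root child) ∧
      (∀ n, IndepFun (T n) (G.attr n) (G.P n)) ∧
      Tendsto (fun n => G.P n {ω | ¬ IsTreeIso (G.graph n ω) (G.I n ω) (T n ω) k (θ n ω)})
        atTop (𝓝 0) ∧
      ∀ ε : ℝ, 0 < ε → ε < 1 → Tendsto (fun n =>
        G.P n {ω | ¬ MarksClose (G.graph n ω) (T n ω) k (θ n ω) ε}) atTop (𝓝 0) := by
  obtain ⟨T, θ, hT, hθ, hlaw, hind, h1, -, h2⟩ := h k hk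
  exact ⟨T, θ, hT, hθ, hlaw, hind,
    GraphSeq.tendsto_measure_of_condLExp (fun n => (measurableSet_isTreeIso (G.measurable_graph n)
      (G.measurable_I n) (hT n) (hθ n) k).compl) h1,
    fun ε hε hε1 => GraphSeq.tendsto_measure_compl_of_condLExp
      (fun n => measurableSet_marksClose (G.measurable_graph n) (hT n) (hθ n) k ε) (h2 ε hε hε1)⟩

variable [IsProbabilityMeasure root] [IsProbabilityMeasure child]

lemma gwLaw_map_root : (gwLaw root child).map (fun t => t []) = root := by
  have (q : List ℕ) : IsProbabilityMeasure (if q = [] then root else child) := by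
    split_ifs <;> infer_instance
  have := Measure.infinitePi_map_eval (fun q : List ℕ => if q = [] then root else child) []
  simpa [gwLaw] using this

lemma gwLaw_ae {q : List ℕ} {A : ℕ × Mark S → Prop} (h : ∀ᵐ y ∂root, A y) (h' : ∀ᵐ y ∂child, A y) :
    ∀ᵐ t ∂gwLaw root child, A (t q) := by
  have (q : List ℕ) : IsProbabilityMeasure (if q = [] then root else child) := by
    split_ifs <;> infer_instance
  have e := Measure.infinitePi_map_eval (fun q : List ℕ => if q = [] then root else child) q
  refine ae_of_ae_map (f := fun t : Tree S => t q) (measurable_pi_apply q).aemeasurable ?_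
  rw [gwLaw, e]
  split_ifs <;> assumption

lemma GraphSeq.AdmitsStrongCoupling.tight (h : G.AdmitsStrongCoupling root child) {b : Mark S → ℝ}
    (hb : Continuous b) : G.Tight b := by
  obtain ⟨T, θ, hT, -, hlaw, -, h1, h2⟩ := h.exists_tendsto le_rfl
  have hr : Measurable fun t : Tree S => (t []).2 := by fun_prop
  have : IsProbabilityMeasure ((gwLaw root child).map fun t => (t []).2) := by
    rw [← hlaw 0, Measure.map_map hr (hT 0)]
    exact Measure.isProbabilityMeasure_map (hr.comp (hT 0)).aemeasurable
  refine GraphSeq.tight_of_coupling (X := fun n ω => (T n ω []).2) (fun n => hr.comp (hT n))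
    (μ := (gwLaw root child).map fun t => (t []).2)
    (fun n => by rw [← hlaw n, Measure.map_map hr (hT n)]; rfl) (fun ε hε hε1 => ?_) hb
  have h3 := h1.add (h2 ε hε hε1)
  rw [add_zero] at h3
  refine tendsto_of_tendsto_of_tendsto_of_le_of_le tendsto_const_nhds h3 (fun _ => bot_le)
    fun n => (measure_mono fun ω hω => ?_).trans (measure_union_le _ _)
  by_contra hc
  simp only [Set.mem_union, Set.mem_ofPred_eq, not_or, not_not] at hc
  have h4 := hc.2 [] ⟨trivial, Nat.zero_le _⟩
  rw [hc.1.1] at h4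
  exact absurd hω (not_lt.2 h4)

/-- In the limit, the offspring number of the root is the in-degree in its mark. -/
lemma GraphSeq.AdmitsStrongCoupling.root_degree_eq (h : G.AdmitsStrongCoupling root child) :
    ∀ᵐ y ∂root, y.1 = y.2.1 := by
  obtain ⟨T, θ, hT, -, hlaw, -, h1, h2⟩ := h.exists_tendsto le_rfl
  have h3 := h1.add (h2 (1 / 2) (by norm_num) (by norm_num))
  rw [add_zero] at h3
  have hA : MeasurableSet {y : ℕ × Mark S | ¬ y.1 = y.2.1} :=
    (measurableSet_eq_fun (by fun_prop) (by fun_prop)).compl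
  rw [ae_iff, ← nonpos_iff_eq_zero]
  refine ge_of_tendsto' h3 fun n => ?_
  rw [← gwLaw_map_root (root := root) (child := child), Measure.map_apply (by fun_prop) hA,
    ← hlaw n, Measure.map_apply (hT n) (hA.preimage (by fun_prop))]
  refine (measure_mono fun ω hω => ?_).trans (measure_union_le _ _)
  by_contra hc
  simp only [Set.mem_union, Set.mem_ofPred_eq, not_or, not_not] at hc
  have h4 := hc.2 [] ⟨trivial, Nat.zero_le _⟩
  refine hω ?_
  rw [← (rho_lt_one (h4.trans_lt (by norm_num))).1]
  exact (hc.1.inDeg_eq (q := []) trivial Nat.one_pos).symm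

lemma lqn_map_root_σm_ne_top (hp : p ≠ ∞) (hM : M.Regular p σm σp β K K₀ G root child)
    (hG : G.Regular M p σm σp β root child) :
    lqn p.toReal (root.map fun y => σm y.2 * (y.2.1 : ℝ)) (fun x => ‖x‖ₑ) ≠ ∞ := by
  have hσ := measurable_of_continuous_mark hM.continuous_σm
  have hc : Measurable fun n : ℕ => (n : ℝ) := measurable_from_top
  rw [lqn_map (by fun_prop) measurable_enorm]
  refine ne_top_of_le_ne_top hG.root_σm.eLpNorm_ne_top ?_
  rw [lqn_eq_eLpNorm hp]
  refine lqn_mono_ae (one_le_toReal hp) ?_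
  filter_upwards [hG.strongCoupling.root_degree_eq] with y hy
  rw [← hy, mul_comm]

lemma unifInt_degree (hp : p ≠ ∞) (hM : M.Regular p σm σp β K K₀ G root child)
    (hG : G.Regular M p σm σp β root child) :
    G.UnifInt p.toReal fun _ H i => ENNReal.ofReal (σm (mark H i)) * (inDeg H i : ℝ≥0∞) := by
  have hσ := measurable_of_continuous_mark hM.continuous_σm
  have hc : Measurable fun n : ℕ => (n : ℝ) := measurable_from_top
  refine (GraphSeq.unifInt_of_tendsto hp (φ := fun x => σm x * (x.1 : ℝ)) (by fun_prop)
    (lqn_map_root_σm_ne_top hp hM hG) hG.tendsto_σm).mono (one_le_toReal hp)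
    fun n => Eventually.of_forall fun ω i => ?_
  rw [enorm_mul, ← ENNReal.ofReal_natCast]
  exact mul_le_mul' (ofReal_le_enorm _) (ofReal_le_enorm _)

lemma unifInt_driftBound (hp : p ≠ ∞) (hM : M.Regular p σm σp β K K₀ G root child)
    (hG : G.Regular M p σm σp β root child) :
    G.UnifInt p.toReal fun _ H i => M.driftBound σm β H i := by
  have hq := one_le_toReal hp
  have hσ := measurable_of_continuous_mark hM.continuous_σm
  have hβ := measurable_of_continuous_mark hM.continuous_β
  have hg0 : Continuous fun x => |M.g 0 x| := (hM.continuous_g 0).abs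
  have hg0' := measurable_of_continuous_mark hg0
  have h1 : G.UnifInt p.toReal fun _ H i => edgeSum σm (fun x => |M.g 0 x|) H (fun _ => 1) i :=
    GraphSeq.UnifInt.edgeSum_vec hp hσ hg0' (fun _ => abs_nonneg _) hM.norm_C0
      (hG.strongCoupling.tight hg0) (unifInt_degree hp hM hG) (w := fun _ _ _ => 1)
      (fun _ _ => measurable_const) (fun _ _ _ => ENNReal.one_ne_top)
      (by simpa using GraphSeq.UnifInt.const (G := G) hq 1)
  have h2 : G.UnifInt p.toReal fun _ H i => ENNReal.ofReal (β (mark H i)) := by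
    refine (GraphSeq.unifInt_of_tendsto hp hβ ?_ hG.tendsto_β).mono hq
      fun n => Eventually.of_forall fun ω i => ofReal_le_enorm _
    rw [lqn_map (by fun_prop) measurable_enorm]
    exact lqn_ne_top_of_memLp hp hG.root_β fun _ => le_rfl
  exact h1.add hq h2 (fun n i => measurable_edgeSum hσ hg0' (fun _ => measurable_const) i)
    fun n i => (hβ.comp (measurable_mark i)).ennreal_ofReal

lemma unifInt_momentBound (hp : p ≠ ∞) (hM : M.Regular p σm σp β K K₀ G root child)
    (hG : G.Regular M p σm σp β root child) (k : ℕ) :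
    G.UnifInt p.toReal fun _ H i => M.momentBound σm σp β k H i := by
  have hq := one_le_toReal hp
  have hσ := measurable_of_continuous_mark hM.continuous_σm
  have hσp := measurable_of_continuous_mark hM.continuous_σp
  have hβ := measurable_of_continuous_mark hM.continuous_β
  have hm : ∀ (n : ℕ) k (i : Vert n), Measurable fun H => M.momentBound σm σp β k H i :=
    fun n => M.measurable_momentBound hM.measurable_g hσ hσp hβ
  induction k with
  | zero => simpa [Recursion.momentBound] using GraphSeq.UnifInt.const (G := G) hq 0
  | succ k ih =>
    refine GraphSeq.UnifInt.add hq (GraphSeq.UnifInt.edgeSum_vec hp hσ hσp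
      (nonneg_of_lipschitz M hM.lipschitz_g) hM.norm_C (hG.strongCoupling.tight hM.continuous_σp)
      (unifInt_degree hp hM hG) (fun n i => hm n k i)
      (fun n H i => M.momentBound_ne_top k H i) ih) (unifInt_driftBound hp hM hG)
      (fun n i => measurable_edgeSum hσ hσp (hm n k) i)
      fun n i => M.measurable_driftBound hM.measurable_g hσ hβ i

end Coupling

/-! ### Comparison of the chain with the tree recursion -/

section Comparison

variable {S Z Ξ : Type*} [MetricSpace S] [MeasurableSpace S] [MeasurableSpace Z]
  [MeasurableSpace Ξ] {M : Recursion S Z Ξ}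

lemma Recursion.treeRLaw_zeroStart (hg : Measurable fun w : ℝ × Mark S => M.g w.1 w.2)
    (root child : Measure (ℕ × Mark S)) [IsProbabilityMeasure root] [IsProbabilityMeasure child]
    (k : ℕ) :
    M.zeroStart.treeRLaw root child (k + 1) =
      ((gwLaw root child).prod M.treeNoise).map fun τ => M.treeR τ 0 (k + 1) := by
  have e : (M.zeroStart.noisyTreeLaw root child).prod
      (Measure.infinitePi fun _ : List ℕ => M.zeroStart.initial) =
      (M.noisyTreeLaw root child).map fun τ => (τ, (0 : List ℕ → ℝ)) := by
    change (M.noisyTreeLaw root child).prod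
      (Measure.infinitePi fun _ : List ℕ => Measure.dirac (0 : ℝ)) = _
    rw [Measure.infinitePi_dirac, Measure.prod_dirac]
    rfl
  have hm : Measurable fun z : NoisyTree S Z Ξ × (List ℕ → ℝ) =>
      M.zeroStart.treeR z.1 z.2 (k + 1) := Recursion.measurable_treeR_succ (M := M.zeroStart) hg k
  rw [Recursion.treeRLaw, e, Measure.map_map hm (by fun_prop)]
  refine congrArg₂ Measure.map (funext fun τ => ?_) rfl
  simp only [Function.comp_apply, Recursion.treeR]
  rw [show M.zeroStart.treeV τ 0 k = M.treeV τ 0 k from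
    funext fun q => M.treeV_zeroStart τ 0 k q]
  rfl

/-- The conditional law given the attributes of the component at the uniformly chosen vertex of the
chain started from `0`. -/
def GraphSeq.chainMarginal (G : GraphSeq S) (M : Recursion S Z Ξ) (k n : ℕ) (ω : G.Ω n) :
    Measure ℝ :=
  condDistrib (fun z : G.Ω n × Noise (Vert n) Z Ξ => M.chain (G.graph n z.1) 0 z.2 k (G.I n z.1))
    (fun z => G.attr n z.1) ((G.P n).prod (M.noiseLaw (Vert n))) (G.attr n ω)

variable {p : ℝ≥0∞} [hp1 : Fact (1 ≤ p)] {G : GraphSeq S}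

lemma GraphSeq.measurable_chain_I (hg : Measurable fun w : ℝ × Mark S => M.g w.1 w.2) (k n : ℕ) :
    Measurable fun z : G.Ω n × Noise (Vert n) Z Ξ =>
      M.chain (G.graph n z.1) 0 z.2 k (G.I n z.1) := by
  have h1 : Measurable fun z : (WDigraph (Vert n) S × Noise (Vert n) Z Ξ) × Vert n =>
      M.chain z.1.1 0 z.1.2 k z.2 :=
    measurable_from_prod_countable_left fun i => (measurable_pi_apply i).comp
      ((M.measurable_chain hg k).comp
        (f := fun z : WDigraph (Vert n) S × Noise (Vert n) Z Ξ => (z.1, 0, z.2)) (by fun_prop))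
  have hG := G.measurable_graph n
  have hI := G.measurable_I n
  exact h1.comp (f := fun z : G.Ω n × Noise (Vert n) Z Ξ =>
    ((G.graph n z.1, z.2), G.I n z.1)) (by fun_prop)

variable [BorelSpace S] [TopologicalSpace.SeparableSpace S]
  {root child : Measure (ℕ × Mark S)} [IsProbabilityMeasure root] [IsProbabilityMeasure child]

open scoped Classical in
/-- The cost of the coupling of the chain with the tree recursion. -/
lemma measure_wasserstein_chainMarginal_le (hp : p ≠ ∞)
    (hg : Measurable fun w : ℝ × Mark S => M.g w.1 w.2) {k n : ℕ} {T : G.Ω n → Tree S}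
    {θ : G.Ω n → List ℕ → Vert n} (hT : Measurable T) (hθ : Measurable θ)
    (hlaw : (G.P n).map T = gwLaw root child) (hind : IndepFun T (G.attr n) (G.P n))
    {A : Set (G.Ω n)} (hA : MeasurableSet A)
    (hiso : ∀ ω ∈ A, IsTreeIso (G.graph n ω) (G.I n ω) (T ω) (k + 1) (θ ω))
    {c : G.Ω n → ℝ≥0∞}
    (hc : ∀ᵐ ω ∂G.P n, ω ∈ A → lqn p.toReal M.treeNoise
      (fun w => ‖M.treeR (graphTree (G.graph n ω) (T ω) (θ ω), w) 0 (k + 1) -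
        M.treeR (T ω, w) 0 (k + 1)‖ₑ) ≤ c ω)
    (hc' : ∀ᵐ ω ∂G.P n, ω ∉ A → lqn p.toReal (M.noiseLaw (Vert n))
      (fun e => ‖M.chain (G.graph n ω) 0 e (k + 1) (G.I n ω)‖ₑ) +
        lqn p.toReal M.treeNoise (fun w => ‖M.treeR (T ω, w) 0 (k + 1)‖ₑ) ≤ c ω)
    {J : Set (Vert n → S)} (hJ : MeasurableSet J) {ε : ℝ≥0∞} (h0 : ε ≠ 0) (ht : ε ≠ ∞) :
    G.P n {ω | ε ≤ wasserstein p (G.chainMarginal M (k + 1) n ω)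
      (M.zeroStart.treeRLaw root child (k + 1))} ≤
      G.P n {ω | G.attr n ω ∉ J} + (lqn p.toReal (G.onAttr n J) c / ε) ^ p.toReal := by
  have hq := one_le_toReal hp
  have hq0 : 0 ≤ p.toReal := zero_le_one.trans hq
  have ha := G.measurable_attr n
  let W := ((List ℕ → Z) × (List ℕ → Ξ)) × Noise (Vert n) Z Ξ
  let ν : Measure W := M.treeNoise.prod (M.noiseLaw (Vert n))
  let F : Tree S × W → ℝ := fun z => M.treeR (z.1, z.2.1) 0 (k + 1)
  have hF : Measurable F := (Recursion.measurable_treeR_succ hg k).comp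
    (f := fun z : Tree S × W => ((z.1, z.2.1), (0 : List ℕ → ℝ)))
      ((measurable_fst.prodMk (measurable_fst.comp measurable_snd)).prodMk measurable_const)
  let t' : G.Ω n → Tree S := fun ω => graphTree (G.graph n ω) (T ω) (θ ω)
  have ht' : Measurable t' := by
    refine measurable_pi_iff.2 fun q => ?_
    have h1 : Measurable fun ω => θ ω q := (measurable_pi_apply q).comp hθ
    have h2 : Measurable fun ω => T ω q := (measurable_pi_apply q).comp hT
    exact (measurable_fst.comp h2).prodMk
      (measurable_vertex (G.measurable_graph n) h1 (f := fun H i => mark H i)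
        fun i => measurable_mark i)
  have hch := G.measurable_chain_I hg (k + 1) n
  let C : G.Ω n → Noise (Vert n) Z Ξ → ℝ := fun ω e =>
    M.chain (G.graph n ω) 0 e (k + 1) (G.I n ω)
  let X : G.Ω n → W → ℝ := fun ω w => if ω ∈ A then F (t' ω, w) else C ω w.2
  let Y : G.Ω n → W → ℝ := fun ω w => F (T ω, w)
  have hX : Measurable fun z : G.Ω n × W => X z.1 z.2 :=
    Measurable.ite (measurable_fst hA) (hF.comp (f := fun z : G.Ω n × W => (t' z.1, z.2))
      (by fun_prop)) (hch.comp (f := fun z : G.Ω n × W => (z.1, z.2.2))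
        (measurable_fst.prodMk (measurable_snd.comp measurable_snd)))
  have hY : Measurable fun z : G.Ω n × W => Y z.1 z.2 :=
    hF.comp (f := fun z : G.Ω n × W => (T z.1, z.2)) (by fun_prop)
  have hFt : ∀ t, Measurable fun w => M.treeR (t, w) 0 (k + 1) := fun t =>
    (Recursion.measurable_treeR_succ hg k).comp
      (f := fun w : (List ℕ → Z) × (List ℕ → Ξ) => ((t, w), (0 : List ℕ → ℝ))) (by fun_prop)
  have hCω : ∀ ω, Measurable (C ω) := fun ω => hch.comp measurable_prodMk_left
  have hfst : ν.map Prod.fst = M.treeNoise := by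
    simp [ν, Measure.map_fst_prod]
  have hsnd : ν.map Prod.snd = M.noiseLaw (Vert n) := by
    simp [ν, Measure.map_snd_prod]
  have e1 : condDistrib (fun z : G.Ω n × W => X z.1 z.2) (fun z => G.attr n z.1)
      ((G.P n).prod ν) = condDistrib (fun z : G.Ω n × Noise (Vert n) Z Ξ => C z.1 z.2)
        (fun z => G.attr n z.1) ((G.P n).prod (M.noiseLaw (Vert n))) := by
    refine condDistrib_eq_of_map_eq (map_prod_congr ha hX hch (Eventually.of_forall fun ω => ?_))
    by_cases hω : ω ∈ A
    · have h2 : X ω = (fun w => M.treeR (t' ω, w) 0 (k + 1)) ∘ Prod.fst := by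
        funext w; simp [X, hω, F]
      rw [h2, ← Measure.map_map (hFt _) measurable_fst, hfst]
      exact (hiso ω hω).map_chain hg
    · have h2 : X ω = C ω ∘ Prod.snd := by funext w; simp [X, hω]
      rw [h2, ← Measure.map_map (hCω ω) measurable_snd, hsnd]
  have e2 : ∀ᵐ ω ∂G.P n, condDistrib (fun z : G.Ω n × W => Y z.1 z.2) (fun z => G.attr n z.1)
      ((G.P n).prod ν) (G.attr n ω) = M.zeroStart.treeRLaw root child (k + 1) := by
    suffices h5 : ∀ᵐ x ∂(G.P n).map (G.attr n),
        condDistrib (fun z : G.Ω n × W => Y z.1 z.2) (fun z => G.attr n z.1)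
          ((G.P n).prod ν) x = M.zeroStart.treeRLaw root child (k + 1) from
      ae_of_ae_map ha.aemeasurable h5
    filter_upwards [condDistrib_of_indep (ν := ν) ha hT hind hF] with x hx
    rw [hx, hlaw, M.treeRLaw_zeroStart hg]
    have : IsProbabilityMeasure (gwLaw root child) := by
      rw [← hlaw]; exact Measure.isProbabilityMeasure_map hT.aemeasurable
    have h3 : (gwLaw root child).prod M.treeNoise =
        ((gwLaw root child).prod ν).map (Prod.map id Prod.fst) := by
      rw [← Measure.map_prod_map _ _ measurable_id measurable_fst, Measure.map_id, hfst]
    have hR : Measurable fun τ : NoisyTree S Z Ξ => M.treeR τ 0 (k + 1) :=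
      (Recursion.measurable_treeR_succ hg k).comp
        (f := fun τ : NoisyTree S Z Ξ => (τ, (0 : List ℕ → ℝ))) (by fun_prop)
    rw [h3, Measure.map_map hR (measurable_id.prodMap measurable_fst)]
    rfl
  have e3 : ((G.P n).prod ν).map (fun z => G.attr n z.1) = (G.P n).map (G.attr n) := by
    have := Measure.map_map (μ := (G.P n).prod ν) ha measurable_fst
    simp only [Measure.map_fst_prod, measure_univ, one_smul] at this
    exact this.symm
  calc _ ≤ G.P n {ω | ε ≤ wasserstein p
        (condDistrib (fun z : G.Ω n × W => X z.1 z.2) (fun z => G.attr n z.1)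
          ((G.P n).prod ν) (G.attr n ω))
        (condDistrib (fun z : G.Ω n × W => Y z.1 z.2) (fun z => G.attr n z.1)
          ((G.P n).prod ν) (G.attr n ω))} := by
        refine measure_mono_ae ?_
        filter_upwards [e2] with ω hω h
        change ε ≤ _
        rw [e1, hω]
        exact h
    _ ≤ _ := measure_wasserstein_condDistrib_le hp (a := fun z : G.Ω n × W => G.attr n z.1)
        (ha.comp measurable_fst) hX hY ha e3 hJ h0 ht
    _ ≤ _ := by
        gcongr
        have e4 : ((G.P n).prod ν).restrict ((fun z : G.Ω n × W => G.attr n z.1) ⁻¹' J) =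
            (G.onAttr n J).prod ν := by
          have := Measure.prod_restrict (μ := G.P n) (ν := ν) (G.attr n ⁻¹' J) Set.univ
          rw [Measure.restrict_univ] at this
          rw [GraphSeq.onAttr, this]
          congr 1
          ext z; simp
        rw [e4, lqn_prod hq (hX.edist hY)]
        refine lqn_mono_ae hq ?_
        filter_upwards [ae_restrict_of_ae hc, ae_restrict_of_ae hc'] with ω h1 h2
        by_cases hω : ω ∈ A
        · refine le_trans (le_of_eq ?_) (h1 hω)
          rw [← hfst, lqn_map measurable_fst (measurable_enorm_sub (hFt _) (hFt _))]
          simp only [X, Y, hω, if_true, edist_eq_enorm_sub]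
          rfl
        · refine le_trans ?_ (h2 hω)
          rw [← hfst, ← hsnd, lqn_map measurable_snd (hCω ω).enorm,
            lqn_map measurable_fst (hFt _).enorm]
          refine (lqn_mono hq fun w => ?_).trans (lqn_add_le hq
            ((hCω ω).comp measurable_snd).enorm ((hFt (T ω)).comp measurable_fst).enorm)
          simp only [X, Y, hω, if_false, edist_eq_enorm_sub]
          exact enorm_sub_le

end Comparison

/-! ### Convergence of the marginals of the chain started from zero -/

section Marginals

variable {S Z Ξ : Type*} [MetricSpace S] [MeasurableSpace S] [MeasurableSpace Z]
  [MeasurableSpace Ξ] {M : Recursion S Z Ξ} {p : ℝ≥0∞} [hp1 : Fact (1 ≤ p)] {G : GraphSeq S}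
  {σm σp β : Mark S → ℝ} {K K₀ : ℝ} {root child : Measure (ℕ × Mark S)}

lemma exists_div_rpow_le {q : ℝ} (hq : 1 ≤ q) {ε δ : ℝ≥0∞} (hε : ε ≠ 0) (ht : ε ≠ ∞) (hδ : 0 < δ) :
    ∃ c : ℝ≥0∞, 0 < c ∧ c ≠ ∞ ∧ ∀ x ≤ c, (x / ε) ^ q ≤ δ := by
  refine ⟨min δ 1 * ε, ENNReal.mul_pos (lt_min hδ one_pos).ne' hε,
    ENNReal.mul_ne_top (ne_top_of_le_ne_top ENNReal.one_ne_top (min_le_right _ _)) ht,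
    fun x hx => ?_⟩
  have h : x / ε ≤ min δ 1 := ENNReal.div_le_of_le_mul hx
  exact (ENNReal.rpow_le_self_of_le_one (h.trans (min_le_right _ _)) hq).trans
    (h.trans (min_le_left _ _))

lemma exists_nat_measure_lt_le {X : Type*} [MeasurableSpace X] {μ : Measure X} [IsFiniteMeasure μ]
    {f : X → ℝ≥0∞} (hf : Measurable f) (ht : ∀ x, f x ≠ ∞) {b : ℝ≥0∞} (hb : 0 < b) :
    ∃ m : ℕ, μ {x | (m : ℝ≥0∞) < f x} ≤ b := by
  have h := tendsto_measure_iInter_atTop (μ := μ) (s := fun m : ℕ => {x | (m : ℝ≥0∞) < f x})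
    (fun m => (measurableSet_lt measurable_const hf).nullMeasurableSet)
    (fun m m' hm x hx => lt_of_le_of_lt (show (m : ℝ≥0∞) ≤ m' by exact_mod_cast hm)
      (show (m' : ℝ≥0∞) < f x from hx)) ⟨0, measure_ne_top _ _⟩
  have e : ⋂ m : ℕ, {x | (m : ℝ≥0∞) < f x} = ∅ := by
    refine Set.eq_empty_iff_forall_notMem.2 fun x hx => ?_
    obtain ⟨m, hm⟩ := ENNReal.exists_nat_gt (ht x)
    exact lt_asymm hm (Set.mem_iInter.1 hx m)
  rw [e, measure_empty] at h
  exact (h.eventually (ge_mem_nhds hb)).exists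

lemma GraphSeq.lqn_onAttr_le {q : ℝ} (hq : 1 ≤ q) {n : ℕ} (J : Set (Vert n → S))
    (f : G.Ω n → ℝ≥0∞) : lqn q (G.onAttr n J) f ≤ lqn q (G.P n) f := by
  rw [lqn_le_iff hq, lqn_rpow hq]
  exact lintegral_mono' Measure.restrict_le_self le_rfl

/-- Moments on a small event, by truncation. -/
lemma lqn_indicator_add_le {q : ℝ} (hq : 1 ≤ q) {X : Type*} [MeasurableSpace X] {μ : Measure X}
    {B : Set X} (hB : MeasurableSet B) {y z : X → ℝ≥0∞} (hy : Measurable y) (hz : Measurable z)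
    (m m' : ℕ) :
    lqn q μ (B.indicator fun x => y x + z x) ≤ lqn q μ (fun x => y x - m) +
      lqn q μ (fun x => z x - m') + (m + m' : ℝ≥0∞) * μ B ^ (1 / q) := by
  have h1 : Measurable (B.indicator (1 : X → ℝ≥0∞)) := measurable_one.indicator hB
  calc _ ≤ lqn q μ (fun x => ((y x - m) + (z x - m')) + (m + m') * B.indicator 1 x) := by
        refine lqn_mono hq fun x => ?_
        by_cases hx : x ∈ B
        · simp only [Set.indicator_of_mem hx, Pi.one_apply, mul_one]
          rw [add_add_add_comm]
          exact add_le_add le_tsub_add le_tsub_add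
        · simp [hx]
    _ ≤ _ := by
        refine (lqn_add_le hq ((hy.sub_const _).add (hz.sub_const _)) (h1.const_mul _)).trans
          (add_le_add (lqn_add_le hq (hy.sub_const _) (hz.sub_const _)) ?_)
        rw [lqn_const_mul hq _ h1, lqn_indicator_one_le hq hB]

variable [BorelSpace S] [TopologicalSpace.SeparableSpace S] [IsProbabilityMeasure root]
  [IsProbabilityMeasure child]

/-- On a graph that is close to the tree, the recursions are close. -/
lemma treeClose_of_isTreeIso {V : Type*} [Fintype V] {H : WDigraph V S} {i : V} {t : Tree S} {k : ℕ}
    {θ : List ℕ → V} {ε : ℝ} {h Q e : ℝ≥0∞} (hε : ε < 1)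
    (hmod : ∀ x' x : Mark S, rho x' x ≤ ε → M.Modulus p σm σp β h Q e x' x)
    (hiso : IsTreeIso H i t k θ) (hclose : MarksClose H t k θ ε)
    (hlip : ∀ q, M.LipschitzAt p (σm (t q).2) (t q).1 (t q).2)
    (hgrow : ∀ q, M.GrowthAt p (σm (t q).2) (β (t q).2) (t q).1 (t q).2) :
    M.TreeClose p σm σp β h Q e k (graphTree H t θ) t := by
  refine Recursion.treeClose_of_forall M p σm σp β h Q k (fun q hq hk => ⟨rfl, ?_, ?_, hlip q, hgrow q⟩)
    fun q hq hk => hmod _ _ (hclose q ⟨hq, hk.le⟩)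
  · rw [← (rho_lt_one ((hclose q ⟨hq, hk.le⟩).trans_lt hε)).1]
    exact (hiso.inDeg_eq hq hk).symm
  · exact hmod _ _ (hclose q ⟨hq, hk.le⟩)

theorem tendsto_chainMarginal (hp : p ≠ ∞) (hM : M.Regular p σm σp β K K₀ G root child)
    (hG : G.Regular M p σm σp β root child) (k : ℕ)
    (hfin : lqn p.toReal (M.zeroStart.treeRLaw root child (k + 1)) (fun x => ‖x‖ₑ) ≠ ∞) :
    TendstoZeroInProb G.P fun n ω => wasserstein p (G.chainMarginal M (k + 1) n ω)
      (M.zeroStart.treeRLaw root child (k + 1)) := by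
  have hq := one_le_toReal hp
  have hq0 : 0 < p.toReal := zero_lt_one.trans_le hq
  have hg := hM.measurable_g
  have hσ := measurable_of_continuous_mark hM.continuous_σm
  have hσp := measurable_of_continuous_mark hM.continuous_σp
  have hβ := measurable_of_continuous_mark hM.continuous_β
  intro ε₁ hε₁
  rw [ENNReal.tendsto_nhds_zero]
  intro δ hδ
  set ε := min ε₁ 1
  have hε : 0 < ε := lt_min hε₁ one_pos
  have hεt : ε ≠ ∞ := ne_top_of_le_ne_top ENNReal.one_ne_top (min_le_right _ _)
  have hδ2 := ENNReal.half_pos hδ.ne'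
  obtain ⟨c, hc0, hct, hc⟩ := exists_div_rpow_le hq hε.ne' hεt hδ2
  have hd : 0 < c / 4 := ENNReal.div_pos hc0.ne' (by simp)
  have hdt : c / 4 ≠ ∞ := ENNReal.div_ne_top hct (by simp)
  obtain ⟨m, hm⟩ := unifInt_momentBound hp hM hG (k + 1) (min (δ / 2) (c / 4)) (lt_min hδ2 hd)
  have hR : Measurable fun τ : NoisyTree S Z Ξ => M.treeR τ 0 (k + 1) :=
    (Recursion.measurable_treeR_succ hg k).comp
      (f := fun τ : NoisyTree S Z Ξ => (τ, (0 : List ℕ → ℝ))) (by fun_prop)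
  let z : Tree S → ℝ≥0∞ := fun t => lqn p.toReal M.treeNoise fun w => ‖M.treeR (t, w) 0 (k + 1)‖ₑ
  have hz : Measurable z := measurable_lqn hR.enorm
  have hzt : lqn p.toReal (gwLaw root child) z ≠ ∞ := by
    rwa [M.treeRLaw_zeroStart hg, lqn_map hR measurable_enorm, lqn_prod hq hR.enorm] at hfin
  obtain ⟨m', hm'⟩ := ((tendsto_lqn_tail hq hz hzt).eventually (ge_mem_nhds hd)).exists
  obtain ⟨η, hη, hηd, hηm⟩ := exists_pos_mul_le (c := (m + m' : ℝ≥0∞))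
    (ENNReal.add_ne_top.2 ⟨ENNReal.natCast_ne_top m, ENNReal.natCast_ne_top m'⟩) hd
  have hb : 0 < η ^ p.toReal / 3 := ENNReal.div_pos
    (ENNReal.rpow_pos hη (ne_top_of_le_ne_top hdt hηd)).ne' (by simp)
  obtain ⟨H, Q, hH, hQ, hmod⟩ := hM.exists_modulus hp
  have : IsProbabilityMeasure (gwLaw root child) := by
    have (q : List ℕ) : IsProbabilityMeasure (if q = [] then root else child) := by
      split_ifs <;> infer_instance
    unfold gwLaw; infer_instance
  have hrm := Recursion.measurable_rootErr (M := M) (H := H) (Q := Q) hg hσ hσp hβ k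
  obtain ⟨L, hL⟩ := exists_nat_measure_lt_le (μ := gwLaw root child) hrm
    (fun t => Recursion.rootErr_ne_top hH hQ k t) hb
  obtain ⟨e, he0, he, heL⟩ := exists_pos_mul_le (c := L) (ENNReal.natCast_ne_top L)
    (lt_min hd one_pos)
  obtain ⟨r, hr0, hr1, hr⟩ := hmod e he0
  obtain ⟨T, θ, hT, hθ, hlaw, hind, h1, h2⟩ :=
    hG.strongCoupling.exists_tendsto (k := k + 1) (Nat.le_add_left 1 k)
  filter_upwards [hm, h1.eventually (ge_mem_nhds hb),
    (h2 r hr0 hr1).eventually (ge_mem_nhds hb)] with n ⟨J, hJ, hJ1, hJ2⟩ hn1 hn2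
  set A : Set (G.Ω n) := {ω | IsTreeIso (G.graph n ω) (G.I n ω) (T n ω) (k + 1) (θ n ω)} ∩
    {ω | MarksClose (G.graph n ω) (T n ω) (k + 1) (θ n ω) r} ∩
    {ω | M.rootErr σm σp β H Q k (T n ω) ≤ L} with hAdef
  have hA : MeasurableSet A := ((measurableSet_isTreeIso (G.measurable_graph n)
    (G.measurable_I n) (hT n) (hθ n) (k + 1)).inter (measurableSet_marksClose
    (G.measurable_graph n) (hT n) (hθ n) (k + 1) r)).inter
    (measurableSet_le (hrm.comp (hT n)) measurable_const)
  have hPA : G.P n Aᶜ ≤ η ^ p.toReal := by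
    calc G.P n Aᶜ ≤ G.P n ({ω | ¬ IsTreeIso (G.graph n ω) (G.I n ω) (T n ω) (k + 1) (θ n ω)} ∪
          {ω | ¬ MarksClose (G.graph n ω) (T n ω) (k + 1) (θ n ω) r} ∪
          {ω | (L : ℝ≥0∞) < M.rootErr σm σp β H Q k (T n ω)}) := by
          refine measure_mono fun ω hω => ?_
          by_contra h
          simp only [Set.mem_union, Set.mem_ofPred_eq, not_or, not_not, not_lt] at h
          exact hω h
      _ ≤ η ^ p.toReal / 3 + η ^ p.toReal / 3 + η ^ p.toReal / 3 := by
          refine (measure_union_le _ _).trans (add_le_add ((measure_union_le _ _).trans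
            (add_le_add hn1 hn2)) ?_)
          rw [← hlaw n, Measure.map_apply (hT n) (measurableSet_lt measurable_const hrm)] at hL
          exact hL
      _ = η ^ p.toReal := ENNReal.add_thirds _
  have hy : Measurable fun ω => M.momentBound σm σp β (k + 1) (G.graph n ω) (G.I n ω) :=
    G.measurable_at_I (M.measurable_momentBound hg hσ hσp hβ (k + 1))
  have hzT : Measurable fun ω => z (T n ω) := hz.comp (hT n)
  have htree : ∀ᵐ ω ∂G.P n, ∀ q, M.LipschitzAt p (σm (T n ω q).2) (T n ω q).1 (T n ω q).2 ∧
      M.GrowthAt p (σm (T n ω q).2) (β (T n ω q).2) (T n ω q).1 (T n ω q).2 := by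
    refine ae_all_iff.2 fun q => ae_of_ae_map (f := T n) (p := fun t : Tree S =>
      M.LipschitzAt p (σm (t q).2) (t q).1 (t q).2 ∧
        M.GrowthAt p (σm (t q).2) (β (t q).2) (t q).1 (t q).2) (hT n).aemeasurable ?_
    rw [hlaw]
    exact (gwLaw_ae hM.lipschitz_root hM.lipschitz_child).and
      (gwLaw_ae hM.growth_root hM.growth_child)
  have key := measure_wasserstein_chainMarginal_le (M := M) hp hg (hT n) (hθ n) (hlaw n) (hind n)
    hA (fun ω hω => hω.1.1) (k := k)
    (c := fun ω => c / 4 + Aᶜ.indicator (fun ω =>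
      M.momentBound σm σp β (k + 1) (G.graph n ω) (G.I n ω) + z (T n ω)) ω) (by
      filter_upwards [htree] with ω h hω
      refine le_add_right ((lqn_treeR_sub_le hp hg hM.lipschitz_g (he.trans (min_le_right _ _)) k
        (treeClose_of_isTreeIso hr1 hr hω.1.1 hω.1.2 (fun q => (h q).1) fun q => (h q).2)).trans
          ?_)
      refine (mul_le_mul_right hω.2 _).trans ?_
      rw [mul_comm]
      exact heL.trans (min_le_left _ _)) (by
      filter_upwards [hM.growth_graph n] with ω h hω
      rw [Set.indicator_of_mem (show ω ∈ Aᶜ from hω)]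
      exact le_add_left (add_le_add (Recursion.lqn_chain_le hp hg hM.lipschitz_g h (k + 1) _)
        le_rfl)) hJ hε.ne' hεt
  refine (measure_mono fun ω hω => ?_).trans (key.trans ?_)
  · exact le_trans (min_le_left _ _) (show ε₁ ≤ _ from hω)
  refine (add_le_add (hJ1.trans (min_le_left _ _)) (hc _ ?_)).trans (ENNReal.add_halves δ).le
  have hind' : Measurable (Aᶜ.indicator fun ω =>
      M.momentBound σm σp β (k + 1) (G.graph n ω) (G.I n ω) + z (T n ω)) :=
    (hy.add hzT).indicator hA.compl
  refine (lqn_add_le hq measurable_const hind').trans ?_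
  have h4 : c / 4 + (c / 4 + c / 4 + c / 4) = c := by
    have h8 : c / 4 + c / 4 = c / 2 := by
      rw [ENNReal.div_add_div_same, ← two_mul, show (4 : ℝ≥0∞) = 2 * 2 by norm_num,
        ENNReal.mul_div_mul_left _ _ (by simp) (by simp)]
    rw [add_assoc, ← add_assoc, h8, ENNReal.add_halves]
  refine (add_le_add ((GraphSeq.lqn_onAttr_le hq J _).trans (lqn_const hq _).le)
    ((lqn_indicator_add_le hq hA.compl hy hzT m m').trans (add_le_add (add_le_add
      (hJ2.trans (min_le_right _ _)) ?_) ?_))).trans h4.le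
  · refine (GraphSeq.lqn_onAttr_le hq J _).trans ?_
    rw [← hlaw n, lqn_map (hT n) (hz.sub_const _)] at hm'
    exact hm'
  · refine (mul_le_mul_right ?_ _).trans hηm
    rw [one_div, ENNReal.rpow_inv_le_iff hq0]
    exact (Measure.restrict_apply_le _ _).trans hPA

end Marginals

/-! ### Comparison with the stationary law -/

section Stationary

variable {S Z Ξ : Type*} [MeasurableSpace S] [MeasurableSpace Z] [MeasurableSpace Ξ]
  {M : Recursion S Z Ξ} {p : ℝ≥0∞} [hp1 : Fact (1 ≤ p)] {σm σp β : Mark S → ℝ} {K K₀ : ℝ}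

section FixedGraph

variable {V : Type*} [Fintype V] [DecidableEq V] {G : WDigraph V S}

lemma Recursion.chainLaw_stationaryLaw (hp : p ≠ ∞)
    (hgm : Measurable fun w : ℝ × Mark S => M.g w.1 w.2)
    (hg : ∀ x r r', |M.g r x - M.g r' x| ≤ σp x * |r - r'|)
    (hG : M.GraphRegular p σm σp β K K₀ G) (hK : K < 1) (k : ℕ) :
    M.chainLaw p G (M.stationaryLaw p G) k = M.stationaryLaw p G := by
  have := M.isProbabilityMeasure_stationaryLaw (p := p) (G := G) hgm
  rw [M.chainLaw_eq hgm]
  induction k with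
  | zero => rfl
  | succ k ih =>
    rw [Function.iterate_succ_apply', ih, M.stationaryLaw_stationary hp hgm hg hG hK]

lemma Recursion.GraphRegular.drift_nonneg (hG : M.GraphRegular p σm σp β K K₀ G) (i : V) :
    0 ≤ M.drift p σm β G i := by
  refine (ENNReal.toReal_nonneg.trans (hG.growth i fun l => M.g ((0 : V → ℝ) (inEdgeEquiv G i l).1)
    (mark G (inEdgeEquiv G i l).1)).2).trans (le_of_eq ?_)
  simp only [Recursion.drift, Recursion.matC0, Matrix.mulVec, dotProduct, Matrix.of_apply,
    Pi.one_apply, mul_one, Pi.zero_apply]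
  congr 1
  rw [Equiv.sum_comp (inEdgeEquiv G i) (fun a => σm (mark G i) * |M.g 0 (mark G a.1)|),
    Fintype.sum_sigma]
  refine Finset.sum_congr rfl fun j _ => ?_
  simp; ring

lemma Recursion.GraphRegular.enorm_drift_le (hG : M.GraphRegular p σm σp β K K₀ G) (i : V) :
    ‖M.drift p σm β G i‖ₑ ≤ M.driftBound σm β G i := by
  rw [Real.enorm_of_nonneg (hG.drift_nonneg i)]
  refine ENNReal.ofReal_add_le.trans (add_le_add (le_of_eq ?_) le_rfl)
  have e : (M.matC0 σm G).mulVec 1 i =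
      σm (mark G i) * ∑ j, (G.1 j i : ℝ) * |M.g 0 (mark G j)| := by
    simp only [Recursion.matC0, Matrix.mulVec, dotProduct, Matrix.of_apply, Pi.one_apply, mul_one,
      Finset.mul_sum]
    exact Finset.sum_congr rfl fun j _ => by ring
  rw [e, ENNReal.ofReal_mul' (Finset.sum_nonneg fun j _ => by positivity), edgeSum,
    ENNReal.ofReal_sum_of_nonneg fun j _ => by positivity]
  simp only [mul_one]
  congr 1
  refine Finset.sum_congr rfl fun j _ => ?_
  rw [ENNReal.ofReal_mul (Nat.cast_nonneg _), ENNReal.ofReal_natCast]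

/-- The chain started from the stationary law is close to the chain started from `0`. -/
lemma Recursion.GraphRegular.lintegral_chain_sub_le (hp : p ≠ ∞)
    (hgm : Measurable fun w : ℝ × Mark S => M.g w.1 w.2)
    (hg : ∀ x r r', |M.g r x - M.g r' x| ≤ σp x * |r - r'|)
    (hG : M.GraphRegular p σm σp β K K₀ G) (hK : K < 1) (k : ℕ) :
    ∑ i, ∫⁻ z, ‖M.chain G (WithLp.ofLp z.1) z.2 k i - M.chain G 0 z.2 k i‖ₑ ^ p.toReal
      ∂(M.stationaryLaw p G).prod (M.noiseLaw V) ≤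
    (ENNReal.ofReal K ^ k * (1 - ENNReal.ofReal K)⁻¹) ^ p.toReal *
      ∑ i, M.driftBound σm β G i ^ p.toReal := by
  have hq := one_le_toReal hp
  have h0 : 0 < p.toReal := zero_lt_one.trans_le hq
  have hF := M.measurable_graphMap (p := p) hgm G
  have := M.isProbabilityMeasure_stationaryLaw (p := p) (G := G) hgm
  have hκ : ENNReal.ofReal (opNorm p (matC σm σp G)) ≤ ENNReal.ofReal K :=
    ENNReal.ofReal_le_ofReal hG.norm_C
  have hc : ∀ i, Measurable fun z : (PiLp p fun _ : V => ℝ) × Noise V Z Ξ =>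
      M.chain G (WithLp.ofLp z.1) z.2 k i := fun i => (measurable_pi_apply i).comp
    ((M.measurable_chain hgm k).comp
      (f := fun z : (PiLp p fun _ : V => ℝ) × Noise V Z Ξ => (G, WithLp.ofLp z.1, z.2))
      (by fun_prop))
  have hc0 : ∀ i, Measurable fun z : (PiLp p fun _ : V => ℝ) × Noise V Z Ξ =>
      M.chain G 0 z.2 k i := fun i => (measurable_pi_apply i).comp
    ((M.measurable_chain hgm k).comp
      (f := fun z : (PiLp p fun _ : V => ℝ) × Noise V Z Ξ => (G, 0, z.2)) (by fun_prop))
  let D : (PiLp p fun _ : V => ℝ) × (ℕ → StepNoise V Z Ξ) → PiLp p fun _ : V => ℝ := fun z =>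
    forward (M.graphMap p G) z.1 z.2 k - forward (M.graphMap p G) 0 z.2 k
  have hD1 : Measurable fun z : (PiLp p fun _ : V => ℝ) × (ℕ → StepNoise V Z Ξ) =>
      forward (M.graphMap p G) z.1 z.2 k := measurable_forward hF k
  have hD2 : Measurable fun z : (PiLp p fun _ : V => ℝ) × (ℕ → StepNoise V Z Ξ) =>
      forward (M.graphMap p G) 0 z.2 k :=
    hD1.comp (f := fun z : (PiLp p fun _ : V => ℝ) × (ℕ → StepNoise V Z Ξ) => (0, z.2))
      (by fun_prop)
  have hD : Measurable fun z => ‖D z‖ₑ := measurable_enorm_sub hD1 hD2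
  have e1 : ∀ z : (PiLp p fun _ : V => ℝ) × Noise V Z Ξ,
      ∑ i, ‖M.chain G (WithLp.ofLp z.1) z.2 k i - M.chain G 0 z.2 k i‖ₑ ^ p.toReal =
        ‖D (Prod.map id noiseSeq z)‖ₑ ^ p.toReal := by
    intro z
    rw [piLp_enorm_rpow hp]
    refine Finset.sum_congr rfl fun i _ => ?_
    have h1 := M.chain_eq_forward (p := p) G z.1 z.2 k
    have h2 := M.chain_eq_forward (p := p) G 0 z.2 k
    simp only [D, Prod.map_fst, Prod.map_snd, id, ← h1, ← h2]
    rfl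
  have hns : Measurable (noiseSeq : Noise V Z Ξ → ℕ → StepNoise V Z Ξ) := measurable_noiseSeq
  have e2 : ((M.stationaryLaw p G).prod (M.noiseLaw V)).map (Prod.map id noiseSeq) =
      (M.stationaryLaw p G).prod (Measure.infinitePi fun _ : ℕ => M.stepLaw V) := by
    rw [← Measure.map_prod_map _ _ measurable_id hns, Measure.map_id, M.map_noiseSeq]
  rw [← lintegral_finsetSum _ fun i _ => (measurable_enorm_sub (hc i) (hc0 i)).pow_const _]
  simp only [e1]
  rw [← lintegral_map (hD.pow_const p.toReal) (measurable_id.prodMap hns), e2, ← lqn_rpow hq]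
  calc _ ≤ (ENNReal.ofReal K ^ k * ((1 - ENNReal.ofReal K)⁻¹ * ‖M.drift p σm β G‖ₑ)) ^ p.toReal := by
        refine ENNReal.rpow_le_rpow ?_ h0.le
        rw [lqn_prod hq hD]
        refine (lqn_mono hq fun r => lqn_forward_sub_le hq hF (hG.graphMap_lipschitz hp hgm hg)
          k r 0).trans ?_
        simp only [sub_zero]
        rw [lqn_const_mul hq _ measurable_enorm]
        gcongr
        refine (M.lqn_stationaryLaw_le hp hgm hg hG hK).trans ?_
        rw [mul_comm]
        gcongr
    _ = (ENNReal.ofReal K ^ k * (1 - ENNReal.ofReal K)⁻¹) ^ p.toReal *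
          ∑ i, ‖M.drift p σm β G i‖ₑ ^ p.toReal := by
        rw [← mul_assoc, ENNReal.mul_rpow_of_nonneg _ _ h0.le, piLp_enorm_rpow hp]
    _ ≤ _ := by
        gcongr with i
        exact hG.enorm_drift_le i

end FixedGraph

end Stationary

/-! ### The typical marginal of the stationary law -/

section RandomGraph

variable {S Z Ξ : Type*} [MetricSpace S] [MeasurableSpace S] [MeasurableSpace Z]
  [MeasurableSpace Ξ] [BorelSpace S] [TopologicalSpace.SeparableSpace S] {M : Recursion S Z Ξ}
  {p : ℝ≥0∞} [hp1 : Fact (1 ≤ p)] {G : GraphSeq S} {σm σp β : Mark S → ℝ} {K K₀ : ℝ}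
  {root child : Measure (ℕ × Mark S)}

/-- The cost of the coupling of the stationary chain with the chain started from `0`. -/
lemma measure_wasserstein_rootMarginal_le (hp : p ≠ ∞)
    (hM : M.Regular p σm σp β K K₀ G root child) (hK : K < 1) (k n : ℕ)
    [IsMarkovKernel (M.stationaryKernel (Vert n) p)]
    {J : Set (Vert n → S)} (hJ : MeasurableSet J) {ε : ℝ≥0∞} (h0 : ε ≠ 0) (ht : ε ≠ ∞) :
    G.P n {ω | ε ≤ wasserstein p (G.rootMarginal p (M.stationaryKernel (Vert n) p) ω)
      (G.chainMarginal M k n ω)} ≤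
      G.P n {ω | G.attr n ω ∉ J} + (ENNReal.ofReal K ^ k * (1 - ENNReal.ofReal K)⁻¹ *
        lqn p.toReal (G.onAttr n J)
          (fun ω => M.driftBound σm β (G.graph n ω) (G.I n ω)) / ε) ^ p.toReal := by
  have hq := one_le_toReal hp
  have hq0 : 0 < p.toReal := zero_lt_one.trans_le hq
  have hg := hM.measurable_g
  have ha := G.measurable_attr n
  have hGr := G.measurable_graph n
  have hI := G.measurable_I n
  let κ₀ : Kernel (WDigraph (Vert n) S) ((PiLp p fun _ : Vert n => ℝ) × Noise (Vert n) Z Ξ) :=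
    M.stationaryKernel (Vert n) p ×ₖ Kernel.const _ (M.noiseLaw (Vert n))
  let κ : Kernel (G.Ω n) ((PiLp p fun _ : Vert n => ℝ) × Noise (Vert n) Z Ξ) := κ₀.comap (G.graph n) hGr
  have hκ : ∀ H, κ₀ H = (M.stationaryLaw p H).prod (M.noiseLaw (Vert n)) := fun H => by
    rw [Kernel.prod_apply, M.stationaryKernel_apply hg, Kernel.const_apply]
  have hchain : Measurable fun z : WDigraph (Vert n) S × (PiLp p fun _ : Vert n => ℝ) × Noise (Vert n) Z Ξ =>
      M.chain z.1 (WithLp.ofLp z.2.1) z.2.2 k := (M.measurable_chain hg k).comp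
    (f := fun z : WDigraph (Vert n) S × (PiLp p fun _ : Vert n => ℝ) × Noise (Vert n) Z Ξ =>
      (z.1, WithLp.ofLp z.2.1, z.2.2)) (by fun_prop)
  have hchain0 : Measurable fun z : WDigraph (Vert n) S × (PiLp p fun _ : Vert n => ℝ) × Noise (Vert n) Z Ξ =>
      M.chain z.1 0 z.2.2 k := (M.measurable_chain hg k).comp
    (f := fun z : WDigraph (Vert n) S × (PiLp p fun _ : Vert n => ℝ) × Noise (Vert n) Z Ξ =>
      (z.1, 0, z.2.2)) (by fun_prop)
  let X : G.Ω n → (PiLp p fun _ : Vert n => ℝ) × Noise (Vert n) Z Ξ → ℝ := fun ω z =>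
    M.chain (G.graph n ω) (WithLp.ofLp z.1) z.2 k (G.I n ω)
  let Y : G.Ω n → (PiLp p fun _ : Vert n => ℝ) × Noise (Vert n) Z Ξ → ℝ := fun ω z => M.chain (G.graph n ω) 0 z.2 k (G.I n ω)
  have hX : Measurable fun z : G.Ω n × (PiLp p fun _ : Vert n => ℝ) × Noise (Vert n) Z Ξ => X z.1 z.2 := by
    have h1 : Measurable fun z : (WDigraph (Vert n) S × (PiLp p fun _ : Vert n => ℝ) × Noise (Vert n) Z Ξ) × Vert n =>
        M.chain z.1.1 (WithLp.ofLp z.1.2.1) z.1.2.2 k z.2 :=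
      measurable_from_prod_countable_left fun i => (measurable_pi_apply i).comp hchain
    exact h1.comp (f := fun z : G.Ω n × (PiLp p fun _ : Vert n => ℝ) × Noise (Vert n) Z Ξ =>
      ((G.graph n z.1, z.2), G.I n z.1)) (by fun_prop)
  have hC := G.measurable_chain_I hg k n
  have hY : Measurable fun z : G.Ω n × (PiLp p fun _ : Vert n => ℝ) × Noise (Vert n) Z Ξ => Y z.1 z.2 :=
    hC.comp (f := fun z : G.Ω n × (PiLp p fun _ : Vert n => ℝ) × Noise (Vert n) Z Ξ => (z.1, z.2.2)) (by fun_prop)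
  have hreg := hM.ae_graphRegular n
  have e1 : G.rootMarginal p (M.stationaryKernel (Vert n) p) =
      fun ω => condDistrib (fun z : G.Ω n × (PiLp p fun _ : Vert n => ℝ) × Noise (Vert n) Z Ξ => X z.1 z.2)
        (fun z => G.attr n z.1) (G.P n ⊗ₘ κ) (G.attr n ω) := by
    funext ω
    rw [GraphSeq.rootMarginal]
    congr 1
    refine condDistrib_eq_of_map_eq (map_compProd_congr ha (A := fun ω (r : (PiLp p fun _ : Vert n => ℝ)) => r (G.I n ω))
      ?_ hX ?_)
    · have h1 : Measurable fun z : (PiLp p fun _ : Vert n => ℝ) × Vert n => z.1 z.2 :=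
        measurable_from_prod_countable_left fun i =>
          (show Measurable fun r : (PiLp p fun _ : Vert n => ℝ) => r i by fun_prop)
      exact h1.comp (f := fun z : G.Ω n × (PiLp p fun _ : Vert n => ℝ) => (z.2, G.I n z.1)) (by fun_prop)
    · filter_upwards [hreg] with ω hω
      have hst := M.chainLaw_stationaryLaw hp hg hM.lipschitz_g hω hK k
      have hev : Measurable fun r : (PiLp p fun _ : Vert n => ℝ) => r (G.I n ω) := by fun_prop
      have hto : Measurable fun z : (PiLp p fun _ : Vert n => ℝ) × Noise (Vert n) Z Ξ =>
          WithLp.toLp p (M.chain (G.graph n ω) (WithLp.ofLp z.1) z.2 k) :=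
        (WithLp.measurable_toLp p _).comp (hchain.comp measurable_prodMk_left)
      rw [Kernel.comap_apply, Kernel.comap_apply, hκ, M.stationaryKernel_apply hg]
      calc _ = (M.chainLaw p (G.graph n ω) (M.stationaryLaw p (G.graph n ω)) k).map
            (fun r => r (G.I n ω)) := by rw [hst]
        _ = _ := by rw [Recursion.chainLaw, Measure.map_map hev hto]; rfl
  have e2 : G.chainMarginal M k n =
      fun ω => condDistrib (fun z : G.Ω n × (PiLp p fun _ : Vert n => ℝ) × Noise (Vert n) Z Ξ => Y z.1 z.2)
        (fun z => G.attr n z.1) (G.P n ⊗ₘ κ) (G.attr n ω) := by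
    funext ω
    rw [GraphSeq.chainMarginal]
    have h3 := map_compProd_congr (P := G.P n) (κ := Kernel.const _ (M.noiseLaw (Vert n)))
      (κ' := κ) ha (A := fun ω e => M.chain (G.graph n ω) 0 e k (G.I n ω)) hC hY
      (Eventually.of_forall fun ω => ?_)
    · rw [Measure.compProd_const] at h3
      rw [condDistrib_eq_of_map_eq h3]
    have := M.isProbabilityMeasure_stationaryLaw (p := p) (G := G.graph n ω) hg
    have h2 : Y ω = (fun e => M.chain (G.graph n ω) 0 e k (G.I n ω)) ∘ Prod.snd := rfl
    have h4 : Measurable fun e => M.chain (G.graph n ω) 0 e k (G.I n ω) :=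
      hC.comp measurable_prodMk_left
    rw [h2, Kernel.comap_apply, hκ, Kernel.const_apply, ← Measure.map_map h4 measurable_snd, Measure.map_snd_prod,
      measure_univ, one_smul]
  have e3 : (G.P n ⊗ₘ κ).map (fun z => G.attr n z.1) = (G.P n).map (G.attr n) := by
    have := Measure.map_map (μ := G.P n ⊗ₘ κ) ha measurable_fst
    rw [← Measure.fst, Measure.fst_compProd] at this
    exact this.symm
  rw [e1, e2]
  refine (measure_wasserstein_condDistrib_le hp
    (a := fun z : G.Ω n × (PiLp p fun _ : Vert n => ℝ) × Noise (Vert n) Z Ξ => G.attr n z.1)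
    (ha.comp measurable_fst) hX hY ha e3 hJ h0 ht).trans ?_
  gcongr
  let w : WDigraph (Vert n) S → Vert n → ℝ≥0∞ := fun H i =>
    ∫⁻ z, ‖M.chain H (WithLp.ofLp z.1) z.2 k i - M.chain H 0 z.2 k i‖ₑ ^ p.toReal ∂κ₀ H
  have hw : ∀ i, Measurable fun H => w H i := fun i =>
    Measurable.lintegral_kernel_prod_right (κ := κ₀)
      (f := fun H z => ‖M.chain H (WithLp.ofLp z.1) z.2 k i - M.chain H 0 z.2 k i‖ₑ ^ p.toReal)
      ((measurable_enorm_sub ((measurable_pi_apply i).comp hchain)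
        ((measurable_pi_apply i).comp hchain0)).pow_const _)
  have hb : ∀ i : Vert n, Measurable fun H : WDigraph (Vert n) S =>
      M.driftBound σm β H i ^ p.toReal := fun i =>
    (M.measurable_driftBound hg (measurable_of_continuous_mark hM.continuous_σm)
      (measurable_of_continuous_mark hM.continuous_β) i).pow_const _
  have hpre : (fun z : G.Ω n × (PiLp p fun _ : Vert n => ℝ) × Noise (Vert n) Z Ξ => G.attr n z.1) ⁻¹' J =
      (G.attr n ⁻¹' J) ×ˢ Set.univ := by ext z; simp
  rw [lqn_le_iff hq, ENNReal.mul_rpow_of_nonneg _ _ hq0.le, lqn_rpow hq, hpre]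
  calc _ = ∫⁻ ω, w (G.graph n ω) (G.I n ω) ∂G.onAttr n J := by
        rw [Measure.setLIntegral_compProd ((hX.edist hY).pow_const _) (ha hJ) MeasurableSet.univ]
        simp only [Measure.restrict_univ, edist_eq_enorm_sub]
        rfl
    _ = ((n : ℝ≥0∞) + 1)⁻¹ * ∫⁻ ω, ∑ i, w (G.graph n ω) i ∂G.onAttr n J :=
        G.lintegral_onAttr_at_I hJ hw
    _ ≤ ((n : ℝ≥0∞) + 1)⁻¹ * ∫⁻ ω, (ENNReal.ofReal K ^ k * (1 - ENNReal.ofReal K)⁻¹) ^ p.toReal *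
          ∑ i, M.driftBound σm β (G.graph n ω) i ^ p.toReal ∂G.onAttr n J := by
        refine mul_le_mul_right (lintegral_mono_ae ?_) _
        filter_upwards [ae_restrict_of_ae hreg] with ω hω
        simp only [w, hκ]
        exact hω.lintegral_chain_sub_le hp hg hM.lipschitz_g hK k
    _ = _ := by
        rw [lintegral_const_mul _ (show Measurable fun ω =>
            ∑ i, M.driftBound σm β (G.graph n ω) i ^ p.toReal from
            Finset.measurable_fun_sum _ fun i _ => (hb i).comp hGr),
          mul_left_comm, ← G.lintegral_onAttr_at_I hJ hb]

variable [IsProbabilityMeasure root] [IsProbabilityMeasure child]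

lemma eventually_rootMarginal_chainMarginal (hp : p ≠ ∞)
    (hM : M.Regular p σm σp β K K₀ G root child) (hG : G.Regular M p σm σp β root child)
    (hK : K < 1) [∀ n, IsMarkovKernel (M.stationaryKernel (Vert n) p)] {ε δ : ℝ≥0∞} (hε : 0 < ε)
    (hδ : 0 < δ) :
    ∀ᶠ k in atTop, ∀ᶠ n in atTop, G.P n {ω | ε ≤ wasserstein p
      (G.rootMarginal p (M.stationaryKernel (Vert n) p) ω) (G.chainMarginal M k n ω)} ≤ δ := by
  have hq := one_le_toReal hp
  have hε' : 0 < min ε 1 := lt_min hε one_pos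
  have hεt : min ε 1 ≠ ∞ := ne_top_of_le_ne_top ENNReal.one_ne_top (min_le_right _ _)
  have hδ2 := ENNReal.half_pos hδ.ne'
  obtain ⟨c, hc0, -, hc⟩ := exists_div_rpow_le hq hε'.ne' hεt hδ2
  obtain ⟨m, hm⟩ := unifInt_driftBound hp hM hG (min (δ / 2) 1) (lt_min hδ2 one_pos)
  have hK1 : ENNReal.ofReal K < 1 := ENNReal.ofReal_lt_one.2 hK
  have hlim := tendsto_pow_mul_zero hK1 (b := (1 - ENNReal.ofReal K)⁻¹ * (1 + m))
    (ENNReal.mul_ne_top (ENNReal.inv_ne_top.2 (tsub_pos_of_lt hK1).ne')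
      (ENNReal.add_ne_top.2 ⟨ENNReal.one_ne_top, ENNReal.natCast_ne_top m⟩))
  filter_upwards [hlim.eventually (ge_mem_nhds hc0)] with k hk
  filter_upwards [hm] with n ⟨J, hJ, hJ1, hJ2⟩
  refine (measure_mono fun ω hω => ?_).trans ((measure_wasserstein_rootMarginal_le hp hM hK k n hJ
    hε'.ne' hεt).trans ((add_le_add (hJ1.trans (min_le_left _ _)) (hc _ ?_)).trans
      (ENNReal.add_halves δ).le))
  · exact le_trans (min_le_left _ _) (show ε ≤ _ from hω)
  · refine le_trans ?_ hk
    rw [mul_assoc]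
    gcongr
    have hb : Measurable fun ω => M.driftBound σm β (G.graph n ω) (G.I n ω) :=
      G.measurable_at_I (M.measurable_driftBound hM.measurable_g
        (measurable_of_continuous_mark hM.continuous_σm)
        (measurable_of_continuous_mark hM.continuous_β))
    refine (lqn_mono hq fun ω => le_tsub_add (a := (m : ℝ≥0∞))).trans
      ((lqn_add_le hq (hb.sub_const _) measurable_const).trans (add_le_add
        (hJ2.trans (min_le_right _ _)) ?_))
    exact (GraphSeq.lqn_onAttr_le hq J _).trans (lqn_const hq _).le

theorem tendsto_rootMarginal (hp : p ≠ ∞) (hM : M.Regular p σm σp β K K₀ G root child)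
    (hG : G.Regular M p σm σp β root child) (hK : K < 1) (hμ₀ : MemLp id p M.initial)
    [∀ n, IsMarkovKernel (M.stationaryKernel (Vert n) p)]
    (hc : lqn p.toReal child (fun y => y.1 * lipΨ σm σp y) < 1) :
    TendstoZeroInProb G.P fun n ω => wasserstein p
      (G.rootMarginal p (M.stationaryKernel (Vert n) p) ω) (M.rootLaw root child) := by
  have hq := one_le_toReal hp
  have hT := (hM.treeRegular hG hμ₀).zeroStart
  intro ε hε
  rw [ENNReal.tendsto_nhds_zero]
  intro δ hδ
  have hε3 : 0 < ε / 3 := ENNReal.div_pos hε.ne' (by simp)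
  have hδ2 := ENNReal.half_pos hδ.ne'
  have hlim : Tendsto (fun k => wasserstein p (M.zeroStart.treeRLaw root child k)
      (M.rootLaw root child)) atTop (𝓝 0) := hT.tendsto_treeRLaw hp hc
  obtain ⟨k, hk1, hk2⟩ := (((tendsto_add_atTop_iff_nat 1).2 hlim).eventually (gt_mem_nhds hε3)
    |>.and ((tendsto_add_atTop_nat 1).eventually
      (eventually_rootMarginal_chainMarginal hp hM hG hK hε3 hδ2))).exists
  have h2 := tendsto_chainMarginal hp hM hG k (hT.lqn_treeRLaw_ne_top hp hc.ne_top k) _ hε3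
  have : IsProbabilityMeasure (M.zeroStart.treeRLaw root child (k + 1)) := by
    have (q : List ℕ) : IsProbabilityMeasure (if q = [] then root else child) := by
      split_ifs <;> infer_instance
    have : IsProbabilityMeasure (gwLaw root child) := by unfold gwLaw; infer_instance
    rw [M.treeRLaw_zeroStart hM.measurable_g]
    exact Measure.isProbabilityMeasure_map ((Recursion.measurable_treeR_succ hM.measurable_g k).comp
      (f := fun τ : NoisyTree S Z Ξ => (τ, (0 : List ℕ → ℝ))) (by fun_prop)).aemeasurable
  filter_upwards [hk2, h2.eventually (ge_mem_nhds hδ2)] with n hn1 hn2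
  refine le_trans (measure_mono fun ω hω => ?_) ((measure_union_le _ _).trans
    ((add_le_add hn1 hn2).trans (ENNReal.add_halves δ).le))
  by_contra h
  simp only [Set.mem_union, Set.mem_ofPred_eq, not_or, not_le] at h
  have : IsFiniteMeasure (G.chainMarginal M (k + 1) n ω) := by
    unfold GraphSeq.chainMarginal; infer_instance
  have h3 := wasserstein_triangle hq (G.rootMarginal p (M.stationaryKernel (Vert n) p) ω)
    (G.chainMarginal M (k + 1) n ω) (M.rootLaw root child)
  have h4 := wasserstein_triangle hq (G.chainMarginal M (k + 1) n ω)
    (M.zeroStart.treeRLaw root child (k + 1)) (M.rootLaw root child)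
  refine absurd (show ε ≤ _ from hω) (not_le.2 ?_)
  calc _ ≤ _ := h3.trans (add_le_add le_rfl h4)
    _ < ε / 3 + (ε / 3 + ε / 3) :=
        ENNReal.add_lt_add h.1 (ENNReal.add_lt_add h.2 hk1)
    _ = ε := by rw [← add_assoc, ENNReal.add_thirds]

end RandomGraph

end GraphRecursion

end

open GraphRecursion in
theorem corollary1
    {S Z Ξ : Type*} [MetricSpace S] [TopologicalSpace.SeparableSpace S] [MeasurableSpace S]
    [BorelSpace S] [MeasurableSpace Z] [MeasurableSpace Ξ]
    (p : ℝ≥0∞) [Fact (1 ≤ p)] (hp : p ≠ ∞)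
    (M : Recursion S Z Ξ) (G : GraphSeq S)
    (root child : Measure (ℕ × Mark S)) [IsProbabilityMeasure root] [IsProbabilityMeasure child]
    (σm σp β : Mark S → ℝ) (K K₀ : ℝ)
    (hM : M.Regular p σm σp β K K₀ G root child)
    (hG : G.Regular M p σm σp β root child)
    (hμ₀ : MemLp id p M.initial)
    (hK : K < 1) :
    ∃ (lam : ∀ n, Kernel (WDigraph (Vert n) S) (PiLp p fun _ : Vert n => ℝ))
      (_ : ∀ n, IsMarkovKernel (lam n)),
      -- on almost every graph, the chain converges to a stationary law at the stated rate
      (∀ n, ∀ᵐ ω ∂G.P n,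
        M.chainLaw p (G.graph n ω) (lam n (G.graph n ω)) 1 = lam n (G.graph n ω) ∧
        Tendsto (fun k => wasserstein p
          (M.chainLaw p (G.graph n ω) (M.initialLaw p (Vert n)) k) (lam n (G.graph n ω)))
          atTop (𝓝 0) ∧
        ∀ k, ∃ π : Measure ((PiLp p fun _ : Vert n => ℝ) × (PiLp p fun _ : Vert n => ℝ)),
          π.map Prod.fst = M.chainLaw p (G.graph n ω) (M.initialLaw p (Vert n)) k ∧
          π.map Prod.snd = lam n (G.graph n ω) ∧
          (∫⁻ z, edist z.1 z.2 ^ p.toReal ∂π) ^ (1 / p.toReal) ≤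
            ENNReal.ofReal (M.rate p σm σp β (G.graph n ω) k)) ∧
      -- if `c < 1`, the typical marginal converges to the limiting law `ν` of the tree recursion
      (eLpNorm (fun y : ℕ × Mark S => (y.1 : ℝ) * σm y.2 * σp y.2) p child < 1 →
        ∃ η ν : Measure ℝ,
          M.IsAttractingEndogenous p child η ∧
          IsProbabilityMeasure ν ∧
          ν = M.branchingLaw M.Φ root η ∧
          Tendsto (fun k => wasserstein p (M.treeRLaw root child k) ν) atTop (𝓝 0) ∧
          TendstoZeroInProb G.P (fun n ω => wasserstein p (G.rootMarginal p (lam n) ω) ν)) := by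
  have hg := hM.measurable_g
  have hlam : ∀ n, IsMarkovKernel (M.stationaryKernel (Vert n) p) := fun n =>
    M.isMarkovKernel_stationaryKernel hg
  refine ⟨fun n => M.stationaryKernel (Vert n) p, hlam, fun n => ?_, fun hc => ?_⟩
  · filter_upwards [hM.ae_graphRegular n] with ω hω
    rw [M.stationaryKernel_apply hg]
    have hcoupling := hω.exists_coupling hp hg hM.lipschitz_g hμ₀ hK
    refine ⟨M.chainLaw_stationaryLaw hp hg hM.lipschitz_g hω hK 1, ?_, hcoupling⟩
    have hrate : Tendsto (fun k => ENNReal.ofReal (M.rate p σm σp β (G.graph n ω) k)) atTop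
        (𝓝 0) := by
      rw [← ENNReal.ofReal_zero]
      refine ENNReal.tendsto_ofReal ?_
      unfold Recursion.rate
      have h := (tendsto_pow_atTop_nhds_zero_of_lt_one (norm_nonneg _)
        (hω.norm_C.trans_lt hK)).mul_const
        (2 * (eLpNorm id p M.initial).toReal * (Fintype.card (Vert n) : ℝ) ^ (1 / p.toReal) +
          ‖M.drift p σm β (G.graph n ω)‖ / (1 - opNorm p (matC σm σp (G.graph n ω))))
      rw [zero_mul] at h
      exact h
    refine tendsto_of_tendsto_of_tendsto_of_le_of_le tendsto_const_nhds hrate (fun _ => bot_le)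
      fun k => ?_
    obtain ⟨π, h1, h2, h3⟩ := hcoupling k
    exact (wasserstein_le π h1 h2).trans h3
  · have hT := hM.treeRegular hG hμ₀
    have hc' := lqn_lipΨ_lt_one hp hc
    exact ⟨M.endogenousLaw child, M.rootLaw root child, hT.isAttractingEndogenous hp hc',
      hT.isProbabilityMeasure_rootLaw, rfl, hT.tendsto_treeRLaw hp hc',
      tendsto_rootMarginal hp hM hG hK hμ₀ hc'⟩
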